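/- Let $d\ge 1$, $0<\alpha<2$, and let $n:\mathbb R^d\times\mathbb R^d\to\mathbb R$ be measurable with $\kappa_0\le n(x,h)\le\kappa_1$ and $|n(x,h)-n(y,h)|\le\kappa_2|x-y|^{\theta}$ for all $x,y,h\in\mathbb R^d$, where $\kappa_0,\kappa_1,\kappa_2>0$ and $\theta\in(0,1)$ are constants. If $\alpha=1$, assume in addition that $\int_{\partial B_r}n(x,h)\,h\,\mathrm dS_r(h)=0$ for all $x\in\mathbb R^d$ and $r\in(0,\infty)$, where $\mathrm dS_r$ is the surface measure on the sphere $\partial B_r$ of radius $r$ centred at $0$. Put $\chi_\alpha(h)=\mathbf 1_{\alpha>1}+\mathbf 1_{\alpha=1}\mathbf 1_{\{|h|\le1\}}$ and define, for $y\in\mathbb R^d$, $$\mathcal A f(x)=\int_{\mathbb R^d\setminus\{0\}}\big[f(x+h)-f(x)-\chi_\alpha(h)\,h\cdot\nabla f(x)\big]\frac{n(x,h)}{|h|^{d+\alpha}}\,\mathrm dh,$$ $$\mathcal A^{y} f(x)=\int_{\mathbb R^d\setminus\{0\}}\big[f(x+h)-f(x)-\chi_\alpha(h)\,h\cdot\nabla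 f(x)\big]\frac{n(y,h)}{|h|^{d+\alpha}}\,\mathrm dh,$$ $$\psi^y(v)=-\int_{\mathbb R^d\setminus\{0\}}\big(e^{iv\cdot h}-1-\chi_\alpha(h)\,iv\cdot h\big)\frac{n(y,h)}{|h|^{d+\alpha}}\,\mathrm dh,\qquad f^y_t(x)=\frac1{(2\pi)^d}\int_{\mathbb R^d}e^{-iv\cdot x}e^{-t\psi^y(v)}\,\mathrm dv .$$ For $t\in(0,1]$ and $x,y\in\mathbb R^d$ let $$q(t,x,y)=f^y_t(y-x),\qquad F(t,x,y)=(\mathcal A-\mathcal A^y)q(t,\cdot,y)(x),$$ $$(\varphi_1\otimes\varphi_2)(t,x,y)=\int_0^t\int_{\mathbb R^d}\varphi_1(t-s,x,z)\varphi_2(s,z,y)\,\mathrm dz\,\mathrm ds,$$ $F^{\otimes1}=F$, $F^{\otimes m}=F\otimes F^{\otimes(m-1)}$ for $m\ge2$, $\Phi=\sum_{m\ge1}F^{\otimes m}$, and $p=q+q\otimes\Phi$. Let $\phi\in C_0^\infty(\mathbb R^d)$ (smooth with compact support), and set $u(t,x)=\int_{\mathbb R^d}p(t,x,y)\phi(y)\,\mathrm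 dy$ for $t\in(0,1]$ and $u(0,x)=\phi(x)$. Then: 1. All these objects are well-defined: for every $t\in(0,1]$ and $x,y\in\mathbb R^d$ the integrals and the series in the definition of $p(t,x,y)$ converge absolutely, the gradient $\nabla_x q(t,x,y)$ exists if $\alpha\ge1$, and $p(t,x,\cdot)\phi$ is integrable. 2. $u$ is bounded and continuous on $[0,1]\times\mathbb R^d$, and $u(0,\cdot)=\phi$. 3. For all $t\in(0,1]$ and $x\in\mathbb R^d$, $\mathcal A u(t,\cdot)(x)$ is well-defined (the integral converges absolutely and, if $\alpha\ge1$, $u(t,\cdot)$ is differentiable at $x$), $\partial_t u(t,x)$ exists (as a left derivative if $t=1$), and $\partial_t u(t,x)=\mathcal A u(t,\cdot)(x)$. 4. For each $x\in\mathbb R^d$, $t\mapsto\partial_t u(t,x)$ is continuous on $(0,1]$; for each $t\in(0,1]$, $x\mapsto\partial_t u(t,x)$ is continuous on $\mathbb R^d$. -/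

import Mathlib

open MeasureTheory Set

noncomputable section

namespace StableLike

/-- Euclidean space of dimension `d`. -/
abbrev Rn (d : ℕ) : Type := EuclideanSpace ℝ (Fin d)

variable {d : ℕ}

/-- The surface measure on the sphere of radius `r` centred at the origin, as a measure on the
ambient space: the image under `ω ↦ r • ω` of the surface measure of the unit sphere, multiplied
by `r ^ (d - 1)`. -/
def surfaceMeasure (d : ℕ) (r : ℝ) : Measure (Rn d) :=
  ENNReal.ofReal (r ^ (d - 1)) •
    Measure.map (fun ω : Metric.sphere (0 : Rn d) 1 => r • (ω : Rn d))
      (volume : Measure (Rn d)).toSphere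

/-- The cut-off `χ_α(h) = 1_{α > 1} + 1_{α = 1} 1_{|h| ≤ 1}`. -/
def chi (α : ℝ) (h : Rn d) : ℝ :=
  if 1 < α ∨ (α = 1 ∧ ‖h‖ ≤ 1) then 1 else 0

/-- The integrand `[f(x+h) - f(x) - χ_α(h) h·∇f(x)] k(h) / |h|^{d+α}`. Here
`fderiv ℝ f x h` is `h·∇f(x)`. -/
def jumpIntegrand (α : ℝ) (k : Rn d → ℝ) (f : Rn d → ℝ) (x h : Rn d) : ℝ :=
  (f (x + h) - f x - chi α h * fderiv ℝ f x h) * (k h / ‖h‖ ^ ((d : ℝ) + α))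

/-- The integral over `ℝ^d \ {0}` of `[f(x+h) - f(x) - χ_α(h) h·∇f(x)] k(h) / |h|^{d+α}`. -/
def jumpOp (α : ℝ) (k : Rn d → ℝ) (f : Rn d → ℝ) (x : Rn d) : ℝ :=
  ∫ h in ({0}ᶜ : Set (Rn d)), jumpIntegrand α k f x h

/-- `jumpOp α k f x` is meaningful: the gradient exists if it occurs in the integrand
(that is, if `α ≥ 1`), and the integrand is absolutely integrable. -/
def JumpOpDefinedAt (α : ℝ) (k : Rn d → ℝ) (f : Rn d → ℝ) (x : Rn d) : Prop :=
  (1 ≤ α → DifferentiableAt ℝ f x) ∧ IntegrableOn (jumpIntegrand α k f x) ({0}ᶜ : Set (Rn d))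

/-- The operator `𝒜`. -/
def opA (α : ℝ) (n : Rn d → Rn d → ℝ) (f : Rn d → ℝ) (x : Rn d) : ℝ :=
  jumpOp α (n x) f x

/-- The operator `𝒜^y`, with the coefficient frozen at `y`. -/
def opAFrozen (α : ℝ) (n : Rn d → Rn d → ℝ) (y : Rn d) (f : Rn d → ℝ) (x : Rn d) : ℝ :=
  jumpOp α (n y) f x

/-- The characteristic exponent
`ψ(u) = -∫_{ℝ^d \ {0}} (e^{iu·h} - 1 - χ_α(h) iu·h) k(h) / |h|^{d+α} dh`. -/
def psi (α : ℝ) (k : Rn d → ℝ) (u : Rn d) : ℂ :=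
  -∫ h in ({0}ᶜ : Set (Rn d)),
    (Complex.exp (Complex.I * (inner ℝ u h : ℝ)) - 1
        - (chi α h : ℂ) * (Complex.I * (inner ℝ u h : ℝ)))
      * ((k h / ‖h‖ ^ ((d : ℝ) + α) : ℝ) : ℂ)

/-- The density `f_t(x) = (2π)^{-d} ∫ e^{-iu·x} e^{-tψ(u)} du`; the integral is real because
`ψ(-u)` is the complex conjugate of `ψ(u)`, so taking the real part only changes the type. -/
def levyDensity (α : ℝ) (k : Rn d → ℝ) (t : ℝ) (x : Rn d) : ℝ :=
  ((2 * Real.pi) ^ d)⁻¹ *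
    (∫ u : Rn d, Complex.exp (-(Complex.I * (inner ℝ u x : ℝ)))
      * Complex.exp (-((t : ℂ) * psi α k u))).re

/-- `q(t,x,y) = f_t^y(y - x)`. -/
def q (α : ℝ) (n : Rn d → Rn d → ℝ) (t : ℝ) (x y : Rn d) : ℝ :=
  levyDensity α (n y) t (y - x)

/-- `F(t,x,y) = (𝒜 - 𝒜^y) q(t,·,y)(x)`. -/
def F (α : ℝ) (n : Rn d → Rn d → ℝ) (t : ℝ) (x y : Rn d) : ℝ :=
  opA α n (fun z => q α n t z y) x - opAFrozen α n y (fun z => q α n t z y) x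

/-- The space-time convolution
`(φ₁ ⊗ φ₂)(t,x,y) = ∫_0^t ∫_{ℝ^d} φ₁(t-s,x,z) φ₂(s,z,y) dz ds`. -/
def tensor (φ₁ φ₂ : ℝ → Rn d → Rn d → ℝ) (t : ℝ) (x y : Rn d) : ℝ :=
  ∫ s in (0 : ℝ)..t, ∫ z : Rn d, φ₁ (t - s) x z * φ₂ s z y

/-- Absolute convergence of the integral that defines `(φ₁ ⊗ φ₂)(t,x,y)`. -/
def TensorDefinedAt (φ₁ φ₂ : ℝ → Rn d → Rn d → ℝ) (t : ℝ) (x y : Rn d) : Prop :=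
  IntegrableOn (fun w : ℝ × Rn d => φ₁ (t - w.1) x w.2 * φ₂ w.1 w.2 y)
    (Ioo (0 : ℝ) t ×ˢ (univ : Set (Rn d)))

/-- `Fpow α n m` is `F^{⊗(m+1)}`: `F^{⊗1} = F` and `F^{⊗(m+1)} = F ⊗ F^{⊗m}`. -/
def Fpow (α : ℝ) (n : Rn d → Rn d → ℝ) : ℕ → ℝ → Rn d → Rn d → ℝ
  | 0 => F α n
  | m + 1 => tensor (F α n) (Fpow α n m)

/-- `Φ = ∑_{m ≥ 1} F^{⊗m}`. -/
def Phi (α : ℝ) (n : Rn d → Rn d → ℝ) (t : ℝ) (x y : Rn d) : ℝ :=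
  ∑' m : ℕ, Fpow α n m t x y

/-- The parametrix kernel `p = q + q ⊗ Φ`. -/
def p (α : ℝ) (n : Rn d → Rn d → ℝ) (t : ℝ) (x y : Rn d) : ℝ :=
  q α n t x y + tensor (q α n) (Phi α n) t x y

/-- All the integrals and the series in the construction of `p(t,x,y)` converge absolutely:
the exponents `ψ^y`, the Fourier integral in `q`, the two operators in `F`, the convolution powers
of `F`, their sum `Φ`, and the convolution `q ⊗ Φ`. -/
structure KernelDefinedAt (α : ℝ) (n : Rn d → Rn d → ℝ) (t : ℝ) (x y : Rn d) : Prop where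
  exponent : ∀ u : Rn d, IntegrableOn (fun h : Rn d =>
    (Complex.exp (Complex.I * (inner ℝ u h : ℝ)) - 1
        - (chi α h : ℂ) * (Complex.I * (inner ℝ u h : ℝ)))
      * ((n y h / ‖h‖ ^ ((d : ℝ) + α) : ℝ) : ℂ)) ({0}ᶜ : Set (Rn d))
  density : Integrable (fun u : Rn d =>
    Complex.exp (-(Complex.I * (inner ℝ u (y - x) : ℝ)))
      * Complex.exp (-((t : ℂ) * psi α (n y) u)))
  opA : JumpOpDefinedAt α (n x) (fun z => q α n t z y) x
  opAFrozen : JumpOpDefinedAt α (n y) (fun z => q α n t z y) x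
  powers : ∀ m : ℕ, TensorDefinedAt (F α n) (Fpow α n m) t x y
  series : Summable (fun m : ℕ => Fpow α n m t x y)
  convolution : TensorDefinedAt (q α n) (Phi α n) t x y

/-- `u(t,x) = ∫ p(t,x,y) φ(y) dy` for `t ≠ 0`, and `u(0,x) = φ(x)`. -/
def u (α : ℝ) (n : Rn d → Rn d → ℝ) (φ : Rn d → ℝ) (t : ℝ) (x : Rn d) : ℝ :=
  if t = 0 then φ x else ∫ y : Rn d, p α n t x y * φ y

end StableLike

end

/-! The proof is Levi's parametrix method. For a coefficient frozen at y the operator is translation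
invariant, so q is given by a Fourier integral and ∂_t q = 𝒜^y q. Write Q_t, B_t, F_t for the
integral operators with kernels q, 𝒜q and F = 𝒜q − 𝒜^y q; then ∂_t Q_t = B_t − F_t. The series Φ
solves Φ = F + F ⊗ Φ (`Phi_eq`), and u(t) = Q_t φ + ∫_0^t Q_{t-s} Φ_s φ ds. Formal differentiation
gives (B_t − F_t)φ + Φ_t φ + ∫_0^t (B_{t-s} − F_{t-s}) Φ_s φ ds. The equation for Φ cancels every F,
and the rest, B_t φ + ∫_0^t B_{t-s} Φ_s φ ds, is 𝒜u(t).

The analytic input is a set of bounds on the frozen densities, uniform over all coefficients between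
κ₀ and κ₁ (with vanishing shell integrals if α = 1). This class is invariant under dilation, so time
one suffices. There the jumps are split at size one. The small jumps have an exponent that is entire
along complex lines, and shifting the contour by i x/|x| produces a factor e^{-|x|}
(`exists_norm_fint_psiS_le`). The large jumps form a compound Poisson law whose kernel is dominated
by the profile (1+|x|)^{-d-α}, and this decay survives the exponential series because profiles are
stable under convolution (`profile_mul_le`, `norm_fint_mul_exp_khat_le`). Regularity is expressed
through differences up to order two (`Reg`), which enter the Fourier integral as multipliers.
Dependence on the coefficient is obtained by differentiating along the segment between two
coefficients (`exists_difs_pk_one_sub_le`).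

Put r = t^{1/α}. A jump operator applied to a frozen density costs r^{-α-ω}; the ω absorbs a
logarithm at α = 1. The Hölder continuity of n, with exponent lowered to 4ω, makes the kernel F of
order t^{ω/α-1}, so its convolution powers are summable by Beta integrals. The kernel 𝒜q itself is
not integrable in time. Its action on Hölder functions is: the density frozen at x has total mass
one, and its gradient and compensated increments have integral zero, so comparing q with that
density gains r^{2ω} (`abs_integral_cancel_le`, `Param.integrable_dlt_act_q`). This applies to Φ_s
φ, which inherits Hölder continuity from F (`Param.exists_act_Phi`).

The Duhamel integral is never differentiated directly. The evolution of Q_t g is integrated in time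
(`Param.act_q_eq_add_integral`), Fubini on a triangle treats the Duhamel term (`Param.duh_q_eq`),
and the result is u(t) = φ + ∫_0^t du (`Param.u_eq_integral`), where `du` equals 𝒜u by
`Param.jumpOp_u`. Joint continuity of `du` on (0,1] rests on `continuousOn_integral_Ioo`; the
fundamental theorem of calculus then gives the derivative, one-sided at t = 1, and its continuity.
-/

open MeasureTheory Set

noncomputable section

namespace StableLike

variable {d : ℕ}

/-! ### Profiles and their convolution estimates -/

/-- The profile `r^γ (r + |x|)^{-(d+γ)}`, an approximate identity at scale `r`. -/
def profile (γ r : ℝ) (x : Rn d) : ℝ := r ^ γ * (r + ‖x‖) ^ (-((d : ℝ) + γ))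

lemma profile_nonneg {γ r : ℝ} (hr : 0 < r) (x : Rn d) : 0 ≤ profile γ r x := by
  unfold profile; positivity

lemma profile_pos {γ r : ℝ} (hr : 0 < r) (x : Rn d) : 0 < profile γ r x := by
  unfold profile; positivity

lemma profile_neg (γ r : ℝ) (x : Rn d) : profile γ r (-x) = profile γ r x := by
  simp [profile]

lemma continuous_profile {γ r : ℝ} (hr : 0 < r) : Continuous (profile γ r : Rn d → ℝ) := by
  unfold profile
  refine continuous_const.mul (Continuous.rpow_const (by fun_prop) fun x => Or.inl ?_)
  positivity

lemma profile_scale (γ : ℝ) {r : ℝ} (hr : 0 < r) (x : Rn d) :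
    profile γ r x = (r ^ d)⁻¹ * profile γ 1 (r⁻¹ • x) := by
  have h1 : r + ‖x‖ = r * (1 + r⁻¹ * ‖x‖) := by field_simp
  have h2 : (0 : ℝ) ≤ 1 + r⁻¹ * ‖x‖ := by positivity
  unfold profile
  rw [norm_smul, norm_inv, Real.norm_of_nonneg hr.le, h1, Real.mul_rpow hr.le h2, Real.one_rpow,
    one_mul, ← mul_assoc, ← Real.rpow_add hr, ← Real.rpow_natCast, ← Real.rpow_neg hr.le]
  congr 2; ring

lemma integrable_profile_one {γ : ℝ} (hγ : 0 < γ) : Integrable (profile γ 1 : Rn d → ℝ) := by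
  have := integrable_one_add_norm (E := Rn d) (μ := volume) (r := (d : ℝ) + γ) (by simpa using hγ)
  exact this.congr (Filter.Eventually.of_forall fun x => by simp [profile])

lemma integrable_profile {γ r : ℝ} (hγ : 0 < γ) (hr : 0 < r) :
    Integrable (profile γ r : Rn d → ℝ) := by
  have h := ((integrable_profile_one (d := d) hγ).comp_smul (inv_ne_zero hr.ne')).const_mul
    ((r ^ d)⁻¹)
  exact h.congr (Filter.Eventually.of_forall fun x => (profile_scale γ hr x).symm)

/-- The integral of a profile; it does not depend on the scale. -/
def mass (d : ℕ) (γ : ℝ) : ℝ := ∫ x : Rn d, profile γ 1 x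

lemma mass_nonneg (γ : ℝ) : 0 ≤ mass d γ := integral_nonneg fun x => profile_nonneg one_pos x

lemma integral_profile (γ : ℝ) {r : ℝ} (hr : 0 < r) :
    ∫ x : Rn d, profile γ r x = mass d γ := by
  simp_rw [profile_scale γ hr, integral_const_mul]
  rw [Measure.integral_comp_inv_smul_of_nonneg _ _ hr.le]
  simp only [finrank_euclideanSpace, Fintype.card_fin, smul_eq_mul, mass]
  field_simp

lemma integrable_profile_sub {γ r : ℝ} (hγ : 0 < γ) (hr : 0 < r) (x : Rn d) :
    Integrable (fun y => profile γ r (x - y)) :=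
  (integrable_profile hγ hr).comp_sub_left x

lemma integral_profile_sub (γ : ℝ) {r : ℝ} (hr : 0 < r) (x : Rn d) :
    ∫ y, profile γ r (x - y) = mass d γ := by
  rw [integral_sub_left_eq_self (fun y => profile γ r y), integral_profile γ hr]

/-- Every pointwise comparison of profiles below reduces to a comparison of the bases r + |a| and R
+ |x|; the negative power reverses the inequality at the price of L^{d+γ}. -/
lemma profile_le_of_mul {γ r R L : ℝ} (hγ : 0 < γ) (hr : 0 < r) (hrR : r ≤ R) (hL : 0 < L)
    {x a : Rn d} (h : R + ‖x‖ ≤ L * (r + ‖a‖)) :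
    profile γ r a ≤ L ^ ((d : ℝ) + γ) * profile γ R x := by
  have hR : 0 < R := hr.trans_le hrR
  have hp : 0 < (d : ℝ) + γ := by positivity
  have h1 : r ^ γ ≤ R ^ γ := Real.rpow_le_rpow hr.le hrR hγ.le
  have h2 : (r + ‖a‖) ^ (-((d : ℝ) + γ)) ≤
      L ^ ((d : ℝ) + γ) * (R + ‖x‖) ^ (-((d : ℝ) + γ)) := by
    have : (L * (r + ‖a‖)) ^ (-((d : ℝ) + γ)) ≤ (R + ‖x‖) ^ (-((d : ℝ) + γ)) :=
      Real.rpow_le_rpow_of_nonpos (by positivity) h (by linarith)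
    rw [Real.mul_rpow hL.le (by positivity), Real.rpow_neg hL.le] at this
    have hL' : 0 < L ^ ((d : ℝ) + γ) := by positivity
    rwa [inv_mul_le_iff₀ hL'] at this
  calc profile γ r a ≤ R ^ γ * (L ^ ((d : ℝ) + γ) * (R + ‖x‖) ^ (-((d : ℝ) + γ))) := by
        unfold profile; gcongr
    _ = _ := by unfold profile; ring

/-- The submultiplicativity behind all convolution estimates. -/
lemma profile_mul_le {γ r s R L : ℝ} (hγ : 0 < γ) (hr : 0 < r) (hs : 0 < s) (hrR : r ≤ R)
    (hsR : s ≤ R) (hL : 1 ≤ L) (hR : R ≤ L * (r + s)) {x a b : Rn d} (h : ‖x‖ ≤ ‖a‖ + ‖b‖) :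
    profile γ r a * profile γ s b ≤
      (2 * L) ^ ((d : ℝ) + γ) * profile γ R x * (profile γ r a + profile γ s b) := by
  have hRp : 0 < R := hr.trans_le hrR
  have hA := profile_nonneg (γ := γ) hr a
  have hB := profile_nonneg (γ := γ) hs b
  have hX := profile_nonneg (γ := γ) hRp x
  have hLp : 0 ≤ (2 * L) ^ ((d : ℝ) + γ) := by positivity
  have hn : ‖x‖ ≤ L * (‖a‖ + ‖b‖) :=
    h.trans (le_mul_of_one_le_left (by positivity) hL)
  -- The larger of the two bases is at least (R + |x|)/(2L). Its factor is traded for the profile at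
  -- (R, x), and the other factor survives as an integrable one.
  rcases le_total (r + ‖a‖) (s + ‖b‖) with hab | hab
  · have := profile_le_of_mul (L := 2 * L) (x := x) (a := b) hγ hs hsR (by positivity) (by nlinarith)
    calc _ ≤ profile γ r a * ((2 * L) ^ ((d : ℝ) + γ) * profile γ R x) := by gcongr
      _ ≤ _ := by nlinarith [mul_nonneg hLp hX, mul_nonneg (mul_nonneg hLp hX) hB]
  · have := profile_le_of_mul (L := 2 * L) (x := x) (a := a) hγ hr hrR (by positivity) (by nlinarith)
    calc _ ≤ ((2 * L) ^ ((d : ℝ) + γ) * profile γ R x) * profile γ s b := by gcongr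
      _ ≤ _ := by nlinarith [mul_nonneg hLp hX, mul_nonneg (mul_nonneg hLp hX) hA]

/-- Decay of order σ in space is exchanged for a factor r^σ. This is how a Hölder factor |x−y|^σ
becomes a gain in time. -/
lemma profile_mul_norm_rpow_le {γ σ r : ℝ} (hr : 0 < r) (x : Rn d) :
    profile γ r x * (r + ‖x‖) ^ σ = r ^ σ * profile (γ - σ) r x := by
  have h : 0 < r + ‖x‖ := by positivity
  unfold profile
  rw [mul_assoc, ← Real.rpow_add h, ← mul_assoc, ← Real.rpow_add hr]
  congr 2 <;> ring

/-- The profile is (r/(r+|x|))^γ times (r+|x|)^{-d}, and the base of the first power is at most one.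
-/
lemma profile_anti {γ γ' r : ℝ} (hr : 0 < r) (h : γ' ≤ γ) (x : Rn d) :
    profile γ r x ≤ profile γ' r x := by
  have hx : 0 < r + ‖x‖ := by positivity
  have key : ∀ c, profile c r x = (r / (r + ‖x‖)) ^ c * (r + ‖x‖) ^ (-(d : ℝ)) := by
    intro c
    unfold profile
    rw [Real.div_rpow hr.le hx.le, neg_add, Real.rpow_add hx, Real.rpow_neg hx.le c]
    ring
  rw [key, key]
  have h1 : r / (r + ‖x‖) ≤ 1 := by
    rw [div_le_one hx]; linarith [norm_nonneg x]
  gcongr ?_ * _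
  exact Real.rpow_le_rpow_of_exponent_ge (by positivity) h1 h

lemma profile_shift_le {γ r : ℝ} (hγ : 0 < γ) (hr : 0 < r) {x a : Rn d} (ha : ‖a‖ ≤ r) :
    profile γ r (x + a) ≤ 2 ^ ((d : ℝ) + γ) * profile γ r x := by
  refine profile_le_of_mul hγ hr le_rfl two_pos ?_
  have := norm_le_norm_add_norm_sub' x (x + a)
  simp at this
  nlinarith [norm_nonneg (x + a)]

lemma profile_le_one_scale {γ r₀ r : ℝ} (hγ : 0 < γ) (hr₀ : 0 < r₀) (h : r₀ ≤ r) (hr : r ≤ 1)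
    (x : Rn d) : profile γ r x ≤ r₀⁻¹ ^ ((d : ℝ) + γ) * profile γ 1 x := by
  refine profile_le_of_mul hγ (hr₀.trans_le h) hr (by positivity) ?_
  rw [inv_mul_eq_div, le_div_iff₀ hr₀]
  nlinarith [norm_nonneg x]

lemma rpow_norm_le_profile {α r : ℝ} (hα : 0 < α) (hr : 0 < r) {h : Rn d} (hh : r ≤ ‖h‖) :
    ‖h‖ ^ (-((d : ℝ) + α)) ≤ 2 ^ ((d : ℝ) + α) * r ^ (-α) * profile α r h := by
  have h0 : 0 < ‖h‖ := hr.trans_le hh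
  have h1 : (2 * ‖h‖) ^ (-((d : ℝ) + α)) ≤ (r + ‖h‖) ^ (-((d : ℝ) + α)) :=
    Real.rpow_le_rpow_of_nonpos (by positivity) (by linarith) (by linarith [Nat.cast_nonneg (α := ℝ) d])
  have h2 : r ^ (-α) * profile α r h = (r + ‖h‖) ^ (-((d : ℝ) + α)) := by
    unfold profile
    rw [← mul_assoc, ← Real.rpow_add hr]; simp
  rw [mul_assoc, h2]
  rw [Real.mul_rpow two_pos.le h0.le, Real.rpow_neg two_pos.le, inv_mul_le_iff₀ (by positivity)] at h1
  exact h1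

/-! ### The integrable jump weight and its rescaling -/

/-- The exponent of `|h|` near the origin in the bound for the jump integrand. -/
def tau (α : ℝ) : ℝ := if α < 1 then 1 else 2

/-- The exponent of `|h|` near infinity in the bound for the jump integrand. -/
def sig (α ω : ℝ) : ℝ := if α < 1 then 0 else if α = 1 then 1 - ω else 1

/-- The jump weight: an integrable majorant of the compensated jump kernel. -/
def jw (α ω : ℝ) (h : Rn d) : ℝ :=
  (if ‖h‖ ≤ 1 then ‖h‖ ^ tau α else ‖h‖ ^ sig α ω) * ‖h‖ ^ (-((d : ℝ) + α))

lemma jw_nonneg (α ω : ℝ) (h : Rn d) : 0 ≤ jw α ω h := by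
  unfold jw; split_ifs <;> positivity

lemma lt_tau {α : ℝ} (h2 : α < 2) : α < tau α := by unfold tau; split_ifs <;> linarith

lemma sig_lt {α ω : ℝ} (h0 : 0 < α) (hω : 0 < ω) : sig α ω < α := by
  unfold sig; split_ifs with h1 h2
  · exact h0
  · linarith
  · exact lt_of_le_of_ne (not_lt.1 h1) (Ne.symm h2)

lemma sig_nonneg {α ω : ℝ} (hω : ω < 1) : 0 ≤ sig α ω := by
  unfold sig; split_ifs <;> linarith

lemma measurable_jw (α ω : ℝ) : Measurable (jw α ω : Rn d → ℝ) := by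
  unfold jw
  refine Measurable.mul (Measurable.ite ?_ (by fun_prop) (by fun_prop)) (by fun_prop)
  exact measurableSet_le measurable_norm measurable_const

/-- In polar coordinates the integrand is s^{c-α-1}, with c = `tau α` > α near zero and c = `sig α
ω` < α near infinity. At α = 1 linear growth would be critical at infinity; this is why `sig` is
lowered to 1 − ω there. -/
lemma integrable_jw (hd : 1 ≤ d) {α ω : ℝ} (h0 : 0 < α) (h2 : α < 2) (hω : 0 < ω) :
    Integrable (jw α ω : Rn d → ℝ) := by
  have : Nonempty (Fin d) := ⟨⟨0, hd⟩⟩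
  have key := (integrable_fun_norm_addHaar (E := Rn d) (volume)
    (f := fun s : ℝ => (if s ≤ 1 then s ^ tau α else s ^ sig α ω) * s ^ (-((d : ℝ) + α)))).2
  refine key ?_
  simp only [finrank_euclideanSpace, Fintype.card_fin, smul_eq_mul]
  have hu : Ioi (0 : ℝ) = Ioc 0 1 ∪ Ioi 1 := (Ioc_union_Ioi_eq_Ioi zero_le_one).symm
  have hpow : ∀ s : ℝ, 0 < s → ∀ c : ℝ,
      s ^ (d - 1) * (s ^ c * s ^ (-((d : ℝ) + α))) = s ^ (c - α - 1) := by
    intro s hs c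
    rw [← Real.rpow_natCast, ← Real.rpow_add hs, ← Real.rpow_add hs]
    congr 1; push_cast [Nat.cast_sub hd]; ring
  rw [hu, integrableOn_union]
  constructor
  · have : IntegrableOn (fun s : ℝ => s ^ (tau α - α - 1)) (Ioc 0 1) := by
      rw [← intervalIntegrable_iff_integrableOn_Ioc_of_le zero_le_one]
      exact intervalIntegral.intervalIntegrable_rpow' (by linarith [lt_tau h2])
    refine this.congr_fun (fun s hs => ?_) measurableSet_Ioc
    simp only [hs.2, if_true]; rw [hpow s hs.1]
  · have : IntegrableOn (fun s : ℝ => s ^ (sig α ω - α - 1)) (Ioi 1) :=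
      integrableOn_Ioi_rpow_of_lt (by linarith [sig_lt h0 hω]) one_pos
    refine this.congr_fun (fun s hs => ?_) measurableSet_Ioi
    have hs' : ¬ s ≤ 1 := not_le.2 hs
    simp only [hs', if_false]; rw [hpow s (zero_lt_one.trans hs)]

/-- The jump weight at scale `r`. -/
def jwr (α ω r : ℝ) (h : Rn d) : ℝ := (r ^ d)⁻¹ * r ^ (-α) * jw α ω (r⁻¹ • h)

lemma jwr_nonneg {α ω r : ℝ} (hr : 0 < r) (h : Rn d) : 0 ≤ jwr α ω r h := by
  unfold jwr; have := jw_nonneg α ω (r⁻¹ • h); positivity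

lemma jwr_eq {α ω r : ℝ} (hr : 0 < r) (h : Rn d) : jwr α ω r h =
    (if ‖h‖ ≤ r then (‖h‖ / r) ^ tau α else (‖h‖ / r) ^ sig α ω) * ‖h‖ ^ (-((d : ℝ) + α)) := by
  have h1 : ‖r⁻¹ • h‖ = ‖h‖ / r := by
    rw [norm_smul, norm_inv, Real.norm_of_nonneg hr.le]; field_simp
  have h2 : (r ^ d)⁻¹ * r ^ (-α) = r ^ (-((d : ℝ) + α)) := by
    rw [neg_add, Real.rpow_add hr, Real.rpow_neg hr.le (d : ℝ), Real.rpow_natCast]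
  unfold jwr jw
  have h3 : r ^ (-((d : ℝ) + α)) ≠ 0 := by positivity
  rw [h1, h2, Real.div_rpow (norm_nonneg _) hr.le (-((d : ℝ) + α))]
  simp only [div_le_one hr]
  field_simp

lemma measurable_jwr (α ω r : ℝ) : Measurable (jwr α ω r : Rn d → ℝ) := by
  unfold jwr
  exact measurable_const.mul ((measurable_jw α ω).comp (measurable_const_smul _))

lemma integrable_jwr (hd : 1 ≤ d) {α ω r : ℝ} (h0 : 0 < α) (h2 : α < 2) (hω : 0 < ω)
    (hr : 0 < r) : Integrable (jwr α ω r : Rn d → ℝ) :=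
  ((integrable_jw hd h0 h2 hω).comp_smul (inv_ne_zero hr.ne')).const_mul _

lemma integral_jwr {α ω r : ℝ} (hr : 0 < r) :
    ∫ h : Rn d, jwr α ω r h = r ^ (-α) * ∫ h : Rn d, jw α ω h := by
  simp only [jwr, integral_const_mul]
  rw [Measure.integral_comp_inv_smul_of_nonneg _ _ hr.le]
  simp only [finrank_euclideanSpace, Fintype.card_fin, smul_eq_mul]
  field_simp

/-! ### Admissible coefficients and cancellation on shells -/

/-- The jump coefficients for which the heat kernel estimates are uniform. -/
structure JumpCoeff (α κ₀ κ₁ : ℝ) (k : Rn d → ℝ) : Prop where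
  meas : Measurable k
  lower : ∀ h, κ₀ ≤ k h
  upper : ∀ h, k h ≤ κ₁
  cancel : α = 1 → ∀ a b : ℝ, 0 < a → a ≤ b →
    ∫ h in {h : Rn d | a < ‖h‖ ∧ ‖h‖ ≤ b}, (k h * ‖h‖ ^ (-((d : ℝ) + α))) • h = 0

lemma JumpCoeff.abs_le {α κ₀ κ₁ : ℝ} {k : Rn d → ℝ} (hk : JumpCoeff α κ₀ κ₁ k) (hκ₀ : 0 < κ₀)
    (h : Rn d) : |k h| ≤ κ₁ :=
  _root_.abs_le.2 ⟨by linarith [hk.lower h, hk.upper h], hk.upper h⟩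

/-- A radial multiple of a vector field with vanishing spherical means has zero integral. -/
lemma integral_radial_smul_eq_zero (hd : 1 ≤ d) {k : Rn d → ℝ} (g : ℝ → ℝ)
    (hk : ∀ r : ℝ, 0 < r → ∫ h, k h • h ∂(surfaceMeasure d r) = 0)
    (hkm : Measurable k) : ∫ h : Rn d, (k h * g ‖h‖) • h = 0 := by
  have : Nonempty (Fin d) := ⟨⟨0, hd⟩⟩
  -- Without integrability the Bochner integral is zero by convention, so only the integrable case
  -- needs Fubini in polar coordinates.
  by_cases hi : Integrable (fun h : Rn d => (k h * g ‖h‖) • h)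
  swap; · exact integral_undef hi
  have hsph : ∀ r : ℝ, 0 < r →
      ∫ ω : Metric.sphere (0 : Rn d) 1, k (r • (ω : Rn d)) • (r • (ω : Rn d))
        ∂(volume : Measure (Rn d)).toSphere = 0 := by
    intro r hr
    have h1 := hk r hr
    have hm : Measurable fun ω : Metric.sphere (0 : Rn d) 1 => r • (ω : Rn d) := by fun_prop
    rw [surfaceMeasure, integral_smul_measure, integral_map hm.aemeasurable
      (by exact (hkm.smul measurable_id).aestronglyMeasurable)] at h1
    rcases smul_eq_zero.1 h1 with h2 | h2
    · rw [ENNReal.toReal_ofReal (by positivity)] at h2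
      exact absurd h2 (by positivity)
    · exact h2
  set f : Rn d → Rn d := fun h => (k h * g ‖h‖) • h with hf
  have e1 : ∫ h, f h = ∫ x : ({(0 : Rn d)}ᶜ : Set (Rn d)), f x
      ∂((volume : Measure (Rn d)).comap (↑)) := by
    rw [integral_subtype_comap (measurableSet_singleton _).compl f, restrict_compl_singleton]
  set G : Metric.sphere (0 : Rn d) 1 × Ioi (0 : ℝ) → Rn d := fun w => f (w.2.1 • (w.1 : Rn d))
    with hG
  have hGf : ∀ x : ({(0 : Rn d)}ᶜ : Set (Rn d)), G (homeomorphUnitSphereProd (Rn d) x) = f x := by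
    intro x
    have h0 : ‖(x : Rn d)‖ ≠ 0 := norm_ne_zero_iff.2 x.2
    simp only [hG, homeomorphUnitSphereProd_apply_snd_coe, homeomorphUnitSphereProd_apply_fst_coe]
    rw [smul_smul, mul_inv_cancel₀ h0, one_smul]
  have mp := (volume : Measure (Rn d)).measurePreserving_homeomorphUnitSphereProd
  have e2 := mp.integral_comp (Homeomorph.measurableEmbedding _) G
  simp only [hGf] at e2
  have hGi : Integrable G ((volume : Measure (Rn d)).toSphere.prod
      (Measure.volumeIoiPow (Module.finrank ℝ (Rn d) - 1))) := by
    rw [← mp.integrable_comp_emb (Homeomorph.measurableEmbedding _)]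
    have : (G ∘ homeomorphUnitSphereProd (Rn d)) = fun x => f x.1 := funext hGf
    rw [this]
    have h3 := (integrableOn_iff_comap_subtypeVal (μ := (volume : Measure (Rn d))) (f := f)
      (measurableSet_singleton (0 : Rn d)).compl).1 hi.integrableOn
    exact h3
  rw [e1, e2, integral_prod_symm _ hGi]
  refine integral_eq_zero_of_ae (Filter.Eventually.of_forall fun r => ?_)
  have hr : (0 : ℝ) < r.1 := r.2
  have h4 : ∀ ω : Metric.sphere (0 : Rn d) 1, G (ω, r) =
      g r.1 • (k (r.1 • (ω : Rn d)) • (r.1 • (ω : Rn d))) := by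
    intro ω
    have : ‖r.1 • (ω : Rn d)‖ = r.1 := by
      rw [norm_smul, Real.norm_of_nonneg hr.le, norm_eq_of_mem_sphere, mul_one]
    simp only [hG, hf, this]
    rw [smul_smul, smul_smul, smul_smul]; congr 1; ring
  simp only [h4, integral_smul, hsph r.1 hr, smul_zero, Pi.zero_apply]

/-- The radial factor is chosen as |h|^{-d-α} cut off to a shell. From here on the hypothesis for α
= 1 is used only through shell integrals, which behave well under dilation. -/
lemma jumpCoeff_of_sphere (hd : 1 ≤ d) {α κ₀ κ₁ : ℝ} {k : Rn d → ℝ} (hkm : Measurable k)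
    (hlow : ∀ h, κ₀ ≤ k h) (hup : ∀ h, k h ≤ κ₁)
    (hk : α = 1 → ∀ r : ℝ, 0 < r → ∫ h, k h • h ∂(surfaceMeasure d r) = 0) :
    JumpCoeff α κ₀ κ₁ k where
  meas := hkm
  lower := hlow
  upper := hup
  cancel hα a b _ _ := by
    have hS : MeasurableSet {h : Rn d | a < ‖h‖ ∧ ‖h‖ ≤ b} :=
      (measurableSet_lt measurable_const measurable_norm).inter
        (measurableSet_le measurable_norm measurable_const)
    have h0 := integral_radial_smul_eq_zero hd
      (fun s => if a < s ∧ s ≤ b then s ^ (-((d : ℝ) + α)) else 0) (hk hα) hkm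
    rw [← integral_indicator hS, ← h0]
    congr 1; ext1 h
    by_cases hh : a < ‖h‖ ∧ ‖h‖ ≤ b
    · rw [indicator_of_mem (by exact hh), if_pos hh]
    · rw [indicator_of_notMem (by exact hh), if_neg hh]; simp

lemma JumpCoeff.integrableOn_shell {α κ₀ κ₁ : ℝ} {k : Rn d → ℝ} (hk : JumpCoeff α κ₀ κ₁ k)
    (hκ₀ : 0 < κ₀) (hα : 0 < α) {a b : ℝ} (ha : 0 < a) :
    IntegrableOn (fun h : Rn d => (k h * ‖h‖ ^ (-((d : ℝ) + α))) • h)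
      {h : Rn d | a < ‖h‖ ∧ ‖h‖ ≤ b} := by
  have hS : MeasurableSet {h : Rn d | a < ‖h‖ ∧ ‖h‖ ≤ b} :=
    (measurableSet_lt measurable_const measurable_norm).inter
      (measurableSet_le measurable_norm measurable_const)
  have hfin : volume {h : Rn d | a < ‖h‖ ∧ ‖h‖ ≤ b} < ⊤ :=
    lt_of_le_of_lt (measure_mono (fun h hh => mem_closedBall_zero_iff.2 hh.2))
      (measure_closedBall_lt_top (x := (0 : Rn d)) (r := b))
  have hc : IntegrableOn (fun _ : Rn d => κ₁ * a ^ (-((d : ℝ) + α)) * b)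
      {h : Rn d | a < ‖h‖ ∧ ‖h‖ ≤ b} := integrableOn_const hfin.ne
  refine Integrable.mono' hc ?_ ?_
  · exact ((hk.meas.mul (by fun_prop)).smul measurable_id).aestronglyMeasurable
  · refine (ae_restrict_iff' hS).2 (Filter.Eventually.of_forall fun h hh => ?_)
    have h1 := hk.abs_le hκ₀ h
    have h2 : ‖h‖ ^ (-((d : ℝ) + α)) ≤ a ^ (-((d : ℝ) + α)) :=
      Real.rpow_le_rpow_of_nonpos ha hh.1.le (by linarith [Nat.cast_nonneg (α := ℝ) d])
    have h3 : 0 ≤ ‖h‖ ^ (-((d : ℝ) + α)) := by positivity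
    rw [norm_smul, norm_mul, Real.norm_eq_abs, Real.norm_of_nonneg h3]
    have := (abs_nonneg _).trans h1
    gcongr
    exact hh.2

/-- The kernel |h|^{-d-α} is homogeneous and dilations map shells to shells. Invariance of the
class, with the same κ₀ and κ₁, makes bounds at time one sufficient. -/
lemma JumpCoeff.scale {α κ₀ κ₁ : ℝ} {k : Rn d → ℝ} (hk : JumpCoeff α κ₀ κ₁ k) {r : ℝ}
    (hr : 0 < r) : JumpCoeff α κ₀ κ₁ (fun h => k (r • h)) where
  meas := hk.meas.comp (measurable_const_smul r)
  lower h := hk.lower _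
  upper h := hk.upper _
  cancel hα a b ha hab := by
    have hS : ∀ a b : ℝ, MeasurableSet {h : Rn d | a < ‖h‖ ∧ ‖h‖ ≤ b} := fun a b =>
      (measurableSet_lt measurable_const measurable_norm).inter
        (measurableSet_le measurable_norm measurable_const)
    have h0 := hk.cancel hα (r * a) (r * b) (by positivity) (by gcongr)
    rw [← integral_indicator (hS _ _)] at h0 ⊢
    have h1 := Measure.integral_comp_smul (volume : Measure (Rn d))
      (({h : Rn d | r * a < ‖h‖ ∧ ‖h‖ ≤ r * b}).indicator
        fun h => (k h * ‖h‖ ^ (-((d : ℝ) + α))) • h) r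
    rw [h0, smul_zero] at h1
    have h2 : ∀ h : Rn d, ({h : Rn d | r * a < ‖h‖ ∧ ‖h‖ ≤ r * b}).indicator
        (fun h => (k h * ‖h‖ ^ (-((d : ℝ) + α))) • h) (r • h) = (r ^ (-((d : ℝ) + α)) * r) •
        ({h : Rn d | a < ‖h‖ ∧ ‖h‖ ≤ b}).indicator
          (fun h => (k (r • h) * ‖h‖ ^ (-((d : ℝ) + α))) • h) h := by
      intro h
      have hn : ‖r • h‖ = r * ‖h‖ := by rw [norm_smul, Real.norm_of_nonneg hr.le]
      have hiff : r • h ∈ {h : Rn d | r * a < ‖h‖ ∧ ‖h‖ ≤ r * b} ↔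
          h ∈ {h : Rn d | a < ‖h‖ ∧ ‖h‖ ≤ b} := by
        change (r * a < ‖r • h‖ ∧ ‖r • h‖ ≤ r * b) ↔ (a < ‖h‖ ∧ ‖h‖ ≤ b)
        rw [hn, mul_lt_mul_iff_right₀ hr, mul_le_mul_iff_right₀ hr]
      by_cases hh : h ∈ {h : Rn d | a < ‖h‖ ∧ ‖h‖ ≤ b}
      · rw [indicator_of_mem hh, indicator_of_mem (hiff.2 hh), hn,
          Real.mul_rpow hr.le (norm_nonneg _), smul_smul, smul_smul]
        congr 1; ring
      · rw [indicator_of_notMem hh, indicator_of_notMem (mt hiff.1 hh), smul_zero]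
    simp only [h2, integral_smul] at h1
    rcases smul_eq_zero.1 h1 with h3 | h3
    · exact absurd h3 (by positivity)
    · exact h3

/-- The bounds are convex and the cancellation is linear. The segment between two coefficients is
the path along which the density is later differentiated. -/
lemma JumpCoeff.convex {α κ₀ κ₁ : ℝ} (hκ₀ : 0 < κ₀) (hα : 0 < α) {k l : Rn d → ℝ}
    (hk : JumpCoeff α κ₀ κ₁ k)
    (hl : JumpCoeff α κ₀ κ₁ l) {s : ℝ} (hs : s ∈ Icc (0 : ℝ) 1) :
    JumpCoeff α κ₀ κ₁ (fun h => k h + s * (l h - k h)) where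
  meas := hk.meas.add ((hl.meas.sub hk.meas).const_mul s)
  lower h := by nlinarith [hk.lower h, hl.lower h, hs.1, hs.2]
  upper h := by nlinarith [hk.upper h, hl.upper h, hs.1, hs.2]
  cancel h1 a b ha hab := by
    have e : ∀ h : Rn d, ((k h + s * (l h - k h)) * ‖h‖ ^ (-((d : ℝ) + α))) • h =
        (1 - s) • ((k h * ‖h‖ ^ (-((d : ℝ) + α))) • h) +
          s • ((l h * ‖h‖ ^ (-((d : ℝ) + α))) • h) := by
      intro h; rw [smul_smul, smul_smul, ← add_smul]; congr 1; ring
    simp only [e]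
    have i1 := (hk.integrableOn_shell hκ₀ hα (b := b) ha).smul (1 - s)
    have i2 := (hl.integrableOn_shell hκ₀ hα (b := b) ha).smul s
    simp only [Pi.smul_def] at i1 i2
    rw [integral_add i1 i2, integral_smul, integral_smul,
      hk.cancel h1 a b ha hab, hl.cancel h1 a b ha hab]
    simp

/-! ### The exponent of the small jumps along complex lines -/

lemma norm_exp_sub_one_le (w : ℂ) : ‖Complex.exp w - 1‖ ≤ ‖w‖ * Real.exp |w.re| := by
  have h := norm_image_sub_le_of_norm_deriv_le_segment_01' (f := fun t : ℝ => Complex.exp (t * w))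
    (f' := fun t : ℝ => Complex.exp (t * w) * w) (C := ‖w‖ * Real.exp |w.re|)
    (fun t _ => by
      have h1 : HasDerivAt (fun t : ℝ => (t : ℂ) * w) w t := by
        simpa using (Complex.ofRealCLM.hasDerivAt (x := t)).mul_const w
      exact (h1.cexp).hasDerivWithinAt)
    (fun t ht => by
      rw [norm_mul, Complex.norm_exp, mul_comm]
      gcongr
      rw [Complex.re_ofReal_mul]
      calc t * w.re ≤ t * |w.re| := by gcongr; exacts [ht.1, le_abs_self _]
        _ ≤ 1 * |w.re| := by gcongr; exact ht.2.le
        _ = _ := one_mul _)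
  simpa using h

lemma norm_exp_sub_one_sub_le (w : ℂ) :
    ‖Complex.exp w - 1 - w‖ ≤ ‖w‖ ^ 2 * Real.exp |w.re| := by
  have h := norm_image_sub_le_of_norm_deriv_le_segment_01'
    (f := fun t : ℝ => Complex.exp (t * w) - t * w)
    (f' := fun t : ℝ => Complex.exp (t * w) * w - w) (C := ‖w‖ ^ 2 * Real.exp |w.re|)
    (fun t _ => by
      have h1 : HasDerivAt (fun t : ℝ => (t : ℂ) * w) w t := by
        simpa using (Complex.ofRealCLM.hasDerivAt (x := t)).mul_const w
      exact (h1.cexp.sub h1).hasDerivWithinAt)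
    (fun t ht => by
      have h2 := norm_exp_sub_one_le (t * w)
      have h3 : Complex.exp (t * w) * w - w = (Complex.exp (t * w) - 1) * w := by ring
      have ht1 : |t| ≤ 1 := abs_le.2 ⟨by linarith [ht.1], ht.2.le⟩
      rw [h3, norm_mul]
      rw [norm_mul, Complex.norm_real, Real.norm_eq_abs, Complex.re_ofReal_mul, abs_mul] at h2
      have h4 : |t| * ‖w‖ * Real.exp (|t| * |w.re|) ≤ 1 * ‖w‖ * Real.exp (1 * |w.re|) := by gcongr
      calc _ ≤ (1 * ‖w‖ * Real.exp (1 * |w.re|)) * ‖w‖ := by gcongr; exact h2.trans h4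
        _ = _ := by ring_nf)
  have e : Complex.exp w - 1 - w = Complex.exp w - w - 1 := by ring
  rw [e]; simpa using h

lemma abs_chi_le (α : ℝ) (h : Rn d) : |chi α h| ≤ 1 := by unfold chi; split_ifs <;> simp

lemma measurable_chi (α : ℝ) : Measurable (chi α : Rn d → ℝ) := by
  unfold chi
  refine Measurable.ite ?_ measurable_const measurable_const
  by_cases h1 : 1 < α
  · simp [h1]
  · by_cases h2 : α = 1
    · simpa [h1, h2] using measurableSet_le measurable_norm measurable_const
    · simp [h1, h2]

/-- The compensated exponential of the small jumps, together with the full compensator. -/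
def smallExp (α : ℝ) (h : Rn d) (ζ : ℂ) : ℂ :=
  (if ‖h‖ ≤ 1 then Complex.exp (Complex.I * ζ) - 1 else 0) - (chi α h : ℂ) * (Complex.I * ζ)

/-- For |h| ≤ 1 the increment is of order one if α < 1 and of order two otherwise, because the
compensator is then active. For |h| > 1 only the compensator is left, and it is present only if α >
1. The imaginary part of the frequency costs at most e^B. -/
lemma norm_smallExp_le {α ω : ℝ} {h : Rn d} {ζ : ℂ} {M B : ℝ} (hM : 0 ≤ M)
    (hB : 0 ≤ B) (hζ : ‖ζ‖ ≤ M * ‖h‖) (hIm : ‖h‖ ≤ 1 → |ζ.im| ≤ B) :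
    ‖smallExp α h ζ‖ * ‖h‖ ^ (-((d : ℝ) + α)) ≤ Real.exp B * (1 + M) ^ 2 * jw α ω h := by
  have hJ : 0 ≤ ‖h‖ ^ (-((d : ℝ) + α)) := by positivity
  have hE : 1 ≤ Real.exp B := Real.one_le_exp hB
  have hM1 : 1 ≤ (1 + M) ^ 2 := by nlinarith
  have hM2 : M ≤ (1 + M) ^ 2 := by nlinarith
  have hM3 : M ^ 2 ≤ (1 + M) ^ 2 := by nlinarith
  have hI : ‖Complex.I * ζ‖ = ‖ζ‖ := by simp
  have hre : |(Complex.I * ζ).re| = |ζ.im| := by simp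
  unfold jw
  rw [← mul_assoc]
  gcongr
  by_cases h1 : ‖h‖ ≤ 1
  · have hexp : Real.exp |(Complex.I * ζ).re| ≤ Real.exp B := by
      rw [hre]; exact Real.exp_le_exp.2 (hIm h1)
    rw [if_pos h1]
    unfold smallExp tau chi
    by_cases hα : α < 1
    · have hχ : ¬ (1 < α ∨ (α = 1 ∧ ‖h‖ ≤ 1)) := by
        rintro (h2 | h2) <;> linarith [h2]
      simp only [hα, if_true, if_pos h1, if_neg hχ, Real.rpow_one, Complex.ofReal_zero, zero_mul,
        sub_zero]
      calc _ ≤ ‖ζ‖ * Real.exp B := by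
            refine (norm_exp_sub_one_le _).trans ?_
            rw [hI]; gcongr
        _ ≤ M * ‖h‖ * Real.exp B := by gcongr
        _ ≤ (1 + M) ^ 2 * ‖h‖ * Real.exp B := by gcongr
        _ = _ := by ring
    · have hχ : 1 < α ∨ (α = 1 ∧ ‖h‖ ≤ 1) := by
        rcases (not_lt.1 hα).lt_or_eq with h2 | h2
        · exact Or.inl h2
        · exact Or.inr ⟨h2.symm, h1⟩
      simp only [hα, if_false, if_pos h1, if_pos hχ, Complex.ofReal_one, one_mul]
      calc _ ≤ ‖ζ‖ ^ 2 * Real.exp B := by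
            refine (norm_exp_sub_one_sub_le _).trans ?_
            rw [hI]; gcongr
        _ ≤ (M * ‖h‖) ^ 2 * Real.exp B := by gcongr
        _ = Real.exp B * M ^ 2 * ‖h‖ ^ (2 : ℝ) := by rw [Real.rpow_two]; ring
        _ ≤ _ := by gcongr
  · rw [if_neg h1]
    unfold smallExp sig chi
    have hpos : 0 < ‖h‖ := by linarith
    by_cases hα : 1 < α
    · have h2 : ¬ α < 1 := by linarith
      have h3 : α ≠ 1 := by linarith
      simp only [hα, true_or, if_true, if_neg h1, if_neg h2, if_neg h3, Real.rpow_one,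
        Complex.ofReal_one, one_mul, zero_sub, norm_neg, hI]
      calc ‖ζ‖ ≤ 1 * M * ‖h‖ := by simpa using hζ
        _ ≤ _ := by gcongr
    · have hχ : ¬ (1 < α ∨ (α = 1 ∧ ‖h‖ ≤ 1)) := by
        rintro (h2 | h2)
        · exact hα h2
        · exact h1 h2.2
      simp only [if_neg h1, if_neg hχ, Complex.ofReal_zero, zero_mul, sub_zero, norm_zero]
      split_ifs <;> positivity

/-- The complexified pairing `⟨u + z e, h⟩`. -/
def cpair (u e : Rn d) (z : ℂ) (h : Rn d) : ℂ := (inner ℝ u h : ℝ) + z * (inner ℝ e h : ℝ)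

lemma norm_cpair_le {u e : Rn d} (he : ‖e‖ ≤ 1) (z : ℂ) (h : Rn d) :
    ‖cpair u e z h‖ ≤ (‖u‖ + ‖z‖) * ‖h‖ := by
  have h1 := abs_real_inner_le_norm u h
  have h2 := abs_real_inner_le_norm e h
  unfold cpair
  refine (norm_add_le _ _).trans ?_
  rw [norm_mul, Complex.norm_real, Complex.norm_real, Real.norm_eq_abs, Real.norm_eq_abs, add_mul]
  gcongr
  calc _ ≤ ‖e‖ * ‖h‖ := h2
    _ ≤ 1 * ‖h‖ := by gcongr
    _ = _ := one_mul _

lemma abs_im_cpair_le {u e : Rn d} (he : ‖e‖ ≤ 1) (z : ℂ) (h : Rn d) :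
    |(cpair u e z h).im| ≤ ‖z‖ * ‖h‖ := by
  have h2 := abs_real_inner_le_norm e h
  have h3 : |inner ℝ e h| ≤ 1 * ‖h‖ := h2.trans (by gcongr)
  have : (cpair u e z h).im = z.im * inner ℝ e h := by simp [cpair]
  rw [this, abs_mul]
  have h4 := Complex.abs_im_le_norm z
  calc _ ≤ ‖z‖ * (1 * ‖h‖) := by gcongr
    _ = _ := by ring

/-- The kernel `k(h)/|h|^{d+α}`. -/
def levyK (α : ℝ) (k : Rn d → ℝ) (h : Rn d) : ℝ := k h * ‖h‖ ^ (-((d : ℝ) + α))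

lemma levyK_eq (α : ℝ) (k : Rn d → ℝ) (h : Rn d) : k h / ‖h‖ ^ ((d : ℝ) + α) = levyK α k h := by
  rw [levyK, Real.rpow_neg (norm_nonneg _), div_eq_mul_inv]

lemma measurable_levyK (α : ℝ) {k : Rn d → ℝ} (hk : Measurable k) : Measurable (levyK α k) :=
  hk.mul (by fun_prop)

lemma abs_levyK_le (α : ℝ) {k : Rn d → ℝ} {A : ℝ} (hk : ∀ h, |k h| ≤ A) (h : Rn d) :
    |levyK α k h| ≤ A * ‖h‖ ^ (-((d : ℝ) + α)) := by
  have : 0 ≤ ‖h‖ ^ (-((d : ℝ) + α)) := by positivity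
  rw [levyK, abs_mul, abs_of_nonneg this]
  gcongr; exact hk h

/-- The part of the exponent that extends to an entire function along every complex line. -/
def psiS (α : ℝ) (k : Rn d → ℝ) (u e : Rn d) (z : ℂ) : ℂ :=
  -∫ h, smallExp α h (cpair u e z h) * (levyK α k h : ℂ)

/-- The jump kernel restricted to the jumps larger than one. -/
def bigK (α : ℝ) (k : Rn d → ℝ) (h : Rn d) : ℝ := if ‖h‖ ≤ 1 then 0 else levyK α k h

lemma measurable_smallExp (α : ℝ) : Measurable fun w : Rn d × ℂ => smallExp α w.1 w.2 := by
  unfold smallExp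
  refine Measurable.sub (Measurable.ite ?_ (by fun_prop) measurable_const) ?_
  · exact measurableSet_le (measurable_norm.comp measurable_fst) measurable_const
  · exact (Complex.measurable_ofReal.comp ((measurable_chi α).comp measurable_fst)).mul
      (by fun_prop)

lemma norm_smallExp_mul_levyK_le {α ω A : ℝ} {k : Rn d → ℝ}
    (hk : ∀ h, |k h| ≤ A) {u e : Rn d} (he : ‖e‖ ≤ 1) {z : ℂ} (h : Rn d) :
    ‖smallExp α h (cpair u e z h) * (levyK α k h : ℂ)‖ ≤
      A * (Real.exp ‖z‖ * (1 + (‖u‖ + ‖z‖)) ^ 2) * jw α ω h := by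
  have hA : 0 ≤ A := (abs_nonneg _).trans (hk 0)
  have h1 := norm_smallExp_le (α := α) (ω := ω) (h := h) (ζ := cpair u e z h) (M := ‖u‖ + ‖z‖)
    (B := ‖z‖) (by positivity) (norm_nonneg z) (norm_cpair_le he z h)
    (fun hh => (abs_im_cpair_le he z h).trans (by nlinarith [norm_nonneg z]))
  rw [norm_mul, Complex.norm_real, Real.norm_eq_abs]
  calc _ ≤ ‖smallExp α h (cpair u e z h)‖ * (A * ‖h‖ ^ (-((d : ℝ) + α))) := by
        gcongr; exact abs_levyK_le α hk h
    _ = A * (‖smallExp α h (cpair u e z h)‖ * ‖h‖ ^ (-((d : ℝ) + α))) := by ring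
    _ ≤ A * (Real.exp ‖z‖ * (1 + (‖u‖ + ‖z‖)) ^ 2 * jw α ω h) := by gcongr
    _ = _ := by ring

lemma measurable_smallExp_cpair (α : ℝ) {k : Rn d → ℝ} (hk : Measurable k) (e : Rn d) :
    Measurable fun w : (Rn d × ℂ) × Rn d =>
      smallExp α w.2 (cpair w.1.1 e w.1.2 w.2) * (levyK α k w.2 : ℂ) := by
  have h1 : Measurable fun w : (Rn d × ℂ) × Rn d => cpair w.1.1 e w.1.2 w.2 := by
    unfold cpair; fun_prop
  have h2 : Measurable fun w : (Rn d × ℂ) × Rn d => (w.2, cpair w.1.1 e w.1.2 w.2) :=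
    measurable_snd.prodMk h1
  have h3 : Measurable fun w : (Rn d × ℂ) × Rn d => levyK α k w.2 :=
    (measurable_levyK α hk).comp measurable_snd
  exact ((measurable_smallExp α).comp h2).mul (Complex.measurable_ofReal.comp h3)

lemma integrable_smallExp (hd : 1 ≤ d) {α A : ℝ} (h0 : 0 < α) (h2 : α < 2) {k : Rn d → ℝ}
    (hkm : Measurable k) (hk : ∀ h, |k h| ≤ A) {u e : Rn d} (he : ‖e‖ ≤ 1) (z : ℂ) :
    Integrable fun h => smallExp α h (cpair u e z h) * (levyK α k h : ℂ) := by
  -- Any positive ω would do in the weight here; 1/2 is an arbitrary choice.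
  refine Integrable.mono' ((integrable_jw hd h0 h2 (ω := 1 / 2) (by norm_num)).const_mul _) ?_
    (Filter.Eventually.of_forall fun h => norm_smallExp_mul_levyK_le hk he h)
  have hm : Measurable fun h : Rn d => ((u, z), h) := by fun_prop
  exact ((measurable_smallExp_cpair α hkm e).comp hm).aestronglyMeasurable

lemma measurable_psiS (α : ℝ) {k : Rn d → ℝ} (hk : Measurable k) (e : Rn d) :
    Measurable fun w : Rn d × ℂ => psiS α k w.1 e w.2 := by
  have := (measurable_smallExp_cpair α hk e).stronglyMeasurable.integral_prod_right' (ν := volume)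
  unfold psiS
  exact this.measurable.neg

lemma norm_psiS_le {α ω A : ℝ} (hd : 1 ≤ d) (h0 : 0 < α) (h2 : α < 2) (hω0 : 0 < ω)
    {k : Rn d → ℝ} (hk : ∀ h, |k h| ≤ A) {u e : Rn d} (he : ‖e‖ ≤ 1) (z : ℂ) :
    ‖psiS α k u e z‖ ≤
      A * (Real.exp ‖z‖ * (1 + (‖u‖ + ‖z‖)) ^ 2) * ∫ h : Rn d, jw α ω h := by
  rw [psiS, norm_neg, ← integral_const_mul]
  exact norm_integral_le_of_norm_le ((integrable_jw hd h0 h2 hω0).const_mul _)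
    (Filter.Eventually.of_forall fun h => norm_smallExp_mul_levyK_le hk he h)

/-- A real shift of z is a translation of u along e. Integrals over u are therefore invariant under
real shifts, which is the engine of the contour shift. -/
lemma cpair_add (u e : Rn d) (s : ℝ) (z : ℂ) (h : Rn d) :
    cpair (u + s • e) e z h = cpair u e (z + s) h := by
  simp only [cpair, inner_add_left, inner_smul_left]
  push_cast
  simp; ring

lemma psiS_add (α : ℝ) (k : Rn d → ℝ) (u e : Rn d) (s : ℝ) (z : ℂ) :
    psiS α k (u + s • e) e z = psiS α k u e (z + s) := by
  simp only [psiS, cpair_add]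

/-- Splits off the oscillation: e^{-Im ζ} cos(Re ζ) = e^{-Im ζ} − e^{-Im ζ}(1 − cos(Re ζ)). The
value at the purely imaginary point contributes a bounded amount, while the nonnegative remainder
carries the ellipticity. -/
lemma re_smallExp (α : ℝ) (h : Rn d) (ζ : ℂ) : (smallExp α h ζ).re =
    (smallExp α h (ζ.im * Complex.I)).re -
      (if ‖h‖ ≤ 1 then Real.exp (-ζ.im) * (1 - Real.cos ζ.re) else 0) := by
  unfold smallExp
  split_ifs with h1
  · simp [Complex.exp_re]
    ring
  · simp

/-- The lower bound for the symbol of the truncated stable process. -/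
lemma exists_stable_lower (hd : 1 ≤ d) {α : ℝ} (h0 : 0 < α) :
    ∃ c > 0, ∀ (v : Rn d), 1 ≤ ‖v‖ → ∃ S : Set (Rn d), ∃ b : ℝ, MeasurableSet S ∧
      volume S ≠ ⊤ ∧ 0 ≤ b ∧ c * ‖v‖ ^ α ≤ volume.real S * b ∧ ∀ h ∈ S, ‖h‖ ≤ 1 ∧
        b ≤ (1 - Real.cos (inner ℝ v h)) * ‖h‖ ^ (-((d : ℝ) + α)) := by
  have : Nonempty (Fin d) := ⟨⟨0, hd⟩⟩
  set c₀ : ℝ := 1 - Real.cos (1 / 4) with hc₀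
  have hc₀p : 0 < c₀ := by
    have := Real.cos_lt_cos_of_nonneg_of_le_pi le_rfl (y := 1 / 4)
      (by linarith [Real.pi_gt_three]) (by norm_num)
    rw [Real.cos_zero] at this; linarith
  set V : ℝ := volume.real (Metric.ball (0 : Rn d) 1) with hV
  have hVp : 0 < V := ENNReal.toReal_pos (Metric.measure_ball_pos _ _ one_pos).ne'
    measure_ball_lt_top.ne
  refine ⟨c₀ * V * (4 : ℝ)⁻¹ ^ d, by positivity, fun v hv => ?_⟩
  have hvp : 0 < ‖v‖ := by linarith
  -- The ball is placed so that v·h lies in [1/4, 3/4]: its centre c satisfies v·c = 1/2 and its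
  -- radius allows an oscillation of 1/4. It has volume of order |v|^{-d} and its points satisfy |h|
  -- ≤ 1/|v|, hence the lower bound of order |v|^α.
  set ρ := 1 / (4 * ‖v‖) with hρ
  have hρp : 0 < ρ := by positivity
  set c := (1 / (2 * ‖v‖ ^ 2)) • v with hc
  have hcn : ‖c‖ = 1 / (2 * ‖v‖) := by
    rw [hc, norm_smul, Real.norm_of_nonneg (by positivity)]; field_simp
  refine ⟨Metric.ball c ρ, c₀ * ‖v‖ ^ ((d : ℝ) + α), measurableSet_ball,
    measure_ball_lt_top.ne, by positivity, ?_, fun h hh => ?_⟩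
  · have hball : volume.real (Metric.ball c ρ) = ρ ^ d * V := by
      rw [hV, measureReal_def, measureReal_def, Measure.addHaar_ball _ _ hρp.le]
      simp only [finrank_euclideanSpace, Fintype.card_fin, ENNReal.toReal_mul]
      rw [ENNReal.toReal_ofReal (by positivity)]
    rw [hball]
    have : ρ ^ d * ‖v‖ ^ ((d : ℝ) + α) = (4 : ℝ)⁻¹ ^ d * ‖v‖ ^ α := by
      rw [Real.rpow_add hvp, Real.rpow_natCast, ← mul_assoc, ← mul_pow]
      congr 2; rw [hρ]; field_simp
    apply le_of_eq
    calc _ = c₀ * V * ((4 : ℝ)⁻¹ ^ d * ‖v‖ ^ α) := by ring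
      _ = _ := by rw [← this]; ring
  · have h1 : ‖h - c‖ < ρ := by simpa [dist_eq_norm] using hh
    have h2 : ‖h‖ ≤ 1 / ‖v‖ := by
      have := norm_le_norm_add_norm_sub' h c
      rw [hcn] at this
      have e : 1 / (2 * ‖v‖) + ρ ≤ 1 / ‖v‖ := by
        rw [hρ]; field_simp; norm_num
      linarith
    have h3 : (inner ℝ v c : ℝ) = 1 / 2 := by
      rw [hc, inner_smul_right, real_inner_self_eq_norm_sq]; field_simp
    have h4 : |inner ℝ v (h - c)| ≤ 1 / 4 := by
      refine (abs_real_inner_le_norm _ _).trans ?_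
      calc ‖v‖ * ‖h - c‖ ≤ ‖v‖ * ρ := by gcongr
        _ = 1 / 4 := by rw [hρ]; field_simp
    have h5 : (inner ℝ v h : ℝ) = 1 / 2 + inner ℝ v (h - c) := by rw [inner_sub_right, h3]; ring
    have h6 := abs_le.1 h4
    have hs1 : 1 / 4 ≤ (inner ℝ v h : ℝ) := by linarith [h6.1]
    have hs2 : (inner ℝ v h : ℝ) ≤ 3 / 4 := by linarith [h6.2]
    have hcos : Real.cos (inner ℝ v h) ≤ Real.cos (1 / 4) :=
      Real.cos_le_cos_of_nonneg_of_le_pi (by norm_num) (by linarith [Real.pi_gt_three]) hs1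
    have hhp : 0 < ‖h‖ := by
      rw [norm_pos_iff]; rintro rfl; simp at hs1; linarith
    refine ⟨h2.trans (by rw [div_le_one hvp]; exact hv), ?_⟩
    have h7 : ‖v‖ ^ ((d : ℝ) + α) ≤ ‖h‖ ^ (-((d : ℝ) + α)) := by
      have := Real.rpow_le_rpow_of_nonpos (z := -((d : ℝ) + α)) hhp h2
        (by linarith [Nat.cast_nonneg (α := ℝ) d])
      rw [one_div, Real.inv_rpow hvp.le, Real.rpow_neg hvp.le, inv_inv] at this
      exact this
    have h8 : c₀ ≤ 1 - Real.cos (inner ℝ v h) := by rw [hc₀]; linarith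
    exact mul_le_mul h8 h7 (by positivity) (hc₀p.le.trans h8)

/-- By `re_smallExp` the real part equals its value at zero frequency, bounded in terms of κ₁, plus
the integral of a nonnegative function. The latter is bounded below by κ₀ e^{-2} times the
oscillation of the stable symbol, since |Im⟨u+ze,h⟩| ≤ 2 for |h| ≤ 1. The constants depend on the
coefficient only through κ₀ and κ₁. -/
lemma exists_re_psiS_lower (hd : 1 ≤ d) {α κ₀ κ₁ : ℝ} (h0 : 0 < α) (h2 : α < 2) (hκ₀ : 0 < κ₀)
    (hκ : κ₀ ≤ κ₁) :
    ∃ c > 0, ∃ C : ℝ, ∀ k : Rn d → ℝ, JumpCoeff α κ₀ κ₁ k → ∀ u e : Rn d, ‖e‖ ≤ 1 →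
      ∀ z : ℂ, ‖z‖ ≤ 2 → c * ‖u + z.re • e‖ ^ α - C ≤ (psiS α k u e z).re := by
  obtain ⟨c, hc, hlow⟩ := exists_stable_lower hd h0
  set D : ℝ := κ₁ * (Real.exp 2 * (1 + (0 + 2)) ^ 2) * ∫ h : Rn d, jw α (1 / 2) h with hD
  have hJ : 0 ≤ ∫ h : Rn d, jw α (1 / 2) h := integral_nonneg fun h => jw_nonneg _ _ h
  have hκ₁ : 0 < κ₁ := hκ₀.trans_le hκ
  set c' := κ₀ * Real.exp (-2) * c with hc'
  have hc'p : 0 < c' := by positivity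
  refine ⟨c', hc'p, D + c', fun k hk u e he z hz => ?_⟩
  set v := u + z.re • e with hv
  set f : Rn d → ℝ := fun h =>
    (if ‖h‖ ≤ 1 then Real.exp (-(cpair u e z h).im) * (1 - Real.cos (inner ℝ v h)) else 0) *
      levyK α k h with hf
  have hre : ∀ h, (cpair u e z h).re = inner ℝ v h := by
    intro h; simp [cpair, hv, inner_add_left, inner_smul_left]
  -- The comparison point: the same imaginary part, but zero real frequency.
  set w : ℂ := z.im * Complex.I with hw
  have hwn : ‖w‖ ≤ 2 := by
    rw [hw]; simpa using (Complex.abs_im_le_norm z).trans hz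
  have hpw : ∀ h, ((cpair u e z h).im : ℂ) * Complex.I = cpair 0 e w h := by
    intro h; simp [cpair, hw]; ring
  have i1 := integrable_smallExp hd h0 h2 hk.meas (hk.abs_le hκ₀) (u := u) he z
  have i2 := integrable_smallExp hd h0 h2 hk.meas (hk.abs_le hκ₀) (u := 0) he w
  have hfeq : ∀ h, f h = (smallExp α h (cpair 0 e w h) * (levyK α k h : ℂ)).re -
      (smallExp α h (cpair u e z h) * (levyK α k h : ℂ)).re := by
    intro h
    rw [Complex.re_mul_ofReal, Complex.re_mul_ofReal, re_smallExp α h (cpair u e z h), hpw, hre, hf]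
    ring
  have hfi : Integrable f := (i2.re.sub i1.re).congr
    (Filter.Eventually.of_forall fun h => (hfeq h).symm)
  have hfint : ∫ h, f h = (psiS α k u e z).re - (psiS α k 0 e w).re := by
    simp only [hfeq]
    have e1 := integral_re i1
    have e2 := integral_re i2
    simp only [RCLike.re_eq_complex_re] at e1 e2
    have e3 := integral_sub i2.re i1.re
    simp only [RCLike.re_eq_complex_re] at e3
    rw [e3, e1, e2, psiS, psiS, Complex.neg_re, Complex.neg_re]; ring
  have hw0 : |(psiS α k 0 e w).re| ≤ D := by
    refine (Complex.abs_re_le_norm _).trans ((norm_psiS_le hd h0 h2 (ω := 1 / 2) (by norm_num)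
      (hk.abs_le hκ₀) he w).trans ?_)
    rw [norm_zero, hD]; gcongr
  have hf0 : ∀ h, 0 ≤ f h := by
    intro h
    refine mul_nonneg ?_ ?_
    · split_ifs
      · exact mul_nonneg (Real.exp_pos _).le (by linarith [Real.cos_le_one (inner ℝ v h)])
      · exact le_rfl
    · have := hk.lower h
      unfold levyK; have := hκ₀.trans_le this; positivity
  have key : c' * ‖v‖ ^ α - c' ≤ ∫ h, f h := by
    by_cases hv1 : 1 ≤ ‖v‖
    · obtain ⟨S, b, hS, hSv, hb, hcb, hS2⟩ := hlow v hv1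
      have h1 : ∫ h, S.indicator (fun _ => κ₀ * Real.exp (-2) * b) h ≤ ∫ h, f h := by
        refine integral_mono ((integrable_indicator_iff hS).2 (integrableOn_const hSv)) hfi
          fun h => ?_
        by_cases hh : h ∈ S
        · rw [indicator_of_mem hh]
          obtain ⟨q1, q2⟩ := hS2 h hh
          simp only [hf, if_pos q1, levyK]
          have q3 : Real.exp (-2) ≤ Real.exp (-(cpair u e z h).im) := by
            apply Real.exp_le_exp.2
            have := abs_im_cpair_le (u := u) he z h
            have := abs_le.1 this
            nlinarith [norm_nonneg z, norm_nonneg h]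
          calc κ₀ * Real.exp (-2) * b ≤ κ₀ * Real.exp (-2) *
                ((1 - Real.cos (inner ℝ v h)) * ‖h‖ ^ (-((d : ℝ) + α))) := by gcongr
            _ ≤ k h * Real.exp (-(cpair u e z h).im) *
                ((1 - Real.cos (inner ℝ v h)) * ‖h‖ ^ (-((d : ℝ) + α))) := by
              have : 0 ≤ 1 - Real.cos (inner ℝ v h) := by linarith [Real.cos_le_one (inner ℝ v h)]
              have := hκ₀.trans_le (hk.lower h)
              gcongr
              exact hk.lower h
            _ = _ := by ring
        · rw [indicator_of_notMem hh]; exact hf0 h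
      rw [integral_indicator hS, setIntegral_const, smul_eq_mul] at h1
      have : κ₀ * Real.exp (-2) * (c * ‖v‖ ^ α) ≤ κ₀ * Real.exp (-2) * (volume.real S * b) := by
        gcongr
      rw [hc'] at hc'p ⊢
      nlinarith
    · have h1 : ‖v‖ ^ α ≤ 1 := Real.rpow_le_one (norm_nonneg _) (not_le.1 hv1).le h0.le
      have : 0 ≤ ∫ h, f h := integral_nonneg hf0
      nlinarith
  have := abs_le.1 hw0
  linarith [this.1]

/-! ### Integrability of stable exponentials and contour shifts -/

lemma exists_pow_mul_exp_le {α c : ℝ} (h0 : 0 < α) (hc : 0 < c) (p : ℕ) :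
    ∃ C : ℝ, ∀ s : ℝ, 0 ≤ s → (1 + s) ^ p * Real.exp (-(c * s ^ α)) ≤ C := by
  obtain ⟨m, hm⟩ := exists_nat_gt ((p : ℝ) / α)
  rw [div_lt_iff₀ h0] at hm
  refine ⟨2 ^ p * (m.factorial / c ^ m + 1), fun s hs => ?_⟩
  have hC : 0 ≤ (m.factorial : ℝ) / c ^ m := by positivity
  rcases le_total s 1 with h1 | h1
  · have : Real.exp (-(c * s ^ α)) ≤ 1 := Real.exp_le_one_iff.2 (by
      have : 0 ≤ c * s ^ α := by positivity
      linarith)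
    calc _ ≤ (1 + 1) ^ p * (1 : ℝ) := by gcongr
      _ ≤ _ := by norm_num; linarith
  · have hsp : 0 < s := by linarith
    have h2 := Real.pow_div_factorial_le_exp (c * s ^ α) (by positivity) m
    have h3 : s ^ p ≤ (s ^ α) ^ m := by
      rw [← Real.rpow_natCast, ← Real.rpow_natCast, ← Real.rpow_mul hs]
      exact Real.rpow_le_rpow_of_exponent_le h1 (by linarith)
    rw [mul_pow] at h2
    have h4 : s ^ p * Real.exp (-(c * s ^ α)) ≤ m.factorial / c ^ m := by
      rw [Real.exp_neg, ← div_eq_mul_inv, div_le_div_iff₀ (Real.exp_pos _) (by positivity)]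
      rw [div_le_iff₀ (by positivity)] at h2
      calc s ^ p * c ^ m ≤ (s ^ α) ^ m * c ^ m := by gcongr
        _ ≤ _ := by linarith
    calc _ ≤ (s + s) ^ p * Real.exp (-(c * s ^ α)) := by gcongr
      _ = 2 ^ p * (s ^ p * Real.exp (-(c * s ^ α))) := by rw [← two_mul, mul_pow]; ring
      _ ≤ 2 ^ p * (m.factorial / c ^ m + 1) := by gcongr; linarith

lemma integrable_pow_mul_exp {α c : ℝ} (h0 : 0 < α) (hc : 0 < c) (p : ℕ) :
    Integrable fun u : Rn d => (1 + ‖u‖) ^ p * Real.exp (-(c * ‖u‖ ^ α)) := by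
  obtain ⟨C, hC⟩ := exists_pow_mul_exp_le h0 hc (p + (d + 1))
  have hi := (integrable_one_add_norm (E := Rn d) (μ := volume) (r := (d : ℝ) + 1)
    (by simp)).const_mul C
  refine hi.mono' (by fun_prop) (Filter.Eventually.of_forall fun u => ?_)
  have h1 : 0 < 1 + ‖u‖ := by positivity
  rw [Real.norm_of_nonneg (by positivity)]
  have h2 := hC ‖u‖ (norm_nonneg u)
  have h3 : (1 + ‖u‖) ^ (-((d : ℝ) + 1)) = ((1 + ‖u‖) ^ (d + 1))⁻¹ := by
    rw [Real.rpow_neg h1.le, ← Real.rpow_natCast]; push_cast; rfl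
  rw [h3, ← div_eq_mul_inv, le_div_iff₀ (by positivity)]
  calc _ = (1 + ‖u‖) ^ (p + (d + 1)) * Real.exp (-(c * ‖u‖ ^ α)) := by rw [pow_add]; ring
    _ ≤ C := h2

/-- Cauchy's estimate turns a majorant of the integrand on a ball into a majorant of its derivative
on a smaller ball, so no separate domination of the derivative is needed. Measurability of the
derivative in x comes from difference quotients. -/
lemma differentiableAt_integral_of_holomorphic {X : Type*} [MeasurableSpace X] {μ : Measure X}
    {E : X → ℂ → ℂ} {B : X → ℝ} {c : ℂ} {R : ℝ} (hR : 0 < R)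
    (hm : ∀ z, AEStronglyMeasurable (fun x => E x z) μ) (hE : ∀ x, Differentiable ℂ (E x))
    (hB : Integrable B μ) (hb : ∀ x, ∀ z ∈ Metric.ball c R, ‖E x z‖ ≤ B x) :
    DifferentiableAt ℂ (fun z => ∫ x, E x z ∂μ) c := by
  have hR2 : 0 < R / 2 := by positivity
  have hder : ∀ x, ∀ z ∈ Metric.ball c (R / 2), ‖deriv (E x) z‖ ≤ B x / (R / 4) := by
    intro x z hz
    refine Complex.norm_deriv_le_of_forall_mem_sphere_norm_le (by positivity)
      (hE x).diffContOnCl fun w hw => hb x w ?_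
    rw [Metric.mem_ball] at hz ⊢
    rw [Metric.mem_sphere] at hw
    have := dist_triangle w z c
    linarith
  have hmeas : AEStronglyMeasurable (fun x => deriv (E x) c) μ := by
    set t : ℕ → ℂ := fun n => ((n : ℂ) + 1)⁻¹ with ht
    have htend : Filter.Tendsto t Filter.atTop (nhdsWithin 0 {0}ᶜ) := by
      refine tendsto_nhdsWithin_iff.2 ⟨?_, Filter.Eventually.of_forall fun n => ?_⟩
      · have := tendsto_one_div_add_atTop_nhds_zero_nat (𝕜 := ℂ)
        simpa [ht] using this
      · simp only [ht, mem_compl_iff, mem_singleton_iff, inv_eq_zero]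
        exact Nat.cast_add_one_ne_zero n
    refine aestronglyMeasurable_of_tendsto_ae (Filter.atTop)
      (f := fun n x => (t n)⁻¹ • (E x (c + t n) - E x c)) (fun n => ?_)
      (Filter.Eventually.of_forall fun x => ?_)
    · exact ((hm (c + t n)).sub (hm c)).const_smul (t n)⁻¹
    exact ((hE x c).hasDerivAt.tendsto_slope_zero).comp htend
  have hint : Integrable (fun x => E x c) μ :=
    hB.mono' (hm c) (Filter.Eventually.of_forall fun x => hb x c (Metric.mem_ball_self hR))
  exact (hasDerivAt_integral_of_dominated_loc_of_deriv_le (F := fun z x => E x z)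
    (F' := fun z x => deriv (E x) z) (Metric.ball_mem_nhds c hR2)
    (Filter.Eventually.of_forall hm) hint hmeas
    (Filter.Eventually.of_forall hder) (hB.div_const _)
    (Filter.Eventually.of_forall fun x z _ => (hE x z).hasDerivAt)).2.differentiableAt

/-- Shift of the contour of integration by an imaginary vector: translation invariance makes the
integral constant in the real directions, and holomorphy does the rest. -/
lemma integral_contour_shift {E : Rn d → ℂ → ℂ} {B : Rn d → ℝ} {e : Rn d}
    (hm : ∀ z, AEStronglyMeasurable (fun u => E u z)) (hE : ∀ u, Differentiable ℂ (E u))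
    (hB : Integrable B) (hb : ∀ u, ∀ z ∈ Metric.ball (0 : ℂ) 2, ‖E u z‖ ≤ B u)
    (hadd : ∀ u (s : ℝ) z, E (u + s • e) z = E u (z + s)) :
    ∫ u, E u 0 = ∫ u, E u Complex.I := by
  set Φ : ℂ → ℂ := fun z => ∫ u, E u z with hΦ
  have hdiff : ∀ z ∈ Metric.ball (0 : ℂ) 2, DifferentiableAt ℂ Φ z := by
    intro z hz
    obtain ⟨ε, hε, hsub⟩ := Metric.isOpen_ball.mem_nhds hz |> Metric.mem_nhds_iff.1
    exact differentiableAt_integral_of_holomorphic hε hm hE hB fun u w hw => hb u w (hsub hw)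
  have hinv : ∀ (z : ℂ) (s : ℝ), Φ (z + s) = Φ z := by
    intro z s
    simp only [hΦ, ← hadd]
    exact integral_add_right_eq_self (fun u => E u z) (s • e)
  have hder : ∀ z ∈ Metric.ball (0 : ℂ) 2, deriv Φ z = 0 := by
    intro z hz
    have h1 := (hdiff z hz).hasDerivAt
    have h2 : HasDerivAt (fun s : ℝ => z + (s : ℂ)) 1 0 := by
      simpa using (Complex.ofRealCLM.hasDerivAt (x := (0 : ℝ))).const_add z
    have h3 : HasDerivAt (fun s : ℝ => Φ (z + (s : ℂ))) (deriv Φ z * 1) 0 := by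
      have h1' : HasDerivAt Φ (deriv Φ z) (z + ((0 : ℝ) : ℂ)) := by simpa using h1
      exact h1'.comp (0 : ℝ) h2
    simp only [hinv] at h3
    simpa using h3.unique (hasDerivAt_const (0 : ℝ) (Φ z))
  exact Metric.isOpen_ball.is_const_of_deriv_eq_zero (f := Φ)
    (convex_ball (0 : ℂ) 2).isPreconnected
    (fun z hz => (hdiff z hz).differentiableWithinAt) (fun z hz => hder z hz)
    (by simp) (by simp)

/-! ### Fourier integrals and compound Poisson factors -/

/-- The Fourier integral `∫ e^{iu·x} f(u) du`. -/
def fint (f : Rn d → ℂ) (x : Rn d) : ℂ :=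
  ∫ u, Complex.exp (Complex.I * (inner ℝ u x : ℝ)) * f u

lemma norm_exp_I_mul_real (s : ℝ) : ‖Complex.exp (Complex.I * (s : ℂ))‖ = 1 := by
  rw [mul_comm]; exact Complex.norm_exp_ofReal_mul_I s

lemma integrable_exp_inner_mul {f : Rn d → ℂ} (hf : Integrable f) (x : Rn d) :
    Integrable fun u => Complex.exp (Complex.I * (inner ℝ u x : ℝ)) * f u := by
  refine hf.norm.mono' ?_ (Filter.Eventually.of_forall fun u => ?_)
  · exact AEStronglyMeasurable.mul (by fun_prop) hf.1
  · rw [norm_mul, norm_exp_I_mul_real, one_mul]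

/-- The Fourier transform of a real kernel. -/
def khat (ν : Rn d → ℝ) (u : Rn d) : ℂ :=
  ∫ h, Complex.exp (Complex.I * (inner ℝ u h : ℝ)) * (ν h : ℂ)

lemma norm_khat_le {ν : Rn d → ℝ} (u : Rn d) : ‖khat ν u‖ ≤ ∫ h, |ν h| := by
  refine (norm_integral_le_integral_norm _).trans_eq ?_
  congr 1; ext h
  rw [norm_mul, norm_exp_I_mul_real, one_mul, Complex.norm_real, Real.norm_eq_abs]

lemma measurable_khat {ν : Rn d → ℝ} (hν : Measurable ν) : Measurable (khat ν) := by
  have h1 : Measurable fun w : Rn d × Rn d =>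
      Complex.exp (Complex.I * (inner ℝ w.1 w.2 : ℝ)) * (ν w.2 : ℂ) :=
    Measurable.mul (by fun_prop) (Complex.measurable_ofReal.comp (hν.comp measurable_snd))
  exact (h1.stronglyMeasurable.integral_prod_right' (ν := volume)).measurable

lemma integrable_mul_khat {f : Rn d → ℂ} (hf : Integrable f) {ν : Rn d → ℝ} (hν : Measurable ν) :
    Integrable fun u => f u * khat ν u :=
  Integrable.mul_bdd (c := ∫ h, |ν h|) hf (measurable_khat hν).aestronglyMeasurable
    (Filter.Eventually.of_forall fun u => norm_khat_le u)

lemma fint_mul_khat {f : Rn d → ℂ} (hf : Integrable f) {ν : Rn d → ℝ} (hν : Integrable ν)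
    (x : Rn d) : fint (fun u => f u * khat ν u) x = ∫ h, (ν h : ℂ) * fint f (x + h) := by
  have hν' : Integrable fun h => (ν h : ℂ) := hν.ofReal
  have hprod : Integrable (Function.uncurry fun u h : Rn d =>
      Complex.exp (Complex.I * (inner ℝ u x : ℝ)) * f u *
        (Complex.exp (Complex.I * (inner ℝ u h : ℝ)) * (ν h : ℂ)))
      ((volume : Measure (Rn d)).prod volume) := by
    have h1 := (integrable_exp_inner_mul hf x).mul_prod hν'
    refine h1.norm.mono' ?_ (Filter.Eventually.of_forall fun w => ?_)
    · have h2 : AEStronglyMeasurable (fun w : Rn d × Rn d =>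
          Complex.exp (Complex.I * (inner ℝ w.1 w.2 : ℝ)))
          ((volume : Measure (Rn d)).prod volume) := by fun_prop
      refine (h1.1.mul h2).congr (Filter.Eventually.of_forall fun w => ?_)
      simp only [Function.uncurry, Pi.mul_apply]; ring
    · simp only [Function.uncurry, norm_mul, norm_exp_I_mul_real, one_mul, le_refl]
  have e1 : fint (fun u => f u * khat ν u) x = ∫ u, ∫ h,
      Complex.exp (Complex.I * (inner ℝ u x : ℝ)) * f u *
        (Complex.exp (Complex.I * (inner ℝ u h : ℝ)) * (ν h : ℂ)) := by
    simp only [fint, khat, integral_const_mul, mul_assoc]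
  rw [e1, integral_integral_swap hprod]
  congr 1; ext h
  rw [fint, ← integral_const_mul]
  congr 1; ext u
  rw [inner_add_right]; push_cast; rw [mul_add, Complex.exp_add]; ring

/-- Multiplication by the transform of ν convolves with ν, and the convolution of two unit-scale
profiles is bounded by a multiple of the same profile. The factor acquired does not depend on f, so
m multiplications cost its m-th power. -/
lemma norm_fint_mul_khat_le {f : Rn d → ℂ} (hf : Integrable f) {ν : Rn d → ℝ}
    (hνm : Measurable ν) {α A D : ℝ} (h0 : 0 < α) (hA : 0 ≤ A) (hD : 0 ≤ D)
    (hν : ∀ h, |ν h| ≤ D * profile α 1 h) (hfx : ∀ x, ‖fint f x‖ ≤ A * profile α 1 x) (x : Rn d) :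
    ‖fint (fun u => f u * khat ν u) x‖ ≤
      A * (D * (2 * 1) ^ ((d : ℝ) + α) * (2 * mass d α)) * profile α 1 x := by
  have hνi : Integrable ν := ((integrable_profile_one h0).const_mul D).mono'
    hνm.aestronglyMeasurable (Filter.Eventually.of_forall hν)
  have i1 : Integrable fun h : Rn d => profile α 1 (x + h) :=
    (integrable_profile_one h0).comp_add_left x
  have i2 := i1.add (integrable_profile_one (d := d) h0)
  rw [fint_mul_khat hf hνi]
  refine (norm_integral_le_of_norm_le (g := fun h => A * D * (2 * 1) ^ ((d : ℝ) + α) *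
    profile α 1 x * (profile α 1 (x + h) + profile α 1 h)) (i2.const_mul _)
    (Filter.Eventually.of_forall fun h => ?_)).trans_eq ?_
  · have hm := profile_mul_le (x := x) (a := x + h) (b := h) h0 one_pos one_pos (R := 1) (L := 1)
      le_rfl le_rfl le_rfl (by norm_num)
      (by have := norm_sub_le (x + h) h; simpa using this)
    rw [norm_mul, Complex.norm_real, Real.norm_eq_abs]
    have p1 := profile_nonneg (γ := α) one_pos h
    have p2 := profile_nonneg (γ := α) one_pos (x + h)
    calc |ν h| * ‖fint f (x + h)‖ ≤ (D * profile α 1 h) * (A * profile α 1 (x + h)) :=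
          mul_le_mul (hν h) (hfx _) (norm_nonneg _) (by positivity)
      _ = A * D * (profile α 1 (x + h) * profile α 1 h) := by ring
      _ ≤ A * D * ((2 * 1) ^ ((d : ℝ) + α) * profile α 1 x *
            (profile α 1 (x + h) + profile α 1 h)) := by gcongr
      _ = _ := by ring
  · rw [integral_const_mul, integral_add i1 (integrable_profile_one h0),
      integral_add_left_eq_self (fun h => profile α 1 h), ← mass]
    ring

/-- The bound for a Fourier integral is stable under convolution with a compound Poisson law. -/
lemma norm_fint_mul_exp_khat_le {f : Rn d → ℂ} (hf : Integrable f) {ν : Rn d → ℝ}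
    (hνm : Measurable ν) {α A D : ℝ} (h0 : 0 < α) (hA : 0 ≤ A) (hD : 0 ≤ D)
    (hν : ∀ h, |ν h| ≤ D * profile α 1 h) (hfx : ∀ x, ‖fint f x‖ ≤ A * profile α 1 x) (x : Rn d) :
    ‖fint (fun u => f u * Complex.exp (khat ν u)) x‖ ≤
      A * Real.exp (D * (2 * 1) ^ ((d : ℝ) + α) * (2 * mass d α)) * profile α 1 x := by
  set c := D * (2 * 1) ^ ((d : ℝ) + α) * (2 * mass d α) with hc
  have hc0 : 0 ≤ c := by have := mass_nonneg (d := d) α; positivity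
  -- Each power of the transform keeps the profile at scale one and multiplies the constant by c;
  -- the exponential series of these constants then sums to e^c.
  have hpow : ∀ m : ℕ, Integrable (fun u => f u * khat ν u ^ m) ∧
      ∀ x, ‖fint (fun u => f u * khat ν u ^ m) x‖ ≤ A * c ^ m * profile α 1 x := by
    intro m
    induction m with
    | zero => simpa using ⟨hf, hfx⟩
    | succ m ih =>
      have e : (fun u => f u * khat ν u ^ (m + 1)) = fun u => (f u * khat ν u ^ m) * khat ν u := by
        ext u; ring
      rw [e]
      refine ⟨integrable_mul_khat ih.1 hνm, fun x => ?_⟩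
      refine (norm_fint_mul_khat_le ih.1 hνm h0 (by positivity) hD hν ih.2 x).trans_eq ?_
      rw [← hc]; ring
  set M := ∫ h, |ν h| with hM
  have hM0 : 0 ≤ M := integral_nonneg fun h => abs_nonneg _
  set F : ℕ → Rn d → ℂ := fun m u =>
    Complex.exp (Complex.I * (inner ℝ u x : ℝ)) * (f u * khat ν u ^ m) / (m.factorial : ℂ) with hF
  have hFi : ∀ m, Integrable (F m) := fun m =>
    (integrable_exp_inner_mul (hpow m).1 x).div_const _
  have hFn : ∀ m, ∫ u, ‖F m u‖ ≤ (∫ u, ‖f u‖) * (M ^ m / m.factorial) := by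
    intro m
    rw [← integral_mul_const]
    refine integral_mono (hFi m).norm (hf.norm.mul_const _) fun u => ?_
    simp only [hF, norm_div, norm_mul, norm_pow, norm_exp_I_mul_real, one_mul, Complex.norm_natCast]
    rw [← mul_div_assoc]
    gcongr
    exact norm_khat_le u
  have hsum : Summable fun m => ∫ u, ‖F m u‖ :=
    Summable.of_nonneg_of_le (fun m => integral_nonneg fun u => norm_nonneg _) hFn
      ((Real.summable_pow_div_factorial M).mul_left _)
  have hs := hasSum_integral_of_summable_integral_norm hFi hsum
  have e1 : ∀ u, ∑' m, F m u =
      Complex.exp (Complex.I * (inner ℝ u x : ℝ)) * (f u * Complex.exp (khat ν u)) := by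
    intro u
    have h1 := NormedSpace.expSeries_div_hasSum_exp (khat ν u)
    rw [← Complex.exp_eq_exp_ℂ] at h1
    have h2 := h1.mul_left (Complex.exp (Complex.I * (inner ℝ u x : ℝ)) * f u)
    rw [← mul_assoc, ← h2.tsum_eq]
    congr 1; ext m; simp only [hF]; ring
  simp only [e1] at hs
  have e2 : ∀ m, ∫ u, F m u = fint (fun u => f u * khat ν u ^ m) x / (m.factorial : ℂ) := by
    intro m; simp only [hF, integral_div, fint]
  simp only [e2] at hs
  have hR : HasSum (fun m : ℕ => A * profile α 1 x * (c ^ m / m.factorial))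
      (A * profile α 1 x * Real.exp c) := by
    have h1 := NormedSpace.expSeries_div_hasSum_exp c
    rw [← Real.exp_eq_exp_ℝ] at h1
    exact h1.mul_left _
  have := tsum_of_norm_bounded hR (f := fun m : ℕ =>
    fint (fun u => f u * khat ν u ^ m) x / (m.factorial : ℂ)) (fun m => by
      rw [norm_div, Complex.norm_natCast, ← mul_div_assoc]
      have := (hpow m).2 x
      gcongr
      linarith)
  rw [hs.tsum_eq] at this
  refine this.trans_eq (by ring)

/-! ### Differences of the density of the small jumps -/

/-- The Fourier multiplier of an iterated difference, evaluated at the frequency `u + z e`. -/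
def mult (l : List (Rn d)) (u e : Rn d) (z : ℂ) : ℂ :=
  (l.map fun a => Complex.exp (Complex.I * cpair u e z a) - 1).prod

lemma mult_cons (a : Rn d) (l : List (Rn d)) (u e : Rn d) (z : ℂ) :
    mult (a :: l) u e z = (Complex.exp (Complex.I * cpair u e z a) - 1) * mult l u e z := by
  simp [mult]

/-- Each factor vanishes to first order in a, which yields |a| at the price of one power of 1 + |u|.
The exponential decay of the characteristic function pays for these powers. -/
lemma norm_mult_le {l : List (Rn d)} (hl : ∀ a ∈ l, ‖a‖ ≤ 1) {u e : Rn d} (he : ‖e‖ ≤ 1) {z : ℂ}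
    (hz : ‖z‖ ≤ 2) : ‖mult l u e z‖ ≤
      (l.map norm).prod * ((2 * Real.exp 2) ^ l.length * (1 + ‖u‖) ^ l.length) := by
  induction l with
  | nil => simp [mult]
  | cons a l ih =>
    have ha : ‖a‖ ≤ 1 := hl a (by simp)
    have ih' := ih fun b hb => hl b (by simp [hb])
    have h1 : ‖Complex.exp (Complex.I * cpair u e z a) - 1‖ ≤
        ‖a‖ * (2 * Real.exp 2 * (1 + ‖u‖)) := by
      refine (norm_exp_sub_one_le _).trans ?_
      have h2 : |(Complex.I * cpair u e z a).re| ≤ 2 := by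
        have := abs_im_cpair_le (u := u) he z a
        rw [Complex.I_mul_re, abs_neg]
        nlinarith [norm_nonneg z, norm_nonneg a]
      have h3 := norm_cpair_le (u := u) he z a
      rw [norm_mul, Complex.norm_I, one_mul]
      calc _ ≤ ((‖u‖ + ‖z‖) * ‖a‖) * Real.exp 2 := by gcongr
        _ ≤ (2 * (1 + ‖u‖) * ‖a‖) * Real.exp 2 := by
          gcongr; nlinarith [norm_nonneg u]
        _ = _ := by ring
    have hP : 0 ≤ (l.map norm).prod := List.prod_nonneg (by simp +contextual [List.mem_map])
    rw [mult_cons, norm_mul, List.map_cons, List.prod_cons, List.length_cons]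
    calc _ ≤ (‖a‖ * (2 * Real.exp 2 * (1 + ‖u‖))) *
          ((l.map norm).prod * ((2 * Real.exp 2) ^ l.length * (1 + ‖u‖) ^ l.length)) := by gcongr
      _ = _ := by ring

lemma cpair_zero (u e : Rn d) (h : Rn d) : cpair u e 0 h = (inner ℝ u h : ℝ) := by simp [cpair]

lemma norm_mult_zero_le (l : List (Rn d)) (u : Rn d) : ‖mult l u 0 0‖ ≤ 2 ^ l.length := by
  induction l with
  | nil => simp [mult]
  | cons a l ih =>
    rw [mult_cons, norm_mul, List.length_cons, pow_succ', cpair_zero]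
    gcongr
    refine (norm_sub_le _ _).trans ?_
    rw [norm_exp_I_mul_real]; norm_num

lemma mult_add (l : List (Rn d)) (u e : Rn d) (s : ℝ) (z : ℂ) :
    mult l (u + s • e) e z = mult l u e (z + s) := by
  simp only [mult, cpair_add]

lemma differentiable_cpair (u e h : Rn d) : Differentiable ℂ fun z => cpair u e z h := by
  unfold cpair; fun_prop

lemma differentiable_mult (l : List (Rn d)) (u e : Rn d) :
    Differentiable ℂ fun z => mult l u e z := by
  induction l with
  | nil => simp [mult]
  | cons a l ih =>
    simp only [mult_cons]
    exact (((differentiable_cpair u e a).const_mul _).cexp.sub_const 1).mul ih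

lemma continuous_mult_left (l : List (Rn d)) (e : Rn d) (z : ℂ) :
    Continuous fun u => mult l u e z := by
  induction l with
  | nil => simpa [mult] using continuous_const
  | cons a l ih =>
    simp only [mult_cons]
    refine Continuous.mul ?_ ih
    unfold cpair; fun_prop

lemma mult_zero_right (l : List (Rn d)) (u e : Rn d) : mult l u e 0 = mult l u 0 0 := by
  simp only [mult, cpair_zero]

lemma psiS_zero_right (α : ℝ) (k : Rn d → ℝ) (u e : Rn d) : psiS α k u e 0 = psiS α k u 0 0 := by
  simp only [psiS, cpair_zero]

lemma differentiable_psiS (hd : 1 ≤ d) {α A : ℝ} (h0 : 0 < α) (h2 : α < 2) {k : Rn d → ℝ}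
    (hkm : Measurable k) (hk : ∀ h, |k h| ≤ A) {u e : Rn d} (he : ‖e‖ ≤ 1) :
    Differentiable ℂ fun z => psiS α k u e z := by
  intro c
  have hA : 0 ≤ A := (abs_nonneg _).trans (hk 0)
  refine DifferentiableAt.neg ?_
  refine differentiableAt_integral_of_holomorphic one_pos
    (E := fun h z => smallExp α h (cpair u e z h) * (levyK α k h : ℂ))
    (B := fun h => A * (Real.exp (‖c‖ + 1) * (1 + (‖u‖ + (‖c‖ + 1))) ^ 2) * jw α (1 / 2) h)
    (fun z => (integrable_smallExp hd h0 h2 hkm hk he z).1) (fun h => ?_)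
    ((integrable_jw hd h0 h2 (by norm_num)).const_mul _) (fun h z hz => ?_)
  · refine Differentiable.mul_const ?_ _
    have h1 := (differentiable_cpair u e h).const_mul Complex.I
    unfold smallExp
    refine Differentiable.sub ?_ (h1.const_mul _)
    split_ifs
    · exact h1.cexp.sub_const 1
    · exact differentiable_const 0
  · have hz' : ‖z‖ ≤ ‖c‖ + 1 := by
      have := norm_le_norm_add_norm_sub' z c
      rw [Metric.mem_ball, dist_eq_norm] at hz
      linarith
    refine (norm_smallExp_mul_levyK_le (ω := 1 / 2) hk he h).trans ?_
    have := jw_nonneg α (1 / 2) h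
    gcongr

/-- The lower bound for the real part is in terms of |u + (Re z)e|. On |z| ≤ 2 this is replaced by
|u|, so that one integrable majorant serves the whole ball in which the contour moves. -/
lemma exists_norm_exp_psiS_le (hd : 1 ≤ d) {α κ₀ κ₁ : ℝ} (h0 : 0 < α) (h2 : α < 2) (hκ₀ : 0 < κ₀)
    (hκ : κ₀ ≤ κ₁) :
    ∃ c > 0, ∃ C ≥ 0, ∀ k : Rn d → ℝ, JumpCoeff α κ₀ κ₁ k → ∀ u e : Rn d, ‖e‖ ≤ 1 →
      ∀ z : ℂ, ‖z‖ ≤ 2 → ‖Complex.exp (-psiS α k u e z)‖ ≤ C * Real.exp (-(c * ‖u‖ ^ α)) := by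
  obtain ⟨c, hc, C, hC⟩ := exists_re_psiS_lower (d := d) hd h0 h2 hκ₀ hκ
  refine ⟨c / 4, by positivity, Real.exp (C + c * 4), (Real.exp_pos _).le, ?_⟩
  intro k hk u e he z hz
  have h1 := hC k hk u e he z hz
  set v := u + z.re • e with hv
  have hu : ‖u‖ ≤ ‖v‖ + 2 := by
    have e1 : u = v - z.re • e := by rw [hv]; abel
    have e2 : ‖z.re • e‖ ≤ 2 := by
      rw [norm_smul, Real.norm_eq_abs]
      have := Complex.abs_re_le_norm z
      nlinarith [norm_nonneg e, abs_nonneg z.re]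
    calc ‖u‖ = ‖v - z.re • e‖ := by rw [← e1]
      _ ≤ _ := (norm_sub_le _ _).trans (by gcongr)
  have h3 : ‖u‖ ^ α ≤ 4 * (‖v‖ ^ α + 4) := by
    have h4 : (2 : ℝ) ^ α ≤ 4 := by
      calc (2 : ℝ) ^ α ≤ 2 ^ (2 : ℝ) := Real.rpow_le_rpow_of_exponent_le (by norm_num) h2.le
        _ = 4 := by norm_num
    have hv0 : 0 ≤ ‖v‖ ^ α := by positivity
    rcases le_total ‖v‖ 2 with h5 | h5
    · calc ‖u‖ ^ α ≤ (2 * 2) ^ α := by gcongr; linarith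
        _ = 2 ^ α * 2 ^ α := Real.mul_rpow (by norm_num) (by norm_num)
        _ ≤ 4 * 4 := by gcongr
        _ ≤ _ := by linarith
    · calc ‖u‖ ^ α ≤ (2 * ‖v‖) ^ α := by gcongr; linarith
        _ = 2 ^ α * ‖v‖ ^ α := Real.mul_rpow (by norm_num) (by positivity)
        _ ≤ 4 * ‖v‖ ^ α := by gcongr
        _ ≤ _ := by linarith
  rw [Complex.norm_exp, Complex.neg_re, ← Real.exp_add]
  apply Real.exp_le_exp.2
  nlinarith

lemma exists_exp_neg_le_profile (α : ℝ) :
    ∃ C ≥ 0, ∀ x : Rn d, Real.exp (-‖x‖) ≤ C * profile α 1 x := by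
  obtain ⟨m, hm⟩ := exists_nat_ge ((d : ℝ) + α)
  obtain ⟨C, hC⟩ := exists_pow_mul_exp_le one_pos one_pos m
  have hC0 : 0 ≤ C := le_trans (by positivity) (hC 0 le_rfl)
  refine ⟨C, hC0, fun x => ?_⟩
  have h1 := hC ‖x‖ (norm_nonneg x)
  rw [Real.rpow_one, one_mul] at h1
  have hx : 1 ≤ 1 + ‖x‖ := by linarith [norm_nonneg x]
  have h2 : (1 + ‖x‖) ^ ((d : ℝ) + α) ≤ (1 + ‖x‖) ^ m := by
    rw [← Real.rpow_natCast]; exact Real.rpow_le_rpow_of_exponent_le hx hm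
  unfold profile
  rw [Real.one_rpow, one_mul, Real.rpow_neg (by positivity), ← div_eq_mul_inv,
    le_div_iff₀ (by positivity)]
  calc _ ≤ Real.exp (-‖x‖) * (1 + ‖x‖) ^ m := by gcongr
    _ ≤ C := by linarith

lemma measurable_psiS_left (α : ℝ) {k : Rn d → ℝ} (hk : Measurable k) (e : Rn d) (z : ℂ) :
    Measurable fun u => psiS α k u e z := by
  have := measurable_psiS α hk e
  fun_prop

set_option maxHeartbeats 1000000 in
/-- Decay of the iterated differences of the density of the small jumps. -/
lemma exists_norm_fint_psiS_le (hd : 1 ≤ d) {α κ₀ κ₁ : ℝ} (h0 : 0 < α) (h2 : α < 2)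
    (hκ₀ : 0 < κ₀) (hκ : κ₀ ≤ κ₁) (p : ℕ) :
    ∃ C ≥ 0, ∀ k : Rn d → ℝ, JumpCoeff α κ₀ κ₁ k → ∀ l : List (Rn d), l.length = p →
      (∀ a ∈ l, ‖a‖ ≤ 1) →
      Integrable (fun u => mult l u 0 0 * Complex.exp (-psiS α k u 0 0)) ∧ ∀ x,
      ‖fint (fun u => mult l u 0 0 * Complex.exp (-psiS α k u 0 0)) x‖ ≤
        C * (l.map norm).prod * profile α 1 x := by
  obtain ⟨c, hc, C, hC0, hC⟩ := exists_norm_exp_psiS_le (d := d) hd h0 h2 hκ₀ hκ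
  obtain ⟨D, hD0, hD⟩ := exists_exp_neg_le_profile (d := d) α
  have hi := integrable_pow_mul_exp (d := d) h0 hc p
  set T := ∫ u : Rn d, (1 + ‖u‖) ^ p * Real.exp (-(c * ‖u‖ ^ α)) with hT
  have hT0 : 0 ≤ T := integral_nonneg fun u => by positivity
  refine ⟨(2 * Real.exp 2) ^ p * C * T * D, by positivity, fun k hk l hl hl1 => ?_⟩
  set P := (l.map norm).prod with hP
  have hP0 : 0 ≤ P := List.prod_nonneg (by simp +contextual [List.mem_map])
  have hbd : ∀ (u e : Rn d) (z : ℂ), ‖e‖ ≤ 1 → ‖z‖ ≤ 2 →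
      ‖mult l u e z * Complex.exp (-psiS α k u e z)‖ ≤
        P * (2 * Real.exp 2) ^ p * C * ((1 + ‖u‖) ^ p * Real.exp (-(c * ‖u‖ ^ α))) := by
    intro u e z he hz
    have h1 := norm_mult_le hl1 (u := u) he hz
    rw [hl] at h1
    rw [norm_mul]
    calc _ ≤ (P * ((2 * Real.exp 2) ^ p * (1 + ‖u‖) ^ p)) * (C * Real.exp (-(c * ‖u‖ ^ α))) := by
          gcongr; exact hC k hk u e he z hz
      _ = _ := by ring
  have hmeas : ∀ e z, AEStronglyMeasurable
      (fun u => mult l u e z * Complex.exp (-psiS α k u e z)) := by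
    intro e z
    have m1 := (continuous_mult_left l e z).measurable
    have m2 := (measurable_psiS_left α hk.meas e z).neg.cexp
    exact (m1.mul m2).aestronglyMeasurable
  refine ⟨(hi.const_mul _).mono' (hmeas 0 0)
    (Filter.Eventually.of_forall fun u => hbd u 0 0 (by simp) (by simp)), fun x => ?_⟩
  -- Moving the contour to u + i e multiplies the oscillating factor by e^{-|x|}. For x = 0 the
  -- convention 0⁻¹ = 0 gives e = 0, and ⟨e,x⟩ = |x| still holds.
  set e : Rn d := ‖x‖⁻¹ • x with he
  have he1 : ‖e‖ ≤ 1 := by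
    rw [he, norm_smul, norm_inv, norm_norm]; exact inv_mul_le_one
  have hex : (inner ℝ e x : ℝ) = ‖x‖ := by
    rw [he, inner_smul_left, real_inner_self_eq_norm_sq]
    rcases eq_or_ne ‖x‖ 0 with h | h
    · simp [h]
    · simp; field_simp
  set E : Rn d → ℂ → ℂ := fun u z =>
    Complex.exp (Complex.I * cpair u e z x) * (mult l u e z * Complex.exp (-psiS α k u e z)) with hE
  have hnx : ∀ u z, ‖Complex.exp (Complex.I * cpair u e z x)‖ = Real.exp (-(z.im * ‖x‖)) := by
    intro u z
    rw [Complex.norm_exp, Complex.I_mul_re]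
    simp [cpair, hex]
  have hEm : ∀ z, AEStronglyMeasurable (fun u => E u z) := by
    intro z
    refine AEStronglyMeasurable.mul ?_ (hmeas e z)
    unfold cpair; fun_prop
  have hEd : ∀ u, Differentiable ℂ (E u) := by
    intro u
    refine ((differentiable_cpair u e x).const_mul _).cexp.mul ((differentiable_mult l u e).mul ?_)
    exact (differentiable_psiS hd h0 h2 hk.meas (hk.abs_le hκ₀) he1).neg.cexp
  have hEb : ∀ u, ∀ z ∈ Metric.ball (0 : ℂ) 2, ‖E u z‖ ≤ Real.exp (2 * ‖x‖) *
      (P * (2 * Real.exp 2) ^ p * C * ((1 + ‖u‖) ^ p * Real.exp (-(c * ‖u‖ ^ α)))) := by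
    intro u z hz
    have hz2 : ‖z‖ ≤ 2 := by
      rw [Metric.mem_ball, dist_zero_right] at hz; exact hz.le
    simp only [hE]
    rw [norm_mul, hnx]
    have h3 : -(z.im * ‖x‖) ≤ 2 * ‖x‖ := by
      have := (abs_le.1 ((Complex.abs_im_le_norm z).trans hz2)).1
      nlinarith [norm_nonneg x]
    gcongr
    exact hbd u e z he1 hz2
  have hshift := integral_contour_shift (E := E) (e := e)
    (B := fun u => Real.exp (2 * ‖x‖) *
      (P * (2 * Real.exp 2) ^ p * C * ((1 + ‖u‖) ^ p * Real.exp (-(c * ‖u‖ ^ α)))))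
    hEm hEd ((hi.const_mul _).const_mul _) hEb
    (fun u s z => by simp only [hE, cpair_add, mult_add, psiS_add])
  have e0 : fint (fun u => mult l u 0 0 * Complex.exp (-psiS α k u 0 0)) x = ∫ u, E u 0 := by
    simp only [fint, hE, cpair_zero, mult_zero_right, psiS_zero_right]
  rw [e0, hshift]
  refine (norm_integral_le_of_norm_le (g := fun u => Real.exp (-‖x‖) *
    (P * (2 * Real.exp 2) ^ p * C * ((1 + ‖u‖) ^ p * Real.exp (-(c * ‖u‖ ^ α)))))
    ((hi.const_mul _).const_mul _) (Filter.Eventually.of_forall fun u => ?_)).trans ?_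
  · simp only [hE]
    rw [norm_mul, hnx, Complex.I_im, one_mul]
    gcongr
    exact hbd u e Complex.I he1 (by simp)
  · rw [integral_const_mul, integral_const_mul, ← hT]
    clear_value T P E e
    have hK : 0 ≤ P * (2 * Real.exp 2) ^ p * C * T := by positivity
    refine (mul_le_mul_of_nonneg_right (hD x) hK).trans_eq ?_
    ring

/-! ### The full exponent and the density at time one -/

lemma setIntegral_compl_zero (hd : 1 ≤ d) {E : Type*} [NormedAddCommGroup E] [NormedSpace ℝ E]
    (f : Rn d → E) : ∫ h in ({0}ᶜ : Set (Rn d)), f h = ∫ h, f h := by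
  have : Nonempty (Fin d) := ⟨⟨0, hd⟩⟩
  rw [restrict_compl_singleton]

lemma integrableOn_compl_zero (hd : 1 ≤ d) {E : Type*} [NormedAddCommGroup E]
    (f : Rn d → E) : IntegrableOn f ({0}ᶜ : Set (Rn d)) ↔ Integrable f := by
  have : Nonempty (Fin d) := ⟨⟨0, hd⟩⟩
  rw [IntegrableOn, restrict_compl_singleton]

/-- The compensated exponential in the definition of the characteristic exponent. -/
def fullExp (α : ℝ) (u h : Rn d) : ℂ :=
  Complex.exp (Complex.I * (inner ℝ u h : ℝ)) - 1 -
    (chi α h : ℂ) * (Complex.I * (inner ℝ u h : ℝ))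

lemma psi_eq (hd : 1 ≤ d) (α : ℝ) (k : Rn d → ℝ) (u : Rn d) :
    psi α k u = -∫ h, fullExp α u h * (levyK α k h : ℂ) := by
  simp only [psi, levyK_eq, setIntegral_compl_zero hd, fullExp]

lemma abs_bigK_le {α A : ℝ} (h0 : 0 < α) {k : Rn d → ℝ} (hk : ∀ h, |k h| ≤ A) (h : Rn d) :
    |bigK α k h| ≤ A * 2 ^ ((d : ℝ) + α) * profile α 1 h := by
  have hA : 0 ≤ A := (abs_nonneg _).trans (hk 0)
  have := profile_nonneg (γ := α) one_pos h
  unfold bigK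
  split_ifs with h1
  · rw [abs_zero]; positivity
  · refine (abs_levyK_le α hk h).trans ?_
    have := rpow_norm_le_profile (r := 1) h0 one_pos (not_le.1 h1).le
    rw [Real.one_rpow, mul_one] at this
    rw [mul_assoc]; gcongr

lemma measurable_bigK (α : ℝ) {k : Rn d → ℝ} (hk : Measurable k) : Measurable (bigK α k) := by
  unfold bigK
  exact Measurable.ite (measurableSet_le measurable_norm measurable_const) measurable_const
    (measurable_levyK α hk)

lemma integrable_bigK {α A : ℝ} (h0 : 0 < α) {k : Rn d → ℝ} (hkm : Measurable k)
    (hk : ∀ h, |k h| ≤ A) : Integrable (bigK α k) :=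
  ((integrable_profile_one h0).const_mul _).mono' (measurable_bigK α hkm).aestronglyMeasurable
    (Filter.Eventually.of_forall fun h => abs_bigK_le h0 hk h)

lemma fullExp_mul_levyK (α : ℝ) (k : Rn d → ℝ) (u h : Rn d) :
    fullExp α u h * (levyK α k h : ℂ) = smallExp α h (cpair u 0 0 h) * (levyK α k h : ℂ) +
      (Complex.exp (Complex.I * (inner ℝ u h : ℝ)) * (bigK α k h : ℂ) - (bigK α k h : ℂ)) := by
  rw [cpair_zero]
  unfold fullExp smallExp bigK
  split_ifs
  · simp
  · ring

lemma integrable_fullExp (hd : 1 ≤ d) {α A : ℝ} (h0 : 0 < α) (h2 : α < 2) {k : Rn d → ℝ}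
    (hkm : Measurable k) (hk : ∀ h, |k h| ≤ A) (u : Rn d) :
    Integrable fun h => fullExp α u h * (levyK α k h : ℂ) := by
  simp only [fullExp_mul_levyK]
  have i3 : Integrable fun h => (bigK α k h : ℂ) := (integrable_bigK h0 hkm hk).ofReal
  refine (integrable_smallExp hd h0 h2 hkm hk (by simp) 0).add (Integrable.sub ?_ i3)
  have := integrable_exp_inner_mul i3 u
  simpa only [real_inner_comm] using this

/-- Large jumps contribute their total mass minus their Fourier transform. Hence e^{-ψ} is the
small-jump characteristic function times that of a compound Poisson law, up to a normalising
constant. -/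
lemma psi_eq_psiS (hd : 1 ≤ d) {α A : ℝ} (h0 : 0 < α) (h2 : α < 2) {k : Rn d → ℝ}
    (hkm : Measurable k) (hk : ∀ h, |k h| ≤ A) (u : Rn d) :
    psi α k u = psiS α k u 0 0 + ((∫ h, bigK α k h : ℝ) : ℂ) - khat (bigK α k) u := by
  have i1 := integrable_smallExp hd h0 h2 hkm hk (u := u) (e := 0) (by simp) 0
  have i3 : Integrable fun h => (bigK α k h : ℂ) := (integrable_bigK h0 hkm hk).ofReal
  have i2 := integrable_exp_inner_mul i3 u
  simp only [real_inner_comm] at i2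
  rw [psi_eq hd]
  simp only [fullExp_mul_levyK]
  have i4 := i2.sub i3
  simp only [Pi.sub_def] at i4
  rw [integral_add i1 i4, integral_sub i2 i3, psiS, khat]
  have e5 : ((∫ h, bigK α k h : ℝ) : ℂ) = ∫ h, (bigK α k h : ℂ) := integral_ofReal.symm
  rw [e5]; ring

/-- The density of the frozen process, reflected so that it is a function of the starting point. -/
def pk (α : ℝ) (k : Rn d → ℝ) (t : ℝ) (x : Rn d) : ℝ := levyDensity α k t (-x)

lemma q_eq (α : ℝ) (n : Rn d → Rn d → ℝ) (t : ℝ) (x y : Rn d) :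
    q α n t x y = pk α (n y) t (x - y) := by rw [q, pk, neg_sub]

/-- The normalised real part of a Fourier integral. -/
def rfint (f : Rn d → ℂ) (x : Rn d) : ℝ := ((2 * Real.pi) ^ d)⁻¹ * (fint f x).re

lemma pk_eq (α : ℝ) (k : Rn d → ℝ) (t : ℝ) :
    pk α k t = rfint (fun u => Complex.exp (-((t : ℂ) * psi α k u))) := by
  ext x
  simp only [pk, levyDensity, rfint, fint, inner_neg_right, Complex.ofReal_neg, mul_neg, neg_neg]

lemma abs_rfint_le (f : Rn d → ℂ) (x : Rn d) :
    |rfint f x| ≤ ((2 * Real.pi) ^ d)⁻¹ * ‖fint f x‖ := by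
  have : (0 : ℝ) ≤ ((2 * Real.pi) ^ d)⁻¹ := by positivity
  rw [rfint, abs_mul, abs_of_nonneg this]
  gcongr; exact Complex.abs_re_le_norm _

/-- Iterated differences. -/
def difs : List (Rn d) → (Rn d → ℝ) → Rn d → ℝ
  | [], g => g
  | a :: l, g => fun x => difs l g (x + a) - difs l g x

lemma integrable_mult_mul {f : Rn d → ℂ} (hf : Integrable f) (l : List (Rn d)) :
    Integrable fun u => mult l u 0 0 * f u :=
  Integrable.bdd_mul (c := 2 ^ l.length) hf (continuous_mult_left l 0 0).aestronglyMeasurable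
    (Filter.Eventually.of_forall fun u => norm_mult_zero_le l u)

lemma rfint_sub {f g : Rn d → ℂ} (hf : Integrable f) (hg : Integrable g) (x : Rn d) :
    rfint f x - rfint g x = rfint (fun u => f u - g u) x := by
  have : fint (fun u => f u - g u) x = fint f x - fint g x := by
    simp only [fint, mul_sub]
    exact integral_sub (integrable_exp_inner_mul hf x) (integrable_exp_inner_mul hg x)
  rw [rfint, rfint, rfint, this, Complex.sub_re]; ring

lemma rfint_add_right (f : Rn d → ℂ) (x a : Rn d) :
    rfint f (x + a) = rfint (fun u => Complex.exp (Complex.I * (inner ℝ u a : ℝ)) * f u) x := by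
  simp only [rfint, fint]
  congr 3; ext u
  rw [inner_add_right]; push_cast; rw [mul_add, Complex.exp_add]; ring

lemma integrable_exp_mul {f : Rn d → ℂ} (hf : Integrable f) (a : Rn d) :
    Integrable (fun u => Complex.exp (Complex.I * (inner ℝ u a : ℝ)) * f u) :=
  integrable_exp_inner_mul hf a

lemma difs_rfint {f : Rn d → ℂ} (hf : Integrable f) (l : List (Rn d)) (x : Rn d) :
    difs l (rfint f) x = rfint (fun u => mult l u 0 0 * f u) x := by
  induction l generalizing x with
  | nil => simp [difs, mult]
  | cons a l ih =>
    have hi := integrable_mult_mul hf l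
    simp only [difs, ih]
    rw [rfint_add_right, rfint_sub (integrable_exp_mul hi a) hi]
    congr 1; ext u
    rw [mult_cons, cpair_zero]; ring

lemma norm_khat_bigK_le {α κ₀ κ₁ : ℝ} (hκ₀ : 0 < κ₀) {k : Rn d → ℝ}
    (hk : JumpCoeff α κ₀ κ₁ k) (u : Rn d) : ‖khat (bigK α k) u‖ ≤ ∫ h, bigK α k h := by
  refine (norm_khat_le u).trans_eq (integral_congr_ae (Filter.Eventually.of_forall fun h => ?_))
  refine abs_of_nonneg ?_
  have := hκ₀.trans_le (hk.lower h)
  unfold bigK levyK; split_ifs <;> positivity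

/-- The transform of the large-jump kernel is bounded by its mass, so large jumps can only increase
the real part of the exponent. -/
lemma exists_re_psi_lower (hd : 1 ≤ d) {α κ₀ κ₁ : ℝ} (h0 : 0 < α) (h2 : α < 2) (hκ₀ : 0 < κ₀)
    (hκ : κ₀ ≤ κ₁) : ∃ c > 0, ∃ C ≥ 0, ∀ k : Rn d → ℝ, JumpCoeff α κ₀ κ₁ k → ∀ u : Rn d,
      c * ‖u‖ ^ α - C ≤ (psi α k u).re := by
  obtain ⟨c, hc, C, hC⟩ := exists_re_psiS_lower (d := d) hd h0 h2 hκ₀ hκ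
  refine ⟨c, hc, |C|, abs_nonneg C, fun k hk u => ?_⟩
  have h1 := hC k hk u 0 (by simp) 0 (by simp)
  rw [smul_zero, add_zero] at h1
  have h3 := (Complex.re_le_norm _).trans (norm_khat_bigK_le hκ₀ hk u)
  rw [psi_eq_psiS hd h0 h2 hk.meas (hk.abs_le hκ₀), Complex.sub_re, Complex.add_re,
    Complex.ofReal_re]
  linarith [le_abs_self C]

lemma norm_exp_psi_le {c C α : ℝ} {k : Rn d → ℝ} {u : Rn d}
    (h : c * ‖u‖ ^ α - C ≤ (psi α k u).re) {t : ℝ} (ht : 0 ≤ t) :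
    ‖Complex.exp (-((t : ℂ) * psi α k u))‖ ≤
      Real.exp (t * C) * Real.exp (-((t * c) * ‖u‖ ^ α)) := by
  rw [Complex.norm_exp, Complex.neg_re, Complex.re_ofReal_mul, ← Real.exp_add]
  apply Real.exp_le_exp.2
  nlinarith

/-- An integrable majorant, in the jump variable, of the compensated exponential. -/
def expW (α : ℝ) (h : Rn d) : ℝ := jw α (1 / 2) h + 2 * 2 ^ ((d : ℝ) + α) * profile α 1 h

lemma expW_nonneg (α : ℝ) (h : Rn d) : 0 ≤ expW α h := by
  have h1 := jw_nonneg α (1 / 2) h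
  have h2 := profile_nonneg (γ := α) one_pos h
  unfold expW; positivity

lemma integrable_expW (hd : 1 ≤ d) {α : ℝ} (h0 : 0 < α) (h2 : α < 2) :
    Integrable (expW α : Rn d → ℝ) :=
  (integrable_jw hd h0 h2 (by norm_num)).add ((integrable_profile_one h0).const_mul _)

lemma norm_fullExp_mul_levyK_le {α A : ℝ} (h0 : 0 < α) {k : Rn d → ℝ} (hk : ∀ h, |k h| ≤ A)
    (u h : Rn d) : ‖fullExp α u h * (levyK α k h : ℂ)‖ ≤ A * (1 + ‖u‖) ^ 2 * expW α h := by
  have hA : 0 ≤ A := (abs_nonneg _).trans (hk 0)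
  have h1 := norm_smallExp_mul_levyK_le (α := α) (ω := 1 / 2) hk (u := u) (e := 0) (by simp)
    (z := 0) h
  rw [norm_zero, Real.exp_zero, add_zero, one_mul] at h1
  have h2 := abs_bigK_le h0 hk h
  have h3 := profile_nonneg (γ := α) one_pos h
  have hu : 1 ≤ (1 + ‖u‖) ^ 2 := by nlinarith [norm_nonneg u]
  rw [fullExp_mul_levyK]
  refine (norm_add_le _ _).trans ?_
  have h4 : ‖Complex.exp (Complex.I * (inner ℝ u h : ℝ)) * (bigK α k h : ℂ) - (bigK α k h : ℂ)‖ ≤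
      2 * (A * 2 ^ ((d : ℝ) + α) * profile α 1 h) := by
    refine (norm_sub_le _ _).trans ?_
    rw [norm_mul, norm_exp_I_mul_real, Complex.norm_real, Real.norm_eq_abs]
    linarith
  have h5 : 2 * (A * 2 ^ ((d : ℝ) + α) * profile α 1 h) ≤
      (1 + ‖u‖) ^ 2 * (2 * (A * 2 ^ ((d : ℝ) + α) * profile α 1 h)) :=
    le_mul_of_one_le_left (by positivity) hu
  unfold expW
  nlinarith

lemma measurable_fullExp_mul_levyK (α : ℝ) {k : Rn d → ℝ} (hk : Measurable k) :
    Measurable fun w : Rn d × Rn d => fullExp α w.1 w.2 * (levyK α k w.2 : ℂ) := by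
  have h1 : Measurable fun w : Rn d × Rn d => (levyK α k w.2 : ℂ) :=
    Complex.measurable_ofReal.comp ((measurable_levyK α hk).comp measurable_snd)
  have h2 : Measurable fun w : Rn d × Rn d => (chi α w.2 : ℂ) :=
    Complex.measurable_ofReal.comp ((measurable_chi α).comp measurable_snd)
  unfold fullExp
  fun_prop

lemma measurable_psi (hd : 1 ≤ d) (α : ℝ) {k : Rn d → ℝ} (hk : Measurable k) :
    Measurable (psi α k) := by
  have h1 := (measurable_fullExp_mul_levyK α hk).stronglyMeasurable.integral_prod_right'
    (ν := volume)
  have h2 : psi α k = fun u => -∫ h, fullExp α u h * (levyK α k h : ℂ) :=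
    funext fun u => psi_eq hd α k u
  rw [h2]
  exact h1.measurable.neg

lemma norm_psi_le (hd : 1 ≤ d) {α A : ℝ} (h0 : 0 < α) (h2 : α < 2) {k : Rn d → ℝ}
    (hk : ∀ h, |k h| ≤ A) (u : Rn d) :
    ‖psi α k u‖ ≤ A * (1 + ‖u‖) ^ 2 * ∫ h : Rn d, expW α h := by
  rw [psi_eq hd, norm_neg, ← integral_const_mul]
  exact norm_integral_le_of_norm_le ((integrable_expW hd h0 h2).const_mul _)
    (Filter.Eventually.of_forall fun h => norm_fullExp_mul_levyK_le h0 hk u h)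

lemma integrable_pow_mul_exp_psi (hd : 1 ≤ d) {α κ₀ κ₁ : ℝ} (h0 : 0 < α) (h2 : α < 2)
    (hκ₀ : 0 < κ₀) {k : Rn d → ℝ} (hk : JumpCoeff α κ₀ κ₁ k) {t : ℝ} (ht : 0 < t) (p : ℕ) :
    Integrable fun u => (((1 + ‖u‖) ^ p : ℝ) : ℂ) * Complex.exp (-((t : ℂ) * psi α k u)) := by
  obtain ⟨c, hc, C, hC0, hC⟩ := exists_re_psi_lower (d := d) hd h0 h2 hκ₀
    ((hk.lower 0).trans (hk.upper 0))
  refine ((integrable_pow_mul_exp (d := d) h0 (mul_pos ht hc) p).const_mul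
    (Real.exp (t * C))).mono' ?_ (Filter.Eventually.of_forall fun u => ?_)
  · have := measurable_psi hd α hk.meas
    exact Measurable.aestronglyMeasurable (by fun_prop)
  · have := norm_exp_psi_le (hC k hk u) ht.le
    rw [norm_mul, Complex.norm_real, Real.norm_of_nonneg (by positivity)]
    calc _ ≤ (1 + ‖u‖) ^ p * (Real.exp (t * C) * Real.exp (-((t * c) * ‖u‖ ^ α))) := by gcongr
      _ = _ := by ring

lemma integrable_exp_psi (hd : 1 ≤ d) {α κ₀ κ₁ : ℝ} (h0 : 0 < α) (h2 : α < 2)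
    (hκ₀ : 0 < κ₀) {k : Rn d → ℝ} (hk : JumpCoeff α κ₀ κ₁ k) {t : ℝ} (ht : 0 < t) :
    Integrable fun u => Complex.exp (-((t : ℂ) * psi α k u)) := by
  simpa using integrable_pow_mul_exp_psi hd h0 h2 hκ₀ hk ht 0

lemma prod_norm_nonneg (l : List (Rn d)) : 0 ≤ (l.map norm).prod :=
  List.prod_nonneg (by simp +contextual [List.mem_map])

/-- The contour shift handles the small jumps, `norm_fint_mul_exp_khat_le` transports the bound
through the large ones, and the normalising factor e^{-L} is at most one since their mass L is
nonnegative. -/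
lemma exists_norm_fint_mult_le (hd : 1 ≤ d) {α κ₀ κ₁ : ℝ} (h0 : 0 < α) (h2 : α < 2)
    (hκ₀ : 0 < κ₀) (hκ : κ₀ ≤ κ₁) (p : ℕ) :
    ∃ C ≥ 0, ∀ k : Rn d → ℝ, JumpCoeff α κ₀ κ₁ k → ∀ l : List (Rn d), l.length = p →
      (∀ a ∈ l, ‖a‖ ≤ 1) → ∀ x,
      ‖fint (fun u => mult l u 0 0 * Complex.exp (-(((1 : ℝ) : ℂ) * psi α k u))) x‖ ≤
        C * (l.map norm).prod * profile α 1 x := by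
  obtain ⟨C, hC0, hC⟩ := exists_norm_fint_psiS_le (d := d) hd h0 h2 hκ₀ hκ p
  have hκ₁ : 0 ≤ κ₁ := hκ₀.le.trans hκ
  set B := Real.exp (κ₁ * 2 ^ ((d : ℝ) + α) * (2 * 1) ^ ((d : ℝ) + α) * (2 * mass d α)) with hB
  refine ⟨C * B, by positivity, fun k hk l hl hl1 x => ?_⟩
  obtain ⟨hi, hbd⟩ := hC k hk l hl hl1
  have hP := prod_norm_nonneg l
  set L : ℝ := ∫ h, bigK α k h with hL
  have hL0 : 0 ≤ L := (norm_nonneg _).trans (norm_khat_bigK_le hκ₀ hk 0)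
  have key := norm_fint_mul_exp_khat_le hi (measurable_bigK α hk.meas) h0 (A := C * (l.map norm).prod)
    (D := κ₁ * 2 ^ ((d : ℝ) + α)) (by positivity) (by positivity)
    (fun h => abs_bigK_le h0 (hk.abs_le hκ₀) h) hbd x
  have e1 : fint (fun u => mult l u 0 0 * Complex.exp (-(((1 : ℝ) : ℂ) * psi α k u))) x =
      fint (fun u => mult l u 0 0 * Complex.exp (-psiS α k u 0 0) *
        Complex.exp (khat (bigK α k) u)) x * Complex.exp (-(L : ℂ)) := by
    rw [fint, fint, ← integral_mul_const]
    congr 1; ext u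
    rw [psi_eq_psiS hd h0 h2 hk.meas (hk.abs_le hκ₀), ← hL, Complex.ofReal_one, one_mul]
    have : -(psiS α k u 0 0 + (L : ℂ) - khat (bigK α k) u) =
      -psiS α k u 0 0 + khat (bigK α k) u + -(L : ℂ) := by ring
    rw [this, Complex.exp_add, Complex.exp_add]; ring
  have e2 : ‖Complex.exp (-(L : ℂ))‖ ≤ 1 := by
    rw [Complex.norm_exp]
    simpa using hL0
  rw [e1, norm_mul]
  have hx := profile_nonneg (γ := α) one_pos x
  calc _ ≤ (C * (l.map norm).prod * B * profile α 1 x) * 1 := by gcongr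
    _ = _ := by ring

lemma exists_difs_pk_one_le (hd : 1 ≤ d) {α κ₀ κ₁ : ℝ} (h0 : 0 < α) (h2 : α < 2)
    (hκ₀ : 0 < κ₀) (hκ : κ₀ ≤ κ₁) (p : ℕ) :
    ∃ C ≥ 0, ∀ k : Rn d → ℝ, JumpCoeff α κ₀ κ₁ k → ∀ l : List (Rn d), l.length = p →
      (∀ a ∈ l, ‖a‖ ≤ 1) → ∀ x,
      |difs l (pk α k 1) x| ≤ C * (l.map norm).prod * profile α 1 x := by
  obtain ⟨C, hC0, hC⟩ := exists_norm_fint_mult_le (d := d) hd h0 h2 hκ₀ hκ p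
  refine ⟨((2 * Real.pi) ^ d)⁻¹ * C, by positivity, fun k hk l hl hl1 x => ?_⟩
  rw [pk_eq, difs_rfint (integrable_exp_psi hd h0 h2 hκ₀ hk one_pos)]
  refine (abs_rfint_le _ _).trans ?_
  rw [mul_assoc, mul_assoc, ← mul_assoc C]
  gcongr
  exact hC k hk l hl hl1 x

/-! ### Scaling in time and space -/

lemma chi_smul {α r : ℝ} (hα : α ≠ 1) (h : Rn d) : chi α (r • h) = chi α h := by
  unfold chi; simp [hα]

lemma fullExp_scale (α : ℝ) {r : ℝ} (hr : 0 < r) (u h : Rn d) :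
    fullExp α (r⁻¹ • u) (r • h) = fullExp α u h -
      ((chi α (r • h) - chi α h : ℝ) : ℂ) * (Complex.I * (inner ℝ u h : ℝ)) := by
  have : (inner ℝ (r⁻¹ • u) (r • h) : ℝ) = inner ℝ u h := by
    rw [inner_smul_left, inner_smul_right]; simp; field_simp
  rw [fullExp, fullExp, this]; push_cast; ring

/-- Everything is homogeneous under dilation except the compensator at α = 1, whose cut-off moves
from 1 to 1/r. The discrepancy is linear in h and supported on the shell 1 < |h| ≤ 1/r, where the
cancellation condition makes its integral vanish. -/
lemma psi_scale (hd : 1 ≤ d) {α κ₀ κ₁ : ℝ} (h0 : 0 < α) (h2 : α < 2) (hκ₀ : 0 < κ₀)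
    {k : Rn d → ℝ} (hk : JumpCoeff α κ₀ κ₁ k) {r : ℝ} (hr : 0 < r) (hr1 : r ≤ 1) (u : Rn d) :
    ((r ^ α : ℝ) : ℂ) * psi α k (r⁻¹ • u) = psi α (fun h => k (r • h)) u := by
  set k' : Rn d → ℝ := fun h => k (r • h) with hk'
  have hkr : JumpCoeff α κ₀ κ₁ k' := hk.scale hr
  -- The change of compensator. It is identically zero if α ≠ 1, since `chi` is then invariant under
  -- dilation.
  set D : Rn d → ℂ := fun h => ((chi α (r • h) - chi α h : ℝ) : ℂ) *
    (Complex.I * (inner ℝ u h : ℝ)) * (levyK α k' h : ℂ) with hD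
  have hDint : Integrable D ∧ ∫ h, D h = 0 := by
    by_cases hα : α = 1
    · have hS : MeasurableSet {h : Rn d | 1 < ‖h‖ ∧ ‖h‖ ≤ r⁻¹} :=
        (measurableSet_lt measurable_const measurable_norm).inter
          (measurableSet_le measurable_norm measurable_const)
      have i1 := hkr.integrableOn_shell hκ₀ h0 (a := 1) (b := r⁻¹) one_pos
      have c1 := hkr.cancel hα 1 r⁻¹ one_pos ((one_le_inv₀ hr).2 hr1)
      rw [← integrable_indicator_iff hS] at i1
      rw [← integral_indicator hS] at c1
      have hDe : ∀ h, D h = Complex.I * ((inner ℝ u (({h : Rn d | 1 < ‖h‖ ∧ ‖h‖ ≤ r⁻¹}).indicator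
          (fun h => (k' h * ‖h‖ ^ (-((d : ℝ) + α))) • h) h) : ℝ) : ℂ) := by
        intro h
        have hn : ‖r • h‖ ≤ 1 ↔ ‖h‖ ≤ r⁻¹ := by
          rw [norm_smul, Real.norm_of_nonneg hr.le, ← le_inv_mul_iff₀ hr, mul_one]
        by_cases hh : h ∈ {h : Rn d | 1 < ‖h‖ ∧ ‖h‖ ≤ r⁻¹}
        · rw [indicator_of_mem hh, inner_smul_right]
          obtain ⟨q1, q2⟩ := hh
          have e1 : chi α (r • h) = 1 := by
            unfold chi; rw [if_pos (Or.inr ⟨hα, hn.2 q2⟩)]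
          have e2 : chi α h = 0 := by
            unfold chi; rw [if_neg]; rintro (q | q)
            · linarith
            · exact absurd q.2 (not_le.2 q1)
          simp only [hD, e1, e2, levyK]; push_cast; ring
        · rw [indicator_of_notMem hh, inner_zero_right]
          have e1 : chi α (r • h) = chi α h := by
            unfold chi
            by_cases q : ‖h‖ ≤ 1
            · have q' : ‖h‖ ≤ r⁻¹ := q.trans ((one_le_inv₀ hr).2 hr1)
              simp [hα, q, hn.2 q']
            · have q' : ¬ ‖h‖ ≤ r⁻¹ := fun q'' => hh ⟨not_le.1 q, q''⟩
              have q3 : ¬ ‖r • h‖ ≤ 1 := fun q4 => q' (hn.1 q4)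
              simp [hα, q, q3]
          simp [hD, e1]
      have i2 : Integrable fun h => ((inner ℝ u (({h : Rn d | 1 < ‖h‖ ∧ ‖h‖ ≤ r⁻¹}).indicator
          (fun h => (k' h * ‖h‖ ^ (-((d : ℝ) + α))) • h) h) : ℝ) : ℂ) := (i1.const_inner u).ofReal
      refine ⟨(i2.const_mul Complex.I).congr (Filter.Eventually.of_forall fun h => (hDe h).symm), ?_⟩
      simp only [hDe]
      rw [integral_const_mul]
      have e3 := integral_inner (𝕜 := ℝ) i1 u
      rw [c1, inner_zero_right] at e3
      have e4 : ∫ h, ((inner ℝ u (({h : Rn d | 1 < ‖h‖ ∧ ‖h‖ ≤ r⁻¹}).indicator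
          (fun h => (k' h * ‖h‖ ^ (-((d : ℝ) + α))) • h) h) : ℝ) : ℂ) = ((0 : ℝ) : ℂ) := by
        rw [← e3]; exact integral_ofReal
      rw [e4]; simp
    · have : D = fun _ => 0 := by
        ext h; simp only [hD, chi_smul hα, sub_self, Complex.ofReal_zero, zero_mul]
      rw [this]; simp
  have hi := integrable_fullExp hd h0 h2 hkr.meas (hkr.abs_le hκ₀) u
  have h1 := Measure.integral_comp_smul (volume : Measure (Rn d))
    (fun h => fullExp α (r⁻¹ • u) h * (levyK α k h : ℂ)) r
  have h3 : ∀ h : Rn d, fullExp α (r⁻¹ • u) (r • h) * (levyK α k (r • h) : ℂ) =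
      ((r ^ (-((d : ℝ) + α)) : ℝ) : ℂ) * (fullExp α u h * (levyK α k' h : ℂ) - D h) := by
    intro h
    have e1 : levyK α k (r • h) = r ^ (-((d : ℝ) + α)) * levyK α k' h := by
      unfold levyK
      rw [norm_smul, Real.norm_of_nonneg hr.le, Real.mul_rpow hr.le (norm_nonneg _)]; ring
    rw [fullExp_scale α hr, e1]; simp only [hD]; push_cast; ring
  simp only [h3] at h1
  rw [integral_const_mul, integral_sub hi hDint.1, hDint.2, sub_zero,
    abs_of_nonneg (by positivity)] at h1
  simp only [finrank_euclideanSpace, Fintype.card_fin] at h1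
  rw [psi_eq hd, psi_eq hd]
  have hr0 : (r : ℂ) ≠ 0 := by exact_mod_cast hr.ne'
  have e5 : r ^ (-((d : ℝ) + α)) = (r ^ d)⁻¹ * (r ^ α)⁻¹ := by
    rw [neg_add, Real.rpow_add hr, Real.rpow_neg hr.le (d : ℝ), Real.rpow_natCast,
      Real.rpow_neg hr.le]
  have hra : ((r ^ α : ℝ) : ℂ) ≠ 0 := by exact_mod_cast (Real.rpow_pos_of_pos hr α).ne'
  rw [e5, Complex.real_smul] at h1
  push_cast at h1
  have h4 : ((r ^ α : ℝ) : ℂ) * ∫ h, fullExp α (r⁻¹ • u) h * (levyK α k h : ℂ) =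
      ∫ h, fullExp α u h * (levyK α k' h : ℂ) := by
    have hrd : (r : ℂ) ^ d ≠ 0 := pow_ne_zero _ hr0
    generalize (∫ h, fullExp α (r⁻¹ • u) h * (levyK α k h : ℂ)) = I₁ at h1 ⊢
    generalize (∫ h, fullExp α u h * (levyK α k' h : ℂ)) = I₂ at h1 ⊢
    field_simp at h1
    exact h1.symm
  rw [mul_neg, h4]

lemma pk_scale (hd : 1 ≤ d) {α κ₀ κ₁ : ℝ} (h0 : 0 < α) (h2 : α < 2) (hκ₀ : 0 < κ₀)
    {k : Rn d → ℝ} (hk : JumpCoeff α κ₀ κ₁ k) {r : ℝ} (hr : 0 < r) (hr1 : r ≤ 1) (x : Rn d) :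
    pk α k (r ^ α) x = (r ^ d)⁻¹ * pk α (fun h => k (r • h)) 1 (r⁻¹ • x) := by
  rw [pk_eq, pk_eq, rfint, rfint]
  have h1 := Measure.integral_comp_inv_smul_of_nonneg (volume : Measure (Rn d))
    (fun u => Complex.exp (Complex.I * (inner ℝ u x : ℝ)) *
      Complex.exp (-(((r ^ α : ℝ) : ℂ) * psi α k u))) hr.le
  simp only [psi_scale hd h0 h2 hκ₀ hk hr hr1, finrank_euclideanSpace, Fintype.card_fin] at h1
  have h3 : fint (fun u => Complex.exp (-(((1 : ℝ) : ℂ) * psi α (fun h => k (r • h)) u)))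
      (r⁻¹ • x) = (r ^ d) • fint (fun u => Complex.exp (-(((r ^ α : ℝ) : ℂ) * psi α k u))) x := by
    rw [fint, fint, ← h1]
    congr 1; ext u
    rw [inner_smul_left, inner_smul_right, Complex.ofReal_one, one_mul]
    simp
  rw [h3, Complex.smul_re, smul_eq_mul]
  field_simp

lemma difs_scale (l : List (Rn d)) (c s : ℝ) (g : Rn d → ℝ) (x : Rn d) :
    difs l (fun x => c * g (s • x)) x = c * difs (l.map (s • ·)) g (s • x) := by
  induction l generalizing x with
  | nil => simp [difs]
  | cons a l ih => simp only [difs, List.map_cons, ih, smul_add]; ring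

/-- The density at time r^α is a rescaled time-one density for the coefficient k(r·), which lies in
the same class. Step lengths are therefore measured in units of r and the constant is unchanged. -/
lemma exists_difs_pk_le (hd : 1 ≤ d) {α κ₀ κ₁ : ℝ} (h0 : 0 < α) (h2 : α < 2)
    (hκ₀ : 0 < κ₀) (hκ : κ₀ ≤ κ₁) (p : ℕ) :
    ∃ C ≥ 0, ∀ k : Rn d → ℝ, JumpCoeff α κ₀ κ₁ k → ∀ r : ℝ, 0 < r → r ≤ 1 →
      ∀ l : List (Rn d), l.length = p → (∀ a ∈ l, ‖a‖ ≤ r) → ∀ x,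
      |difs l (pk α k (r ^ α)) x| ≤ C * (l.map fun a => ‖a‖ / r).prod * profile α r x := by
  obtain ⟨C, hC0, hC⟩ := exists_difs_pk_one_le (d := d) hd h0 h2 hκ₀ hκ p
  refine ⟨C, hC0, fun k hk r hr hr1 l hl hl1 x => ?_⟩
  have hn : ∀ a : Rn d, ‖r⁻¹ • a‖ = ‖a‖ / r := by
    intro a; rw [norm_smul, norm_inv, Real.norm_of_nonneg hr.le]; field_simp
  have h1 := hC _ (hk.scale hr) (l.map (r⁻¹ • ·)) (by simpa using hl) (by
    intro a ha
    obtain ⟨b, hb, rfl⟩ := List.mem_map.1 ha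
    simp only [hn]
    rw [div_le_one hr]; exact hl1 b hb) (r⁻¹ • x)
  have e : pk α k (r ^ α) = fun x => (r ^ d)⁻¹ * pk α (fun h => k (r • h)) 1 (r⁻¹ • x) :=
    funext fun x => pk_scale hd h0 h2 hκ₀ hk hr hr1 x
  rw [e, difs_scale, abs_mul, abs_of_nonneg (by positivity), profile_scale α hr]
  rw [List.map_map] at h1
  simp only [Function.comp_def, hn] at h1
  calc _ ≤ (r ^ d)⁻¹ * (C * (l.map fun a => ‖a‖ / r).prod * profile α 1 (r⁻¹ • x)) := by gcongr
    _ = _ := by ring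

/-! ### Jump operators acting on Fourier integrals -/

/-- The compensated increment `g(x+h) - g(x) - χ_α(h) h·∇g(x)`. -/
def dlt (α : ℝ) (g : Rn d → ℝ) (x h : Rn d) : ℝ :=
  g (x + h) - g x - chi α h * fderiv ℝ g x h

lemma jumpIntegrand_eq (α : ℝ) (k g : Rn d → ℝ) (x h : Rn d) :
    jumpIntegrand α k g x h = dlt α g x h * levyK α k h := by
  rw [jumpIntegrand, levyK_eq, dlt]

lemma jumpOp_eq (hd : 1 ≤ d) (α : ℝ) (k g : Rn d → ℝ) (x : Rn d) :
    jumpOp α k g x = ∫ h, dlt α g x h * levyK α k h := by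
  simp only [jumpOp, jumpIntegrand_eq, setIntegral_compl_zero hd]

lemma fint_eq_fourier (f : Rn d → ℂ) (x : Rn d) :
    fint f x = FourierTransform.fourier f (-(2 * Real.pi)⁻¹ • x) := by
  rw [Real.fourier_eq', fint]
  congr 1; ext u
  rw [smul_eq_mul, inner_smul_right]
  congr 2
  have : (Real.pi : ℂ) ≠ 0 := by exact_mod_cast Real.pi_ne_zero
  push_cast; field_simp

lemma differentiable_rfint {f : Rn d → ℂ} (hf : Integrable f)
    (hf1 : Integrable fun u => ‖u‖ * ‖f u‖) : Differentiable ℝ (rfint f) := by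
  have h1 := Real.differentiable_fourier hf hf1
  have h2 : rfint f = fun x => ((2 * Real.pi) ^ d)⁻¹ *
      (Complex.reCLM (FourierTransform.fourier f (-(2 * Real.pi)⁻¹ • x))) := by
    ext x; rw [rfint, fint_eq_fourier]; rfl
  rw [h2]
  exact (Complex.reCLM.differentiable.comp
    (h1.comp (differentiable_id.const_smul (-(2 * Real.pi)⁻¹)))).const_mul _

lemma fderiv_rfint {f : Rn d → ℂ} (hf : Integrable f)
    (hf1 : Integrable fun u => ‖u‖ * ‖f u‖) (x h : Rn d) :
    fderiv ℝ (rfint f) x h = rfint (fun u => Complex.I * (inner ℝ u h : ℝ) * f u) x := by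
  have key : HasDerivAt (fun s : ℝ => ∫ u,
      Complex.exp (Complex.I * (inner ℝ u (x + s • h) : ℝ)) * f u)
      (∫ u, Complex.exp (Complex.I * (inner ℝ u (x + (0 : ℝ) • h) : ℝ)) *
        (Complex.I * (inner ℝ u h : ℝ)) * f u) 0 := by
    refine (hasDerivAt_integral_of_dominated_loc_of_deriv_le (𝕜 := ℝ)
      (F := fun s u => Complex.exp (Complex.I * (inner ℝ u (x + s • h) : ℝ)) * f u)
      (F' := fun s u => Complex.exp (Complex.I * (inner ℝ u (x + s • h) : ℝ)) *
        (Complex.I * (inner ℝ u h : ℝ)) * f u)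
      (bound := fun u => ‖h‖ * (‖u‖ * ‖f u‖)) (s := univ) Filter.univ_mem
      (Filter.Eventually.of_forall fun s => (integrable_exp_inner_mul hf (x + s • h)).1)
      (integrable_exp_inner_mul hf _) ?_ ?_ (hf1.const_mul _) ?_).2
    · refine AEStronglyMeasurable.mul ?_ hf.1
      fun_prop
    · refine Filter.Eventually.of_forall fun u s _ => ?_
      rw [norm_mul, norm_mul, norm_exp_I_mul_real, one_mul, norm_mul, Complex.norm_I, one_mul,
        Complex.norm_real]
      have := norm_inner_le_norm (𝕜 := ℝ) u h
      calc _ ≤ ‖u‖ * ‖h‖ * ‖f u‖ := by gcongr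
        _ = _ := by ring
    · refine Filter.Eventually.of_forall fun u s _ => ?_
      have h1 : HasDerivAt (fun s : ℝ => (Complex.I * (inner ℝ u (x + s • h) : ℝ) : ℂ))
          (Complex.I * (inner ℝ u h : ℝ)) s := by
        have h2 : HasDerivAt (fun s : ℝ => (inner ℝ u (x + s • h) : ℝ)) (inner ℝ u h) s := by
          simp only [inner_add_right, inner_smul_right]
          simpa using ((hasDerivAt_id s).mul_const (inner ℝ u h)).const_add (inner ℝ u x)
        exact h2.ofReal_comp.const_mul _
      exact (h1.cexp).mul_const _
  have h3 : HasDerivAt (fun s : ℝ => rfint f (x + s • h))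
      (rfint (fun u => Complex.I * (inner ℝ u h : ℝ) * f u) x) 0 := by
    have h4 := ((Complex.reCLM.hasFDerivAt).comp_hasDerivAt (0 : ℝ) key).const_mul
      (((2 * Real.pi) ^ d)⁻¹)
    simp only [zero_smul, add_zero, mul_assoc] at h4
    simp only [rfint, fint, mul_assoc]
    exact h4
  have h5 : HasDerivAt (fun s : ℝ => rfint f (x + s • h)) (fderiv ℝ (rfint f) x h) 0 := by
    have h6 : HasDerivAt (fun s : ℝ => x + s • h) h 0 := by
      simpa using ((hasDerivAt_id (0 : ℝ)).smul_const h).const_add x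
    have h7 : HasFDerivAt (rfint f) (fderiv ℝ (rfint f) x) (x + (0 : ℝ) • h) := by
      simpa using (differentiable_rfint hf hf1 x).hasFDerivAt
    exact h7.comp_hasDerivAt (0 : ℝ) h6
  exact h5.unique h3

lemma integrable_norm_mul_of_sq {f : Rn d → ℂ}
    (hf2 : Integrable fun u => (((1 + ‖u‖) ^ 2 : ℝ) : ℂ) * f u) (hf : Integrable f) :
    Integrable fun u => ‖u‖ * ‖f u‖ := by
  refine hf2.norm.mono' (continuous_norm.aestronglyMeasurable.mul hf.1.norm)
    (Filter.Eventually.of_forall fun u => ?_)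
  rw [norm_mul, norm_mul, norm_norm, norm_norm, Complex.norm_real,
    Real.norm_of_nonneg (by positivity)]
  gcongr
  nlinarith [norm_nonneg u]

lemma const_mul_rfint (c : ℝ) (f : Rn d → ℂ) (x : Rn d) :
    c * rfint f x = rfint (fun u => (c : ℂ) * f u) x := by
  have : fint (fun u => (c : ℂ) * f u) x = (c : ℂ) * fint f x := by
    rw [fint, fint, ← integral_const_mul]
    congr 1; ext u; ring
  rw [rfint, rfint, this, Complex.re_ofReal_mul]; ring

lemma dlt_rfint {f : Rn d → ℂ} (hf : Integrable f)
    (hf1 : Integrable fun u => ‖u‖ * ‖f u‖) (α : ℝ) (x h : Rn d) :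
    dlt α (rfint f) x h = rfint (fun u => fullExp α u h * f u) x := by
  have i2 : Integrable fun u => Complex.I * (inner ℝ u h : ℝ) * f u := by
    refine (hf1.const_mul ‖h‖).mono' (AEStronglyMeasurable.mul (by fun_prop) hf.1)
      (Filter.Eventually.of_forall fun u => ?_)
    rw [norm_mul, norm_mul, Complex.norm_I, one_mul, Complex.norm_real]
    have := norm_inner_le_norm (𝕜 := ℝ) u h
    calc _ ≤ ‖u‖ * ‖h‖ * ‖f u‖ := by gcongr
      _ = _ := by ring
  have i1 := integrable_exp_mul hf h
  have i3 := i1.sub hf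
  simp only [Pi.sub_def] at i3
  rw [dlt, fderiv_rfint hf hf1, rfint_add_right, rfint_sub i1 hf, const_mul_rfint,
    rfint_sub i3 (i2.const_mul _)]
  congr 1; ext u; rw [fullExp]; ring

/-- The jump operator acts on a Fourier integral through its symbol. -/
lemma integral_dlt_rfint (hd : 1 ≤ d) {α A : ℝ} (h0 : 0 < α) (h2 : α < 2) {k : Rn d → ℝ}
    (hkm : Measurable k) (hk : ∀ h, |k h| ≤ A) {f : Rn d → ℂ} (hf : Integrable f)
    (hf2 : Integrable fun u => (((1 + ‖u‖) ^ 2 : ℝ) : ℂ) * f u) (x : Rn d) :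
    ∫ h, dlt α (rfint f) x h * levyK α k h = rfint (fun u => -psi α k u * f u) x := by
  have hf1 := integrable_norm_mul_of_sq hf2 hf
  set Z : Rn d → Rn d → ℂ := fun u h =>
    (Complex.exp (Complex.I * (inner ℝ u x : ℝ)) * f u) * (fullExp α u h * (levyK α k h : ℂ)) with hZ
  have hZi : Integrable (Function.uncurry Z) ((volume : Measure (Rn d)).prod volume) := by
    refine Integrable.mono' (hf2.norm.mul_prod ((integrable_expW hd h0 h2).const_mul A)) ?_
      (Filter.Eventually.of_forall fun w => ?_)
    · exact ((integrable_exp_inner_mul hf x).1.comp_fst).mul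
        (measurable_fullExp_mul_levyK α hkm).aestronglyMeasurable
    · have h3 := norm_fullExp_mul_levyK_le h0 hk w.1 w.2
      simp only [Function.uncurry, hZ]
      rw [norm_mul, norm_mul, norm_exp_I_mul_real, one_mul, norm_mul (((1 + ‖w.1‖) ^ 2 : ℝ) : ℂ),
        Complex.norm_real, Real.norm_of_nonneg (by positivity)]
      calc _ ≤ ‖f w.1‖ * (A * (1 + ‖w.1‖) ^ 2 * expW α w.2) := by gcongr
        _ = _ := by ring
  have e1 : ∀ h, dlt α (rfint f) x h * levyK α k h = ((2 * Real.pi) ^ d)⁻¹ * (∫ u, Z u h).re := by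
    intro h
    rw [dlt_rfint hf hf1, mul_comm, const_mul_rfint, rfint, fint]
    congr 3; ext u; simp only [hZ]; ring
  have e2 := hZi.integral_prod_right
  have e3 := integral_re e2
  simp only [RCLike.re_eq_complex_re, Function.uncurry] at e3
  simp only [e1]
  rw [integral_const_mul, e3, ← integral_integral_swap hZi, rfint, fint]
  congr 3; ext u
  simp only [hZ]
  rw [integral_const_mul, psi_eq hd]; ring

/-! ### Regularity at a given scale and bounds for jump operators -/

/-- Regularity of a function at scale `r`, in terms of differences up to order two. -/
structure Reg (α r A : ℝ) (g : Rn d → ℝ) : Prop where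
  diff : Differentiable ℝ g
  bound : ∀ x, |g x| ≤ A * profile α r x
  bound_one : ∀ a x, ‖a‖ ≤ r → |g (x + a) - g x| ≤ A * (‖a‖ / r) * profile α r x
  bound_two : ∀ a b x, ‖a‖ ≤ r → ‖b‖ ≤ r →
    |(g (x + a + b) - g (x + a)) - (g (x + b) - g x)| ≤ A * (‖a‖ / r * (‖b‖ / r)) * profile α r x

lemma Reg.nonneg {α r A : ℝ} {g : Rn d → ℝ} (hg : Reg α r A g) (hr : 0 < r) : 0 ≤ A :=
  nonneg_of_mul_nonneg_left ((abs_nonneg _).trans (hg.bound 0)) (profile_pos hr 0)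

lemma hasDerivAt_line {g : Rn d → ℝ} (hg : Differentiable ℝ g) (x h : Rn d) (s : ℝ) :
    HasDerivAt (fun s : ℝ => g (x + s • h)) (fderiv ℝ g (x + s • h) h) s := by
  have h6 : HasDerivAt (fun s : ℝ => x + s • h) h s := by
    simpa using ((hasDerivAt_id s).smul_const h).const_add x
  exact (hg _).hasFDerivAt.comp_hasDerivAt s h6

lemma eventually_norm_smul_le {r : ℝ} (hr : 0 < r) (h : Rn d) :
    ∀ᶠ s : ℝ in nhds 0, ‖s • h‖ ≤ r := by
  have : Filter.Tendsto (fun s : ℝ => ‖s • h‖) (nhds 0) (nhds ‖(0 : ℝ) • h‖) :=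
    (by fun_prop : Continuous fun s : ℝ => ‖s • h‖).tendsto 0
  rw [zero_smul, norm_zero] at this
  exact this.eventually (ge_mem_nhds hr)

/-- The gradient is controlled by difference quotients along the line through x, so derivatives of
the density never have to be estimated separately. -/
lemma Reg.abs_fderiv_le {α r A : ℝ} {g : Rn d → ℝ} (hg : Reg α r A g) (hr : 0 < r) (x h : Rn d) :
    |fderiv ℝ g x h| ≤ A * (‖h‖ / r) * profile α r x := by
  have hA := hg.nonneg hr
  have hp := profile_nonneg (γ := α) hr x
  have h1 := hasDerivAt_line hg.diff x h 0
  rw [zero_smul, add_zero] at h1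
  refine h1.le_of_lip' (by positivity) ?_
  filter_upwards [eventually_norm_smul_le hr h] with s hs
  have := hg.bound_one _ x hs
  rw [norm_smul] at this
  rw [zero_smul, add_zero, sub_zero, Real.norm_eq_abs]
  refine this.trans_eq (by ring)

lemma Reg.abs_fderiv_sub_le {α r A : ℝ} {g : Rn d → ℝ} (hg : Reg α r A g) (hr : 0 < r)
    (x h a : Rn d) (ha : ‖a‖ ≤ r) :
    |fderiv ℝ g (x + a) h - fderiv ℝ g x h| ≤ A * (‖a‖ / r * (‖h‖ / r)) * profile α r x := by
  have hA := hg.nonneg hr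
  have hp := profile_nonneg (γ := α) hr x
  have h1 := (hasDerivAt_line hg.diff (x + a) h 0).sub (hasDerivAt_line hg.diff x h 0)
  rw [zero_smul, add_zero, add_zero] at h1
  refine h1.le_of_lip' (by positivity) ?_
  filter_upwards [eventually_norm_smul_le hr h] with s hs
  have := hg.bound_two a _ x ha hs
  rw [norm_smul] at this
  simp only [Pi.sub_apply, zero_smul, add_zero, sub_zero, Real.norm_eq_abs]
  rw [Real.norm_eq_abs] at this
  have e : g (x + a + s • h) - g (x + s • h) - (g (x + a) - g x) =
    g (x + a + s • h) - g (x + a) - (g (x + s • h) - g x) := by ring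
  rw [e]
  refine this.trans_eq (by ring)

lemma Reg.abs_taylor_le {α r A : ℝ} {g : Rn d → ℝ} (hg : Reg α r A g) (hr : 0 < r)
    (x h : Rn d) (hh : ‖h‖ ≤ r) :
    |g (x + h) - g x - fderiv ℝ g x h| ≤ A * (‖h‖ / r) ^ 2 * profile α r x := by
  have hA := hg.nonneg hr
  have hp := profile_nonneg (γ := α) hr x
  have h1 := norm_image_sub_le_of_norm_deriv_le_segment_01'
    (f := fun s : ℝ => g (x + s • h) - s * fderiv ℝ g x h)
    (f' := fun s : ℝ => fderiv ℝ g (x + s • h) h - fderiv ℝ g x h)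
    (C := A * (‖h‖ / r) ^ 2 * profile α r x)
    (fun s _ => by
      have := (hasDerivAt_line hg.diff x h s).sub ((hasDerivAt_id s).mul_const (fderiv ℝ g x h))
      rw [one_mul] at this
      exact this.hasDerivWithinAt)
    (fun s hs => by
      have hs1 : ‖s • h‖ ≤ ‖h‖ := by
        rw [norm_smul, Real.norm_of_nonneg hs.1]
        exact mul_le_of_le_one_left (norm_nonneg _) hs.2.le
      refine (hg.abs_fderiv_sub_le hr x h (s • h) (hs1.trans hh)).trans ?_
      rw [pow_two]; gcongr)
  rw [Real.norm_eq_abs] at h1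
  have e : g (x + h) - g x - fderiv ℝ g x h =
    g (x + (1 : ℝ) • h) - 1 * fderiv ℝ g x h - (g (x + (0 : ℝ) • h) - 0 * fderiv ℝ g x h) := by
    rw [one_smul, zero_smul, add_zero]; ring
  rw [e]; exact h1

/-- A majorant, integrable in `h`, of the compensated increments of regular functions. -/
def jumpMaj (α ω r : ℝ) (x h : Rn d) : ℝ :=
  2 * r ^ (-ω) * (jwr α ω r h * profile α r x) +
    2 ^ ((d : ℝ) + α) * r ^ (-α) * (profile α r (x + h) * profile α r h)

lemma jumpMaj_nonneg {α ω r : ℝ} (hr : 0 < r) (x h : Rn d) : 0 ≤ jumpMaj α ω r x h := by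
  have h1 := jwr_nonneg (α := α) (ω := ω) hr h
  have h2 := profile_nonneg (γ := α) hr x
  have h3 := profile_nonneg (γ := α) hr h
  have h4 := profile_nonneg (γ := α) hr (x + h)
  unfold jumpMaj; positivity

/-- For |h| ≤ r the first-difference bound (α < 1) or the Taylor bound (α ≥ 1) supplies the exponent
`tau α`. For |h| > r the three terms of the increment are bounded one by one: the shifted term gives
the product of profiles, and the other two the jump weight. The loss r^{-ω} is forced only by the
compensator at α = 1, but is kept for all α to have a single majorant. -/
lemma Reg.dlt_le {α ω r A : ℝ} {g : Rn d → ℝ} (hg : Reg α r A g) (h0 : 0 < α) (hω0 : 0 < ω)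
    (hω1 : ω < 1) (hr : 0 < r) (hr1 : r ≤ 1) (x h : Rn d) :
    |dlt α g x h| * ‖h‖ ^ (-((d : ℝ) + α)) ≤ A * jumpMaj α ω r x h := by
  have hA := hg.nonneg hr
  have hp := profile_nonneg (γ := α) hr x
  have hp2 := profile_nonneg (γ := α) hr h
  have hp3 := profile_nonneg (γ := α) hr (x + h)
  set J := ‖h‖ ^ (-((d : ℝ) + α)) with hJ
  have hJ0 : 0 ≤ J := by positivity
  have hw0 := jwr_nonneg (α := α) (ω := ω) hr h
  have hrω : 1 ≤ r ^ (-ω) := Real.one_le_rpow_of_pos_of_le_one_of_nonpos hr hr1 (by linarith)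
  have hrα : 0 ≤ r ^ (-α) := by positivity
  have hwe := jwr_eq (α := α) (ω := ω) hr h
  by_cases hh : ‖h‖ ≤ r
  · rw [if_pos hh] at hwe
    have key : |dlt α g x h| * J ≤ A * (jwr α ω r h * profile α r x) := by
      rw [hwe]
      unfold dlt chi tau
      by_cases hα : α < 1
      · have hχ : ¬ (1 < α ∨ (α = 1 ∧ ‖h‖ ≤ 1)) := by
          rintro (q | q) <;> linarith [q]
        rw [if_neg hχ, if_pos hα, zero_mul, sub_zero, Real.rpow_one]
        calc _ ≤ (A * (‖h‖ / r) * profile α r x) * J := by gcongr; exact hg.bound_one h x hh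
          _ = _ := by ring
      · have hχ : 1 < α ∨ (α = 1 ∧ ‖h‖ ≤ 1) := by
          rcases (not_lt.1 hα).lt_or_eq with q | q
          · exact Or.inl q
          · exact Or.inr ⟨q.symm, hh.trans hr1⟩
        rw [if_pos hχ, if_neg hα, one_mul, Real.rpow_two]
        calc _ ≤ (A * (‖h‖ / r) ^ 2 * profile α r x) * J := by
              gcongr; exact hg.abs_taylor_le hr x h hh
          _ = _ := by ring
    refine key.trans ?_
    unfold jumpMaj
    gcongr
    have : jwr α ω r h * profile α r x ≤ 2 * r ^ (-ω) * (jwr α ω r h * profile α r x) :=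
      le_mul_of_one_le_left (by positivity) (by linarith)
    have q2 : 0 ≤ 2 ^ ((d : ℝ) + α) * r ^ (-α) * (profile α r (x + h) * profile α r h) := by
      positivity
    linarith
  · rw [if_neg hh] at hwe
    have hh' : r ≤ ‖h‖ := (not_le.1 hh).le
    have hJ2 : J ≤ 2 ^ ((d : ℝ) + α) * r ^ (-α) * profile α r h := rpow_norm_le_profile h0 hr hh'
    have h1r : 1 ≤ ‖h‖ / r := (one_le_div hr).2 hh'
    have hsig1 : 1 ≤ (‖h‖ / r) ^ sig α ω := Real.one_le_rpow h1r (sig_nonneg hω1)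
    have t1 : |g (x + h)| * J ≤
        A * (2 ^ ((d : ℝ) + α) * r ^ (-α) * (profile α r (x + h) * profile α r h)) := by
      calc _ ≤ (A * profile α r (x + h)) * (2 ^ ((d : ℝ) + α) * r ^ (-α) * profile α r h) := by
            gcongr; exact hg.bound _
        _ = _ := by ring
    have hwJ : J ≤ jwr α ω r h := by
      rw [hwe]; exact le_mul_of_one_le_left hJ0 hsig1
    have t2 : |g x| * J ≤ A * (r ^ (-ω) * (jwr α ω r h * profile α r x)) := by
      calc _ ≤ (A * profile α r x) * jwr α ω r h := by gcongr; exact hg.bound _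
        _ ≤ r ^ (-ω) * ((A * profile α r x) * jwr α ω r h) :=
          le_mul_of_one_le_left (by positivity) hrω
        _ = _ := by ring
    have t3 : |chi α h * fderiv ℝ g x h| * J ≤
        A * (r ^ (-ω) * (jwr α ω r h * profile α r x)) := by
      have hd1 := hg.abs_fderiv_le hr x h
      have hχ : |chi α h| * (‖h‖ / r) ≤ r ^ (-ω) * (‖h‖ / r) ^ sig α ω := by
        unfold chi sig
        rcases lt_trichotomy α 1 with q | q | q
        · have hχ : ¬ (1 < α ∨ (α = 1 ∧ ‖h‖ ≤ 1)) := by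
            rintro (q' | q') <;> linarith [q']
          rw [if_neg hχ, abs_zero, zero_mul]; positivity
        · have q' : ¬ α < 1 := by linarith
          rw [if_neg q', if_pos q]
          by_cases hh1 : ‖h‖ ≤ 1
          · rw [if_pos (Or.inr ⟨q, hh1⟩), abs_one, one_mul]
            have hhp : 0 < ‖h‖ := hr.trans_le hh'
            -- At α = 1 and r < |h| ≤ 1 the compensator grows linearly, which would give a logarithm
            -- of r after integration. Moving |h|^ω ≤ 1 out of the way leaves the integrable growth
            -- 1 − ω and a loss r^{-ω}.
            have e : ‖h‖ / r = ‖h‖ ^ ω * r ^ (-ω) * (‖h‖ / r) ^ (1 - ω) := by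
              rw [Real.rpow_sub (by positivity), Real.rpow_one, Real.div_rpow hhp.le hr.le,
                Real.rpow_neg hr.le]
              field_simp
            have q3 : ‖h‖ ^ ω ≤ 1 := Real.rpow_le_one hhp.le hh1 hω0.le
            calc ‖h‖ / r = ‖h‖ ^ ω * r ^ (-ω) * (‖h‖ / r) ^ (1 - ω) := e
              _ ≤ 1 * r ^ (-ω) * (‖h‖ / r) ^ (1 - ω) := by gcongr
              _ = _ := by ring
          · rw [if_neg, abs_zero, zero_mul]
            · positivity
            · rintro (q' | q')
              · linarith
              · exact hh1 q'.2
        · have q' : ¬ α < 1 := by linarith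
          rw [if_pos (Or.inl q), if_neg q', if_neg q.ne', abs_one, one_mul, Real.rpow_one]
          exact le_mul_of_one_le_left (by positivity) hrω
      rw [abs_mul, hwe]
      calc |chi α h| * |fderiv ℝ g x h| * J ≤
            |chi α h| * (A * (‖h‖ / r) * profile α r x) * J := by gcongr
        _ = A * profile α r x * J * (|chi α h| * (‖h‖ / r)) := by ring
        _ ≤ A * profile α r x * J * (r ^ (-ω) * (‖h‖ / r) ^ sig α ω) := by gcongr
        _ = _ := by ring
    have t4 : |dlt α g x h| ≤ |g (x + h)| + |g x| + |chi α h * fderiv ℝ g x h| := by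
      unfold dlt
      exact (abs_sub _ _).trans (by gcongr; exact abs_sub _ _)
    calc |dlt α g x h| * J ≤ (|g (x + h)| + |g x| + |chi α h * fderiv ℝ g x h|) * J := by gcongr
      _ ≤ _ := by unfold jumpMaj; linarith

lemma integrable_jumpMaj_aux {α r : ℝ} (h0 : 0 < α) (hr : 0 < r) (x : Rn d) :
    Integrable (fun h => profile α r (x + h) * profile α r h) ∧
    ∫ h, profile α r (x + h) * profile α r h ≤
      (2 * 1) ^ ((d : ℝ) + α) * profile α r x * (2 * mass d α) := by
  have i1 : Integrable fun h : Rn d => profile α r (x + h) := (integrable_profile h0 hr).comp_add_left x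
  have i2 : Integrable fun h : Rn d => (2 * 1) ^ ((d : ℝ) + α) * profile α r x *
      (profile α r (x + h) + profile α r h) := (i1.add (integrable_profile h0 hr)).const_mul _
  have hb : ∀ h, profile α r (x + h) * profile α r h ≤
      (2 * 1) ^ ((d : ℝ) + α) * profile α r x * (profile α r (x + h) + profile α r h) := fun h =>
    profile_mul_le h0 hr hr le_rfl le_rfl le_rfl (by linarith)
      (by have := norm_sub_le (x + h) h; simpa using this)
  have i3 : Integrable (fun h => profile α r (x + h) * profile α r h) := by
    have hc := continuous_profile (d := d) (γ := α) hr
    have hc' : Continuous fun h : Rn d => profile α r (x + h) * profile α r h := by fun_prop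
    have hn : ∀ h, ‖profile α r (x + h) * profile α r h‖ ≤
        (2 * 1) ^ ((d : ℝ) + α) * profile α r x * (profile α r (x + h) + profile α r h) := fun h => by
      have e := Real.norm_of_nonneg
        (mul_nonneg (profile_nonneg (γ := α) hr (x + h)) (profile_nonneg (γ := α) hr h))
      exact e.trans_le (hb h)
    exact i2.mono' hc'.aestronglyMeasurable (Filter.Eventually.of_forall hn)
  refine ⟨i3, (integral_mono i3 i2 hb).trans_eq ?_⟩
  rw [integral_const_mul, integral_add i1 (integrable_profile h0 hr),
    integral_add_left_eq_self (fun h => profile α r h), integral_profile α hr]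
  ring

lemma integrable_jumpMaj (hd : 1 ≤ d) {α ω r : ℝ} (h0 : 0 < α) (h2 : α < 2) (hω : 0 < ω)
    (hr : 0 < r) (x : Rn d) : Integrable (jumpMaj α ω r x) :=
  (((integrable_jwr hd h0 h2 hω hr).mul_const _).const_mul _).add
    ((integrable_jumpMaj_aux h0 hr x).1.const_mul _)

/-- The constant in the integral bound for `jumpMaj`. -/
def jumpMajC (d : ℕ) (α ω : ℝ) : ℝ :=
  2 * (∫ h : Rn d, jw α ω h) + 2 ^ ((d : ℝ) + α) * ((2 * 1) ^ ((d : ℝ) + α) * (2 * mass d α))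

lemma jumpMajC_nonneg (d : ℕ) (α ω : ℝ) : 0 ≤ jumpMajC d α ω := by
  have h1 : 0 ≤ ∫ h : Rn d, jw α ω h := integral_nonneg fun h => jw_nonneg _ _ h
  have h2 := mass_nonneg (d := d) α
  unfold jumpMajC; positivity

/-- The rescaled weight has integral of order r^{-α}, and the convolution of two profiles at scale r
is again bounded by a profile at scale r. -/
lemma integral_jumpMaj_le (hd : 1 ≤ d) {α ω r : ℝ} (h0 : 0 < α) (h2 : α < 2) (hω : 0 < ω)
    (hr : 0 < r) (hr1 : r ≤ 1) (x : Rn d) :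
    ∫ h, jumpMaj α ω r x h ≤ jumpMajC d α ω * r ^ (-(α + ω)) * profile α r x := by
  have hp := profile_nonneg (γ := α) hr x
  have h1 : 0 ≤ ∫ h : Rn d, jw α ω h := integral_nonneg fun h => jw_nonneg _ _ h
  have h3 := mass_nonneg (d := d) α
  have hrr : r ^ (-(α + ω)) = r ^ (-α) * r ^ (-ω) := by rw [← Real.rpow_add hr]; congr 1; ring
  have hrω : 1 ≤ r ^ (-ω) := Real.one_le_rpow_of_pos_of_le_one_of_nonpos hr hr1 (by linarith)
  obtain ⟨i1, b1⟩ := integrable_jumpMaj_aux h0 hr x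
  have e : ∫ h, jumpMaj α ω r x h = 2 * r ^ (-ω) * (r ^ (-α) * (∫ h : Rn d, jw α ω h) * profile α r x)
      + 2 ^ ((d : ℝ) + α) * r ^ (-α) * ∫ h, profile α r (x + h) * profile α r h := by
    unfold jumpMaj
    rw [integral_add (((integrable_jwr hd h0 h2 hω hr).mul_const _).const_mul _) (i1.const_mul _),
      integral_const_mul, integral_const_mul, integral_mul_const, integral_jwr hr]
  rw [e, hrr, jumpMajC]
  generalize (∫ h, profile α r (x + h) * profile α r h) = I at b1
  generalize (∫ h : Rn d, jw α ω h) = J at h1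
  generalize profile α r x = P at *
  have hA : (0 : ℝ) ≤ 2 ^ ((d : ℝ) + α) * r ^ (-α) := by positivity
  have hB : (0 : ℝ) ≤ (2 * 1) ^ ((d : ℝ) + α) * P * (2 * mass d α) := by positivity
  have s1 := mul_le_mul_of_nonneg_left b1 hA
  have s2 := mul_le_mul_of_nonneg_left hrω (mul_nonneg hA hB)
  linarith

lemma differentiable_difs {g : Rn d → ℝ} (hg : Differentiable ℝ g) (l : List (Rn d)) :
    Differentiable ℝ (difs l g) := by
  induction l with
  | nil => exact hg
  | cons a l ih =>
    change Differentiable ℝ fun x => difs l g (x + a) - difs l g x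
    exact (ih.comp (differentiable_id.add_const a)).sub ih

lemma difs_append (l m : List (Rn d)) (g : Rn d → ℝ) : difs (l ++ m) g = difs l (difs m g) := by
  induction l with
  | nil => rfl
  | cons a l ih => funext x; simp only [List.cons_append, difs, ih]

lemma difs_sub (l : List (Rn d)) (f g : Rn d → ℝ) (x : Rn d) :
    difs l (fun x => f x - g x) x = difs l f x - difs l g x := by
  induction l generalizing x with
  | nil => rfl
  | cons a l ih => simp only [difs, ih]; ring

lemma Reg.of_difs {α r A : ℝ} {g : Rn d → ℝ} (hg : Differentiable ℝ g)
    (h : ∀ l : List (Rn d), l.length ≤ 2 → (∀ a ∈ l, ‖a‖ ≤ r) → ∀ x,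
      |difs l g x| ≤ A * (l.map fun a => ‖a‖ / r).prod * profile α r x) : Reg α r A g where
  diff := hg
  bound x := by simpa [difs] using h [] (by simp) (by simp) x
  bound_one a x ha := by simpa [difs] using h [a] (by simp) (by simpa using ha) x
  bound_two a b x ha hb := by
    have := h [a, b] (by simp) (by simpa using ⟨ha, hb⟩) x
    simpa [difs] using this

lemma prod_div_nonneg {r : ℝ} (hr : 0 < r) (l : List (Rn d)) :
    0 ≤ (l.map fun a => ‖a‖ / r).prod := by
  refine List.prod_nonneg fun b hb => ?_
  obtain ⟨a, -, rfl⟩ := List.mem_map.1 hb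
  positivity

lemma differentiable_pk (hd : 1 ≤ d) {α κ₀ κ₁ : ℝ} (h0 : 0 < α) (h2 : α < 2)
    (hκ₀ : 0 < κ₀) {k : Rn d → ℝ} (hk : JumpCoeff α κ₀ κ₁ k) {t : ℝ} (ht : 0 < t) :
    Differentiable ℝ (pk α k t) := by
  rw [pk_eq]
  have hi := integrable_exp_psi hd h0 h2 hκ₀ hk ht
  exact differentiable_rfint hi
    (integrable_norm_mul_of_sq (integrable_pow_mul_exp_psi hd h0 h2 hκ₀ hk ht 2) hi)

/-- Regularity of a difference of order p involves differences of orders p, p+1 and p+2 of the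
density; the constant is the sum of the three. -/
lemma exists_reg_difs_pk (hd : 1 ≤ d) {α κ₀ κ₁ : ℝ} (h0 : 0 < α) (h2 : α < 2)
    (hκ₀ : 0 < κ₀) (hκ : κ₀ ≤ κ₁) (p : ℕ) :
    ∃ C ≥ 0, ∀ k : Rn d → ℝ, JumpCoeff α κ₀ κ₁ k → ∀ r : ℝ, 0 < r → r ≤ 1 →
      ∀ l : List (Rn d), l.length = p → (∀ a ∈ l, ‖a‖ ≤ r) →
      Reg α r (C * (l.map fun a => ‖a‖ / r).prod) (difs l (pk α k (r ^ α))) := by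
  obtain ⟨C0, hC00, hC0⟩ := exists_difs_pk_le (d := d) hd h0 h2 hκ₀ hκ p
  obtain ⟨C1, hC10, hC1⟩ := exists_difs_pk_le (d := d) hd h0 h2 hκ₀ hκ (p + 1)
  obtain ⟨C2, hC20, hC2⟩ := exists_difs_pk_le (d := d) hd h0 h2 hκ₀ hκ (p + 2)
  refine ⟨C0 + C1 + C2, by positivity, fun k hk r hr hr1 L hL hL1 => ?_⟩
  refine Reg.of_difs (differentiable_difs (differentiable_pk hd h0 h2 hκ₀ hk (by positivity)) L)
    fun l hl hl1 x => ?_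
  have hP := prod_div_nonneg hr (l ++ L)
  have hp := profile_nonneg (γ := α) hr x
  have hall : ∀ a ∈ l ++ L, ‖a‖ ≤ r := by
    intro a ha
    rcases List.mem_append.1 ha with h | h
    exacts [hl1 a h, hL1 a h]
  rw [← difs_append]
  have key : |difs (l ++ L) (pk α k (r ^ α)) x| ≤
      (C0 + C1 + C2) * ((l ++ L).map fun a => ‖a‖ / r).prod * profile α r x := by
    have hcase : l.length = 0 ∨ l.length = 1 ∨ l.length = 2 := by omega
    rcases hcase with h | h | h
    · refine (hC0 k hk r hr hr1 _ (by simp [h, hL]) hall x).trans ?_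
      gcongr; linarith
    · refine (hC1 k hk r hr hr1 _ (by simp [h, hL]; ring) hall x).trans ?_
      gcongr; linarith
    · refine (hC2 k hk r hr hr1 _ (by simp [h, hL]; ring) hall x).trans ?_
      gcongr; linarith
  rw [List.map_append, List.prod_append] at key
  calc _ ≤ _ := key
    _ = _ := by ring

lemma measurable_dlt {α : ℝ} {g : Rn d → ℝ} (hg : Differentiable ℝ g) (x : Rn d) :
    Measurable (dlt α g x) := by
  have h1 := measurable_chi (d := d) α
  have h2 : Measurable fun h => g (x + h) := (hg.continuous.comp (continuous_const_add x)).measurable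
  have h3 : Measurable fun h => fderiv ℝ g x h := (fderiv ℝ g x).continuous.measurable
  exact (h2.sub_const _).sub (h1.mul h3)

lemma Reg.abs_dlt_mul_levyK_le {α ω r A ε : ℝ} {g : Rn d → ℝ} (hg : Reg α r A g) (h0 : 0 < α)
    (hω0 : 0 < ω) (hω1 : ω < 1) (hr : 0 < r) (hr1 : r ≤ 1) {m : Rn d → ℝ}
    (hm : ∀ h, |m h| ≤ ε) (x h : Rn d) :
    |dlt α g x h * levyK α m h| ≤ ε * A * jumpMaj α ω r x h := by
  have hε : 0 ≤ ε := (abs_nonneg _).trans (hm h)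
  have h1 := hg.dlt_le h0 hω0 hω1 hr hr1 x h
  rw [abs_mul]
  calc _ ≤ |dlt α g x h| * (ε * ‖h‖ ^ (-((d : ℝ) + α))) := by gcongr; exact abs_levyK_le α hm h
    _ = ε * (|dlt α g x h| * ‖h‖ ^ (-((d : ℝ) + α))) := by ring
    _ ≤ ε * (A * jumpMaj α ω r x h) := by gcongr
    _ = _ := by ring

lemma Reg.integrable_dlt (hd : 1 ≤ d) {α r A ε : ℝ} {g : Rn d → ℝ} (hg : Reg α r A g)
    (h0 : 0 < α) (h2 : α < 2) (hr : 0 < r) (hr1 : r ≤ 1)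
    {m : Rn d → ℝ} (hmm : Measurable m) (hm : ∀ h, |m h| ≤ ε) (x : Rn d) :
    Integrable fun h => dlt α g x h * levyK α m h := by
  refine ((integrable_jumpMaj hd (ω := 1 / 2) h0 h2 (by norm_num) hr x).const_mul (ε * A)).mono'
    ((measurable_dlt hg.diff x).mul (measurable_levyK α hmm)).aestronglyMeasurable
    (Filter.Eventually.of_forall fun h => ?_)
  exact hg.abs_dlt_mul_levyK_le h0 (by norm_num) (by norm_num) hr hr1 hm x h

/-- Only boundedness of m enters: neither a sign nor cancellation is needed. The estimate thus
covers a coefficient itself as well as a difference of two coefficients, for which ε is a Hölder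
modulus. -/
lemma Reg.abs_integral_dlt_le (hd : 1 ≤ d) {α ω r A ε : ℝ} {g : Rn d → ℝ} (hg : Reg α r A g)
    (h0 : 0 < α) (h2 : α < 2) (hω0 : 0 < ω) (hω1 : ω < 1) (hr : 0 < r) (hr1 : r ≤ 1)
    {m : Rn d → ℝ} (hm : ∀ h, |m h| ≤ ε) (x : Rn d) :
    |∫ h, dlt α g x h * levyK α m h| ≤
      ε * A * (jumpMajC d α ω * r ^ (-(α + ω)) * profile α r x) := by
  have hε : 0 ≤ ε := (abs_nonneg _).trans (hm 0)
  have hA := hg.nonneg hr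
  have hb : ∀ h, ‖dlt α g x h * levyK α m h‖ ≤ ε * A * jumpMaj α ω r x h := fun h =>
    hg.abs_dlt_mul_levyK_le h0 hω0 hω1 hr hr1 hm x h
  have h1 := norm_integral_le_of_norm_le
    ((integrable_jumpMaj hd (ω := ω) h0 h2 hω0 hr x).const_mul (ε * A))
    (Filter.Eventually.of_forall hb)
  rw [integral_const_mul] at h1
  have h3 := integral_jumpMaj_le hd (ω := ω) h0 h2 hω0 hr hr1 x
  exact h1.trans (mul_le_mul_of_nonneg_left h3 (by positivity))

/-! ### Dependence of the density on the coefficient -/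

lemma psi_add_mul (hd : 1 ≤ d) {α A B : ℝ} (h0 : 0 < α) (h2 : α < 2) {k m : Rn d → ℝ}
    (hkm : Measurable k) (hk : ∀ h, |k h| ≤ A) (hmm : Measurable m) (hm : ∀ h, |m h| ≤ B)
    (s : ℝ) (u : Rn d) :
    psi α (fun h => k h + s * m h) u = psi α k u + s * psi α m u := by
  rw [psi_eq hd, psi_eq hd, psi_eq hd]
  have i1 := integrable_fullExp hd h0 h2 hkm hk u
  have i2 := (integrable_fullExp hd h0 h2 hmm hm u).const_mul (s : ℂ)
  rw [mul_neg, ← neg_add, ← integral_const_mul, ← integral_add i1 i2]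
  congr 2; ext h
  simp only [levyK]; push_cast; ring

lemma hasDerivAt_rfint {M a b : Rn d → ℂ} (hM : Measurable M) (ha : Measurable a)
    (hb : Measurable b) {s₀ : ℝ} {S : Set ℝ} (hS : S ∈ nhds s₀)
    (hi : Integrable fun u => M u * Complex.exp (-(a u + s₀ * b u))) {B : Rn d → ℝ}
    (hB : Integrable B) (hbd : ∀ u, ∀ s ∈ S, ‖b u * (M u * Complex.exp (-(a u + s * b u)))‖ ≤ B u)
    (x : Rn d) :
    HasDerivAt (fun s : ℝ => rfint (fun u => M u * Complex.exp (-(a u + s * b u))) x)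
      (rfint (fun u => -b u * (M u * Complex.exp (-(a u + s₀ * b u)))) x) s₀ := by
  have key := (hasDerivAt_integral_of_dominated_loc_of_deriv_le (μ := (volume : Measure (Rn d)))
    (F := fun (s : ℝ) u => Complex.exp (Complex.I * (inner ℝ u x : ℝ)) *
      (M u * Complex.exp (-(a u + s * b u))))
    (F' := fun (s : ℝ) u => Complex.exp (Complex.I * (inner ℝ u x : ℝ)) *
      (-b u * (M u * Complex.exp (-(a u + s * b u))))) (bound := B) hS
    (Filter.Eventually.of_forall fun s => Measurable.aestronglyMeasurable (by fun_prop))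
    (integrable_exp_inner_mul hi x) (Measurable.aestronglyMeasurable (by fun_prop))
    (Filter.Eventually.of_forall fun u s hs => ?_) hB
    (Filter.Eventually.of_forall fun u s hs => ?_)).2
  · have h1 := (Complex.reCLM.hasFDerivAt.comp_hasDerivAt s₀ key).const_mul (((2 * Real.pi) ^ d)⁻¹)
    exact h1
  · rw [norm_mul, norm_exp_I_mul_real, one_mul, neg_mul, norm_neg]
    exact hbd u s hs
  · refine HasDerivAt.const_mul _ ?_
    have h1 : HasDerivAt (fun s : ℝ => -(a u + s * b u)) (-b u) s := by
      have h2 : HasDerivAt (fun s : ℝ => (s : ℂ)) 1 s := Complex.ofRealCLM.hasDerivAt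
      have h4 := ((h2.mul_const (b u)).const_add (a u)).fun_neg
      rwa [one_mul] at h4
    have h3 := h1.cexp.const_mul (M u)
    convert h3 using 1
    ring

lemma continuousOn_rfint {X : Type*} [TopologicalSpace X] [FirstCountableTopology X]
    {f : X → Rn d → ℂ} {g : X → Rn d} {S : Set X} {B : Rn d → ℝ} (hg : ContinuousOn g S)
    (hm : ∀ s ∈ S, AEStronglyMeasurable (f s)) (hB : Integrable B)
    (hbd : ∀ s ∈ S, ∀ u, ‖f s u‖ ≤ B u) (hc : ∀ u, ContinuousOn (fun s => f s u) S) :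
    ContinuousOn (fun s => rfint (f s) (g s)) S := by
  have key : ContinuousOn (fun s => fint (f s) (g s)) S := by
    unfold fint
    refine continuousOn_of_dominated (bound := B) (fun s hs => ?_)
      (fun s hs => Filter.Eventually.of_forall fun u => ?_) hB
      (Filter.Eventually.of_forall fun u => ?_)
    · exact (Continuous.aestronglyMeasurable (by fun_prop)).mul (hm s hs)
    · rw [norm_mul, norm_exp_I_mul_real, one_mul]; exact hbd s hs u
    · have := hc u
      fun_prop
  unfold rfint
  fun_prop

/-- Along the segment k + τm with m = l − k, the τ-derivative of e^{-ψ} is −ψ_m e^{-ψ}. On the side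
of x this is the jump operator with coefficient m acting on the intermediate density, which is
regular by convexity of the class. Since |m| ≤ ε, the mean value theorem concludes. -/
lemma exists_difs_pk_one_sub_le (hd : 1 ≤ d) {α κ₀ κ₁ : ℝ} (h0 : 0 < α) (h2 : α < 2)
    (hκ₀ : 0 < κ₀) (hκ : κ₀ ≤ κ₁) (p : ℕ) :
    ∃ C ≥ 0, ∀ k l : Rn d → ℝ, JumpCoeff α κ₀ κ₁ k → JumpCoeff α κ₀ κ₁ l → ∀ ε : ℝ,
      (∀ h, |l h - k h| ≤ ε) → ∀ L : List (Rn d), L.length = p → (∀ a ∈ L, ‖a‖ ≤ 1) → ∀ x,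
      |difs L (fun x => pk α l 1 x - pk α k 1 x) x| ≤
        C * ε * (L.map norm).prod * profile α 1 x := by
  obtain ⟨C, hC0, hC⟩ := exists_reg_difs_pk (d := d) hd h0 h2 hκ₀ hκ p
  obtain ⟨c, hc, D, hD0, hD⟩ := exists_re_psi_lower (d := d) hd h0 h2 hκ₀ hκ
  refine ⟨C * jumpMajC d α (1 / 2), mul_nonneg hC0 (jumpMajC_nonneg d α _),
    fun k l hk hl ε hε L hL hL1 x => ?_⟩
  have hε0 : 0 ≤ ε := (abs_nonneg _).trans (hε 0)
  set m : Rn d → ℝ := fun h => l h - k h with hm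
  have hmm : Measurable m := hl.meas.sub hk.meas
  set J : ℝ → Rn d → ℝ := fun τ h => k h + τ * m h with hJ
  have hJc : ∀ τ ∈ Icc (0 : ℝ) 1, JumpCoeff α κ₀ κ₁ (J τ) := fun τ hτ =>
    JumpCoeff.convex hκ₀ h0 hk hl hτ
  have hψ : ∀ τ u, psi α (J τ) u = psi α k u + τ * psi α m u := fun τ u =>
    psi_add_mul hd h0 h2 hk.meas (hk.abs_le hκ₀) hmm hε τ u
  have hpk : ∀ τ ∈ Icc (0 : ℝ) 1, ∀ x, difs L (pk α (J τ) 1) x =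
      rfint (fun u => mult L u 0 0 * Complex.exp (-(psi α k u + τ * psi α m u))) x := by
    intro τ hτ x
    rw [pk_eq, difs_rfint (integrable_exp_psi hd h0 h2 hκ₀ (hJc τ hτ) one_pos)]
    simp only [hψ, Complex.ofReal_one, one_mul]
  have hexp : ∀ τ ∈ Icc (0 : ℝ) 1, ∀ u, ‖Complex.exp (-(psi α k u + τ * psi α m u))‖ ≤
      Real.exp D * Real.exp (-(c * ‖u‖ ^ α)) := by
    intro τ hτ u
    have := norm_exp_psi_le (hD _ (hJc τ hτ) u) zero_le_one
    simpa only [hψ, Complex.ofReal_one, one_mul] using this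
  have mM : Measurable fun u : Rn d => mult L u 0 0 := (continuous_mult_left L 0 0).measurable
  have ma := measurable_psi hd α hk.meas
  have mb := measurable_psi hd α hmm
  have hint : ∀ τ ∈ Icc (0 : ℝ) 1, ∀ q : ℕ, Integrable fun u => (((1 + ‖u‖) ^ q : ℝ) : ℂ) *
      (mult L u 0 0 * Complex.exp (-(psi α k u + τ * psi α m u))) := by
    intro τ hτ q
    refine ((integrable_pow_mul_exp (d := d) h0 hc q).const_mul (2 ^ L.length * Real.exp D)).mono'
      (Measurable.aestronglyMeasurable (by fun_prop)) (Filter.Eventually.of_forall fun u => ?_)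
    rw [norm_mul, norm_mul, Complex.norm_real, Real.norm_of_nonneg (by positivity)]
    calc _ ≤ (1 + ‖u‖) ^ q * (2 ^ L.length * (Real.exp D * Real.exp (-(c * ‖u‖ ^ α)))) := by
          gcongr
          exacts [norm_mult_zero_le L u, hexp τ hτ u]
      _ = _ := by ring
  have hint0 : ∀ τ ∈ Icc (0 : ℝ) 1, Integrable fun u =>
      mult L u 0 0 * Complex.exp (-(psi α k u + τ * psi α m u)) := by
    intro τ hτ; simpa using hint τ hτ 0
  set G : ℝ → ℝ := fun τ =>
    rfint (fun u => mult L u 0 0 * Complex.exp (-(psi α k u + τ * psi α m u))) x with hG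
  set G' : ℝ → ℝ := fun τ => rfint (fun u => -psi α m u *
    (mult L u 0 0 * Complex.exp (-(psi α k u + τ * psi α m u)))) x with hG'
  have hcont : ContinuousOn G (Icc 0 1) := by
    refine continuousOn_rfint (B := fun u => 2 ^ L.length * Real.exp D *
      ((1 + ‖u‖) ^ 0 * Real.exp (-(c * ‖u‖ ^ α)))) continuousOn_const
      (fun τ hτ => (hint0 τ hτ).1)
      ((integrable_pow_mul_exp h0 hc 0).const_mul _) (fun τ hτ u => ?_) (fun u => by fun_prop)
    rw [norm_mul, pow_zero, one_mul, mul_assoc]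
    gcongr
    exacts [norm_mult_zero_le L u, hexp τ hτ u]
  have hderiv : ∀ τ ∈ Ioo (0 : ℝ) 1, HasDerivAt G (G' τ) τ := by
    intro τ hτ
    refine hasDerivAt_rfint mM ma mb (S := Ioo 0 1) (Ioo_mem_nhds hτ.1 hτ.2)
      (hint0 τ (Ioo_subset_Icc_self hτ))
      (B := fun u => ε * (∫ h : Rn d, expW α h) * 2 ^ L.length * Real.exp D *
        ((1 + ‖u‖) ^ 2 * Real.exp (-(c * ‖u‖ ^ α))))
      ((integrable_pow_mul_exp h0 hc 2).const_mul _) (fun u s hs => ?_) x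
    rw [norm_mul, norm_mul]
    have hE : 0 ≤ ∫ h : Rn d, expW α h := integral_nonneg fun h => expW_nonneg α h
    calc _ ≤ (ε * (1 + ‖u‖) ^ 2 * ∫ h : Rn d, expW α h) *
          (2 ^ L.length * (Real.exp D * Real.exp (-(c * ‖u‖ ^ α)))) := by
          gcongr
          exacts [norm_psi_le hd h0 h2 hε u, norm_mult_zero_le L u,
            hexp s (Ioo_subset_Icc_self hs) u]
      _ = _ := by ring
  -- The mean value theorem is applied at fixed x; the intermediate τ may depend on x, which is
  -- harmless because the bound is uniform in τ.
  obtain ⟨τ, hτ, he⟩ := exists_hasDerivAt_eq_slope G G' zero_lt_one hcont hderiv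
  have hτ' := Ioo_subset_Icc_self hτ
  have e0 : difs L (pk α k 1) x = G 0 := by
    rw [hG]; simp only; rw [← hpk 0 ⟨le_rfl, zero_le_one⟩]; simp [hJ]
  have e1 : difs L (pk α l 1) x = G 1 := by
    rw [hG]; simp only; rw [← hpk 1 ⟨zero_le_one, le_rfl⟩]; simp [hJ, hm]
  rw [difs_sub, e0, e1]
  have he' : G 1 - G 0 = G' τ := by rw [he]; ring
  have hreg := hC _ (hJc τ hτ') 1 one_pos le_rfl L hL hL1
  simp only [Real.one_rpow, div_one] at hreg
  have h5 := hreg.abs_integral_dlt_le hd (ω := 1 / 2) h0 h2 (by norm_num) (by norm_num) one_pos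
    le_rfl hε x
  have e2 : difs L (pk α (J τ) 1) =
      rfint (fun u => mult L u 0 0 * Complex.exp (-(psi α k u + τ * psi α m u))) :=
    funext (hpk τ hτ')
  rw [e2, integral_dlt_rfint hd h0 h2 hmm hε (hint0 τ hτ') (hint τ hτ' 2)] at h5
  rw [he']
  refine h5.trans_eq ?_
  rw [Real.one_rpow]
  ring

lemma exists_reg_pk_sub (hd : 1 ≤ d) {α κ₀ κ₁ : ℝ} (h0 : 0 < α) (h2 : α < 2)
    (hκ₀ : 0 < κ₀) (hκ : κ₀ ≤ κ₁) :
    ∃ C ≥ 0, ∀ k l : Rn d → ℝ, JumpCoeff α κ₀ κ₁ k → JumpCoeff α κ₀ κ₁ l → ∀ ε : ℝ,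
      (∀ h, |l h - k h| ≤ ε) → ∀ r : ℝ, 0 < r → r ≤ 1 →
      Reg α r (C * ε) (fun x => pk α l (r ^ α) x - pk α k (r ^ α) x) := by
  obtain ⟨C0, hC00, hC0⟩ := exists_difs_pk_one_sub_le (d := d) hd h0 h2 hκ₀ hκ 0
  obtain ⟨C1, hC10, hC1⟩ := exists_difs_pk_one_sub_le (d := d) hd h0 h2 hκ₀ hκ 1
  obtain ⟨C2, hC20, hC2⟩ := exists_difs_pk_one_sub_le (d := d) hd h0 h2 hκ₀ hκ 2
  refine ⟨C0 + C1 + C2, by positivity, fun k l hk hl ε hε r hr hr1 => ?_⟩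
  have hε0 : 0 ≤ ε := (abs_nonneg _).trans (hε 0)
  refine Reg.of_difs ((differentiable_pk hd h0 h2 hκ₀ hl (by positivity)).sub
    (differentiable_pk hd h0 h2 hκ₀ hk (by positivity))) fun L hL hL1 x => ?_
  have hn : ∀ a : Rn d, ‖r⁻¹ • a‖ = ‖a‖ / r := by
    intro a; rw [norm_smul, norm_inv, Real.norm_of_nonneg hr.le]; field_simp
  have e : (fun x => pk α l (r ^ α) x - pk α k (r ^ α) x) = fun x => (r ^ d)⁻¹ *
      (fun y => pk α (fun h => l (r • h)) 1 y - pk α (fun h => k (r • h)) 1 y) (r⁻¹ • x) := by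
    funext x
    rw [pk_scale hd h0 h2 hκ₀ hk hr hr1 x, pk_scale hd h0 h2 hκ₀ hl hr hr1 x]
    simp only; ring
  have hL1' : ∀ a ∈ L.map (r⁻¹ • ·), ‖a‖ ≤ 1 := by
    intro a ha
    obtain ⟨b, hb, rfl⟩ := List.mem_map.1 ha
    simp only [hn]
    rw [div_le_one hr]; exact hL1 b hb
  have hp := profile_nonneg (γ := α) one_pos (r⁻¹ • x)
  have hP := prod_norm_nonneg (L.map (r⁻¹ • ·))
  have key : |difs (L.map (r⁻¹ • ·)) (fun y => pk α (fun h => l (r • h)) 1 y -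
      pk α (fun h => k (r • h)) 1 y) (r⁻¹ • x)| ≤
      (C0 + C1 + C2) * ε * ((L.map (r⁻¹ • ·)).map norm).prod * profile α 1 (r⁻¹ • x) := by
    have hcase : L.length = 0 ∨ L.length = 1 ∨ L.length = 2 := by omega
    rcases hcase with h | h | h
    · refine (hC0 _ _ (hk.scale hr) (hl.scale hr) ε (fun _ => hε _) _ (by simpa using h)
        hL1' _).trans ?_
      gcongr; linarith
    · refine (hC1 _ _ (hk.scale hr) (hl.scale hr) ε (fun _ => hε _) _ (by simpa using h)
        hL1' _).trans ?_
      gcongr; linarith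
    · refine (hC2 _ _ (hk.scale hr) (hl.scale hr) ε (fun _ => hε _) _ (by simpa using h)
        hL1' _).trans ?_
      gcongr; linarith
  have e' := difs_scale L (r ^ d)⁻¹ r⁻¹
    (fun y => pk α (fun h => l (r • h)) 1 y - pk α (fun h => k (r • h)) 1 y) x
  rw [e, e', abs_mul, abs_of_nonneg (by positivity), profile_scale α hr]
  rw [List.map_map] at key
  simp only [Function.comp_def, hn] at key
  calc _ ≤ (r ^ d)⁻¹ * ((C0 + C1 + C2) * ε * (L.map fun a => ‖a‖ / r).prod *
      profile α 1 (r⁻¹ • x)) := by gcongr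
    _ = _ := by ring

/-! ### Time derivative, continuity and total mass of the frozen density -/

lemma hasDerivAt_pk (hd : 1 ≤ d) {α κ₀ κ₁ : ℝ} (h0 : 0 < α) (h2 : α < 2) (hκ₀ : 0 < κ₀)
    {k : Rn d → ℝ} (hk : JumpCoeff α κ₀ κ₁ k) {t : ℝ} (ht : 0 < t) (x : Rn d) :
    HasDerivAt (fun s => pk α k s x) (jumpOp α k (pk α k t) x) t := by
  obtain ⟨c, hc, D, hD0, hD⟩ := exists_re_psi_lower (d := d) hd h0 h2 hκ₀
    ((hk.lower 0).trans (hk.upper 0))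
  have hκ₁ : 0 ≤ κ₁ := (abs_nonneg _).trans (hk.abs_le hκ₀ 0)
  have mb := measurable_psi hd α hk.meas
  have hi := integrable_exp_psi hd h0 h2 hκ₀ hk ht
  have key := hasDerivAt_rfint (M := fun _ : Rn d => 1) (a := fun _ => 0) (b := psi α k)
    measurable_const measurable_const mb (s₀ := t) (S := Ioo (t / 2) (2 * t))
    (Ioo_mem_nhds (by linarith) (by linarith)) (by simpa using hi)
    (B := fun u => κ₁ * (∫ h : Rn d, expW α h) * Real.exp (2 * t * D) *
      ((1 + ‖u‖) ^ 2 * Real.exp (-((t / 2 * c) * ‖u‖ ^ α))))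
    ((integrable_pow_mul_exp h0 (by positivity) 2).const_mul _) (fun u s hs => ?_) x
  · simp only [zero_add, one_mul] at key
    rw [jumpOp_eq hd, pk_eq, integral_dlt_rfint hd h0 h2 hk.meas (hk.abs_le hκ₀) hi
      (integrable_pow_mul_exp_psi hd h0 h2 hκ₀ hk ht 2)]
    simp only [pk_eq]
    exact key
  · rw [norm_mul, one_mul, zero_add]
    have hE : 0 ≤ ∫ h : Rn d, expW α h := integral_nonneg fun h => expW_nonneg α h
    have hs0 : 0 < s := by linarith [hs.1]
    have h3 : Real.exp (s * D) ≤ Real.exp (2 * t * D) := by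
      rw [Real.exp_le_exp]; gcongr; exact hs.2.le
    have h4 : Real.exp (-((s * c) * ‖u‖ ^ α)) ≤ Real.exp (-((t / 2 * c) * ‖u‖ ^ α)) := by
      rw [Real.exp_le_exp, neg_le_neg_iff]; gcongr; exact hs.1.le
    calc _ ≤ (κ₁ * (1 + ‖u‖) ^ 2 * ∫ h : Rn d, expW α h) *
          (Real.exp (2 * t * D) * Real.exp (-((t / 2 * c) * ‖u‖ ^ α))) := by
          gcongr
          · exact norm_psi_le hd h0 h2 (hk.abs_le hκ₀) u
          · exact (norm_exp_psi_le (hD k hk u) hs0.le).trans (by gcongr)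
      _ = _ := by ring

lemma continuousOn_rfint_mul_exp (hd : 1 ≤ d) {α κ₀ κ₁ : ℝ} (h0 : 0 < α) (h2 : α < 2)
    (hκ₀ : 0 < κ₀) {k : Rn d → ℝ} (hk : JumpCoeff α κ₀ κ₁ k) {M : Rn d → ℂ} (hM : Measurable M)
    {A : ℝ} {p : ℕ} (hA : ∀ u, ‖M u‖ ≤ A * (1 + ‖u‖) ^ p) :
    ContinuousOn (fun w : ℝ × Rn d => rfint (fun u => M u * Complex.exp (-((w.1 : ℂ) * psi α k u)))
      w.2) (Ioi 0 ×ˢ univ) := by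
  obtain ⟨c, hc, D, hD0, hD⟩ := exists_re_psi_lower (d := d) hd h0 h2 hκ₀
    ((hk.lower 0).trans (hk.upper 0))
  have hA0 : 0 ≤ A := by
    have := (norm_nonneg _).trans (hA 0)
    simpa using this
  have mb := measurable_psi hd α hk.meas
  have hloc : ∀ t : ℝ, 0 < t → ContinuousOn (fun w : ℝ × Rn d =>
      rfint (fun u => M u * Complex.exp (-((w.1 : ℂ) * psi α k u))) w.2)
      (Ioo (t / 2) (2 * t) ×ˢ univ) := by
    intro t ht
    refine continuousOn_rfint (B := fun u => A * Real.exp (2 * t * D) *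
      ((1 + ‖u‖) ^ p * Real.exp (-((t / 2 * c) * ‖u‖ ^ α)))) (by fun_prop)
      (fun s hs => Measurable.aestronglyMeasurable (by fun_prop))
      ((integrable_pow_mul_exp h0 (by positivity) p).const_mul _) (fun s hs u => ?_)
      (fun u => by fun_prop)
    have hs' := hs.1
    have hs0 : 0 < s.1 := by linarith [hs'.1]
    have h3 : Real.exp (s.1 * D) ≤ Real.exp (2 * t * D) := by
      rw [Real.exp_le_exp]; gcongr; exact hs'.2.le
    have h4 : Real.exp (-((s.1 * c) * ‖u‖ ^ α)) ≤ Real.exp (-((t / 2 * c) * ‖u‖ ^ α)) := by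
      rw [Real.exp_le_exp, neg_le_neg_iff]; gcongr; exact hs'.1.le
    rw [norm_mul]
    calc _ ≤ (A * (1 + ‖u‖) ^ p) *
          (Real.exp (2 * t * D) * Real.exp (-((t / 2 * c) * ‖u‖ ^ α))) := by
          gcongr
          · exact hA u
          · exact (norm_exp_psi_le (hD k hk u) hs0.le).trans (by gcongr)
      _ = _ := by ring
  rintro ⟨t, x⟩ ⟨ht, -⟩
  have ht' : 0 < t := ht
  have ho : IsOpen (Ioo (t / 2) (2 * t) ×ˢ (univ : Set (Rn d))) := isOpen_Ioo.prod isOpen_univ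
  exact ((hloc t ht').continuousAt (ho.mem_nhds
    ⟨⟨by simp only; linarith, by simp only; linarith⟩, mem_univ _⟩)).continuousWithinAt

lemma continuousAt_psi_zero (hd : 1 ≤ d) {α A : ℝ} (h0 : 0 < α) (h2 : α < 2) {k : Rn d → ℝ}
    (hkm : Measurable k) (hk : ∀ h, |k h| ≤ A) : ContinuousAt (psi α k) 0 := by
  have e : psi α k = fun u => -∫ h, fullExp α u h * (levyK α k h : ℂ) := funext (psi_eq hd α k)
  have hA : 0 ≤ A := (abs_nonneg _).trans (hk 0)
  rw [e]
  refine (continuousAt_of_dominated (bound := fun h => A * (1 + 1) ^ 2 * expW α h)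
    (Filter.Eventually.of_forall fun u => (integrable_fullExp hd h0 h2 hkm hk u).1) ?_
    ((integrable_expW hd h0 h2).const_mul _) (Filter.Eventually.of_forall fun h => ?_)).neg
  · filter_upwards [Metric.ball_mem_nhds (0 : Rn d) one_pos] with u hu
    refine Filter.Eventually.of_forall fun h => ?_
    refine (norm_fullExp_mul_levyK_le h0 hk u h).trans ?_
    have := expW_nonneg α h
    have hu' : ‖u‖ ≤ 1 := (mem_ball_zero_iff.1 hu).le
    gcongr
  · unfold fullExp; fun_prop

lemma psi_zero (hd : 1 ≤ d) (α : ℝ) (k : Rn d → ℝ) : psi α k 0 = 0 := by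
  rw [psi_eq hd]; simp [fullExp]

lemma continuous_fint {f : Rn d → ℂ} (hf : Integrable f) : Continuous (fint f) := by
  have hm := hf.1
  refine continuous_of_dominated (bound := fun u => ‖f u‖)
    (fun x => (integrable_exp_inner_mul hf x).1)
    (fun x => Filter.Eventually.of_forall fun u => ?_) hf.norm
    (Filter.Eventually.of_forall fun u => by fun_prop)
  rw [norm_mul, norm_exp_I_mul_real, one_mul]

/-- Fourier inversion at the origin, where e^{-ψ(0)} = 1. The density is integrable by its profile
bound, and inversion needs continuity of e^{-ψ} at the origin only. -/
lemma integral_pk_one (hd : 1 ≤ d) {α κ₀ κ₁ : ℝ} (h0 : 0 < α) (h2 : α < 2) (hκ₀ : 0 < κ₀)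
    {k : Rn d → ℝ} (hk : JumpCoeff α κ₀ κ₁ k) : ∫ x, pk α k 1 x = 1 := by
  obtain ⟨C, hC0, hC⟩ := exists_norm_fint_mult_le (d := d) hd h0 h2 hκ₀
    ((hk.lower 0).trans (hk.upper 0)) 0
  set f : Rn d → ℂ := fun u => Complex.exp (-(((1 : ℝ) : ℂ) * psi α k u)) with hf
  have hfi : Integrable f := integrable_exp_psi hd h0 h2 hκ₀ hk one_pos
  have hb : ∀ x, ‖fint f x‖ ≤ C * profile α 1 x := by
    intro x
    have := hC k hk [] rfl (by simp) x
    simpa [mult, hf] using this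
  have hpi : (2 * Real.pi) ≠ 0 := by positivity
  have hF : ∀ w, FourierTransform.fourier f w = fint f (-(2 * Real.pi) • w) := by
    intro w
    rw [fint_eq_fourier, smul_smul, neg_mul_neg, inv_mul_cancel₀ hpi, one_smul]
  have hcfi : Continuous (fint f) := continuous_fint hfi
  have hii : Integrable (fint f) :=
    ((integrable_profile h0 one_pos).const_mul C).mono' hcfi.aestronglyMeasurable
      (Filter.Eventually.of_forall hb)
  have hFi : Integrable (FourierTransform.fourier f) := by
    have e : FourierTransform.fourier f = fun w => fint f (-(2 * Real.pi) • w) := funext hF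
    rw [e]
    exact hii.comp_smul (neg_ne_zero.2 hpi)
  have hcont : ContinuousAt f 0 := by
    have := continuousAt_psi_zero hd h0 h2 hk.meas (hk.abs_le hκ₀)
    rw [hf]; fun_prop
  have hinv := hfi.fourierInv_fourier_eq hFi hcont
  rw [Real.fourierInv_eq'] at hinv
  simp only [inner_zero_right, mul_zero, Complex.ofReal_zero, zero_mul, Complex.exp_zero,
    one_smul] at hinv
  simp only [hF] at hinv
  rw [Measure.integral_comp_smul] at hinv
  have hf0 : f 0 = 1 := by rw [hf]; simp [psi_zero hd]
  rw [hf0, finrank_euclideanSpace, Fintype.card_fin, abs_inv, abs_pow, abs_neg,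
    abs_of_nonneg (by positivity : (0 : ℝ) ≤ 2 * Real.pi)] at hinv
  have hre := integral_re hii
  simp only [RCLike.re_eq_complex_re] at hre
  simp only [pk_eq]
  change ∫ x, ((2 * Real.pi) ^ d)⁻¹ * (fint f x).re = 1
  rw [integral_const_mul, hre]
  have := congrArg Complex.re hinv
  rwa [Complex.smul_re, smul_eq_mul, Complex.one_re] at this

lemma integral_pk (hd : 1 ≤ d) {α κ₀ κ₁ : ℝ} (h0 : 0 < α) (h2 : α < 2) (hκ₀ : 0 < κ₀)
    {k : Rn d → ℝ} (hk : JumpCoeff α κ₀ κ₁ k) {r : ℝ} (hr : 0 < r) (hr1 : r ≤ 1) :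
    ∫ x, pk α k (r ^ α) x = 1 := by
  simp only [pk_scale hd h0 h2 hκ₀ hk hr hr1]
  rw [integral_const_mul, Measure.integral_comp_smul, finrank_euclideanSpace, Fintype.card_fin,
    integral_pk_one hd h0 h2 hκ₀ (hk.scale hr), inv_pow, inv_inv, abs_of_nonneg (by positivity)]
  simp only [smul_eq_mul, mul_one]
  field_simp

section Reg

variable {α r A : ℝ} {g : Rn d → ℝ}

lemma Reg.integrable (hg : Reg α r A g) (h0 : 0 < α) (hr : 0 < r) : Integrable g :=
  ((integrable_profile h0 hr).const_mul A).mono' hg.diff.continuous.aestronglyMeasurable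
    (Filter.Eventually.of_forall hg.bound)

lemma Reg.integrable_fderiv (hg : Reg α r A g) (h0 : 0 < α) (hr : 0 < r) (h : Rn d) :
    Integrable fun x => fderiv ℝ g x h :=
  ((integrable_profile h0 hr).const_mul (A * (‖h‖ / r))).mono'
    (measurable_fderiv_apply_const ℝ g h).aestronglyMeasurable
    (Filter.Eventually.of_forall fun x => hg.abs_fderiv_le hr x h)

lemma Reg.integral_fderiv (hg : Reg α r A g) (h0 : 0 < α) (hr : 0 < r) (h : Rn d) :
    ∫ x, fderiv ℝ g x h = 0 := by
  have := integral_mul_fderiv_eq_neg_fderiv_mul_of_integrable (μ := (volume : Measure (Rn d)))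
    (f := fun _ : Rn d => (1 : ℝ)) (g := g) (v := h) (by simp)
    (by simpa using hg.integrable_fderiv h0 hr h) (by simpa using hg.integrable h0 hr)
    (fun _ _ => differentiableAt_const _) (fun x _ => hg.diff x)
  simpa using this

lemma Reg.integrable_dlt_left (hg : Reg α r A g) (h0 : 0 < α) (hr : 0 < r) (h : Rn d) :
    Integrable fun x => dlt α g x h :=
  (((hg.integrable h0 hr).comp_add_right h).sub (hg.integrable h0 hr)).sub
    ((hg.integrable_fderiv h0 hr h).const_mul _)

/-- Translation invariance removes g(x+h) − g(x), and the gradient of an integrable regular function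
has mean zero. This vanishing is the source of all cancellation for densities frozen at the starting
point. -/
lemma Reg.integral_dlt (hg : Reg α r A g) (h0 : 0 < α) (hr : 0 < r) (h : Rn d) :
    ∫ x, dlt α g x h = 0 := by
  have i1 := hg.integrable h0 hr
  have i2 : Integrable fun x => g (x + h) := i1.comp_add_right h
  have i3 := (hg.integrable_fderiv h0 hr h).const_mul (chi α h)
  have i4 : Integrable fun x => g (x + h) - g x := i2.sub i1
  unfold dlt
  rw [integral_sub i4 i3, integral_sub i2 i1, integral_add_right_eq_self g h,
    integral_const_mul, hg.integral_fderiv h0 hr]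
  ring

end Reg

/-! ### Standing assumptions and joint measurability -/

section

/-- The spatial scale `t ^ (1 / α)`. -/
def rt (α t : ℝ) : ℝ := t ^ (1 / α)

lemma rt_pos (α : ℝ) {t : ℝ} (ht : t ∈ Ioc (0 : ℝ) 1) : 0 < rt α t := Real.rpow_pos_of_pos ht.1 _

lemma rt_le_one {α t : ℝ} (h0 : 0 < α) (ht : t ∈ Ioc (0 : ℝ) 1) : rt α t ≤ 1 :=
  Real.rpow_le_one ht.1.le ht.2 (by positivity)

lemma rt_rpow {α t : ℝ} (ht : t ∈ Ioc (0 : ℝ) 1) (s : ℝ) : rt α t ^ s = t ^ (s / α) := by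
  rw [rt, ← Real.rpow_mul ht.1.le]; congr 1; ring

lemma rt_rpow_self {α t : ℝ} (h0 : 0 < α) (ht : t ∈ Ioc (0 : ℝ) 1) : rt α t ^ α = t := by
  rw [rt_rpow ht, div_self h0.ne', Real.rpow_one]

/-- The standing assumptions on the coefficient, together with the regularity estimates for the
frozen densities. -/
structure Param (d : ℕ) (α ω κ₀ κ₁ L C : ℝ) (n : Rn d → Rn d → ℝ) : Prop where
  hd : 1 ≤ d
  h0 : 0 < α
  h2 : α < 2
  hκ₀ : 0 < κ₀
  hω0 : 0 < ω
  hω1 : 8 * ω ≤ 1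
  hω2 : 8 * ω ≤ α
  hL : 0 ≤ L
  hC : 0 ≤ C
  meas : Measurable (Function.uncurry n)
  coeff : ∀ y, JumpCoeff α κ₀ κ₁ (n y)
  holder : ∀ x y h, |n x h - n y h| ≤ L * ‖x - y‖ ^ (4 * ω)
  reg : ∀ t ∈ Ioc (0 : ℝ) 1, ∀ y, Reg α (rt α t) C (pk α (n y) t)
  reg_shift : ∀ t ∈ Ioc (0 : ℝ) 1, ∀ y a, ‖a‖ ≤ rt α t →
    Reg α (rt α t) (C * (‖a‖ / rt α t)) (fun x => pk α (n y) t (x + a) - pk α (n y) t x)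
  reg_sub : ∀ t ∈ Ioc (0 : ℝ) 1, ∀ y y', Reg α (rt α t) (C * ‖y - y'‖ ^ (4 * ω))
    (fun x => pk α (n y) t x - pk α (n y') t x)

/-- Gathers the density estimates at scale r = t^{1/α} and fixes ω small enough that every loss
below is covered by the Hölder exponent. -/
lemma exists_param (hd : 1 ≤ d) {α κ₀ κ₁ κ₂ θ : ℝ} (h0 : 0 < α) (h2 : α < 2) (hκ₀ : 0 < κ₀)
    (hκ₂ : 0 < κ₂) (hθ0 : 0 < θ) (n : Rn d → Rn d → ℝ)
    (hm : Measurable (Function.uncurry n)) (hlow : ∀ x h, κ₀ ≤ n x h) (hup : ∀ x h, n x h ≤ κ₁)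
    (hh : ∀ x y h, |n x h - n y h| ≤ κ₂ * ‖x - y‖ ^ θ)
    (hone : α = 1 → ∀ (x : Rn d) (r : ℝ), 0 < r → ∫ h, n x h • h ∂(surfaceMeasure d r) = 0) :
    ∃ ω L C, Param d α ω κ₀ κ₁ L C n := by
  have hκ : κ₀ ≤ κ₁ := (hlow 0 0).trans (hup 0 0)
  -- The factor 8 ensures 4ω ≤ θ, 4ω < α (profiles of order α − 4ω stay integrable), and 2ω ≤ 1. Of
  -- the Hölder budget 4ω, the jump operator spends ω and the modulus in x of F spends 2ω; ω is left
  -- for the time singularity.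
  set ω := min (min θ α) 1 / 8 with hω
  have hω0 : 0 < ω := by positivity
  have w1 : min (min θ α) 1 ≤ θ := (min_le_left _ _).trans (min_le_left _ _)
  have w2 : min (min θ α) 1 ≤ α := (min_le_left _ _).trans (min_le_right _ _)
  have w3 : min (min θ α) 1 ≤ 1 := min_le_right _ _
  have hcoeff : ∀ y, JumpCoeff α κ₀ κ₁ (n y) := fun y =>
    jumpCoeff_of_sphere hd (hm.comp measurable_prodMk_left) (hlow y) (hup y)
      (fun h r hr => hone h y r hr)
  obtain ⟨C0, hC00, hC0⟩ := exists_reg_difs_pk (d := d) hd h0 h2 hκ₀ hκ 0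
  obtain ⟨C1, hC10, hC1⟩ := exists_reg_difs_pk (d := d) hd h0 h2 hκ₀ hκ 1
  obtain ⟨C2, hC20, hC2⟩ := exists_reg_pk_sub (d := d) hd h0 h2 hκ₀ hκ
  have hL : 0 ≤ κ₂ + κ₁ := by linarith
  -- The exponent θ is lowered to 4ω: for |x−y| ≤ 1 this weakens the bound, and for larger distances
  -- two values in [κ₀, κ₁] differ by at most κ₁.
  have hhold : ∀ x y h, |n x h - n y h| ≤ (κ₂ + κ₁) * ‖x - y‖ ^ (4 * ω) := by
    intro x y h
    rcases le_total ‖x - y‖ 1 with hx | hx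
    · rcases eq_or_lt_of_le (norm_nonneg (x - y)) with hz | hz
      · have : x = y := sub_eq_zero.1 (norm_eq_zero.1 hz.symm)
        subst this
        simp only [sub_self, abs_zero]; positivity
      · have := Real.rpow_le_rpow_of_exponent_ge hz hx (show 4 * ω ≤ θ by linarith)
        refine (hh x y h).trans ?_
        gcongr; linarith
    · have h1 : |n x h - n y h| ≤ κ₁ := by
        have a1 := hlow x h; have a2 := hup x h; have a3 := hlow y h; have a4 := hup y h
        rw [abs_le]; constructor <;> linarith
      have h3 : 1 ≤ ‖x - y‖ ^ (4 * ω) := Real.one_le_rpow hx (by positivity)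
      nlinarith
  have mono : ∀ {r A B : ℝ} {g : Rn d → ℝ}, 0 < r → A ≤ B → Reg α r A g → Reg α r B g := by
    intro r A B g hr hAB hg
    refine ⟨hg.diff, fun x => (hg.bound x).trans ?_, fun a x ha => (hg.bound_one a x ha).trans ?_,
      fun a b x ha hb => (hg.bound_two a b x ha hb).trans ?_⟩ <;>
    · have := profile_nonneg (γ := α) hr x
      gcongr
  refine ⟨ω, κ₂ + κ₁, C0 + C1 + C2 * (κ₂ + κ₁), hd, h0, h2, hκ₀, hω0, by linarith, by linarith, hL,
    by positivity, hm, hcoeff, hhold, fun t ht y => ?_, fun t ht y a ha => ?_,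
    fun t ht y y' => ?_⟩
  · have h := hC0 _ (hcoeff y) _ (rt_pos α ht) (rt_le_one h0 ht) [] rfl (by simp)
    rw [rt_rpow_self h0 ht] at h
    refine mono (rt_pos α ht) ?_ h
    simp only [List.map_nil, List.prod_nil, mul_one]
    have : 0 ≤ C2 * (κ₂ + κ₁) := by positivity
    linarith
  · have h := hC1 _ (hcoeff y) _ (rt_pos α ht) (rt_le_one h0 ht) [a] rfl (by simpa using ha)
    rw [rt_rpow_self h0 ht] at h
    refine mono (rt_pos α ht) ?_ h
    simp only [List.map_cons, List.map_nil, List.prod_cons, List.prod_nil, mul_one]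
    have : 0 ≤ C2 * (κ₂ + κ₁) := by positivity
    have := rt_pos α ht
    gcongr; linarith
  · have h := hC2 _ _ (hcoeff y') (hcoeff y) _ (hhold y y') _ (rt_pos α ht) (rt_le_one h0 ht)
    rw [rt_rpow_self h0 ht] at h
    refine mono (rt_pos α ht) ?_ h
    rw [← mul_assoc]
    gcongr; linarith

lemma measurable_fullExp (α : ℝ) : Measurable fun w : Rn d × Rn d => fullExp α w.1 w.2 := by
  have h1 := measurable_chi (d := d) α
  have h2 : Measurable fun w : Rn d × Rn d => chi α w.2 := h1.fun_comp measurable_snd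
  unfold fullExp
  fun_prop

lemma dlt_comp_sub (α : ℝ) (g : Rn d → ℝ) (y x h : Rn d) :
    dlt α (fun z => g (z - y)) x h = dlt α g (x - y) h := by
  unfold dlt
  rw [fderiv_comp_sub]
  simp only [add_sub_right_comm]

attribute [local irreducible] psi fullExp pk

namespace Param

variable {α ω κ₀ κ₁ L C : ℝ} {n : Rn d → Rn d → ℝ} (P : Param d α ω κ₀ κ₁ L C n)

include P

lemma abs_n_le (x h : Rn d) : |n x h| ≤ κ₁ := (P.coeff x).abs_le P.hκ₀ h

lemma hκ₁ : 0 ≤ κ₁ := (abs_nonneg _).trans (P.abs_n_le 0 0)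

/-- Joint measurability in the frozen point and the frequency. All later measurability of kernels,
needed for Fubini, descends from it through parametric integrals. -/
lemma measurable_psi : Measurable fun w : Rn d × Rn d => psi α (n w.1) w.2 := by
  have e : (fun w : Rn d × Rn d => psi α (n w.1) w.2) =
      fun w => -∫ h, fullExp α w.2 h * (levyK α (n w.1) h : ℂ) :=
    funext fun w => psi_eq P.hd α (n w.1) w.2
  have hn := P.meas
  have h1 : Measurable fun z : (Rn d × Rn d) × Rn d => n z.1.1 z.2 :=
    hn.fun_comp (measurable_fst.fst.prodMk measurable_snd)
  have h3 : Measurable fun z : (Rn d × Rn d) × Rn d => fullExp α z.1.2 z.2 :=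
    (measurable_fullExp α).fun_comp (measurable_fst.snd.prodMk measurable_snd)
  have h2 : Measurable fun z : (Rn d × Rn d) × Rn d => (levyK α (n z.1.1) z.2 : ℂ) := by
    unfold levyK; fun_prop
  have h4 := h3.mul h2
  rw [e]
  exact (h4.stronglyMeasurable.integral_prod_right' (ν := volume)).measurable.neg

lemma measurable_rfint {X : Type*} [MeasurableSpace X] {M : X → Rn d → ℂ}
    (hM : Measurable (Function.uncurry M)) {t : X → ℝ} (ht : Measurable t) {z y : X → Rn d}
    (hz : Measurable z) (hy : Measurable y) : Measurable fun w => rfint (fun u => M w u *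
      Complex.exp (-((t w : ℂ) * psi α (n (y w)) u))) (z w) := by
  have h1 : Measurable fun v : X × Rn d => psi α (n (y v.1)) v.2 :=
    P.measurable_psi.fun_comp ((hy.comp measurable_fst).prodMk measurable_snd)
  have h3 : Measurable fun v : X × Rn d => M v.1 v.2 := hM
  have h5 : Measurable fun v : X × Rn d => t v.1 := ht.comp measurable_fst
  have h6 : Measurable fun v : X × Rn d => inner ℝ v.2 (z v.1) :=
    measurable_snd.inner (hz.comp measurable_fst)
  have h4 : Measurable fun v : X × Rn d => Complex.exp (Complex.I * (inner ℝ v.2 (z v.1) : ℝ)) *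
      (M v.1 v.2 * Complex.exp (-((t v.1 : ℂ) * psi α (n (y v.1)) v.2))) := by fun_prop
  have h7 := (h4.stronglyMeasurable.integral_prod_right' (ν := volume)).measurable
  exact (Complex.measurable_re.comp h7).const_mul _

lemma measurable_pk {X : Type*} [MeasurableSpace X] {t : X → ℝ} (ht : Measurable t)
    {z y : X → Rn d} (hz : Measurable z) (hy : Measurable y) :
    Measurable fun w => pk α (n (y w)) (t w) (z w) := by
  have := P.measurable_rfint (M := fun _ _ => 1) measurable_const ht hz hy
  simpa only [pk_eq, one_mul] using this

lemma dlt_pk {t : ℝ} (ht : 0 < t) (y z h : Rn d) : dlt α (pk α (n y) t) z h =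
    rfint (fun u => fullExp α u h * Complex.exp (-((t : ℂ) * psi α (n y) u))) z := by
  have hi := integrable_exp_psi P.hd P.h0 P.h2 P.hκ₀ (P.coeff y) ht
  rw [pk_eq, dlt_rfint hi (integrable_norm_mul_of_sq
    (integrable_pow_mul_exp_psi P.hd P.h0 P.h2 P.hκ₀ (P.coeff y) ht 2) hi)]

lemma fderiv_pk {t : ℝ} (ht : 0 < t) (y z h : Rn d) : fderiv ℝ (pk α (n y) t) z h =
    rfint (fun u => Complex.I * (inner ℝ u h : ℝ) * Complex.exp (-((t : ℂ) * psi α (n y) u))) z := by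
  have hi := integrable_exp_psi P.hd P.h0 P.h2 P.hκ₀ (P.coeff y) ht
  rw [pk_eq, fderiv_rfint hi (integrable_norm_mul_of_sq
    (integrable_pow_mul_exp_psi P.hd P.h0 P.h2 P.hκ₀ (P.coeff y) ht 2) hi)]

lemma measurable_dlt_pk {X : Type*} [MeasurableSpace X] {t : X → ℝ} (ht : Measurable t)
    {z y h : X → Rn d} (hz : Measurable z) (hy : Measurable y) (hh : Measurable h) :
    Measurable fun w => rfint (fun u => fullExp α u (h w) *
      Complex.exp (-((t w : ℂ) * psi α (n (y w)) u))) (z w) := by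
  refine P.measurable_rfint (M := fun w u => fullExp α u (h w)) ?_ ht hz hy
  exact (measurable_fullExp α).fun_comp (measurable_snd.prodMk (hh.comp measurable_fst))

lemma measurable_fderiv_pk {X : Type*} [MeasurableSpace X] {t : X → ℝ} (ht : Measurable t)
    {z y : X → Rn d} (hz : Measurable z) (hy : Measurable y) (h : Rn d) :
    Measurable fun w => rfint (fun u => Complex.I * (inner ℝ u h : ℝ) *
      Complex.exp (-((t w : ℂ) * psi α (n (y w)) u))) (z w) := by
  refine P.measurable_rfint (M := fun w u => Complex.I * (inner ℝ u h : ℝ)) ?_ ht hz hy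
  have : Measurable fun v : X × Rn d => inner ℝ v.2 h := measurable_snd.inner measurable_const
  have h3 : Measurable fun v : X × Rn d => Complex.I * (inner ℝ v.2 h : ℝ) := by fun_prop
  exact h3

end Param

end

/-! ### The kernels of the generator and of the error term -/

section

attribute [local irreducible] psi fullExp pk levyK jumpMaj profile

/-- The kernel `𝒜 q(t,·,y)(x)`. -/
def bker (α : ℝ) (n : Rn d → Rn d → ℝ) (t : ℝ) (x y : Rn d) : ℝ :=
  ∫ h, dlt α (pk α (n y) t) (x - y) h * levyK α (n x) h

/-- The kernel `∂_t q(t,x,y) = 𝒜^y q(t,·,y)(x)`. -/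
def bfro (α : ℝ) (n : Rn d → Rn d → ℝ) (t : ℝ) (x y : Rn d) : ℝ :=
  ∫ h, dlt α (pk α (n y) t) (x - y) h * levyK α (n y) h

/-- Measurability of a kernel for times in `(0,1]`. -/
def MeasKer (K : ℝ → Rn d → Rn d → ℝ) : Prop :=
  ∃ G : ℝ × Rn d × Rn d → ℝ, Measurable G ∧ ∀ t ∈ Ioc (0 : ℝ) 1, ∀ x y, K t x y = G (t, x, y)

lemma MeasKer.sub {K K' : ℝ → Rn d → Rn d → ℝ} (h : MeasKer K) (h' : MeasKer K') :
    MeasKer fun t x y => K t x y - K' t x y := by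
  obtain ⟨G, hG, e⟩ := h
  obtain ⟨G', hG', e'⟩ := h'
  exact ⟨fun w => G w - G' w, hG.sub hG', fun t ht x y => by simp only [e t ht, e' t ht]⟩

lemma MeasKer.measurable_right {K : ℝ → Rn d → Rn d → ℝ} (h : MeasKer K) {t : ℝ}
    (ht : t ∈ Ioc (0 : ℝ) 1) (x : Rn d) : Measurable fun y => K t x y := by
  obtain ⟨G, hG, e⟩ := h
  simp only [e t ht]
  fun_prop

lemma MeasKer.measurable_left {K : ℝ → Rn d → Rn d → ℝ} (h : MeasKer K) {t : ℝ}
    (ht : t ∈ Ioc (0 : ℝ) 1) (y : Rn d) : Measurable fun x => K t x y := by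
  obtain ⟨G, hG, e⟩ := h
  simp only [e t ht]
  fun_prop

lemma levyK_sub (α : ℝ) (k l : Rn d → ℝ) (h : Rn d) :
    levyK α k h - levyK α l h = levyK α (fun h => k h - l h) h := by
  simp only [levyK]; ring

lemma norm_rpow_mul_profile_le {γ σ r : ℝ} (hσ : 0 ≤ σ) (hr : 0 < r) (x : Rn d) :
    ‖x‖ ^ σ * profile γ r x ≤ r ^ σ * profile (γ - σ) r x := by
  rw [← profile_mul_norm_rpow_le hr x, mul_comm]
  have := profile_nonneg (γ := γ) hr x
  gcongr
  linarith

namespace Param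

variable {α ω κ₀ κ₁ L C : ℝ} {n : Rn d → Rn d → ℝ} (P : Param d α ω κ₀ κ₁ L C n)

include P

lemma measurable_n (y : Rn d) : Measurable (n y) := (P.coeff y).meas

lemma measurable_n_sub (x y : Rn d) : Measurable fun h => n x h - n y h :=
  (P.measurable_n x).sub (P.measurable_n y)

lemma hω1' : ω < 1 := by linarith [P.hω1, P.hω0]

lemma opA_q (t : ℝ) (x x' y : Rn d) : jumpOp α (n x') (fun z => q α n t z y) x =
    ∫ h, dlt α (pk α (n y) t) (x - y) h * levyK α (n x') h := by
  rw [jumpOp_eq P.hd]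
  simp only [q_eq, dlt_comp_sub]

lemma F_eq_sub (t : ℝ) (x y : Rn d) : F α n t x y = bker α n t x y - bfro α n t x y := by
  rw [F, StableLike.opA, StableLike.opAFrozen, P.opA_q, P.opA_q]; rfl

lemma F_eq {t : ℝ} (ht : t ∈ Ioc (0 : ℝ) 1) (x y : Rn d) : F α n t x y =
    ∫ h, dlt α (pk α (n y) t) (x - y) h * levyK α (fun h => n x h - n y h) h := by
  have hr := P.reg t ht y
  have r0 := rt_pos α ht
  have r1 := rt_le_one P.h0 ht
  rw [P.F_eq_sub, bker, bfro, ← integral_sub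
    (hr.integrable_dlt P.hd P.h0 P.h2 r0 r1 (P.measurable_n x) (P.abs_n_le x) _)
    (hr.integrable_dlt P.hd P.h0 P.h2 r0 r1 (P.measurable_n y) (P.abs_n_le y) _)]
  simp only [← mul_sub, levyK_sub]

lemma measKer_q : MeasKer (q α n) := by
  refine ⟨fun w => pk α (n w.2.2) w.1 (w.2.1 - w.2.2), ?_, fun t _ x y => q_eq α n t x y⟩
  exact P.measurable_pk (t := fun w : ℝ × Rn d × Rn d => w.1) (z := fun w => w.2.1 - w.2.2)
    (y := fun w => w.2.2) (by fun_prop) (by fun_prop) (by fun_prop)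

/-- The map m selects the point whose coefficient is used in the operator: the starting point for
`bker`, the frozen point for `bfro`. -/
lemma measKer_int (m : Rn d × Rn d → Rn d) (hm : Measurable m) :
    MeasKer fun t x y => ∫ h, dlt α (pk α (n y) t) (x - y) h * levyK α (n (m (x, y))) h := by
  refine ⟨fun w => ∫ h, rfint (fun u => fullExp α u h *
    Complex.exp (-((w.1 : ℂ) * psi α (n w.2.2) u))) (w.2.1 - w.2.2) * levyK α (n (m w.2)) h, ?_,
    fun t ht x y => ?_⟩
  · have h1 := P.measurable_dlt_pk (t := fun w : (ℝ × Rn d × Rn d) × Rn d => w.1.1)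
      (z := fun w => w.1.2.1 - w.1.2.2) (y := fun w => w.1.2.2) (h := fun w => w.2)
      (by fun_prop) (by fun_prop) (by fun_prop) (by fun_prop)
    have hn := P.meas
    have h2 : Measurable fun z : (ℝ × Rn d × Rn d) × Rn d => n (m z.1.2) z.2 :=
      hn.fun_comp ((hm.fun_comp measurable_fst.snd).prodMk measurable_snd)
    have h3 : Measurable fun z : (ℝ × Rn d × Rn d) × Rn d => levyK α (n (m z.1.2)) z.2 := by
      unfold levyK; fun_prop
    exact ((h1.mul h3).stronglyMeasurable.integral_prod_right' (ν := volume)).measurable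
  · simp only [P.dlt_pk ht.1]

lemma measKer_bker : MeasKer (bker α n) := P.measKer_int Prod.fst measurable_fst

lemma measKer_bfro : MeasKer (bfro α n) := P.measKer_int Prod.snd measurable_snd

lemma measKer_F : MeasKer (F α n) := by
  have e : F α n = fun t x y => bker α n t x y - bfro α n t x y := by
    funext t x y; exact P.F_eq_sub t x y
  rw [e]
  exact P.measKer_bker.sub P.measKer_bfro

lemma abs_int_le {m : Rn d → ℝ} (hm : ∀ h, |m h| ≤ κ₁) {t : ℝ} (ht : t ∈ Ioc (0 : ℝ) 1)
    (y z : Rn d) : |∫ h, dlt α (pk α (n y) t) z h * levyK α m h| ≤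
      κ₁ * C * jumpMajC d α ω * (rt α t ^ (-(α + ω)) * profile α (rt α t) z) := by
  have := (P.reg t ht y).abs_integral_dlt_le P.hd P.h0 P.h2 P.hω0 P.hω1' (rt_pos α ht)
    (rt_le_one P.h0 ht) hm z
  refine this.trans_eq (by ring)

lemma abs_bker_le {t : ℝ} (ht : t ∈ Ioc (0 : ℝ) 1) (x y : Rn d) : |bker α n t x y| ≤
      κ₁ * C * jumpMajC d α ω * (rt α t ^ (-(α + ω)) * profile α (rt α t) (x - y)) :=
  P.abs_int_le (P.abs_n_le x) ht y (x - y)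

lemma abs_bfro_le {t : ℝ} (ht : t ∈ Ioc (0 : ℝ) 1) (x y : Rn d) : |bfro α n t x y| ≤
      κ₁ * C * jumpMajC d α ω * (rt α t ^ (-(α + ω)) * profile α (rt α t) (x - y)) :=
  P.abs_int_le (P.abs_n_le y) ht y (x - y)

/-- The operator acts with the coefficient n(x,·) − n(y,·), of size |x−y|^{4ω}. Absorbing this
factor in the profile yields r^{4ω} against the loss r^{-α-ω}. -/
lemma abs_F_le {t : ℝ} (ht : t ∈ Ioc (0 : ℝ) 1) (x y : Rn d) : |F α n t x y| ≤
      L * C * jumpMajC d α ω *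
        (rt α t ^ (-α + 3 * ω) * profile (α - 4 * ω) (rt α t) (x - y)) := by
  have r0 := rt_pos α ht
  have h1 := (P.reg t ht y).abs_integral_dlt_le P.hd P.h0 P.h2 P.hω0 P.hω1' r0
    (rt_le_one P.h0 ht) (P.holder x y) (x - y)
  have h2 := norm_rpow_mul_profile_le (γ := α) (σ := 4 * ω) (by linarith [P.hω0]) r0 (x - y)
  have hJ := jumpMajC_nonneg d α ω
  have hL := P.hL
  have hC := P.hC
  have e : rt α t ^ (-α + 3 * ω) = rt α t ^ (-(α + ω)) * rt α t ^ (4 * ω) := by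
    rw [← Real.rpow_add r0]; congr 1; ring
  rw [P.F_eq ht, e]
  calc _ ≤ _ := h1
    _ = L * C * jumpMajC d α ω * rt α t ^ (-(α + ω)) *
        (‖x - y‖ ^ (4 * ω) * profile α (rt α t) (x - y)) := by ring
    _ ≤ L * C * jumpMajC d α ω * rt α t ^ (-(α + ω)) *
        (rt α t ^ (4 * ω) * profile (α - 4 * ω) (rt α t) (x - y)) := by gcongr
    _ = _ := by ring

lemma abs_q_le {t : ℝ} (ht : t ∈ Ioc (0 : ℝ) 1) (x y : Rn d) :
    |q α n t x y| ≤ C * profile (α - 4 * ω) (rt α t) (x - y) := by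
  rw [q_eq]
  refine ((P.reg t ht y).bound _).trans ?_
  have hC := P.hC
  gcongr
  exact profile_anti (rt_pos α ht) (by linarith [P.hω0]) _

lemma rpow_mul_profile_eq {t : ℝ} (ht : t ∈ Ioc (0 : ℝ) 1) :
    rt α t ^ (-α + ω) = t ^ (ω / α - 1) := by
  have := P.h0
  rw [rt_rpow ht]; congr 1; field_simp; ring

/-- A modulus of exponent 2ω in x leaves the singularity r^{-α+ω}, still integrable in time. It is
the only spatial regularity of Φ that the proof needs. -/
lemma abs_F_sub_le {t : ℝ} (ht : t ∈ Ioc (0 : ℝ) 1) (x x' y : Rn d) :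
    |F α n t x y - F α n t x' y| ≤ 2 * (L * C * jumpMajC d α ω) * ‖x - x'‖ ^ (2 * ω) *
      (rt α t ^ (-α + ω) * (profile (α - 4 * ω) (rt α t) (x - y) +
        profile (α - 4 * ω) (rt α t) (x' - y))) := by
  have r0 := rt_pos α ht
  have r1 := rt_le_one P.h0 ht
  have hJ := jumpMajC_nonneg d α ω
  have hL := P.hL
  have hC := P.hC
  have hω := P.hω0
  set r := rt α t with hr
  set γ := α - 4 * ω with hγ
  set J := jumpMajC d α ω with hJdef
  have hp := profile_nonneg (γ := γ) r0 (x - y)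
  have hp' := profile_nonneg (γ := γ) r0 (x' - y)
  have hp2 := profile_nonneg (γ := α) r0 (x' - y)
  rcases le_or_gt ‖x - x'‖ r with hx | hx
  · set a := x - x' with ha
    have hxa : x - y = x' - y + a := by rw [ha]; abel
    have i1 := (P.reg t ht y).integrable_dlt P.hd P.h0 P.h2 r0 r1
      (P.measurable_n_sub x y) (P.holder x y) (x - y)
    have i2 := (P.reg t ht y).integrable_dlt P.hd P.h0 P.h2 r0 r1
      (P.measurable_n_sub x' y) (P.holder x' y) (x' - y)
    have hs := P.reg_shift t ht y a hx
    have i3 := hs.integrable_dlt P.hd P.h0 P.h2 r0 r1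
      (P.measurable_n_sub x y) (P.holder x y) (x' - y)
    have i4 := (P.reg t ht y).integrable_dlt P.hd P.h0 P.h2 r0 r1
      (P.measurable_n_sub x x') (P.holder x x') (x' - y)
    have b3 := hs.abs_integral_dlt_le P.hd P.h0 P.h2 P.hω0 P.hω1' r0 r1 (P.holder x y) (x' - y)
    have b4 := (P.reg t ht y).abs_integral_dlt_le P.hd P.h0 P.h2 P.hω0 P.hω1' r0 r1
      (P.holder x x') (x' - y)
    have hg := (P.reg t ht y).diff
    have edlt : ∀ h, dlt α (fun z => pk α (n y) t (z + a) - pk α (n y) t z) (x' - y) h =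
        dlt α (pk α (n y) t) (x - y) h - dlt α (pk α (n y) t) (x' - y) h := by
      intro h
      have ef : fderiv ℝ (fun z => pk α (n y) t (z + a) - pk α (n y) t z) (x' - y) =
          fderiv ℝ (pk α (n y) t) (x - y) - fderiv ℝ (pk α (n y) t) (x' - y) := by
        have d1 : Differentiable ℝ fun z => pk α (n y) t (z + a) :=
          hg.comp (differentiable_id.add_const a)
        rw [fderiv_fun_sub (d1 _) (hg _), fderiv_comp_add_right, hxa]
      simp only [dlt, ef, hxa, sub_apply]
      rw [show x' - y + h + a = x' - y + a + h by abel]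
      ring
    -- For |x−x'| ≤ r the difference splits into a displaced density with the coefficient difference
    -- at x, and the density at x' with the coefficient n(x,·) − n(x',·). The first is of size |a|/r
    -- ≤ (|a|/r)^{2ω} and keeps the gain r^{4ω}; the second is of size |a|^{4ω} ≤ |a|^{2ω} r^{2ω}.
    have key : F α n t x y - F α n t x' y =
        (∫ h, dlt α (fun z => pk α (n y) t (z + a) - pk α (n y) t z) (x' - y) h *
          levyK α (fun h => n x h - n y h) h) +
        ∫ h, dlt α (pk α (n y) t) (x' - y) h * levyK α (fun h => n x h - n x' h) h := by
      rw [P.F_eq ht, P.F_eq ht, ← integral_sub i1 i2, ← integral_add i3 i4]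
      congr 1; ext h
      rw [edlt, ← levyK_sub, ← levyK_sub, ← levyK_sub]; ring
    have hq : (‖a‖ / r) ≤ ‖a‖ ^ (2 * ω) * r ^ (-(2 * ω)) := by
      have h1 : ‖a‖ / r ≤ (‖a‖ / r) ^ (2 * ω) := by
        conv_lhs => rw [← Real.rpow_one (‖a‖ / r)]
        rcases eq_or_lt_of_le (norm_nonneg a) with hz | hz
        · rw [← hz, zero_div, Real.rpow_one]
          exact Real.rpow_nonneg le_rfl _
        · exact Real.rpow_le_rpow_of_exponent_ge (by positivity) ((div_le_one r0).2 hx)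
            (by linarith [P.hω1])
      refine h1.trans_eq ?_
      rw [Real.div_rpow (norm_nonneg a) r0.le, Real.rpow_neg r0.le]; rfl
    have hq2 : ‖a‖ ^ (4 * ω) ≤ ‖a‖ ^ (2 * ω) * r ^ (2 * ω) := by
      rw [show 4 * ω = 2 * ω + 2 * ω by ring, Real.rpow_add' (norm_nonneg a) (by linarith)]
      gcongr
    have hq3 : ‖x - y‖ ^ (4 * ω) * profile α r (x' - y) ≤ r ^ (4 * ω) * profile γ r (x' - y) := by
      rw [hγ, ← profile_mul_norm_rpow_le r0 (x' - y), mul_comm]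
      have := profile_nonneg (γ := α) r0 (x' - y)
      gcongr
      rw [hxa]
      linarith [norm_add_le (x' - y) a]
    have hq4 : profile α r (x' - y) ≤ profile γ r (x' - y) :=
      profile_anti r0 (by linarith) _
    have e1 : r ^ (-α + ω) = r ^ (-(2 * ω)) * r ^ (-(α + ω)) * r ^ (4 * ω) := by
      rw [← Real.rpow_add r0, ← Real.rpow_add r0]; congr 1; ring
    have e2 : r ^ (-α + ω) = r ^ (2 * ω) * r ^ (-(α + ω)) := by
      rw [← Real.rpow_add r0]; congr 1; ring
    have B3 : L * ‖x - y‖ ^ (4 * ω) * (C * (‖a‖ / r)) *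
        (J * r ^ (-(α + ω)) * profile α r (x' - y)) ≤
        L * C * J * ‖a‖ ^ (2 * ω) * (r ^ (-α + ω) * profile γ r (x' - y)) := by
      calc _ = L * C * J * (‖a‖ / r) * r ^ (-(α + ω)) *
            (‖x - y‖ ^ (4 * ω) * profile α r (x' - y)) := by ring
        _ ≤ L * C * J * (‖a‖ ^ (2 * ω) * r ^ (-(2 * ω))) * r ^ (-(α + ω)) *
            (r ^ (4 * ω) * profile γ r (x' - y)) := by gcongr
        _ = _ := by rw [e1]; ring
    have B4 : L * ‖a‖ ^ (4 * ω) * C * (J * r ^ (-(α + ω)) * profile α r (x' - y)) ≤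
        L * C * J * ‖a‖ ^ (2 * ω) * (r ^ (-α + ω) * profile γ r (x' - y)) := by
      calc _ ≤ L * (‖a‖ ^ (2 * ω) * r ^ (2 * ω)) * C *
            (J * r ^ (-(α + ω)) * profile γ r (x' - y)) := by gcongr
        _ = _ := by rw [e2]; ring
    rw [key]
    refine (abs_add_le _ _).trans ((add_le_add (b3.trans B3) (b4.trans B4)).trans ?_)
    have : 0 ≤ L * C * J * ‖a‖ ^ (2 * ω) * (r ^ (-α + ω) * profile γ r (x - y)) := by positivity
    linarith
  -- For |x−x'| > r the separate bounds of the two values suffice, since r^{2ω} ≤ |x−x'|^{2ω}.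
  · have hq : r ^ (-α + 3 * ω) ≤ ‖x - x'‖ ^ (2 * ω) * r ^ (-α + ω) := by
      rw [show -α + 3 * ω = 2 * ω + (-α + ω) by ring, Real.rpow_add r0]
      gcongr
    have B : ∀ z : Rn d, 0 ≤ profile γ r z → L * C * J * (r ^ (-α + 3 * ω) * profile γ r z) ≤
        L * C * J * ‖x - x'‖ ^ (2 * ω) * (r ^ (-α + ω) * profile γ r z) := by
      intro z hz
      calc _ ≤ L * C * J * (‖x - x'‖ ^ (2 * ω) * r ^ (-α + ω) * profile γ r z) := by gcongr
        _ = _ := by ring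
    refine (abs_sub _ _).trans ((add_le_add ((P.abs_F_le ht x y).trans (B _ hp))
      ((P.abs_F_le ht x' y).trans (B _ hp'))).trans ?_)
    have : 0 ≤ L * C * J * ‖x - x'‖ ^ (2 * ω) * (r ^ (-α + ω) * (profile γ r (x - y) +
      profile γ r (x' - y))) := by positivity
    linarith

end Param

end

/-! ### Beta integrals, space-time convolutions and the series Φ -/

section

open Filter Topology

attribute [local irreducible] profile

/-- The weight `(t - s)^(a-1) s^(b-1)`. -/
def betaW (a b t s : ℝ) : ℝ := (t - s) ^ (a - 1) * s ^ (b - 1)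

/-- The real beta integral. -/
def betaI (a b : ℝ) : ℝ := ∫ s in Ioo (0 : ℝ) 1, betaW a b 1 s

lemma betaW_nonneg {a b t s : ℝ} (hs : s ∈ Ioo 0 t) : 0 ≤ betaW a b t s := by
  have h1 : 0 ≤ t - s := by linarith [hs.2]
  have h2 : 0 ≤ s := hs.1.le
  unfold betaW; positivity

lemma measurable_betaW (a b t : ℝ) : Measurable (betaW a b t) := by
  unfold betaW; fun_prop

lemma intervalIntegrable_betaW_one {a b : ℝ} (ha : 0 < a) (hb : 0 < b) :
    IntervalIntegrable (betaW a b 1) volume 0 1 := by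
  have h1 := (Complex.betaIntegral_convergent (u := b) (v := a) (by simpa) (by simpa)).norm
  rw [intervalIntegrable_iff_integrableOn_Ioo_of_le zero_le_one] at h1 ⊢
  refine h1.congr_fun (fun s hs => ?_) measurableSet_Ioo
  have e1 : ((s : ℂ) ^ ((b : ℂ) - 1)) = ((s ^ (b - 1) : ℝ) : ℂ) := by
    rw [Complex.ofReal_cpow hs.1.le]; push_cast; rfl
  have e2 : ((1 - (s : ℂ)) ^ ((a : ℂ) - 1)) = (((1 - s) ^ (a - 1) : ℝ) : ℂ) := by
    rw [Complex.ofReal_cpow (by linarith [hs.2])]; push_cast; rfl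
  simp only [e1, e2]
  rw [← Complex.ofReal_mul, Complex.norm_real, mul_comm, Real.norm_of_nonneg]
  · rfl
  · exact betaW_nonneg hs

lemma betaW_div {a b t s : ℝ} (hs : s ∈ Ioo 0 t) :
    betaW a b t s = t ^ (a + b - 2) * betaW a b 1 (s / t) := by
  have ht : 0 < t := hs.1.trans hs.2
  have h1 : 0 ≤ t - s := by linarith [hs.2]
  rw [betaW, betaW, show 1 - s / t = (t - s) / t by field_simp, Real.div_rpow h1 ht.le,
    Real.div_rpow hs.1.le ht.le, show a + b - 2 = (a - 1) + (b - 1) by ring, Real.rpow_add ht]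
  have := Real.rpow_pos_of_pos ht (a - 1)
  have := Real.rpow_pos_of_pos ht (b - 1)
  field_simp

lemma integrableOn_betaW {a b t : ℝ} (ha : 0 < a) (hb : 0 < b) (ht : 0 < t) :
    IntegrableOn (betaW a b t) (Ioo 0 t) := by
  have h1 := ((intervalIntegrable_betaW_one ha hb).comp_mul_left (c := t⁻¹)).const_mul
    (t ^ (a + b - 2))
  simp only [zero_mul, div_inv_eq_mul, one_mul] at h1
  rw [intervalIntegrable_iff_integrableOn_Ioo_of_le ht.le] at h1
  refine h1.congr_fun (fun s hs => ?_) measurableSet_Ioo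
  simp only [betaW_div hs]
  rw [div_eq_inv_mul]

lemma integral_betaW {a b t : ℝ} (ht : 0 < t) :
    ∫ s in Ioo 0 t, betaW a b t s = t ^ (a + b - 1) * betaI a b := by
  rw [setIntegral_congr_fun measurableSet_Ioo fun s hs => betaW_div (a := a) (b := b) hs,
    integral_const_mul, ← integral_Ioc_eq_integral_Ioo,
    ← intervalIntegral.integral_of_le ht.le,
    intervalIntegral.integral_comp_div (fun s => betaW a b 1 s) ht.ne', zero_div, div_self ht.ne',
    intervalIntegral.integral_of_le zero_le_one, integral_Ioc_eq_integral_Ioo, betaI, smul_eq_mul,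
    ← mul_assoc, show a + b - 1 = (a + b - 2) + 1 by ring, Real.rpow_add ht, Real.rpow_one]

lemma betaI_nonneg (a b : ℝ) : 0 ≤ betaI a b :=
  setIntegral_nonneg measurableSet_Ioo fun _ hs => betaW_nonneg hs

/-- On (0,1) the factor s^{b-1} tends to zero and is at most one for b ≥ 1, so dominated convergence
applies. This replaces the Gamma-function asymptotics in the usual summation of the parametrix
series. -/
lemma tendsto_betaI {a : ℝ} (ha : 0 < a) : Tendsto (fun b => betaI a b) atTop (𝓝 0) := by
  have h0 : (0 : ℝ) = ∫ s in Ioo (0 : ℝ) 1, (0 : ℝ) := by simp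
  rw [h0]
  refine tendsto_integral_filter_of_dominated_convergence (betaW a 1 1)
    (Eventually.of_forall fun b => (measurable_betaW a b 1).aestronglyMeasurable) ?_
    (integrableOn_betaW ha one_pos one_pos) ?_
  · filter_upwards [eventually_ge_atTop (1 : ℝ)] with b hb
    rw [ae_restrict_iff' measurableSet_Ioo]
    refine Eventually.of_forall fun s hs => ?_
    rw [Real.norm_of_nonneg (betaW_nonneg hs), betaW, betaW]
    have h1 : 0 ≤ 1 - s := by linarith [hs.2]
    have h2 := Real.rpow_le_rpow_of_exponent_ge hs.1 hs.2.le (show (1 : ℝ) - 1 ≤ b - 1 by linarith)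
    gcongr
  · rw [ae_restrict_iff' measurableSet_Ioo]
    refine Eventually.of_forall fun s hs => ?_
    have h1 : Tendsto (fun b : ℝ => s ^ (b - 1)) atTop (𝓝 0) :=
      (tendsto_rpow_atTop_of_base_lt_one s (by linarith [hs.1]) hs.2).comp
        (tendsto_atTop_add_const_right _ _ tendsto_id)
    simpa [betaW] using h1.const_mul ((1 - s) ^ (a - 1))

lemma integrable_prod_of_bound {X Y : Type*} [MeasurableSpace X] [MeasurableSpace Y]
    {μ : Measure X} {ν : Measure Y} [SFinite μ] [SFinite ν] {f : X × Y → ℝ}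
    (hm : AEStronglyMeasurable f (μ.prod ν)) {g : X → ℝ} (hg : Integrable g μ)
    (h : ∀ᵐ x ∂μ, Integrable (fun y => f (x, y)) ν ∧ ∫ y, |f (x, y)| ∂ν ≤ g x) :
    Integrable f (μ.prod ν) ∧ ∫ w, |f w| ∂(μ.prod ν) ≤ ∫ x, g x ∂μ := by
  have hi : Integrable f (μ.prod ν) := by
    rw [integrable_prod_iff hm]
    refine ⟨h.mono fun x hx => hx.1, hg.mono' hm.norm.integral_prod_right' (h.mono fun x hx => ?_)⟩
    rw [Real.norm_of_nonneg (integral_nonneg fun y => norm_nonneg _)]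
    exact hx.2
  refine ⟨hi, ?_⟩
  have hi' : Integrable (fun w => |f w|) (μ.prod ν) := hi.abs
  rw [integral_prod _ hi']
  exact integral_mono_ae hi'.integral_prod_left hg (h.mono fun x hx => hx.2)

/-- The constant in the convolution estimate for the profiles. -/
def convC (d : ℕ) (α γ : ℝ) : ℝ := (2 * 2 ^ (1 / α)) ^ ((d : ℝ) + γ) * (2 * mass d γ)

lemma convC_nonneg (d : ℕ) (α γ : ℝ) : 0 ≤ convC d α γ := by
  have := mass_nonneg (d := d) γ
  unfold convC; positivity

lemma sub_mem_Ioc {t s : ℝ} (ht : t ∈ Ioc (0 : ℝ) 1) (hs : s ∈ Ioo 0 t) : t - s ∈ Ioc (0 : ℝ) 1 :=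
  ⟨by linarith [hs.2], by linarith [hs.1, ht.2]⟩

lemma mem_Ioc_of_Ioo {t s : ℝ} (ht : t ∈ Ioc (0 : ℝ) 1) (hs : s ∈ Ioo 0 t) : s ∈ Ioc (0 : ℝ) 1 :=
  ⟨hs.1, hs.2.le.trans ht.2⟩

lemma rt_mono {α s t : ℝ} (h0 : 0 < α) (hs : 0 ≤ s) (h : s ≤ t) : rt α s ≤ rt α t :=
  Real.rpow_le_rpow hs h (by positivity)

lemma integrable_conv_profile {α γ : ℝ} (h0 : 0 < α) (hγ : 0 < γ) {t s : ℝ}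
    (ht : t ∈ Ioc (0 : ℝ) 1) (hs : s ∈ Ioo 0 t) (x y : Rn d) :
    Integrable (fun z => profile γ (rt α (t - s)) (x - z) * profile γ (rt α s) (z - y)) ∧
    ∫ z, profile γ (rt α (t - s)) (x - z) * profile γ (rt α s) (z - y) ≤
      convC d α γ * profile γ (rt α t) (x - y) := by
  have r1 := rt_pos α (sub_mem_Ioc ht hs)
  have r2 := rt_pos α (mem_Ioc_of_Ioo ht hs)
  have hs0 := hs.1
  have hs1 := hs.2
  have hL : (1 : ℝ) ≤ 2 ^ (1 / α) := Real.one_le_rpow (by norm_num) (by positivity)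
  -- The larger of t − s and s is at least t/2, whence the constant 2^{1/α} when the scales are
  -- compared.
  have hR : rt α t ≤ 2 ^ (1 / α) * (rt α (t - s) + rt α s) := by
    have hmax : rt α t ≤ 2 ^ (1 / α) * rt α (max (t - s) s) := by
      rw [rt, rt, ← Real.mul_rpow (by norm_num) (le_max_of_le_right hs0.le)]
      refine Real.rpow_le_rpow ht.1.le ?_ (by positivity)
      rcases le_total (t - s) s with h | h
      · rw [max_eq_right h]; linarith
      · rw [max_eq_left h]; linarith
    refine hmax.trans ?_
    gcongr
    rcases le_total (t - s) s with h | h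
    · rw [max_eq_right h]; linarith
    · rw [max_eq_left h]; linarith
  have i1 : Integrable fun z : Rn d => profile γ (rt α (t - s)) (x - z) :=
    integrable_profile_sub hγ r1 x
  have i2 : Integrable fun z : Rn d => profile γ (rt α s) (z - y) :=
    (integrable_profile hγ r2).comp_sub_right y
  have i3 : Integrable fun z : Rn d => (2 * 2 ^ (1 / α)) ^ ((d : ℝ) + γ) *
      profile γ (rt α t) (x - y) * (profile γ (rt α (t - s)) (x - z) + profile γ (rt α s) (z - y)) :=
    (i1.add i2).const_mul _
  have hb : ∀ z, profile γ (rt α (t - s)) (x - z) * profile γ (rt α s) (z - y) ≤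
      (2 * 2 ^ (1 / α)) ^ ((d : ℝ) + γ) * profile γ (rt α t) (x - y) *
        (profile γ (rt α (t - s)) (x - z) + profile γ (rt α s) (z - y)) := fun z =>
    profile_mul_le hγ r1 r2 (rt_mono h0 (by linarith) (by linarith))
      (rt_mono h0 hs0.le hs1.le) hL hR (by
        have := norm_add_le (x - z) (z - y)
        simpa using this)
  have c1 := continuous_profile (d := d) (γ := γ) r1
  have c2 := continuous_profile (d := d) (γ := γ) r2
  have c3 : Continuous fun z : Rn d => profile γ (rt α (t - s)) (x - z) * profile γ (rt α s) (z - y) := by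
    fun_prop
  have i4 : Integrable fun z => profile γ (rt α (t - s)) (x - z) * profile γ (rt α s) (z - y) :=
    i3.mono' c3.aestronglyMeasurable (Eventually.of_forall fun z => by
      have e := Real.norm_of_nonneg
        (mul_nonneg (profile_nonneg (γ := γ) r1 (x - z)) (profile_nonneg (γ := γ) r2 (z - y)))
      exact e.trans_le (hb z))
  refine ⟨i4, (integral_mono i4 i3 hb).trans_eq ?_⟩
  rw [integral_const_mul, integral_add i1 i2, integral_profile_sub γ r1,
    integral_sub_right_eq_self (fun z => profile γ (rt α s) z), integral_profile γ r2, convC]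
  ring

/-- Kernels with a time singularity of order `b - 1` and spatial decay given by `profile`. -/
structure Ker (α γ b A : ℝ) (K : ℝ → Rn d → Rn d → ℝ) : Prop where
  meas : MeasKer K
  nonneg : 0 ≤ A
  bound : ∀ t ∈ Ioc (0 : ℝ) 1, ∀ x y,
    |K t x y| ≤ A * (t ^ (b - 1) * profile γ (rt α t) (x - y))

lemma MeasKer.measurable_tensor {K₁ K₂ : ℝ → Rn d → Rn d → ℝ} (h₁ : MeasKer K₁) (h₂ : MeasKer K₂) :
    ∃ G : (ℝ × Rn d × Rn d) × ℝ × Rn d → ℝ, Measurable G ∧ ∀ t ∈ Ioc (0 : ℝ) 1, ∀ s ∈ Ioo 0 t,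
      ∀ x y z, K₁ (t - s) x z * K₂ s z y = G ((t, x, y), s, z) := by
  obtain ⟨G₁, m₁, e₁⟩ := h₁
  obtain ⟨G₂, m₂, e₂⟩ := h₂
  refine ⟨fun w => G₁ (w.1.1 - w.2.1, w.1.2.1, w.2.2) * G₂ (w.2.1, w.2.2, w.1.2.2), by fun_prop,
    fun t ht s hs x y z => ?_⟩
  rw [e₁ _ (sub_mem_Ioc ht hs), e₂ _ (mem_Ioc_of_Ioo ht hs)]

lemma tensor_eq_Ioo (K₁ K₂ : ℝ → Rn d → Rn d → ℝ) {t : ℝ} (ht : 0 ≤ t) (x y : Rn d) :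
    tensor K₁ K₂ t x y = ∫ s in Ioo 0 t, ∫ z, K₁ (t - s) x z * K₂ s z y := by
  rw [tensor, intervalIntegral.integral_of_le ht, integral_Ioc_eq_integral_Ioo]

lemma MeasKer.tensor {K₁ K₂ : ℝ → Rn d → Rn d → ℝ} (h₁ : MeasKer K₁) (h₂ : MeasKer K₂) :
    MeasKer (tensor K₁ K₂) := by
  obtain ⟨G, hG, e⟩ := h₁.measurable_tensor h₂
  have hs : MeasurableSet {w : ((ℝ × Rn d × Rn d) × ℝ) × Rn d | w.1.2 ∈ Ioo 0 w.1.1.1} := by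
    have a1 : Measurable fun w : ((ℝ × Rn d × Rn d) × ℝ) × Rn d => w.1.2 := by fun_prop
    have a2 : Measurable fun w : ((ℝ × Rn d × Rn d) × ℝ) × Rn d => w.1.1.1 := by fun_prop
    exact (measurableSet_lt measurable_const a1).inter (measurableSet_lt a1 a2)
  have hG1 : Measurable fun w : ((ℝ × Rn d × Rn d) × ℝ) × Rn d => G (w.1.1, w.1.2, w.2) := by
    fun_prop
  have hG2 := ((hG1.indicator hs).stronglyMeasurable.integral_prod_right' (ν := volume)
    ).integral_prod_right' (ν := volume)
  refine ⟨_, hG2.measurable, fun t ht x y => ?_⟩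
  rw [tensor_eq_Ioo _ _ ht.1.le, ← integral_indicator measurableSet_Ioo]
  congr 1; ext s
  by_cases h : s ∈ Ioo 0 t
  · rw [indicator_of_mem h]
    congr 1; ext z
    rw [indicator_of_mem (show ((((t, x, y), s), z) : ((ℝ × Rn d × Rn d) × ℝ) × Rn d) ∈
      {w : ((ℝ × Rn d × Rn d) × ℝ) × Rn d | w.1.2 ∈ Ioo 0 w.1.1.1} from h), e t ht s h]
  · rw [indicator_of_notMem h]
    have : ∀ z, (((t, x, y), s), z) ∉
      {w : ((ℝ × Rn d × Rn d) × ℝ) × Rn d | w.1.2 ∈ Ioo 0 w.1.1.1} := fun z => h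
    simp only [indicator_of_notMem (this _), integral_zero]

section Tensor

variable {α γ a b A B : ℝ} {K₁ K₂ : ℝ → Rn d → Rn d → ℝ}

lemma Ker.slice (h₁ : Ker α γ a A K₁) (h₂ : Ker α γ b B K₂) (h0 : 0 < α) (hγ : 0 < γ)
    {t s : ℝ} (ht : t ∈ Ioc (0 : ℝ) 1) (hs : s ∈ Ioo 0 t) (x y : Rn d) :
    Integrable (fun z => K₁ (t - s) x z * K₂ s z y) ∧
    ∫ z, |K₁ (t - s) x z * K₂ s z y| ≤
      A * B * convC d α γ * profile γ (rt α t) (x - y) * betaW a b t s := by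
  have hA := h₁.nonneg
  have hB := h₂.nonneg
  have s1 := sub_mem_Ioc ht hs
  have s2 := mem_Ioc_of_Ioo ht hs
  obtain ⟨i, hi⟩ := integrable_conv_profile (d := d) h0 hγ ht hs x y
  have hw := betaW_nonneg (a := a) (b := b) hs
  have hb : ∀ z, |K₁ (t - s) x z * K₂ s z y| ≤ A * B * betaW a b t s *
      (profile γ (rt α (t - s)) (x - z) * profile γ (rt α s) (z - y)) := by
    intro z
    rw [abs_mul]
    have p1 := profile_nonneg (γ := γ) (rt_pos α s1) (x - z)
    have q1 : 0 ≤ (t - s) ^ (a - 1) := Real.rpow_nonneg s1.1.le _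
    calc _ ≤ (A * ((t - s) ^ (a - 1) * profile γ (rt α (t - s)) (x - z))) *
          (B * (s ^ (b - 1) * profile γ (rt α s) (z - y))) := by
          gcongr
          exacts [h₁.bound _ s1 x z, h₂.bound _ s2 z y]
      _ = _ := by rw [betaW]; ring
  have hm := (h₁.meas.measurable_right s1 x).mul (h₂.meas.measurable_left s2 y)
  have hi1 : Integrable (fun z => K₁ (t - s) x z * K₂ s z y) :=
    (i.const_mul _).mono' hm.aestronglyMeasurable (Eventually.of_forall hb)
  refine ⟨hi1, (integral_mono hi1.abs (i.const_mul _) hb).trans ?_⟩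
  rw [integral_const_mul]
  calc _ ≤ A * B * betaW a b t s * (convC d α γ * profile γ (rt α t) (x - y)) := by gcongr
    _ = _ := by ring

lemma restrict_prod_univ (t : ℝ) :
    (volume : Measure (ℝ × Rn d)).restrict (Ioo (0 : ℝ) t ×ˢ (univ : Set (Rn d))) =
      (volume.restrict (Ioo 0 t)).prod volume := by
  rw [Measure.volume_eq_prod, ← Measure.prod_restrict, Measure.restrict_univ]

lemma Ker.integrable_tensor (h₁ : Ker α γ a A K₁) (h₂ : Ker α γ b B K₂) (h0 : 0 < α) (hγ : 0 < γ)
    (ha : 0 < a) (hb : 0 < b) {t : ℝ} (ht : t ∈ Ioc (0 : ℝ) 1) (x y : Rn d) :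
    Integrable (fun w : ℝ × Rn d => K₁ (t - w.1) x w.2 * K₂ w.1 w.2 y)
      ((volume.restrict (Ioo 0 t)).prod volume) ∧
    ∫ w, |K₁ (t - w.1) x w.2 * K₂ w.1 w.2 y| ∂((volume.restrict (Ioo 0 t)).prod volume) ≤
      A * B * convC d α γ * betaI a b * (t ^ (a + b - 1) * profile γ (rt α t) (x - y)) := by
  obtain ⟨G, hG, e⟩ := h₁.meas.measurable_tensor h₂.meas
  have hm : AEStronglyMeasurable (fun w : ℝ × Rn d => K₁ (t - w.1) x w.2 * K₂ w.1 w.2 y)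
      ((volume.restrict (Ioo 0 t)).prod volume) := by
    have m1 : Measurable fun w : ℝ × Rn d => G ((t, x, y), w.1, w.2) := by fun_prop
    refine m1.aestronglyMeasurable.congr ?_
    rw [← restrict_prod_univ, EventuallyEq,
      ae_restrict_iff' (measurableSet_Ioo.prod MeasurableSet.univ)]
    exact Eventually.of_forall fun w hw => (e t ht w.1 hw.1 x y w.2).symm
  have key := integrable_prod_of_bound hm
    ((integrableOn_betaW ha hb ht.1).const_mul (A * B * convC d α γ * profile γ (rt α t) (x - y)))
    (by
      rw [ae_restrict_iff' measurableSet_Ioo]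
      exact Eventually.of_forall fun s hs => h₁.slice h₂ h0 hγ ht hs x y)
  refine ⟨key.1, key.2.trans_eq ?_⟩
  rw [integral_const_mul, integral_betaW ht.1]
  ring

lemma Ker.tensorDefinedAt (h₁ : Ker α γ a A K₁) (h₂ : Ker α γ b B K₂) (h0 : 0 < α) (hγ : 0 < γ)
    (ha : 0 < a) (hb : 0 < b) {t : ℝ} (ht : t ∈ Ioc (0 : ℝ) 1) (x y : Rn d) :
    TensorDefinedAt K₁ K₂ t x y := by
  rw [TensorDefinedAt, IntegrableOn, restrict_prod_univ]
  exact (h₁.integrable_tensor h₂ h0 hγ ha hb ht x y).1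

lemma Ker.tensor_eq (h₁ : Ker α γ a A K₁) (h₂ : Ker α γ b B K₂) (h0 : 0 < α) (hγ : 0 < γ)
    (ha : 0 < a) (hb : 0 < b) {t : ℝ} (ht : t ∈ Ioc (0 : ℝ) 1) (x y : Rn d) :
    StableLike.tensor K₁ K₂ t x y = ∫ w, K₁ (t - w.1) x w.2 * K₂ w.1 w.2 y
      ∂((volume.restrict (Ioo 0 t)).prod (volume : Measure (Rn d))) := by
  rw [integral_prod _ (h₁.integrable_tensor h₂ h0 hγ ha hb ht x y).1, tensor_eq_Ioo _ _ ht.1.le]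

/-- Spatial profiles reproduce under convolution, while the time factors combine into a Beta
integral. The orders a and b add, so each convolution is less singular than its factors. -/
lemma Ker.tensor (h₁ : Ker α γ a A K₁) (h₂ : Ker α γ b B K₂) (h0 : 0 < α) (hγ : 0 < γ)
    (ha : 0 < a) (hb : 0 < b) :
    Ker α γ (a + b) (A * B * convC d α γ * betaI a b) (StableLike.tensor K₁ K₂) where
  meas := h₁.meas.tensor h₂.meas
  nonneg := by
    have := h₁.nonneg; have := h₂.nonneg; have := convC_nonneg d α γ; have := betaI_nonneg a b
    positivity
  bound t ht x y := by
    rw [h₁.tensor_eq h₂ h0 hγ ha hb ht]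
    exact (abs_integral_le_integral_abs).trans (h₁.integrable_tensor h₂ h0 hγ ha hb ht x y).2

end Tensor

/-- The constants in the bounds of the convolution powers. -/
def powC (d : ℕ) (α γ β A : ℝ) : ℕ → ℝ
  | 0 => A
  | m + 1 => A * powC d α γ β A m * convC d α γ * betaI β ((m + 1) * β)

lemma powC_nonneg {α γ β A : ℝ} (hA : 0 ≤ A) (m : ℕ) : 0 ≤ powC d α γ β A m := by
  induction m with
  | zero => exact hA
  | succ m ih =>
    have := convC_nonneg d α γ
    have := betaI_nonneg β ((m + 1) * β)
    rw [powC]; positivity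

/-- Ratio test: consecutive constants have ratio A · `convC` · B(β, (m+1)β), and the Beta factor
tends to zero. -/
lemma summable_powC {α γ β A : ℝ} (hβ : 0 < β) (hA : 0 ≤ A) : Summable (powC d α γ β A) := by
  refine summable_of_ratio_norm_eventually_le (r := 1 / 2) (by norm_num) ?_
  have h1 : Tendsto (fun m : ℕ => ((m : ℝ) + 1) * β) atTop atTop :=
    (tendsto_atTop_add_const_right _ _ tendsto_natCast_atTop_atTop).atTop_mul_const hβ
  have h2 := ((tendsto_betaI hβ).comp h1).const_mul (A * convC d α γ)
  rw [mul_zero] at h2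
  filter_upwards [h2.eventually (gt_mem_nhds (show (0 : ℝ) < 1 / 2 by norm_num))] with m hm
  rw [Real.norm_of_nonneg (powC_nonneg hA _), Real.norm_of_nonneg (powC_nonneg hA _), powC]
  have := powC_nonneg (d := d) (α := α) (γ := γ) (β := β) hA m
  simp only [Function.comp_apply] at hm
  calc _ = A * convC d α γ * betaI β ((m + 1) * β) * powC d α γ β A m := by ring
    _ ≤ _ := by gcongr

section Phi

variable {α γ β A : ℝ} {n : Rn d → Rn d → ℝ}

lemma ker_Fpow (hF : Ker α γ β A (F α n)) (h0 : 0 < α) (hγ : 0 < γ) (hβ : 0 < β) (m : ℕ) :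
    Ker α γ ((m + 1) * β) (powC d α γ β A m) (Fpow α n m) := by
  induction m with
  | zero => simpa [powC, Fpow] using hF
  | succ m ih =>
    have := hF.tensor ih h0 hγ hβ (by positivity)
    rw [Fpow, powC]
    convert this using 1
    push_cast; ring

lemma abs_Fpow_le (hF : Ker α γ β A (F α n)) (h0 : 0 < α) (hγ : 0 < γ) (hβ : 0 < β) (m : ℕ)
    {t : ℝ} (ht : t ∈ Ioc (0 : ℝ) 1) (x y : Rn d) :
    |Fpow α n m t x y| ≤ powC d α γ β A m * (t ^ (β - 1) * profile γ (rt α t) (x - y)) := by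
  refine ((ker_Fpow hF h0 hγ hβ m).bound t ht x y).trans ?_
  have := powC_nonneg (d := d) (α := α) (γ := γ) (β := β) hF.nonneg m
  have := profile_nonneg (γ := γ) (rt_pos α ht) (x - y)
  have h2 := Real.rpow_le_rpow_of_exponent_ge ht.1 ht.2 (show β - 1 ≤ (m + 1) * β - 1 by
    have : (0 : ℝ) ≤ m * β := by positivity
    linarith)
  gcongr

lemma summable_Fpow (hF : Ker α γ β A (F α n)) (h0 : 0 < α) (hγ : 0 < γ) (hβ : 0 < β)
    {t : ℝ} (ht : t ∈ Ioc (0 : ℝ) 1) (x y : Rn d) : Summable fun m => Fpow α n m t x y :=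
  Summable.of_norm_bounded
    (g := fun m => powC d α γ β A m * (t ^ (β - 1) * profile γ (rt α t) (x - y)))
    ((summable_powC hβ hF.nonneg).mul_right _) fun m => abs_Fpow_le hF h0 hγ hβ m ht x y

lemma ker_Phi (hF : Ker α γ β A (F α n)) (h0 : 0 < α) (hγ : 0 < γ) (hβ : 0 < β) :
    Ker α γ β (∑' m, powC d α γ β A m) (Phi α n) where
  meas := by
    choose G hG e using fun m => (ker_Fpow hF h0 hγ hβ m).meas
    have hS : MeasurableSet {w : ℝ × Rn d × Rn d | w.1 ∈ Ioc (0 : ℝ) 1} :=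
      measurable_fst measurableSet_Ioc
    -- Outside (0,1] the partial sums need not converge. The cut-off makes them converge everywhere,
    -- so that their limit is measurable.
    refine ⟨{w : ℝ × Rn d × Rn d | w.1 ∈ Ioc (0 : ℝ) 1}.indicator
      (fun w => Phi α n w.1 w.2.1 w.2.2), ?_, fun t ht x y => ?_⟩
    · refine measurable_of_tendsto_metrizable (f := fun N : ℕ =>
        {w : ℝ × Rn d × Rn d | w.1 ∈ Ioc (0 : ℝ) 1}.indicator
          (fun w => ∑ m ∈ Finset.range N, G m w))
        (fun N => (Finset.measurable_sum _ fun m _ => hG m).indicator hS) ?_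
      rw [tendsto_pi_nhds]
      rintro ⟨t, x, y⟩
      by_cases ht : t ∈ Ioc (0 : ℝ) 1
      · have hmem : ((t, x, y) : ℝ × Rn d × Rn d) ∈
          {w : ℝ × Rn d × Rn d | w.1 ∈ Ioc (0 : ℝ) 1} := ht
        simp only [indicator_of_mem hmem, ← e _ t ht]
        exact (summable_Fpow hF h0 hγ hβ ht x y).hasSum.tendsto_sum_nat
      · have hmem : ((t, x, y) : ℝ × Rn d × Rn d) ∉
          {w : ℝ × Rn d × Rn d | w.1 ∈ Ioc (0 : ℝ) 1} := ht
        simp only [indicator_of_notMem hmem]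
        exact tendsto_const_nhds
    · rw [indicator_of_mem (show ((t, x, y) : ℝ × Rn d × Rn d) ∈
          {w : ℝ × Rn d × Rn d | w.1 ∈ Ioc (0 : ℝ) 1} from ht)]
  nonneg := tsum_nonneg fun m => powC_nonneg hF.nonneg m
  bound t ht x y := by
    rw [← tsum_mul_right]
    have hb : ∀ m, ‖Fpow α n m t x y‖ ≤
        powC d α γ β A m * (t ^ (β - 1) * profile γ (rt α t) (x - y)) :=
      fun m => abs_Fpow_le hF h0 hγ hβ m ht x y
    exact tsum_of_norm_bounded ((summable_powC hβ hF.nonneg).mul_right _).hasSum hb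

/-- The series may be convolved term by term because the integrals of absolute values are summable;
shifting the index gives the fixed-point equation. -/
lemma Phi_eq (hF : Ker α γ β A (F α n)) (h0 : 0 < α) (hγ : 0 < γ) (hβ : 0 < β)
    {t : ℝ} (ht : t ∈ Ioc (0 : ℝ) 1) (x y : Rn d) :
    Phi α n t x y = F α n t x y + tensor (F α n) (Phi α n) t x y := by
  have hΦ := ker_Phi hF h0 hγ hβ
  have hpos : ∀ m : ℕ, (0 : ℝ) < (m + 1) * β := fun m => by positivity
  have hs := summable_Fpow hF h0 hγ hβ ht x y
  have h1 := hasSum_integral_of_summable_integral_norm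
    (μ := (volume.restrict (Ioo 0 t)).prod (volume : Measure (Rn d)))
    (F := fun m w => F α n (t - w.1) x w.2 * Fpow α n m w.1 w.2 y)
    (fun m => (hF.integrable_tensor (ker_Fpow hF h0 hγ hβ m) h0 hγ hβ (hpos m) ht x y).1) (by
      refine Summable.of_nonneg_of_le (fun m => integral_nonneg fun _ => norm_nonneg _)
        (fun m => (hF.integrable_tensor (ker_Fpow hF h0 hγ hβ m) h0 hγ hβ (hpos m) ht x y).2)
        (f := fun m : ℕ => A * powC d α γ β A m * convC d α γ * betaI β ((m + 1) * β) *
          (t ^ (β + (m + 1) * β - 1) * profile γ (rt α t) (x - y))) ?_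
      have hsum := ((summable_nat_add_iff 1).2 (summable_powC (d := d) (α := α) (γ := γ) hβ
        hF.nonneg)).mul_right (1 / t * profile γ (rt α t) (x - y))
      have hp := profile_nonneg (γ := γ) (rt_pos α ht) (x - y)
      have hA := hF.nonneg
      have hc := convC_nonneg d α γ
      refine Summable.of_nonneg_of_le (fun m => ?_) (fun m => ?_) hsum
      · have := powC_nonneg (d := d) (α := α) (γ := γ) (β := β) hF.nonneg m
        have := betaI_nonneg β ((m + 1) * β)
        have := Real.rpow_nonneg ht.1.le (β + (m + 1) * β - 1)
        positivity
      · have := powC_nonneg (d := d) (α := α) (γ := γ) (β := β) hF.nonneg (m + 1)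
        -- The constant of the convolution of F with its m-th power is by definition the next
        -- `powC`. The exponent of t is at least −1, which makes the remaining factor independent of
        -- m.
        change powC d α γ β A (m + 1) * _ ≤ _
        gcongr
        have h3 := Real.rpow_le_rpow_of_exponent_ge ht.1 ht.2
          (show -1 ≤ β + (m + 1) * β - 1 by have := hpos m; linarith)
        rw [Real.rpow_neg_one] at h3
        rwa [one_div])
  have h2 : (∑' m, Fpow α n (m + 1) t x y) = tensor (F α n) (Phi α n) t x y := by
    rw [hF.tensor_eq hΦ h0 hγ hβ hβ ht]
    have e1 : ∀ m, Fpow α n (m + 1) t x y = ∫ w, F α n (t - w.1) x w.2 * Fpow α n m w.1 w.2 y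
      ∂((volume.restrict (Ioo 0 t)).prod (volume : Measure (Rn d))) := fun m =>
      hF.tensor_eq (ker_Fpow hF h0 hγ hβ m) h0 hγ hβ (hpos m) ht x y
    simp only [e1, h1.tsum_eq]
    congr 1; ext w
    rw [tsum_mul_left]; rfl
  rw [← h2]
  exact hs.tsum_eq_zero_add

end Phi

end

/-! ### Action on functions and Hölder continuity of Φφ -/

section

open Filter Topology

attribute [local irreducible] profile

/-- The action of a kernel on a function. -/
def act (K : ℝ → Rn d → Rn d → ℝ) (t : ℝ) (g : Rn d → ℝ) (x : Rn d) : ℝ := ∫ y, K t x y * g y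

/-- Measurable time-dependent functions with a time singularity of order `b - 1`. -/
structure Fam (b B : ℝ) (Ψ : ℝ → Rn d → ℝ) : Prop where
  meas : ∃ G : ℝ × Rn d → ℝ, Measurable G ∧ ∀ t ∈ Ioc (0 : ℝ) 1, ∀ x, Ψ t x = G (t, x)
  nonneg : 0 ≤ B
  bound : ∀ t ∈ Ioc (0 : ℝ) 1, ∀ x, |Ψ t x| ≤ B * t ^ (b - 1)

lemma Fam.measurable {b B : ℝ} {Ψ : ℝ → Rn d → ℝ} (h : Fam b B Ψ) {t : ℝ}
    (ht : t ∈ Ioc (0 : ℝ) 1) : Measurable (Ψ t) := by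
  obtain ⟨G, hG, e⟩ := h.meas
  have : Ψ t = fun x => G (t, x) := funext (e t ht)
  rw [this]; fun_prop

lemma Fam.const {B : ℝ} {φ : Rn d → ℝ} (hm : Measurable φ) (hB : 0 ≤ B) (hφ : ∀ x, |φ x| ≤ B) :
    Fam 1 B fun _ => φ :=
  ⟨⟨fun w => φ w.2, by fun_prop, fun _ _ _ => rfl⟩, hB, fun t _ x => by simpa using hφ x⟩

lemma MeasKer.measurable_act {b B : ℝ} {K : ℝ → Rn d → Rn d → ℝ} {Ψ : ℝ → Rn d → ℝ}
    (hK : MeasKer K) (hΨ : Fam b B Ψ) : ∃ G : ℝ × ℝ × Rn d → ℝ, Measurable G ∧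
      ∀ t ∈ Ioc (0 : ℝ) 1, ∀ s ∈ Ioc (0 : ℝ) 1, ∀ x, act K t (Ψ s) x = G (t, s, x) := by
  obtain ⟨G₁, m₁, e₁⟩ := hK
  obtain ⟨G₂, m₂, e₂⟩ := hΨ.meas
  have h : Measurable fun w : (ℝ × ℝ × Rn d) × Rn d =>
      G₁ (w.1.1, w.1.2.2, w.2) * G₂ (w.1.2.1, w.2) := by fun_prop
  refine ⟨_, (h.stronglyMeasurable.integral_prod_right' (ν := volume)).measurable,
    fun t ht s hs x => ?_⟩
  simp only [act, e₁ t ht, e₂ s hs]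

section Act

variable {α γ a A b B M : ℝ} {K K' : ℝ → Rn d → Rn d → ℝ} {g : Rn d → ℝ} {Ψ : ℝ → Rn d → ℝ}

lemma Ker.abs_mul_le (hK : Ker α γ a A K) (hg : ∀ x, |g x| ≤ M) {t : ℝ}
    (ht : t ∈ Ioc (0 : ℝ) 1) (x y : Rn d) :
    |K t x y * g y| ≤ A * t ^ (a - 1) * M * profile γ (rt α t) (x - y) := by
  have hA := hK.nonneg
  have p1 := profile_nonneg (γ := γ) (rt_pos α ht) (x - y)
  have q1 : 0 ≤ t ^ (a - 1) := Real.rpow_nonneg ht.1.le _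
  rw [abs_mul]
  calc _ ≤ (A * (t ^ (a - 1) * profile γ (rt α t) (x - y))) * M := by
        gcongr
        exacts [hK.bound t ht x y, hg y]
    _ = _ := by ring

lemma Ker.integrable_act (hK : Ker α γ a A K) (hγ : 0 < γ) (hgm : Measurable g)
    (hg : ∀ x, |g x| ≤ M) {t : ℝ} (ht : t ∈ Ioc (0 : ℝ) 1) (x : Rn d) :
    Integrable fun y => K t x y * g y := by
  have hm := (hK.meas.measurable_right ht x).mul hgm
  exact ((integrable_profile_sub hγ (rt_pos α ht) x).const_mul (A * t ^ (a - 1) * M)).mono'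
    hm.aestronglyMeasurable (Eventually.of_forall fun y => hK.abs_mul_le hg ht x y)

lemma Ker.integral_abs_act_le (hK : Ker α γ a A K) (hγ : 0 < γ) (hgm : Measurable g)
    (hg : ∀ x, |g x| ≤ M) {t : ℝ} (ht : t ∈ Ioc (0 : ℝ) 1) (x : Rn d) :
    ∫ y, |K t x y * g y| ≤ A * mass d γ * M * t ^ (a - 1) := by
  have h := integral_mono (hK.integrable_act hγ hgm hg ht x).abs
    ((integrable_profile_sub hγ (rt_pos α ht) x).const_mul (A * t ^ (a - 1) * M))
    fun y => hK.abs_mul_le hg ht x y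
  rw [integral_const_mul, integral_profile_sub γ (rt_pos α ht)] at h
  exact h.trans_eq (by ring)

lemma Ker.abs_act_le (hK : Ker α γ a A K) (hγ : 0 < γ) (hgm : Measurable g)
    (hg : ∀ x, |g x| ≤ M) {t : ℝ} (ht : t ∈ Ioc (0 : ℝ) 1) (x : Rn d) :
    |act K t g x| ≤ A * mass d γ * M * t ^ (a - 1) :=
  abs_integral_le_integral_abs.trans (hK.integral_abs_act_le hγ hgm hg ht x)

lemma Ker.fam_act (hK : Ker α γ a A K) (hγ : 0 < γ) (hgm : Measurable g) (hM : 0 ≤ M)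
    (hg : ∀ x, |g x| ≤ M) : Fam a (A * mass d γ * M) (fun t => act K t g) where
  meas := by
    obtain ⟨G, hG, e⟩ := hK.meas.measurable_act (Fam.const hgm hM hg)
    exact ⟨fun w => G (w.1, 1, w.2), by fun_prop, fun t ht x =>
      e t ht 1 ⟨one_pos, le_rfl⟩ x⟩
  nonneg := by
    have := hK.nonneg; have := mass_nonneg (d := d) γ
    positivity
  bound t ht x := hK.abs_act_le hγ hgm hg ht x

lemma Ker.abs_act_fam_le (hK : Ker α γ a A K) (hγ : 0 < γ) (hΨ : Fam b B Ψ) {t s : ℝ}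
    (ht : t ∈ Ioc (0 : ℝ) 1) (hs : s ∈ Ioo 0 t) (x : Rn d) :
    |act K (t - s) (Ψ s) x| ≤ A * mass d γ * B * betaW a b t s := by
  have s2 := mem_Ioc_of_Ioo ht hs
  have := hK.abs_act_le hγ (hΨ.measurable s2) (hΨ.bound s s2) (sub_mem_Ioc ht hs) x
  refine this.trans_eq ?_
  rw [betaW]; ring

lemma MeasKer.aestronglyMeasurable_act (hK : MeasKer K) (hΨ : Fam b B Ψ) {t : ℝ}
    (ht : t ∈ Ioc (0 : ℝ) 1) (x : Rn d) :
    AEStronglyMeasurable (fun s => act K (t - s) (Ψ s) x) (volume.restrict (Ioo 0 t)) := by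
  obtain ⟨G, hG, e⟩ := hK.measurable_act hΨ
  have m : Measurable fun s => G (t - s, s, x) := by fun_prop
  refine m.aestronglyMeasurable.congr ?_
  rw [EventuallyEq, ae_restrict_iff' measurableSet_Ioo]
  exact Eventually.of_forall fun s hs => (e _ (sub_mem_Ioc ht hs) _ (mem_Ioc_of_Ioo ht hs) x).symm

lemma Ker.integrableOn_act_fam (hK : Ker α γ a A K) (hγ : 0 < γ) (ha : 0 < a) (hb : 0 < b)
    (hΨ : Fam b B Ψ) {t : ℝ} (ht : t ∈ Ioc (0 : ℝ) 1) (x : Rn d) :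
    IntegrableOn (fun s => act K (t - s) (Ψ s) x) (Ioo 0 t) := by
  refine ((integrableOn_betaW ha hb ht.1).const_mul (A * mass d γ * B)).mono'
    (hK.meas.aestronglyMeasurable_act hΨ ht x) ?_
  rw [ae_restrict_iff' measurableSet_Ioo]
  exact Eventually.of_forall fun s hs => hK.abs_act_fam_le hγ hΨ ht hs x

/-- Fubini turns the kernel convolution into a time integral of composed operators, the Duhamel form
used from here on. -/
lemma Ker.act_tensor (hK : Ker α γ a A K) (hK' : Ker α γ b B K') (h0 : 0 < α) (hγ : 0 < γ)
    (ha : 0 < a) (hb : 0 < b) (hgm : Measurable g) (hg : ∀ x, |g x| ≤ M) {t : ℝ}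
    (ht : t ∈ Ioc (0 : ℝ) 1) (x : Rn d) :
    act (StableLike.tensor K K') t g x = ∫ s in Ioo 0 t, act K (t - s) (act K' s g) x := by
  obtain ⟨G, hG, e⟩ := hK.meas.measurable_tensor hK'.meas
  set μ := (volume.restrict (Ioo 0 t)).prod (volume : Measure (Rn d)) with hμ
  have hT := hK.tensor hK' h0 hγ ha hb
  set f : Rn d × (ℝ × Rn d) → ℝ := fun w => K (t - w.2.1) x w.2.2 * K' w.2.1 w.2.2 w.1 * g w.1 with hf
  have hm : AEStronglyMeasurable f ((volume : Measure (Rn d)).prod μ) := by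
    have m1 : Measurable fun w : Rn d × (ℝ × Rn d) => G ((t, x, w.1), w.2) * g w.1 := by fun_prop
    refine m1.aestronglyMeasurable.congr ?_
    have h1 : ∀ᵐ w : Rn d × (ℝ × Rn d) ∂(volume : Measure (Rn d)).prod μ, w.2.1 ∈ Ioo 0 t := by
      have h2 : ∀ᵐ w : ℝ × Rn d ∂μ, w.1 ∈ Ioo 0 t := by
        rw [hμ, ← restrict_prod_univ]
        exact (ae_restrict_mem (measurableSet_Ioo.prod MeasurableSet.univ)).mono fun w hw => hw.1
      exact Measure.quasiMeasurePreserving_snd.ae h2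
    filter_upwards [h1] with w hw
    rw [hf]; simp only; rw [e t ht _ hw]
  have hi : Integrable f ((volume : Measure (Rn d)).prod μ) := by
    refine (integrable_prod_of_bound hm
      ((integrable_profile_sub hγ (rt_pos α ht) x).const_mul
        (A * B * convC d α γ * betaI a b * t ^ (a + b - 1) * M))
      (Eventually.of_forall fun y => ?_)).1
    obtain ⟨i1, i2⟩ := hK.integrable_tensor hK' h0 hγ ha hb ht x y
    have i3 : Integrable (fun w => f (y, w)) μ := i1.mul_const (g y)
    refine ⟨i3, ?_⟩
    simp only [hf, abs_mul _ (g y)]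
    rw [integral_mul_const]
    calc _ ≤ (A * B * convC d α γ * betaI a b * (t ^ (a + b - 1) * profile γ (rt α t) (x - y))) *
          M := by
          gcongr
          · exact (abs_nonneg _).trans (hT.bound t ht x y)
          · exact hg y
      _ = _ := by ring
  have e1 : act (StableLike.tensor K K') t g x = ∫ y, ∫ w, f (y, w) ∂μ := by
    rw [act]
    congr 1; ext y
    rw [hK.tensor_eq hK' h0 hγ ha hb ht, ← integral_mul_const]
  have hi2 : Integrable (Function.uncurry fun y w => f (y, w)) ((volume : Measure (Rn d)).prod μ) := hi
  rw [e1, integral_integral_swap hi2]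
  have hi3 := hi.integral_prod_right
  rw [hμ, integral_prod _ (by simpa only [hμ] using hi3)]
  refine setIntegral_congr_fun measurableSet_Ioo fun s hs => ?_
  simp only [act, hf]
  congr 1; ext z
  rw [← integral_const_mul]
  congr 1; ext y; ring

end Act

namespace Param

variable {α ω κ₀ κ₁ L C : ℝ} {n : Rn d → Rn d → ℝ} (P : Param d α ω κ₀ κ₁ L C n)

include P

lemma hβ : 0 < ω / α := div_pos P.hω0 P.h0

lemma hγ : 0 < α - 4 * ω := by linarith [P.hω2, P.hω0]

lemma ker_q : Ker α (α - 4 * ω) 1 C (q α n) :=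
  ⟨P.measKer_q, P.hC, fun t ht x y => by simpa using P.abs_q_le ht x y⟩

lemma ker_F : Ker α (α - 4 * ω) (ω / α) (L * C * jumpMajC d α ω) (F α n) := by
  have hJ := jumpMajC_nonneg d α ω
  have hL := P.hL
  have hC := P.hC
  refine ⟨P.measKer_F, by positivity, fun t ht x y => (P.abs_F_le ht x y).trans ?_⟩
  have r0 := rt_pos α ht
  have hp := profile_nonneg (γ := α - 4 * ω) r0 (x - y)
  rw [← P.rpow_mul_profile_eq ht]
  have := Real.rpow_le_rpow_of_exponent_ge r0 (rt_le_one P.h0 ht)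
    (show -α + ω ≤ -α + 3 * ω by linarith [P.hω0])
  gcongr

lemma rpow_neg_eq {t : ℝ} (ht : t ∈ Ioc (0 : ℝ) 1) :
    rt α t ^ (-(α + ω)) = t ^ (-(ω / α) - 1) := by
  have := P.h0
  rw [rt_rpow ht]; congr 1; field_simp; ring

lemma ker_bker : Ker α α (-(ω / α)) (κ₁ * C * jumpMajC d α ω) (bker α n) := by
  have hJ := jumpMajC_nonneg d α ω
  have := P.hκ₁
  have hC := P.hC
  refine ⟨P.measKer_bker, by positivity, fun t ht x y => (P.abs_bker_le ht x y).trans_eq ?_⟩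
  rw [P.rpow_neg_eq ht]

lemma ker_bfro : Ker α α (-(ω / α)) (κ₁ * C * jumpMajC d α ω) (bfro α n) := by
  have hJ := jumpMajC_nonneg d α ω
  have := P.hκ₁
  have hC := P.hC
  refine ⟨P.measKer_bfro, by positivity, fun t ht x y => (P.abs_bfro_le ht x y).trans_eq ?_⟩
  rw [P.rpow_neg_eq ht]

lemma ker_Phi : Ker α (α - 4 * ω) (ω / α)
    (∑' m, powC d α (α - 4 * ω) (ω / α) (L * C * jumpMajC d α ω) m) (Phi α n) :=
  StableLike.ker_Phi P.ker_F P.h0 P.hγ P.hβ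

lemma abs_act_F_sub_le {g : Rn d → ℝ} {M : ℝ} (hgm : Measurable g) (hg : ∀ x, |g x| ≤ M) {t : ℝ}
    (ht : t ∈ Ioc (0 : ℝ) 1) (x x' : Rn d) : |act (F α n) t g x - act (F α n) t g x'| ≤
      4 * (L * C * jumpMajC d α ω) * mass d (α - 4 * ω) * M * ‖x - x'‖ ^ (2 * ω) *
        t ^ (ω / α - 1) := by
  have r0 := rt_pos α ht
  have hM : 0 ≤ M := (abs_nonneg _).trans (hg 0)
  have i1 := P.ker_F.integrable_act P.hγ hgm hg ht x
  have i2 := P.ker_F.integrable_act P.hγ hgm hg ht x'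
  have j1 := integrable_profile_sub P.hγ r0 x
  have j2 := integrable_profile_sub P.hγ r0 x'
  have hb : ∀ y, ‖F α n t x y * g y - F α n t x' y * g y‖ ≤
      2 * (L * C * jumpMajC d α ω) * ‖x - x'‖ ^ (2 * ω) * t ^ (ω / α - 1) * M *
        (profile (α - 4 * ω) (rt α t) (x - y) + profile (α - 4 * ω) (rt α t) (x' - y)) := by
    intro y
    have h1 := P.abs_F_sub_le ht x x' y
    have h3 := (abs_nonneg _).trans h1
    rw [P.rpow_mul_profile_eq ht] at h1 h3
    rw [← sub_mul, norm_mul, Real.norm_eq_abs, Real.norm_eq_abs]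
    calc _ ≤ _ := mul_le_mul h1 (hg y) (abs_nonneg _) h3
      _ = _ := by ring
  rw [act, act, ← integral_sub i1 i2]
  refine (norm_integral_le_of_norm_le ((j1.add j2).const_mul _)
    (Eventually.of_forall hb)).trans_eq ?_
  simp only [Pi.add_apply]
  rw [integral_const_mul, integral_add j1 j2, integral_profile_sub _ r0, integral_profile_sub _ r0]
  ring

/-- In Φφ = Fφ + ∫ F_{t-s} Φ_s φ ds the variable x enters only through the first argument of F. The
modulus of F, together with the mere boundedness of Φ_s φ up to its time singularity, gives the
Hölder bound without any iteration. -/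
lemma exists_act_Phi : ∃ A ≥ 0, ∀ (φ : Rn d → ℝ) (M : ℝ), Measurable φ → (∀ x, |φ x| ≤ M) →
    Fam (ω / α) (A * M) (fun t => act (Phi α n) t φ) ∧
    (∀ t ∈ Ioc (0 : ℝ) 1, ∀ x x', |act (Phi α n) t φ x - act (Phi α n) t φ x'| ≤
      A * M * t ^ (ω / α - 1) * ‖x - x'‖ ^ (2 * ω)) ∧
    (∀ t ∈ Ioc (0 : ℝ) 1, ∀ x, act (Phi α n) t φ x = act (F α n) t φ x +
      ∫ s in Ioo 0 t, act (F α n) (t - s) (act (Phi α n) s φ) x) := by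
  have hβ := P.hβ
  have hγ := P.hγ
  have hm := mass_nonneg (d := d) (α - 4 * ω)
  have hF := P.ker_F
  have hΦ := P.ker_Phi
  set A₁ := L * C * jumpMajC d α ω with hA₁
  set A₂ := ∑' m, powC d α (α - 4 * ω) (ω / α) A₁ m with hA₂
  set m := mass d (α - 4 * ω) with hmd
  set β := ω / α with hβd
  have hA1 := hF.nonneg
  have hA2 := hΦ.nonneg
  have hB := betaI_nonneg β β
  refine ⟨A₂ * m + (4 * A₁ * m + 4 * A₁ * m * (A₂ * m) * betaI β β), by positivity,
    fun φ M hφm hφ => ?_⟩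
  have hM : 0 ≤ M := (abs_nonneg _).trans (hφ 0)
  have hfam : Fam β (A₂ * m * M) fun t => act (Phi α n) t φ := hΦ.fam_act hγ hφm hM hφ
  have hT := hF.tensor hΦ P.h0 hγ hβ hβ
  have heq : ∀ t ∈ Ioc (0 : ℝ) 1, ∀ x, act (Phi α n) t φ x = act (F α n) t φ x +
      ∫ s in Ioo 0 t, act (F α n) (t - s) (act (Phi α n) s φ) x := by
    intro t ht x
    rw [← hF.act_tensor hΦ P.h0 hγ hβ hβ hφm hφ ht, act, act, act,
      ← integral_add (hF.integrable_act hγ hφm hφ ht x) (hT.integrable_act hγ hφm hφ ht x)]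
    congr 1; ext y
    rw [Phi_eq hF P.h0 hγ hβ ht]; ring
  refine ⟨⟨hfam.meas, by positivity, fun t ht x => (hfam.bound t ht x).trans ?_⟩,
    fun t ht x x' => ?_, heq⟩
  · have : 0 ≤ t ^ (β - 1) := Real.rpow_nonneg ht.1.le _
    have h3 : 0 ≤ 4 * A₁ * m + 4 * A₁ * m * (A₂ * m) * betaI β β := by positivity
    gcongr
    linarith
  · have hN : 0 ≤ ‖x - x'‖ ^ (2 * ω) := Real.rpow_nonneg (norm_nonneg _) _
    have ht0 : 0 ≤ t ^ (β - 1) := Real.rpow_nonneg ht.1.le _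
    have b1 := P.abs_act_F_sub_le hφm hφ ht x x'
    rw [← hA₁, ← hmd, ← hβd] at b1
    have b2 : |(∫ s in Ioo 0 t, act (F α n) (t - s) (act (Phi α n) s φ) x) -
        ∫ s in Ioo 0 t, act (F α n) (t - s) (act (Phi α n) s φ) x'| ≤
        4 * A₁ * m * (A₂ * m * M) * ‖x - x'‖ ^ (2 * ω) * (t ^ (β + β - 1) * betaI β β) := by
      rw [← integral_sub (hF.integrableOn_act_fam hγ hβ hβ hfam ht x)
        (hF.integrableOn_act_fam hγ hβ hβ hfam ht x'), ← integral_betaW ht.1, ← integral_const_mul,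
        ← Real.norm_eq_abs]
      refine norm_integral_le_of_norm_le ((integrableOn_betaW hβ hβ ht.1).const_mul _) ?_
      rw [ae_restrict_iff' measurableSet_Ioo]
      refine Eventually.of_forall fun s hs => ?_
      have s2 := mem_Ioc_of_Ioo ht hs
      have := P.abs_act_F_sub_le (hfam.measurable s2) (hfam.bound s s2) (sub_mem_Ioc ht hs) x x'
      rw [← hA₁, ← hmd, ← hβd] at this
      refine this.trans_eq ?_
      rw [betaW]; ring
    -- For t ≤ 1 the Duhamel part is less singular than the first term and is absorbed in it.
    have b3 : t ^ (β + β - 1) ≤ t ^ (β - 1) :=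
      Real.rpow_le_rpow_of_exponent_ge ht.1 ht.2 (by linarith)
    have b4 : 4 * A₁ * m * (A₂ * m * M) * ‖x - x'‖ ^ (2 * ω) * (t ^ (β + β - 1) * betaI β β) ≤
        4 * A₁ * m * (A₂ * m * M) * ‖x - x'‖ ^ (2 * ω) * (t ^ (β - 1) * betaI β β) := by gcongr
    rw [heq t ht x, heq t ht x', add_sub_add_comm]
    refine (abs_add_le _ _).trans ((add_le_add b1 (b2.trans b4)).trans ?_)
    have : 0 ≤ A₂ * m * (M * t ^ (β - 1) * ‖x - x'‖ ^ (2 * ω)) := by positivity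
    linarith

end Param

end

/-! ### Cancellation on Hölder functions -/

section

open Filter Topology

attribute [local irreducible] profile psi fullExp pk levyK

/-- Bounded Hölder functions with exponent `2 ω`. -/
structure Hol (ω A : ℝ) (g : Rn d → ℝ) : Prop where
  meas : Measurable g
  bound : ∀ x, |g x| ≤ A
  holder : ∀ x y, |g x - g y| ≤ A * ‖x - y‖ ^ (2 * ω)

lemma Hol.nonneg {ω A : ℝ} {g : Rn d → ℝ} (hg : Hol ω A g) : 0 ≤ A :=
  (abs_nonneg _).trans (hg.bound 0)

section Reg

variable {α r A B : ℝ} {f g : Rn d → ℝ}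

lemma Reg.mono (hg : Reg α r A g) (hr : 0 < r) (hAB : A ≤ B) : Reg α r B g := by
  refine ⟨hg.diff, fun x => (hg.bound x).trans ?_, fun a x ha => (hg.bound_one a x ha).trans ?_,
    fun a b x ha hb => (hg.bound_two a b x ha hb).trans ?_⟩ <;>
  · have := profile_nonneg (γ := α) hr x
    gcongr

lemma Reg.sub (hf : Reg α r A f) (hg : Reg α r B g) : Reg α r (A + B) fun x => f x - g x where
  diff := hf.diff.sub hg.diff
  bound x := (abs_sub _ _).trans ((add_le_add (hf.bound x) (hg.bound x)).trans_eq (by ring))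
  bound_one a x ha := by
    rw [sub_sub_sub_comm]
    exact (abs_sub _ _).trans ((add_le_add (hf.bound_one a x ha)
      (hg.bound_one a x ha)).trans_eq (by ring))
  bound_two a b x ha hb := by
    have e : (f (x + a + b) - g (x + a + b) - (f (x + a) - g (x + a))) -
        (f (x + b) - g (x + b) - (f x - g x)) =
        ((f (x + a + b) - f (x + a)) - (f (x + b) - f x)) -
        ((g (x + a + b) - g (x + a)) - (g (x + b) - g x)) := by ring
    rw [e]
    exact (abs_sub _ _).trans ((add_le_add (hf.bound_two a b x ha hb)
      (hg.bound_two a b x ha hb)).trans_eq (by ring))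

lemma dlt_sub (hf : Differentiable ℝ f) (hg : Differentiable ℝ g) (x h : Rn d) :
    dlt α (fun z => f z - g z) x h = dlt α f x h - dlt α g x h := by
  unfold dlt
  rw [fderiv_fun_sub (hf x) (hg x)]
  simp only [sub_apply]
  ring

end Reg

lemma integral_profile_mul_norm_le {α σ r : ℝ} (hσ : 0 ≤ σ) (hσα : σ < α) (hr : 0 < r)
    (x : Rn d) : Integrable (fun y => ‖x - y‖ ^ σ * profile α r (x - y)) ∧
    ∫ y, ‖x - y‖ ^ σ * profile α r (x - y) ≤ mass d (α - σ) * r ^ σ := by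
  have i1 := (integrable_profile_sub (d := d) (γ := α - σ) (by linarith) hr x).const_mul (r ^ σ)
  have hc := continuous_profile (d := d) (γ := α) hr
  have hm : Measurable fun y : Rn d => ‖x - y‖ ^ σ * profile α r (x - y) := by
    have h1 : Measurable fun y : Rn d => profile α r (x - y) := hc.measurable.fun_comp (by fun_prop)
    fun_prop
  have hb : ∀ y : Rn d, ‖x - y‖ ^ σ * profile α r (x - y) ≤ r ^ σ * profile (α - σ) r (x - y) :=
    fun y => norm_rpow_mul_profile_le hσ hr _
  have i2 : Integrable fun y : Rn d => ‖x - y‖ ^ σ * profile α r (x - y) := by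
    refine i1.mono' hm.aestronglyMeasurable (Eventually.of_forall fun y => ?_)
    have e := Real.norm_of_nonneg (mul_nonneg (Real.rpow_nonneg (norm_nonneg (x - y)) σ)
      (profile_nonneg (γ := α) hr (x - y)))
    exact e.trans_le (hb y)
  refine ⟨i2, (integral_mono i2 i1 hb).trans_eq ?_⟩
  rw [integral_const_mul, integral_profile_sub _ hr, mul_comm]

/-- Writes k_y g(y) − g(x) k_x = k_y (g(y) − g(x)) + g(x)(k_y − k_x), with all kernels at x − y. The
first term uses the modulus of g, the second that of the coefficient; the constant is 1 + 2. It is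
applied where ∫ k_x is explicit: one for the density, zero for its gradient and its compensated
increments. -/
lemma abs_integral_cancel_le {ω A : ℝ} {g : Rn d → ℝ} (hg : Hol ω A g)
    {k : Rn d → Rn d → ℝ} {B : Rn d → ℝ} {x : Rn d}
    (hB : ∀ y, |k y (x - y)| ≤ B y) (hB' : ∀ y, |k y (x - y) - k x (x - y)| ≤
      2 * ‖y - x‖ ^ (2 * ω) * B y)
    (i1 : Integrable fun y => k y (x - y) * g y) (i2 : Integrable fun y => k x (x - y))
    (iB : Integrable fun y => ‖x - y‖ ^ (2 * ω) * B y) :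
    |(∫ y, k y (x - y) * g y) - g x * ∫ y, k x (x - y)| ≤
      3 * A * ∫ y, ‖x - y‖ ^ (2 * ω) * B y := by
  have hA := hg.nonneg
  rw [← integral_const_mul, ← integral_sub i1 (i2.const_mul _), ← integral_const_mul,
    ← Real.norm_eq_abs]
  refine norm_integral_le_of_norm_le (iB.const_mul _) (Eventually.of_forall fun y => ?_)
  have hBy : 0 ≤ B y := (abs_nonneg _).trans (hB y)
  have hn : 0 ≤ ‖x - y‖ ^ (2 * ω) := Real.rpow_nonneg (norm_nonneg _) _
  have h1 := hB y
  have h2 := hB' y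
  have h3 := hg.holder y x
  have h4 := hg.bound x
  rw [norm_sub_rev] at h2 h3
  have e : k y (x - y) * g y - g x * k x (x - y) =
      k y (x - y) * (g y - g x) + g x * (k y (x - y) - k x (x - y)) := by ring
  rw [e, Real.norm_eq_abs]
  refine (abs_add_le _ _).trans ?_
  rw [abs_mul, abs_mul]
  calc _ ≤ B y * (A * ‖x - y‖ ^ (2 * ω)) + A * (2 * ‖x - y‖ ^ (2 * ω) * B y) := by gcongr
    _ = _ := by ring

lemma measurable_jumpMaj (α ω r : ℝ) : Measurable fun w : Rn d × Rn d => jumpMaj α ω r w.1 w.2 := by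
  have h1 := measurable_jwr (d := d) α ω r
  have h2 : Measurable (profile α r : Rn d → ℝ) := by unfold profile; fun_prop
  unfold jumpMaj
  fun_prop

/-- The majorant of the jump integrand after integration against the modulus of continuity. -/
def holMaj (α ω r : ℝ) (h : Rn d) : ℝ := ∫ z : Rn d, ‖z‖ ^ (2 * ω) * jumpMaj α ω r z h

/-- Tonelli in (z, h). Cancellation in z is available for each fixed jump h, so the jump variable
has to be integrated last. The modulus contributes r^{2ω} against r^{-α-ω}. -/
lemma holMaj_spec (hd : 1 ≤ d) {α ω r : ℝ} (h0 : 0 < α) (h2 : α < 2) (hω : 0 < ω)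
    (hωα : 2 * ω < α) (hr : 0 < r) (hr1 : r ≤ 1) :
    (∀ᵐ h : Rn d, Integrable fun z : Rn d => ‖z‖ ^ (2 * ω) * jumpMaj α ω r z h) ∧
    Integrable (holMaj α ω r : Rn d → ℝ) ∧
    ∫ h : Rn d, holMaj α ω r h ≤ jumpMajC d α ω * mass d (α - 2 * ω) * r ^ (-α + ω) := by
  have hJ := jumpMajC_nonneg d α ω
  obtain ⟨i1, b1⟩ := integral_profile_mul_norm_le (d := d) (α := α) (σ := 2 * ω) (by linarith)
    hωα hr 0
  simp only [zero_sub, norm_neg, profile_neg] at i1 b1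
  have hm : Measurable fun w : Rn d × Rn d => ‖w.1‖ ^ (2 * ω) * jumpMaj α ω r w.1 w.2 := by
    have := measurable_jumpMaj (d := d) α ω r
    fun_prop
  have key := integrable_prod_of_bound (μ := (volume : Measure (Rn d)))
    (ν := (volume : Measure (Rn d))) hm.aestronglyMeasurable
    (i1.const_mul (jumpMajC d α ω * r ^ (-(α + ω)))) (Eventually.of_forall fun z => by
      have hn : 0 ≤ ‖z‖ ^ (2 * ω) := Real.rpow_nonneg (norm_nonneg _) _
      have i3 : Integrable fun h => ‖z‖ ^ (2 * ω) * jumpMaj α ω r z h :=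
        (integrable_jumpMaj hd h0 h2 hω hr z).const_mul _
      refine ⟨i3, ?_⟩
      have e : ∀ h, |‖z‖ ^ (2 * ω) * jumpMaj α ω r z h| = ‖z‖ ^ (2 * ω) * jumpMaj α ω r z h :=
        fun h => abs_of_nonneg (mul_nonneg hn (jumpMaj_nonneg hr z h))
      simp only [e]
      rw [integral_const_mul]
      calc _ ≤ ‖z‖ ^ (2 * ω) * (jumpMajC d α ω * r ^ (-(α + ω)) * profile α r z) := by
            gcongr
            exact integral_jumpMaj_le hd h0 h2 hω hr hr1 z
        _ = _ := by ring)
  obtain ⟨k1, k2⟩ := key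
  refine ⟨k1.prod_left_ae, k1.integral_prod_right, ?_⟩
  have e : ∀ w : Rn d × Rn d, |‖w.1‖ ^ (2 * ω) * jumpMaj α ω r w.1 w.2| =
      ‖w.1‖ ^ (2 * ω) * jumpMaj α ω r w.1 w.2 := fun w =>
    abs_of_nonneg (mul_nonneg (Real.rpow_nonneg (norm_nonneg _) _) (jumpMaj_nonneg hr _ _))
  simp only [e] at k2
  rw [integral_prod_symm _ k1, integral_const_mul] at k2
  refine k2.trans ?_
  have e2 : r ^ (-α + ω) = r ^ (-(α + ω)) * r ^ (2 * ω) := by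
    rw [← Real.rpow_add hr]; congr 1; ring
  rw [e2]
  calc _ ≤ jumpMajC d α ω * r ^ (-(α + ω)) * (mass d (α - 2 * ω) * r ^ (2 * ω)) := by gcongr
    _ = _ := by ring

lemma measurable_clm {X : Type*} [MeasurableSpace X] {f : X → Rn d →L[ℝ] ℝ}
    (h : ∀ v, Measurable fun x => f x v) : Measurable f := by
  have e : f = fun x => ∑ i : Fin d, f x (EuclideanSpace.single i 1) •
      (EuclideanSpace.proj i : Rn d →L[ℝ] ℝ) := by
    funext x
    ext v
    have hv : v = ∑ i : Fin d, v i • EuclideanSpace.single i (1 : ℝ) := by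
      ext j
      simp [Finset.sum_apply, Pi.single_apply]
    conv_lhs => rw [hv]
    rw [map_sum]
    simp [mul_comm]
  rw [e]
  exact Finset.measurable_sum _ fun i _ => (h _).smul_const _

namespace Param

variable {α ω κ₀ κ₁ L C : ℝ} {n : Rn d → Rn d → ℝ} (P : Param d α ω κ₀ κ₁ L C n)

include P

/-- For |y−y'| ≤ 1 the exponent 4ω is weakened to 2ω. For larger distances the triangle inequality
suffices and produces the factor 2. -/
lemma reg_sub' {t : ℝ} (ht : t ∈ Ioc (0 : ℝ) 1) (y y' : Rn d) :
    Reg α (rt α t) (2 * ‖y - y'‖ ^ (2 * ω) * C) (fun x => pk α (n y) t x - pk α (n y') t x) := by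
  have hC := P.hC
  have r0 := rt_pos α ht
  rcases le_total ‖y - y'‖ 1 with h | h
  · refine (P.reg_sub t ht y y').mono r0 ?_
    have h1 : ‖y - y'‖ ^ (4 * ω) ≤ ‖y - y'‖ ^ (2 * ω) := by
      rcases eq_or_lt_of_le (norm_nonneg (y - y')) with hz | hz
      · rw [← hz, Real.zero_rpow (by linarith [P.hω0]), Real.zero_rpow (by linarith [P.hω0])]
      · exact Real.rpow_le_rpow_of_exponent_ge hz h (by linarith [P.hω0])
    have h2 : 0 ≤ ‖y - y'‖ ^ (2 * ω) := Real.rpow_nonneg (norm_nonneg _) _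
    calc _ ≤ C * ‖y - y'‖ ^ (2 * ω) := by gcongr
      _ ≤ _ := by nlinarith [mul_nonneg hC h2]
  · refine ((P.reg t ht y).sub (P.reg t ht y')).mono r0 ?_
    have h1 : 1 ≤ ‖y - y'‖ ^ (2 * ω) := Real.one_le_rpow h (by linarith [P.hω0])
    nlinarith

lemma measurable_fderiv_right {t : ℝ} (ht : 0 < t) (x h : Rn d) :
    Measurable fun y => fderiv ℝ (pk α (n y) t) (x - y) h := by
  simp only [P.fderiv_pk ht]
  exact P.measurable_fderiv_pk (t := fun _ : Rn d => t) (z := fun y => x - y) (y := fun y => y)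
    (by fun_prop) (by fun_prop) (by fun_prop) h

lemma hasFDerivAt_act_q {g : Rn d → ℝ} {M : ℝ} (hgm : Measurable g) (hg : ∀ x, |g x| ≤ M) {t : ℝ}
    (ht : t ∈ Ioc (0 : ℝ) 1) (x : Rn d) : Integrable (fun y => g y • fderiv ℝ (pk α (n y) t) (x - y)) ∧
    HasFDerivAt (act (q α n) t g) (∫ y, g y • fderiv ℝ (pk α (n y) t) (x - y)) x := by
  have r0 := rt_pos α ht
  have hC := P.hC
  have hM : 0 ≤ M := (abs_nonneg _).trans (hg 0)
  have hnorm : ∀ y z, ‖fderiv ℝ (pk α (n y) t) z‖ ≤ C / rt α t * profile α (rt α t) z := by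
    intro y z
    have hp := profile_nonneg (γ := α) r0 z
    refine ContinuousLinearMap.opNorm_le_bound _ (by positivity) fun h => ?_
    exact ((P.reg t ht y).abs_fderiv_le r0 z h).trans_eq (by ring)
  have hmeas : ∀ z, Measurable fun y => g y • fderiv ℝ (pk α (n y) t) (z - y) := fun z =>
    measurable_clm fun v => by
      have h3 : Measurable fun y => g y * fderiv ℝ (pk α (n y) t) (z - y) v :=
        hgm.mul (P.measurable_fderiv_right ht.1 z v)
      simpa using h3
  have hint : Integrable fun y => M * (C / rt α t * (2 ^ ((d : ℝ) + α) * profile α (rt α t) (x - y))) :=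
    (((integrable_profile_sub P.h0 r0 x).const_mul _).const_mul _).const_mul _
  have hbd : ∀ y, ∀ z ∈ Metric.ball x (rt α t), ‖g y • fderiv ℝ (pk α (n y) t) (z - y)‖ ≤
      M * (C / rt α t * (2 ^ ((d : ℝ) + α) * profile α (rt α t) (x - y))) := by
    intro y z hz
    have hzx : ‖z - x‖ ≤ rt α t := (mem_ball_iff_norm.1 hz).le
    have h1 := profile_shift_le (d := d) P.h0 r0 (x := x - y) hzx
    rw [show x - y + (z - x) = z - y by abel] at h1
    rw [norm_smul, Real.norm_eq_abs]
    have h2 : ‖fderiv ℝ (pk α (n y) t) (z - y)‖ ≤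
        C / rt α t * (2 ^ ((d : ℝ) + α) * profile α (rt α t) (x - y)) :=
      (hnorm y (z - y)).trans (by gcongr)
    exact mul_le_mul (hg y) h2 (norm_nonneg _) hM
  refine ⟨hint.mono' (hmeas x).aestronglyMeasurable (Eventually.of_forall fun y =>
    hbd y x (Metric.mem_ball_self r0)), ?_⟩
  refine hasFDerivAt_integral_of_dominated_of_fderiv_le
    (F := fun z y => q α n t z y * g y)
    (F' := fun z y => g y • fderiv ℝ (pk α (n y) t) (z - y)) (Metric.ball_mem_nhds x r0)
    (Eventually.of_forall fun z => (P.ker_q.integrable_act P.hγ hgm hg ht z).1)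
    (P.ker_q.integrable_act P.hγ hgm hg ht x) (hmeas x).aestronglyMeasurable
    (Eventually.of_forall hbd) hint (Eventually.of_forall fun y z _ => ?_)
  simp only [q_eq]
  have h1 : HasFDerivAt (fun z => pk α (n y) t (z - y)) (fderiv ℝ (pk α (n y) t) (z - y)) z := by
    have := ((P.reg t ht y).diff (z - y)).hasFDerivAt
    exact (hasFDerivAt_comp_sub y).2 this
  exact h1.mul_const (g y)

lemma differentiable_act_q {g : Rn d → ℝ} {M : ℝ} (hgm : Measurable g) (hg : ∀ x, |g x| ≤ M)
    {t : ℝ} (ht : t ∈ Ioc (0 : ℝ) 1) : Differentiable ℝ (act (q α n) t g) := fun x =>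
  (P.hasFDerivAt_act_q hgm hg ht x).2.differentiableAt

lemma fderiv_act_q {g : Rn d → ℝ} {M : ℝ} (hgm : Measurable g) (hg : ∀ x, |g x| ≤ M) {t : ℝ}
    (ht : t ∈ Ioc (0 : ℝ) 1) (x h : Rn d) :
    Integrable (fun y => fderiv ℝ (pk α (n y) t) (x - y) h * g y) ∧
    fderiv ℝ (act (q α n) t g) x h = ∫ y, fderiv ℝ (pk α (n y) t) (x - y) h * g y := by
  obtain ⟨i, hd⟩ := P.hasFDerivAt_act_q hgm hg ht x
  have e : ∀ y, (g y • fderiv ℝ (pk α (n y) t) (x - y)) h =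
      fderiv ℝ (pk α (n y) t) (x - y) h * g y := fun y => by simp [mul_comm]
  have i2 := i.apply_continuousLinearMap h
  simp only [e] at i2
  refine ⟨i2, ?_⟩
  rw [hd.fderiv, ContinuousLinearMap.integral_apply i]
  simp only [e]

lemma dlt_act_q {g : Rn d → ℝ} {M : ℝ} (hgm : Measurable g) (hg : ∀ x, |g x| ≤ M) {t : ℝ}
    (ht : t ∈ Ioc (0 : ℝ) 1) (x h : Rn d) :
    Integrable (fun y => dlt α (pk α (n y) t) (x - y) h * g y) ∧
    dlt α (act (q α n) t g) x h = ∫ y, dlt α (pk α (n y) t) (x - y) h * g y := by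
  obtain ⟨i3, e3⟩ := P.fderiv_act_q hgm hg ht x h
  have i1 := P.ker_q.integrable_act P.hγ hgm hg ht (x + h)
  have i2 := P.ker_q.integrable_act P.hγ hgm hg ht x
  have i4 : Integrable fun y => q α n t (x + h) y * g y - q α n t x y * g y := i1.sub i2
  have i5 := i3.const_mul (chi α h)
  have e : ∀ y, dlt α (pk α (n y) t) (x - y) h * g y =
      (q α n t (x + h) y * g y - q α n t x y * g y) -
        chi α h * (fderiv ℝ (pk α (n y) t) (x - y) h * g y) := by
    intro y
    rw [dlt, q_eq, q_eq, show x + h - y = x - y + h by abel]; ring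
  simp only [e]
  refine ⟨i4.sub i5, ?_⟩
  rw [integral_sub i4 i5, integral_sub i1 i2, integral_const_mul, ← e3]
  rfl

/-- The density frozen at x has mass one, so it reproduces g(x) exactly. The rate r^{2ω}, uniform in
x, yields the initial condition. -/
lemma abs_act_q_sub_le {g : Rn d → ℝ} {A : ℝ} (hg : Hol ω A g) {t : ℝ} (ht : t ∈ Ioc (0 : ℝ) 1)
    (x : Rn d) : |act (q α n) t g x - g x| ≤
      3 * C * mass d (α - 2 * ω) * A * rt α t ^ (2 * ω) := by
  have r0 := rt_pos α ht
  have hC := P.hC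
  have hA := hg.nonneg
  obtain ⟨i0, b0⟩ := integral_profile_mul_norm_le (d := d) (α := α) (σ := 2 * ω)
    (by linarith [P.hω0]) (by linarith [P.hω2, P.hω0]) r0 x
  have i1 := P.ker_q.integrable_act P.hγ hg.meas hg.bound ht x
  simp only [q_eq] at i1
  have i2 : Integrable fun y => pk α (n x) t (x - y) :=
    ((P.reg t ht x).integrable P.h0 r0).comp_sub_left x
  have key := abs_integral_cancel_le hg (k := fun y z => pk α (n y) t z)
    (B := fun y => C * profile α (rt α t) (x - y)) (x := x)
    (fun y => (P.reg t ht y).bound _)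
    (fun y => ((P.reg_sub' ht y x).bound _).trans_eq (by ring)) i1 i2
    ((i0.const_mul C).congr (Eventually.of_forall fun y => by simp only; ring))
  have hone : ∫ y, pk α (n x) t (x - y) = 1 := by
    rw [integral_sub_left_eq_self (fun z => pk α (n x) t z)]
    have := integral_pk P.hd P.h0 P.h2 P.hκ₀ (P.coeff x) r0 (rt_le_one P.h0 ht)
    rwa [rt_rpow_self P.h0 ht] at this
  rw [hone, mul_one] at key
  have e : act (q α n) t g x = ∫ y, pk α (n y) t (x - y) * g y := by simp only [act, q_eq]
  rw [e]
  refine key.trans ?_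
  have e2 : ∫ y, ‖x - y‖ ^ (2 * ω) * (C * profile α (rt α t) (x - y)) =
      C * ∫ y, ‖x - y‖ ^ (2 * ω) * profile α (rt α t) (x - y) := by
    rw [← integral_const_mul]; congr 1; ext y; ring
  rw [e2]
  calc _ ≤ 3 * A * (C * (mass d (α - 2 * ω) * rt α t ^ (2 * ω))) := by gcongr
    _ = _ := by ring

/-- The gradient of the density frozen at x has mean zero. The gain r^{2ω} over the naive r^{-1} is
what keeps the gradient integrable in time at α = 1. -/
lemma norm_fderiv_act_q_le {g : Rn d → ℝ} {A : ℝ} (hg : Hol ω A g) {t : ℝ}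
    (ht : t ∈ Ioc (0 : ℝ) 1) (x : Rn d) : ‖fderiv ℝ (act (q α n) t g) x‖ ≤
      3 * C * mass d (α - 2 * ω) * A * rt α t ^ (-1 + 2 * ω) := by
  have r0 := rt_pos α ht
  have hC := P.hC
  have hA := hg.nonneg
  have hm := mass_nonneg (d := d) (α - 2 * ω)
  refine ContinuousLinearMap.opNorm_le_bound _ (by positivity) fun h => ?_
  obtain ⟨i0, b0⟩ := integral_profile_mul_norm_le (d := d) (α := α) (σ := 2 * ω)
    (by linarith [P.hω0]) (by linarith [P.hω2, P.hω0]) r0 x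
  obtain ⟨i1, e1⟩ := P.fderiv_act_q hg.meas hg.bound ht x h
  have i2 : Integrable fun y => fderiv ℝ (pk α (n x) t) (x - y) h :=
    ((P.reg t ht x).integrable_fderiv P.h0 r0 h).comp_sub_left x
  have key := abs_integral_cancel_le hg (k := fun y z => fderiv ℝ (pk α (n y) t) z h)
    (B := fun y => C * (‖h‖ / rt α t) * profile α (rt α t) (x - y)) (x := x)
    (fun y => (P.reg t ht y).abs_fderiv_le r0 _ h)
    (fun y => by
      have h1 := (P.reg_sub' ht y x).abs_fderiv_le r0 (x - y) h
      rw [fderiv_fun_sub ((P.reg t ht y).diff _) ((P.reg t ht x).diff _)] at h1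
      exact h1.trans_eq (by ring)) i1 i2
    ((i0.const_mul (C * (‖h‖ / rt α t))).congr (Eventually.of_forall fun y => by simp only; ring))
  have hzero : ∫ y, fderiv ℝ (pk α (n x) t) (x - y) h = 0 := by
    rw [integral_sub_left_eq_self (fun z => fderiv ℝ (pk α (n x) t) z h)]
    exact (P.reg t ht x).integral_fderiv P.h0 r0 h
  rw [hzero, mul_zero, sub_zero, ← e1] at key
  rw [Real.norm_eq_abs]
  refine key.trans ?_
  have e2 : ∫ y, ‖x - y‖ ^ (2 * ω) * (C * (‖h‖ / rt α t) * profile α (rt α t) (x - y)) =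
      C * (‖h‖ / rt α t) * ∫ y, ‖x - y‖ ^ (2 * ω) * profile α (rt α t) (x - y) := by
    rw [← integral_const_mul]; congr 1; ext y; ring
  rw [e2, Real.rpow_add r0, Real.rpow_neg_one]
  calc _ ≤ 3 * A * (C * (‖h‖ / rt α t) * (mass d (α - 2 * ω) * rt α t ^ (2 * ω))) := by gcongr
    _ = _ := by ring

/-- For almost every h, cancellation is applied to the increments at fixed h, whose frozen version
has mean zero; integration in h then uses `holMaj`. The bound t^{ω/α-1} is integrable in time, in
contrast with the pointwise kernel bound t^{-ω/α-1}. -/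
lemma integrable_dlt_act_q {g : Rn d → ℝ} {A : ℝ} (hg : Hol ω A g) {t : ℝ} (ht : t ∈ Ioc (0 : ℝ) 1)
    {m : Rn d → ℝ} (hmm : Measurable m) (hm : ∀ h, |m h| ≤ κ₁) (x : Rn d) :
    Integrable (fun h => dlt α (act (q α n) t g) x h * levyK α m h) ∧
    ∫ h, |dlt α (act (q α n) t g) x h * levyK α m h| ≤
      3 * κ₁ * C * jumpMajC d α ω * mass d (α - 2 * ω) * A * t ^ (ω / α - 1) := by
  have r0 := rt_pos α ht
  have r1 := rt_le_one P.h0 ht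
  have hC := P.hC
  have hA := hg.nonneg
  have hκ := P.hκ₁
  obtain ⟨a1, a2, a3⟩ := holMaj_spec P.hd P.h0 P.h2 P.hω0
    (show 2 * ω < α by linarith [P.hω2, P.hω0]) r0 r1
  have hb : ∀ᵐ h : Rn d, ‖dlt α (act (q α n) t g) x h * levyK α m h‖ ≤
      3 * A * (κ₁ * C) * holMaj α ω (rt α t) h := by
    filter_upwards [a1] with h hh
    obtain ⟨i1, e1⟩ := P.dlt_act_q hg.meas hg.bound ht x h
    have i2 : Integrable fun y => dlt α (pk α (n x) t) (x - y) h :=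
      ((P.reg t ht x).integrable_dlt_left P.h0 r0 h).comp_sub_left x
    have hh' : Integrable fun y => ‖x - y‖ ^ (2 * ω) * jumpMaj α ω (rt α t) (x - y) h :=
      hh.comp_sub_left x
    have key := abs_integral_cancel_le hg
      (k := fun y z => dlt α (pk α (n y) t) z h * levyK α m h)
      (B := fun y => κ₁ * C * jumpMaj α ω (rt α t) (x - y) h) (x := x)
      (fun y => (P.reg t ht y).abs_dlt_mul_levyK_le P.h0 P.hω0 P.hω1' r0 r1 hm _ h)
      (fun y => by
        have h1 := (P.reg_sub' ht y x).abs_dlt_mul_levyK_le P.h0 P.hω0 P.hω1' r0 r1 hm (x - y) h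
        rw [dlt_sub (P.reg t ht y).diff (P.reg t ht x).diff, sub_mul] at h1
        exact h1.trans_eq (by ring))
      ((i1.mul_const (levyK α m h)).congr (Eventually.of_forall fun y => by simp only; ring))
      (i2.mul_const _)
      ((hh'.const_mul (κ₁ * C)).congr (Eventually.of_forall fun y => by simp only; ring))
    have hzero : ∫ y, dlt α (pk α (n x) t) (x - y) h * levyK α m h = 0 := by
      rw [integral_mul_const, integral_sub_left_eq_self (fun z => dlt α (pk α (n x) t) z h),
        (P.reg t ht x).integral_dlt P.h0 r0 h, zero_mul]
    have e3 : ∫ y, dlt α (pk α (n y) t) (x - y) h * levyK α m h * g y =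
        dlt α (act (q α n) t g) x h * levyK α m h := by
      rw [e1, ← integral_mul_const]; congr 1; ext y; ring
    have e4 : ∫ y, ‖x - y‖ ^ (2 * ω) * (κ₁ * C * jumpMaj α ω (rt α t) (x - y) h) =
        κ₁ * C * holMaj α ω (rt α t) h := by
      rw [holMaj, ← integral_sub_left_eq_self
        (fun z => ‖z‖ ^ (2 * ω) * jumpMaj α ω (rt α t) z h) volume x, ← integral_const_mul]
      congr 1; ext y; ring
    rw [hzero, mul_zero, sub_zero, e3, e4] at key
    exact key.trans_eq (by ring)
  have hmeas : Measurable fun h => dlt α (act (q α n) t g) x h * levyK α m h :=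
    (measurable_dlt (P.differentiable_act_q hg.meas hg.bound ht) x).mul (measurable_levyK α hmm)
  have hi := (a2.const_mul (3 * A * (κ₁ * C))).mono' hmeas.aestronglyMeasurable hb
  refine ⟨hi, (integral_mono_ae hi.abs (a2.const_mul (3 * A * (κ₁ * C))) hb).trans ?_⟩
  rw [integral_const_mul, ← P.rpow_mul_profile_eq ht]
  calc _ ≤ 3 * A * (κ₁ * C) *
        (jumpMajC d α ω * mass d (α - 2 * ω) * rt α t ^ (-α + ω)) := by gcongr
    _ = _ := by ring

/-- The generator passes through the y-integral by Fubini. At fixed t the crude kernel bound is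
enough, so only boundedness of g is needed. -/
lemma act_bker_eq {g : Rn d → ℝ} {M : ℝ} (hgm : Measurable g) (hg : ∀ x, |g x| ≤ M) {t : ℝ}
    (ht : t ∈ Ioc (0 : ℝ) 1) (x : Rn d) :
    act (bker α n) t g x = ∫ h, dlt α (act (q α n) t g) x h * levyK α (n x) h := by
  have r0 := rt_pos α ht
  have r1 := rt_le_one P.h0 ht
  have hM : 0 ≤ M := (abs_nonneg _).trans (hg 0)
  set f : Rn d → Rn d → ℝ := fun y h => dlt α (pk α (n y) t) (x - y) h * levyK α (n x) h * g y with hf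
  have hm : Measurable (Function.uncurry f) := by
    have h1 := P.measurable_dlt_pk (t := fun _ : Rn d × Rn d => t) (z := fun w => x - w.1)
      (y := fun w => w.1) (h := fun w => w.2) (by fun_prop) (by fun_prop) (by fun_prop)
      (by fun_prop)
    have h2 := measurable_levyK α (P.measurable_n x)
    have h3 : Measurable fun w : Rn d × Rn d => levyK α (n x) w.2 := h2.fun_comp measurable_snd
    have h4 : Measurable fun w : Rn d × Rn d => g w.1 := hgm.fun_comp measurable_fst
    have h5 := (h1.mul h3).mul h4
    simp only [hf, Function.uncurry_def, P.dlt_pk ht.1]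
    exact h5
  have hi : Integrable (Function.uncurry f) ((volume : Measure (Rn d)).prod volume) := by
    refine (integrable_prod_of_bound hm.aestronglyMeasurable
      ((integrable_profile_sub P.h0 r0 x).const_mul
        (κ₁ * C * (jumpMajC d α ω * rt α t ^ (-(α + ω))) * M))
      (Eventually.of_forall fun y => ?_)).1
    have i1 := (P.reg t ht y).integrable_dlt P.hd P.h0 P.h2 r0 r1 (P.measurable_n x)
      (P.abs_n_le x) (x - y)
    have i2 : Integrable fun h => Function.uncurry f (y, h) := i1.mul_const (g y)
    refine ⟨i2, ?_⟩
    have hb : ∀ h, |Function.uncurry f (y, h)| ≤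
        κ₁ * C * M * jumpMaj α ω (rt α t) (x - y) h := by
      intro h
      simp only [hf, Function.uncurry]
      rw [abs_mul]
      have h1 := (P.reg t ht y).abs_dlt_mul_levyK_le P.h0 P.hω0 P.hω1' r0 r1 (P.abs_n_le x) (x - y) h
      calc _ ≤ κ₁ * C * jumpMaj α ω (rt α t) (x - y) h * M :=
            mul_le_mul h1 (hg y) (abs_nonneg _) ((abs_nonneg _).trans h1)
        _ = _ := by ring
    refine (integral_mono i2.abs ((integrable_jumpMaj P.hd P.h0 P.h2 P.hω0 r0 (x - y)).const_mul _)
      hb).trans ?_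
    rw [integral_const_mul]
    have hκ := P.hκ₁
    have hC := P.hC
    calc _ ≤ κ₁ * C * M * (jumpMajC d α ω * rt α t ^ (-(α + ω)) * profile α (rt α t) (x - y)) := by
          gcongr
          exact integral_jumpMaj_le P.hd P.h0 P.h2 P.hω0 r0 r1 _
      _ = _ := by ring
  have e1 : act (bker α n) t g x = ∫ y, ∫ h, f y h := by
    simp only [act, bker, hf, integral_mul_const]
  rw [e1, integral_integral_swap hi]
  congr 1; ext h
  rw [(P.dlt_act_q hgm hg ht x h).2, ← integral_mul_const]
  congr 1; ext y
  simp only [hf]; ring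

lemma abs_act_bker_le {g : Rn d → ℝ} {A : ℝ} (hg : Hol ω A g) {t : ℝ} (ht : t ∈ Ioc (0 : ℝ) 1)
    (x : Rn d) : |act (bker α n) t g x| ≤
      3 * κ₁ * C * jumpMajC d α ω * mass d (α - 2 * ω) * A * t ^ (ω / α - 1) := by
  rw [P.act_bker_eq hg.meas hg.bound ht]
  exact abs_integral_le_integral_abs.trans
    (P.integrable_dlt_act_q hg ht (P.measurable_n x) (P.abs_n_le x) x).2

end Param

end

/-! ### Continuity in (t,x) and the time evolution of the frozen kernel -/

section

open Filter Topology

attribute [local irreducible] profile psi fullExp pk levyK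

lemma profile_le_rpow_mul {α r₀ r : ℝ} (h0 : 0 < α) (hr₀ : 0 < r₀) (h : r₀ ≤ r) (hr1 : r ≤ 1)
    (x : Rn d) : profile α r x ≤ r₀ ^ (-α) * profile α r₀ x := by
  have hr : 0 < r := hr₀.trans_le h
  unfold profile
  have e1 : r ^ α ≤ 1 := Real.rpow_le_one hr.le hr1 h0.le
  have e2 : (r + ‖x‖) ^ (-((d : ℝ) + α)) ≤ (r₀ + ‖x‖) ^ (-((d : ℝ) + α)) :=
    Real.rpow_le_rpow_of_nonpos (by positivity) (by linarith)
      (neg_nonpos.2 (by positivity))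
  have e3 : r₀ ^ (-α) * (r₀ ^ α * (r₀ + ‖x‖) ^ (-((d : ℝ) + α))) =
      1 * (r₀ + ‖x‖) ^ (-((d : ℝ) + α)) := by
    rw [← mul_assoc, ← Real.rpow_add hr₀]; simp
  rw [e3]
  exact mul_le_mul e1 e2 (by positivity) zero_le_one

/-- Regularity at scale r implies regularity at a smaller scale r₀ with a constant depending on r₀
only. One majorant thus serves all times in [s₀, 1] for dominated convergence. -/
lemma Reg.rescale {α r₀ r A : ℝ} {g : Rn d → ℝ} (hg : Reg α r A g) (h0 : 0 < α) (hr₀ : 0 < r₀)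
    (h : r₀ ≤ r) (hr1 : r ≤ 1) : Reg α r₀ (A * r₀ ^ (-α)) g := by
  have hr : 0 < r := hr₀.trans_le h
  have hA := hg.nonneg hr
  have hd (a : Rn d) : ‖a‖ / r ≤ ‖a‖ / r₀ := by gcongr
  have hd0 (a : Rn d) : 0 ≤ ‖a‖ / r := by positivity
  have hp (x : Rn d) := profile_le_rpow_mul h0 hr₀ h hr1 x
  have hp0 (x : Rn d) := profile_nonneg (γ := α) hr x
  refine ⟨hg.diff, fun x => (hg.bound x).trans ?_, fun a x ha => (hg.bound_one a x (ha.trans h)).trans ?_,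
    fun a b x ha hb => (hg.bound_two a b x (ha.trans h) (hb.trans h)).trans ?_⟩
  · calc _ ≤ A * (r₀ ^ (-α) * profile α r₀ x) := mul_le_mul_of_nonneg_left (hp x) hA
      _ = _ := by ring
  · calc _ ≤ A * (‖a‖ / r₀) * (r₀ ^ (-α) * profile α r₀ x) :=
          mul_le_mul (mul_le_mul_of_nonneg_left (hd a) hA) (hp x) (hp0 x) (by positivity)
      _ = _ := by ring
  · calc _ ≤ A * (‖a‖ / r₀ * (‖b‖ / r₀)) * (r₀ ^ (-α) * profile α r₀ x) :=
          mul_le_mul (mul_le_mul_of_nonneg_left (mul_le_mul (hd a) (hd b) (hd0 b) (by positivity)) hA)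
            (hp x) (hp0 x) (by positivity)
      _ = _ := by ring

lemma jumpMaj_shift_le {α ω r : ℝ} (h0 : 0 < α) (hr : 0 < r) {x a : Rn d} (ha : ‖a‖ ≤ r)
    (h : Rn d) : jumpMaj α ω r (x + a) h ≤ 2 ^ ((d : ℝ) + α) * jumpMaj α ω r x h := by
  have e1 := profile_shift_le (x := x) h0 hr ha
  have e2 := profile_shift_le (x := x + h) h0 hr ha
  have e3 := jwr_nonneg (α := α) (ω := ω) hr h
  have e4 := profile_nonneg (γ := α) hr h
  unfold jumpMaj
  rw [show x + a + h = x + h + a by abel]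
  have f1 : 2 * r ^ (-ω) * (jwr α ω r h * profile α r (x + a)) ≤
      2 * r ^ (-ω) * (jwr α ω r h * (2 ^ ((d : ℝ) + α) * profile α r x)) := by gcongr
  have f2 : 2 ^ ((d : ℝ) + α) * r ^ (-α) * (profile α r (x + h + a) * profile α r h) ≤
      2 ^ ((d : ℝ) + α) * r ^ (-α) *
        ((2 ^ ((d : ℝ) + α) * profile α r (x + h)) * profile α r h) := by gcongr
  linarith

lemma norm_fullExp_le (α : ℝ) (u h : Rn d) : ‖fullExp α u h‖ ≤ (2 + ‖h‖) * (1 + ‖u‖) ^ 1 := by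
  unfold fullExp
  have h1 := norm_exp_I_mul_real (inner ℝ u h)
  have h2 : ‖(chi α h : ℂ) * (Complex.I * (inner ℝ u h : ℝ))‖ ≤ 1 * (‖u‖ * ‖h‖) := by
    rw [norm_mul, norm_mul, Complex.norm_I, one_mul, Complex.norm_real, Complex.norm_real]
    exact mul_le_mul (abs_chi_le α h) (norm_inner_le_norm u h) (norm_nonneg _) zero_le_one
  have h3 := norm_sub_le (Complex.exp (Complex.I * (inner ℝ u h : ℝ)) - 1)
    ((chi α h : ℂ) * (Complex.I * (inner ℝ u h : ℝ)))
  have h4 := norm_sub_le (Complex.exp (Complex.I * (inner ℝ u h : ℝ))) 1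
  rw [norm_one] at h4
  have := norm_nonneg u
  have := norm_nonneg h
  nlinarith

/-- A kernel bound that is uniform away from time zero. -/
lemma Ker.abs_le_of_le {α γ b A : ℝ} {K : ℝ → Rn d → Rn d → ℝ} (hK : Ker α γ b A K) (h0 : 0 < α)
    (hγ : 0 < γ) (hb : b ≤ 1) {s₀ s : ℝ} (hs₀ : 0 < s₀) (hs : s ∈ Icc s₀ 1) (x y : Rn d) :
    |K s x y| ≤ A * (s₀ ^ (b - 1) * ((rt α s₀)⁻¹ ^ ((d : ℝ) + γ) * profile γ 1 (x - y))) := by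
  have hs' : s ∈ Ioc (0 : ℝ) 1 := ⟨hs₀.trans_le hs.1, hs.2⟩
  have hs₀' : s₀ ∈ Ioc (0 : ℝ) 1 := ⟨hs₀, hs.1.trans hs.2⟩
  refine (hK.bound s hs' x y).trans (mul_le_mul_of_nonneg_left ?_ hK.nonneg)
  have h1 := profile_le_one_scale hγ (rt_pos α hs₀') (rt_mono h0 hs₀.le hs.1) (rt_le_one h0 hs')
    (x - y)
  exact mul_le_mul (Real.rpow_le_rpow_of_nonpos hs₀ hs.1 (by linarith)) h1
    (profile_nonneg (rt_pos α hs') _) (by positivity)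

/-- If a property of continuity holds on `[s₀, 1]` for all `s₀ > 0`, it holds on `(0, 1]`. -/
lemma continuousOn_Ioc_of_Icc {X : Type*} [TopologicalSpace X] {f : ℝ × X → ℝ}
    (h : ∀ s₀ > 0, ContinuousOn f (Icc s₀ 1 ×ˢ univ)) : ContinuousOn f (Ioc (0 : ℝ) 1 ×ˢ univ) := by
  rintro ⟨t, x⟩ ⟨ht, -⟩
  have ht' : t / 2 < t := by linarith [ht.1]
  refine (h (t / 2) (half_pos ht.1) (t, x) ⟨⟨ht'.le, ht.2⟩, mem_univ _⟩).mono_of_mem_nhdsWithin ?_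
  have h1 : Ioi (t / 2) ×ˢ (univ : Set X) ∈ 𝓝 (t, x) :=
    prod_mem_nhds (Ioi_mem_nhds ht') univ_mem
  refine mem_of_superset (inter_mem_nhdsWithin _ h1) ?_
  rintro ⟨s, z⟩ ⟨⟨hs, -⟩, hs', -⟩
  exact ⟨⟨le_of_lt hs', hs.2⟩, mem_univ _⟩

lemma Ker.continuousOn_act {α γ b A M : ℝ} {K : ℝ → Rn d → Rn d → ℝ} (hK : Ker α γ b A K)
    (h0 : 0 < α) (hγ : 0 < γ) (hb : b ≤ 1)
    (hc : ∀ y, ContinuousOn (fun w : ℝ × Rn d => K w.1 w.2 y) (Ioc 0 1 ×ˢ univ))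
    {g : Rn d → ℝ} (hgm : Measurable g) (hg : ∀ x, |g x| ≤ M) :
    ContinuousOn (fun w : ℝ × Rn d => act K w.1 g w.2) (Ioc 0 1 ×ˢ univ) := by
  have hM : 0 ≤ M := (abs_nonneg _).trans (hg 0)
  refine continuousOn_Ioc_of_Icc fun s₀ hs₀ => ?_
  rintro ⟨t, x⟩ ⟨ht, -⟩
  have hsub : Icc s₀ 1 ⊆ Ioc (0 : ℝ) 1 := fun s hs => ⟨hs₀.trans_le hs.1, hs.2⟩
  have hA := hK.nonneg
  have hr₀ : 0 ≤ rt α s₀ := Real.rpow_nonneg hs₀.le _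
  unfold act
  refine continuousWithinAt_of_dominated
    (bound := fun y => A * (s₀ ^ (b - 1) * ((rt α s₀)⁻¹ ^ ((d : ℝ) + γ) *
      (2 ^ ((d : ℝ) + γ) * profile γ 1 (x - y)))) * M) ?_ ?_ ?_ ?_
  · filter_upwards [self_mem_nhdsWithin] with w hw
    exact ((hK.meas.measurable_right (hsub hw.1) w.2).mul hgm).aestronglyMeasurable
  · have hball : ∀ᶠ w : ℝ × Rn d in 𝓝[Icc s₀ 1 ×ˢ univ] (t, x), ‖w.2 - x‖ < 1 := by
      have : Continuous fun w : ℝ × Rn d => ‖w.2 - x‖ := by fun_prop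
      exact (this.continuousWithinAt.eventually (Iio_mem_nhds (by simp)))
    filter_upwards [self_mem_nhdsWithin, hball] with w hw hw'
    refine Eventually.of_forall fun y => ?_
    rw [norm_mul]
    refine mul_le_mul ((hK.abs_le_of_le h0 hγ hb hs₀ hw.1 w.2 y).trans ?_) (hg y) (norm_nonneg _) ?_
    · have := profile_shift_le (x := x - y) hγ one_pos hw'.le
      rw [show x - y + (w.2 - x) = w.2 - y by abel] at this
      gcongr
    · have := profile_nonneg (γ := γ) one_pos (x - y)
      positivity
  · exact ((((integrable_profile_sub hγ one_pos x).const_mul _).const_mul _).const_mul _).const_mul _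
      |>.mul_const _
  · refine Eventually.of_forall fun y => ?_
    exact ((hc y).mono (prod_mono hsub subset_rfl) (t, x) ⟨ht, mem_univ _⟩).mul_const _

namespace Param

variable {α ω κ₀ κ₁ L C : ℝ} {n : Rn d → Rn d → ℝ} (P : Param d α ω κ₀ κ₁ L C n)

include P

lemma continuous_coeff (h : Rn d) : Continuous fun x => n x h := by
  refine continuous_iff_continuousAt.2 fun x => ?_
  rw [ContinuousAt, tendsto_iff_norm_sub_tendsto_zero]
  have h1 : Tendsto (fun y : Rn d => L * ‖y - x‖ ^ (4 * ω)) (𝓝 x) (𝓝 (L * ‖x - x‖ ^ (4 * ω))) := by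
    have : Continuous fun y : Rn d => L * ‖y - x‖ ^ (4 * ω) :=
      continuous_const.mul ((continuous_id.sub continuous_const).norm.rpow_const
        fun _ => Or.inr (by have := P.hω0; positivity))
    exact this.tendsto x
  have h2 : (0 : ℝ) < 4 * ω := by have := P.hω0; positivity
  rw [sub_self, norm_zero, Real.zero_rpow h2.ne', mul_zero] at h1
  exact squeeze_zero (fun _ => norm_nonneg _) (fun y => P.holder y x h) h1

lemma continuousOn_q (y : Rn d) :
    ContinuousOn (fun w : ℝ × Rn d => q α n w.1 w.2 y) (Ioc 0 1 ×ˢ univ) := by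
  have h1 := continuousOn_rfint_mul_exp P.hd P.h0 P.h2 P.hκ₀ (P.coeff y) (M := fun _ => 1)
    measurable_const (A := 1) (p := 0) (by simp)
  have h2 : ContinuousOn (fun w : ℝ × Rn d => (w.1, w.2 - y)) (Ioc 0 1 ×ˢ univ) := by fun_prop
  refine (h1.comp h2 fun w hw => ⟨hw.1.1, mem_univ _⟩).congr fun w _ => ?_
  simp [q_eq, pk_eq]

lemma continuousOn_dlt (y h : Rn d) : ContinuousOn
    (fun w : ℝ × Rn d => dlt α (pk α (n y) w.1) (w.2 - y) h) (Ioc 0 1 ×ˢ univ) := by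
  have h1 := continuousOn_rfint_mul_exp P.hd P.h0 P.h2 P.hκ₀ (P.coeff y)
    (M := fun u => fullExp α u h)
    ((measurable_fullExp α).fun_comp (measurable_id.prodMk measurable_const)) (A := 2 + ‖h‖) (p := 1)
    (fun u => norm_fullExp_le α u h)
  have h2 : ContinuousOn (fun w : ℝ × Rn d => (w.1, w.2 - y)) (Ioc 0 1 ×ˢ univ) := by fun_prop
  refine (h1.comp h2 fun w hw => ⟨hw.1.1, mem_univ _⟩).congr fun w hw => ?_
  exact P.dlt_pk hw.1.1 y (w.2 - y) h

lemma continuousOn_bker (y : Rn d) :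
    ContinuousOn (fun w : ℝ × Rn d => bker α n w.1 w.2 y) (Ioc 0 1 ×ˢ univ) := by
  refine continuousOn_Ioc_of_Icc fun s₀ hs₀ => ?_
  rintro ⟨t, x⟩ ⟨ht, -⟩
  have hsub : Icc s₀ 1 ⊆ Ioc (0 : ℝ) 1 := fun s hs => ⟨hs₀.trans_le hs.1, hs.2⟩
  have hs₀' : s₀ ∈ Ioc (0 : ℝ) 1 := ⟨hs₀, ht.1.trans ht.2⟩
  have r0 := rt_pos α hs₀'
  have r1 := rt_le_one P.h0 hs₀'
  have hκ := P.hκ₁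
  have hC := P.hC
  unfold bker
  refine continuousWithinAt_of_dominated (bound := fun h => κ₁ * (C * rt α s₀ ^ (-α)) *
      (2 ^ ((d : ℝ) + α) * jumpMaj α ω (rt α s₀) (x - y) h)) ?_ ?_ ?_ ?_
  · filter_upwards [self_mem_nhdsWithin] with w hw
    exact ((measurable_dlt (P.reg _ (hsub hw.1) y).diff _).mul
      (measurable_levyK α (P.measurable_n w.2))).aestronglyMeasurable
  · have hball : ∀ᶠ w : ℝ × Rn d in 𝓝[Icc s₀ 1 ×ˢ univ] (t, x), ‖w.2 - x‖ < rt α s₀ := by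
      have : Continuous fun w : ℝ × Rn d => ‖w.2 - x‖ := by fun_prop
      exact (this.continuousWithinAt.eventually (Iio_mem_nhds (by simpa using r0)))
    filter_upwards [self_mem_nhdsWithin, hball] with w hw hw'
    refine Eventually.of_forall fun h => ?_
    have hreg := (P.reg _ (hsub hw.1) y).rescale P.h0 r0 (rt_mono P.h0 hs₀.le hw.1.1)
      (rt_le_one P.h0 (hsub hw.1))
    refine (hreg.abs_dlt_mul_levyK_le P.h0 P.hω0 P.hω1' r0 r1 (P.abs_n_le w.2) (w.2 - y) h).trans ?_
    have := jumpMaj_shift_le (α := α) (ω := ω) (x := x - y) P.h0 r0 hw'.le h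
    rw [show x - y + (w.2 - x) = w.2 - y by abel] at this
    exact mul_le_mul_of_nonneg_left this (by positivity)
  · exact ((integrable_jumpMaj P.hd P.h0 P.h2 P.hω0 r0 (x - y)).const_mul _).const_mul _
  · refine Eventually.of_forall fun h => ?_
    have h1 := (P.continuousOn_dlt y h).mono (prod_mono hsub subset_rfl) (t, x) ⟨ht, mem_univ _⟩
    refine h1.mul ?_
    have h2 : Continuous fun w : ℝ × Rn d => levyK α (n w.2) h := by
      have := (P.continuous_coeff h).comp (continuous_snd (X := ℝ) (Y := Rn d))
      unfold levyK
      exact this.mul_const _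
    exact h2.continuousWithinAt

lemma hβ1 : ω / α ≤ 1 := by
  rw [div_le_one P.h0]
  have := P.hω0
  have := P.hω2
  linarith

lemma continuousOn_act_q {g : Rn d → ℝ} {M : ℝ} (hgm : Measurable g) (hg : ∀ x, |g x| ≤ M) :
    ContinuousOn (fun w : ℝ × Rn d => act (q α n) w.1 g w.2) (Ioc 0 1 ×ˢ univ) :=
  P.ker_q.continuousOn_act P.h0 P.hγ le_rfl P.continuousOn_q hgm hg

lemma continuousOn_act_bker {g : Rn d → ℝ} {M : ℝ} (hgm : Measurable g) (hg : ∀ x, |g x| ≤ M) :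
    ContinuousOn (fun w : ℝ × Rn d => act (bker α n) w.1 g w.2) (Ioc 0 1 ×ˢ univ) :=
  P.ker_bker.continuousOn_act P.h0 P.h0 (by have := P.hβ; linarith) P.continuousOn_bker hgm hg

lemma hasDerivAt_act_q {g : Rn d → ℝ} {M : ℝ} (hgm : Measurable g) (hg : ∀ x, |g x| ≤ M) {t : ℝ}
    (ht : t ∈ Ioo (0 : ℝ) 1) (x : Rn d) :
    HasDerivAt (fun s => act (q α n) s g x) (act (bfro α n) t g x) t := by
  have hM : 0 ≤ M := (abs_nonneg _).trans (hg 0)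
  have ht2 : 0 < t / 2 := half_pos ht.1
  have hS : Ioo (t / 2) 1 ∈ 𝓝 t := Ioo_mem_nhds (by linarith [ht.1]) ht.2
  have hsub : ∀ s ∈ Ioo (t / 2) 1, s ∈ Ioc (0 : ℝ) 1 := fun s hs => ⟨ht2.trans hs.1, hs.2.le⟩
  have ht' : t ∈ Ioc (0 : ℝ) 1 := ⟨ht.1, ht.2.le⟩
  unfold act
  refine (hasDerivAt_integral_of_dominated_loc_of_deriv_le (F := fun s y => q α n s x y * g y)
    (F' := fun s y => bfro α n s x y * g y)
    (bound := fun y => κ₁ * C * jumpMajC d α ω * ((t / 2) ^ (-(ω / α) - 1) *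
      ((rt α (t / 2))⁻¹ ^ ((d : ℝ) + α) * profile α 1 (x - y))) * M) hS ?_ ?_ ?_ ?_ ?_ ?_).2
  · filter_upwards [hS] with s hs
    exact ((P.measKer_q.measurable_right (hsub s hs) x).mul hgm).aestronglyMeasurable
  · exact P.ker_q.integrable_act P.hγ hgm hg ht' x
  · exact ((P.measKer_bfro.measurable_right ht' x).mul hgm).aestronglyMeasurable
  · refine Eventually.of_forall fun y s hs => ?_
    rw [norm_mul]
    have hb := P.ker_bfro.abs_le_of_le P.h0 P.h0 (by have := P.hβ; linarith) ht2
      (show s ∈ Icc (t / 2) 1 from ⟨hs.1.le, hs.2.le⟩) x y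
    exact mul_le_mul hb (hg y) (norm_nonneg _) ((abs_nonneg _).trans hb)
  · exact ((((integrable_profile_sub P.h0 one_pos x).const_mul _).const_mul _).const_mul _).mul_const _
  · refine Eventually.of_forall fun y s hs => ?_
    have h1 := hasDerivAt_pk P.hd P.h0 P.h2 P.hκ₀ (P.coeff y) (hsub s hs).1 (x - y)
    rw [jumpOp_eq P.hd] at h1
    simp only [q_eq]
    exact h1.mul_const (g y)

/-- Writing the frozen kernel as 𝒜q − F transfers to it the cancellation bound for 𝒜q, since F is
integrable in time already. -/
lemma act_bfro_eq {g : Rn d → ℝ} {M : ℝ} (hgm : Measurable g) (hg : ∀ x, |g x| ≤ M) {t : ℝ}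
    (ht : t ∈ Ioc (0 : ℝ) 1) (x : Rn d) :
    act (bfro α n) t g x = act (bker α n) t g x - act (F α n) t g x := by
  unfold act
  rw [← integral_sub (P.ker_bker.integrable_act P.h0 hgm hg ht x)
    (P.ker_F.integrable_act P.hγ hgm hg ht x)]
  refine integral_congr_ae (Eventually.of_forall fun y => ?_)
  simp only [P.F_eq_sub]
  ring

/-- The action of the frozen kernel on Hölder functions has an integrable singularity in time. -/
lemma exists_abs_act_bfro_le : ∃ D ≥ 0, ∀ (g : Rn d → ℝ) (A : ℝ), Hol ω A g →
    ∀ t ∈ Ioc (0 : ℝ) 1, ∀ x, |act (bfro α n) t g x| ≤ D * A * t ^ (ω / α - 1) := by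
  have hC := P.hC
  have hκ := P.hκ₁
  have hJ := jumpMajC_nonneg d α ω
  have hm := mass_nonneg (d := d) (α - 2 * ω)
  have hF := P.ker_F.nonneg
  have hm' := mass_nonneg (d := d) (α - 4 * ω)
  refine ⟨3 * κ₁ * C * jumpMajC d α ω * mass d (α - 2 * ω) +
    L * C * jumpMajC d α ω * mass d (α - 4 * ω), by positivity, fun g A hg t ht x => ?_⟩
  rw [P.act_bfro_eq hg.meas hg.bound ht]
  have h1 := P.abs_act_bker_le hg ht x
  have h2 := P.ker_F.abs_act_le P.hγ hg.meas hg.bound ht x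
  refine (abs_sub _ _).trans ?_
  refine (add_le_add h1 h2).trans_eq ?_
  ring

/-- The fundamental theorem of calculus on [0, t]: cancellation provides both continuity at time
zero with value g(x) and integrability of the derivative up to time zero. -/
lemma act_q_eq_add_integral {g : Rn d → ℝ} {A : ℝ} (hg : Hol ω A g) {t : ℝ}
    (ht : t ∈ Ioc (0 : ℝ) 1) (x : Rn d) : IntegrableOn (fun s => act (bfro α n) s g x) (Ioo 0 t) ∧
    act (q α n) t g x = g x + ∫ s in Ioo 0 t, act (bfro α n) s g x := by
  obtain ⟨D, hD, hbd⟩ := P.exists_abs_act_bfro_le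
  -- The formula for q has no meaning as a density at s = 0, so the initial value is inserted by
  -- hand.
  set f : ℝ → ℝ := fun s => if s = 0 then g x else act (q α n) s g x with hf
  have hfpos : ∀ s, 0 < s → f s = act (q α n) s g x := fun s hs => by simp [hf, hs.ne']
  have hcont : ContinuousOn f (Icc 0 t) := by
    intro s hs
    rcases hs.1.eq_or_lt with h | h
    · subst h
      have hf0 : f 0 = g x := by simp [hf]
      rw [ContinuousWithinAt, hf0, tendsto_iff_norm_sub_tendsto_zero]
      have h1 : Tendsto (fun s : ℝ => 3 * C * mass d (α - 2 * ω) * A * s ^ (2 * ω / α))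
          (𝓝[Icc 0 t] 0) (𝓝 0) := by
        have hp : 0 < 2 * ω / α := by have := P.hω0; have := P.h0; positivity
        have : Continuous fun s : ℝ => 3 * C * mass d (α - 2 * ω) * A * s ^ (2 * ω / α) :=
          continuous_const.mul (Real.continuous_rpow_const hp.le)
        have h2 := this.tendsto 0
        rw [Real.zero_rpow hp.ne', mul_zero] at h2
        exact h2.mono_left nhdsWithin_le_nhds
      refine squeeze_zero' (Eventually.of_forall fun _ => norm_nonneg _) ?_ h1
      filter_upwards [self_mem_nhdsWithin] with s hs
      rcases hs.1.eq_or_lt with h | h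
      · subst h
        rw [hf0, sub_self, norm_zero]
        have := P.hC
        have := mass_nonneg (d := d) (α - 2 * ω)
        have := hg.nonneg
        have := Real.rpow_nonneg (le_refl (0 : ℝ)) (2 * ω / α)
        positivity
      · rw [hfpos s h]
        have hs' : s ∈ Ioc (0 : ℝ) 1 := ⟨h, hs.2.trans ht.2⟩
        have := P.abs_act_q_sub_le hg hs' x
        rwa [rt_rpow hs'] at this
    · have h1 := P.continuousOn_act_q hg.meas hg.bound
      have h2 : ContinuousOn (fun s : ℝ => act (q α n) s g x) (Ioc 0 1) :=
        h1.comp (f := fun s : ℝ => (s, x)) (by fun_prop) fun s hs => ⟨hs, mem_univ _⟩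
      have h3 : ContinuousOn (fun s : ℝ => act (q α n) s g x) (Ioc 0 t) :=
        h2.mono (Ioc_subset_Ioc_right ht.2)
      have h4 := h3 s ⟨h, hs.2⟩
      refine (h4.mono_of_mem_nhdsWithin ?_).congr_of_eventuallyEq ?_ (hfpos s h)
      · exact mem_of_superset (inter_mem_nhdsWithin _ (Ioi_mem_nhds h)) fun r hr => ⟨hr.2, hr.1.2⟩
      · filter_upwards [mem_nhdsWithin_of_mem_nhds (Ioi_mem_nhds h)] with r hr
        exact hfpos r hr
  have hderiv : ∀ s ∈ Ioo (0 : ℝ) t, HasDerivAt f (act (bfro α n) s g x) s := by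
    intro s hs
    refine (P.hasDerivAt_act_q hg.meas hg.bound ⟨hs.1, hs.2.trans_le ht.2⟩ x).congr_of_eventuallyEq ?_
    filter_upwards [Ioi_mem_nhds hs.1] with r hr
    exact hfpos r hr
  have hint : IntervalIntegrable (fun s => act (bfro α n) s g x) volume 0 t := by
    rw [intervalIntegrable_iff_integrableOn_Ioo_of_le ht.1.le]
    have hi : IntegrableOn (fun s : ℝ => D * A * s ^ (ω / α - 1)) (Ioo 0 t) := by
      refine Integrable.const_mul ?_ _
      have := intervalIntegral.intervalIntegrable_rpow' (a := 0) (b := t) (r := ω / α - 1)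
        (by have := P.hβ; linarith)
      exact (intervalIntegrable_iff_integrableOn_Ioo_of_le ht.1.le).1 this
    refine Integrable.mono' hi ?_ ?_
    · obtain ⟨G, hGm, hG⟩ := P.measKer_bfro.measurable_act (Fam.const hg.meas hg.nonneg hg.bound)
      refine ((hGm.fun_comp (g := G) (f := fun s : ℝ => (s, (1 : ℝ), x))
        (by fun_prop)).aestronglyMeasurable).congr ?_
      filter_upwards [ae_restrict_mem measurableSet_Ioo] with s hs
      exact (hG s (mem_Ioc_of_Ioo ht hs) 1 ⟨one_pos, le_rfl⟩ x).symm
    · filter_upwards [ae_restrict_mem measurableSet_Ioo] with s hs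
      exact hbd g A hg s (mem_Ioc_of_Ioo ht hs) x
  have key := intervalIntegral.integral_eq_sub_of_hasDerivAt_of_le ht.1.le hcont hderiv hint
  rw [intervalIntegral.integral_of_le ht.1.le, integral_Ioc_eq_integral_Ioo, hfpos t ht.1] at key
  refine ⟨(intervalIntegrable_iff_integrableOn_Ioo_of_le ht.1.le).1 hint, ?_⟩
  rw [key]
  simp [hf]

end Param

end

/-! ### Continuity of singular time integrals -/

section

open Filter Topology

attribute [local irreducible] profile psi fullExp pk levyK

/-- Half of the exponent at the singularity s = t is sacrificed for the smallness factor ε^{a/2};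
the other half keeps the weight integrable. -/
lemma betaW_le_mul {a b t s ε : ℝ} (ha : 0 < a) (hs : s ∈ Ioo 0 t) (h : t - ε ≤ s) :
    betaW a b t s ≤ ε ^ (a / 2) * betaW (a / 2) b t s := by
  have h1 : 0 < t - s := sub_pos.2 hs.2
  have h2 : (t - s) ^ (a - 1) = (t - s) ^ (a / 2) * (t - s) ^ (a / 2 - 1) := by
    rw [← Real.rpow_add h1]; ring_nf
  unfold betaW
  rw [h2, mul_assoc]
  have h3 : (t - s) ^ (a / 2) ≤ ε ^ (a / 2) :=
    Real.rpow_le_rpow h1.le (by linarith) (half_pos ha).le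
  exact mul_le_mul_of_nonneg_right h3
    (mul_nonneg (Real.rpow_nonneg h1.le _) (Real.rpow_nonneg hs.1.le _))

lemma integrableOn_rpow_Ioo {b t : ℝ} (hb : 0 < b) (ht : 0 ≤ t) :
    IntegrableOn (fun s : ℝ => s ^ (b - 1)) (Ioo 0 t) :=
  (intervalIntegrable_iff_integrableOn_Ioo_of_le ht).1
    (intervalIntegral.intervalIntegrable_rpow' (by linarith))

/-- Continuity of integrals over `(0, t)` whose integrand has a singularity of Beta type. -/
lemma continuousOn_integral_Ioo {X : Type*} [TopologicalSpace X] [FirstCountableTopology X]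
    {G : ℝ → ℝ → X → ℝ} {a b c : ℝ} (ha : 0 < a) (ha1 : a ≤ 1) (hb : 0 < b) (hc : 0 ≤ c)
    (hm : ∀ t ∈ Ioc (0 : ℝ) 1, ∀ x,
      AEStronglyMeasurable (fun s => G t s x) (volume.restrict (Ioo 0 t)))
    (hbd : ∀ t ∈ Ioc (0 : ℝ) 1, ∀ s ∈ Ioo 0 t, ∀ x, |G t s x| ≤ c * betaW a b t s)
    (hG : ∀ s ∈ Ioo (0 : ℝ) 1, ContinuousOn (fun w : ℝ × X => G w.1 s w.2) (Ioc s 1 ×ˢ univ)) :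
    ContinuousOn (fun w : ℝ × X => ∫ s in Ioo 0 w.1, G w.1 s w.2) (Ioc 0 1 ×ˢ univ) := by
  refine continuousOn_Ioc_of_Icc fun t₀ ht₀ => ?_
  have hint : ∀ t ∈ Ioc (0 : ℝ) 1, ∀ x, IntegrableOn (fun s => G t s x) (Ioo 0 t) := by
    intro t ht x
    refine Integrable.mono' ((integrableOn_betaW ha hb ht.1).const_mul c) (hm t ht x) ?_
    filter_upwards [ae_restrict_mem measurableSet_Ioo] with s hs
    exact hbd t ht s hs x
  refine continuousOn_of_uniform_approx_of_continuousOn fun U hU => ?_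
  obtain ⟨η, hη, hU'⟩ := Metric.mem_uniformity_dist.1 hU
  -- the part of the integral close to `s = t` is uniformly small
  obtain ⟨ε, hε, hεη⟩ : ∃ ε > 0, ε ^ (a / 2) * (c * ((t₀ ^ (-1 : ℝ)) * betaI (a / 2) b)) < η := by
    have h1 : Continuous fun ε : ℝ => ε ^ (a / 2) * (c * ((t₀ ^ (-1 : ℝ)) * betaI (a / 2) b)) :=
      (Real.continuous_rpow_const (half_pos ha).le).mul continuous_const
    have h2 := h1.tendsto 0
    rw [Real.zero_rpow (half_pos ha).ne', zero_mul] at h2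
    have h3 : ∀ᶠ ε in 𝓝[>] (0 : ℝ), ε ^ (a / 2) * (c * ((t₀ ^ (-1 : ℝ)) * betaI (a / 2) b)) < η :=
      (h2.mono_left nhdsWithin_le_nhds).eventually (Iio_mem_nhds hη)
    obtain ⟨ε, h4, h5⟩ := (h3.and self_mem_nhdsWithin).exists
    exact ⟨ε, h5, h4⟩
  -- Cutting at t − ε removes the moving singularity. The truncated integrals are continuous by
  -- dominated convergence and approximate the full one uniformly for t ≥ t₀.
  refine ⟨fun w => ∫ s in Ioo 0 w.1 ∩ Iio (w.1 - ε), G w.1 s w.2, ?_, ?_⟩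
  · rintro ⟨t, x⟩ ⟨ht, -⟩
    have ht' : t ∈ Ioc (0 : ℝ) 1 := ⟨ht₀.trans_le ht.1, ht.2⟩
    have e : ∀ w : ℝ × X, w.1 ≤ 1 → ∫ s in Ioo 0 w.1 ∩ Iio (w.1 - ε), G w.1 s w.2 =
        ∫ s in Ioo (0 : ℝ) 1, (Iio (w.1 - ε)).indicator (fun s => G w.1 s w.2) s := by
      intro w hw
      rw [setIntegral_indicator measurableSet_Iio]
      congr 2
      ext s
      simp only [mem_inter_iff, mem_Ioo, mem_Iio]
      constructor
      · rintro ⟨⟨h1, h2⟩, h3⟩; exact ⟨⟨h1, h2.trans_le hw⟩, h3⟩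
      · rintro ⟨⟨h1, h2⟩, h3⟩; exact ⟨⟨h1, by linarith⟩, h3⟩
    refine ContinuousWithinAt.congr (f := fun w : ℝ × X => ∫ s in Ioo (0 : ℝ) 1,
      (Iio (w.1 - ε)).indicator (fun s => G w.1 s w.2) s) ?_ (fun w hw => e w hw.1.2) (e _ ht.2)
    refine continuousWithinAt_of_dominated
      (bound := fun s => c * ε ^ (a - 1) * s ^ (b - 1)) ?_ ?_ ?_ ?_
    · filter_upwards [self_mem_nhdsWithin] with w hw
      rw [aestronglyMeasurable_indicator_iff measurableSet_Iio,
        Measure.restrict_restrict measurableSet_Iio]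
      refine (hm w.1 ⟨ht₀.trans_le hw.1.1, hw.1.2⟩ w.2).mono_measure
        (Measure.restrict_mono ?_ le_rfl)
      rintro s ⟨h1, h2⟩
      exact ⟨h2.1, by have := mem_Iio.1 h1; linarith⟩
    · filter_upwards [self_mem_nhdsWithin] with w hw
      filter_upwards [ae_restrict_mem measurableSet_Ioo] with s hs
      have hs0 := Real.rpow_nonneg hs.1.le (b - 1)
      by_cases h : s < w.1 - ε
      · rw [indicator_of_mem (by exact h)]
        refine (hbd w.1 ⟨ht₀.trans_le hw.1.1, hw.1.2⟩ s ⟨hs.1, by linarith⟩ w.2).trans ?_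
        unfold betaW
        rw [mul_assoc]
        refine mul_le_mul_of_nonneg_left (mul_le_mul_of_nonneg_right ?_ hs0) hc
        exact Real.rpow_le_rpow_of_nonpos hε (by linarith) (by linarith)
      · rw [indicator_of_notMem (by exact h), norm_zero]
        positivity
    · exact (integrableOn_rpow_Ioo hb zero_le_one).const_mul _
    -- The cut-off indicator is discontinuous only at s = t − ε, a null set. Everywhere else it is
    -- constant for nearby times.
    · have hne : ∀ᵐ s ∂(volume.restrict (Ioo (0 : ℝ) 1)), s ≠ t - ε :=
        ae_restrict_of_ae (Measure.ae_ne volume _)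
      filter_upwards [hne, ae_restrict_mem measurableSet_Ioo] with s hs hs1
      rcases lt_or_gt_of_ne hs with h | h
      · have hev : ∀ᶠ w : ℝ × X in 𝓝[Icc t₀ 1 ×ˢ univ] (t, x), s < w.1 - ε := by
          have : Continuous fun w : ℝ × X => w.1 - ε := by fun_prop
          exact this.continuousWithinAt.eventually (Ioi_mem_nhds h)
        have hcw : ContinuousWithinAt (fun w : ℝ × X => G w.1 s w.2) (Icc t₀ 1 ×ˢ univ) (t, x) := by
          refine (hG s hs1 (t, x) ⟨⟨by linarith, ht.2⟩, mem_univ _⟩).mono_of_mem_nhdsWithin ?_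
          filter_upwards [hev, self_mem_nhdsWithin] with w hw hw'
          exact ⟨⟨by linarith, hw'.1.2⟩, mem_univ _⟩
        refine hcw.congr_of_eventuallyEq ?_ (indicator_of_mem (by exact h) _)
        filter_upwards [hev] with w hw
        exact indicator_of_mem (by exact hw) _
      · have hev : ∀ᶠ w : ℝ × X in 𝓝[Icc t₀ 1 ×ˢ univ] (t, x), w.1 - ε < s := by
          have : Continuous fun w : ℝ × X => w.1 - ε := by fun_prop
          exact this.continuousWithinAt.eventually (Iio_mem_nhds h)
        refine (continuousWithinAt_const (b := (0 : ℝ))).congr_of_eventuallyEq ?_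
          (indicator_of_notMem (by simpa using h.le) _)
        filter_upwards [hev] with w hw
        exact indicator_of_notMem (by simpa using hw.le) _
  · rintro ⟨t, x⟩ ⟨ht, -⟩
    have ht' : t ∈ Ioc (0 : ℝ) 1 := ⟨ht₀.trans_le ht.1, ht.2⟩
    refine hU' ?_
    simp only
    rw [Real.dist_eq]
    have h1 := integral_inter_add_sdiff (μ := volume) (s := Ioo 0 t)
      (measurableSet_Iio (a := t - ε)) (hint t ht' x)
    rw [← h1, add_sub_cancel_left]
    refine lt_of_le_of_lt ?_ hεη
    have hsub : Ioo 0 t \ Iio (t - ε) ⊆ Ioo 0 t := sdiff_subset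
    have hms : MeasurableSet (Ioo 0 t \ Iio (t - ε)) := measurableSet_Ioo.diff measurableSet_Iio
    have i2 : IntegrableOn (fun s => c * ε ^ (a / 2) * betaW (a / 2) b t s) (Ioo 0 t) :=
      (integrableOn_betaW (half_pos ha) hb ht'.1).const_mul (c * ε ^ (a / 2))
    calc |∫ s in Ioo 0 t \ Iio (t - ε), G t s x|
        ≤ ∫ s in Ioo 0 t \ Iio (t - ε), c * ε ^ (a / 2) * betaW (a / 2) b t s := by
          rw [← Real.norm_eq_abs]
          refine norm_integral_le_of_norm_le (i2.mono_set hsub) ?_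
          filter_upwards [ae_restrict_mem hms] with s hs
          refine (hbd t ht' s hs.1 x).trans ?_
          rw [mul_assoc]
          refine mul_le_mul_of_nonneg_left (betaW_le_mul ha hs.1 ?_) hc
          simpa using hs.2
      _ ≤ ∫ s in Ioo 0 t, c * ε ^ (a / 2) * betaW (a / 2) b t s := by
          refine setIntegral_mono_set i2 ?_ (Eventually.of_forall hsub)
          filter_upwards [ae_restrict_mem measurableSet_Ioo] with s hs
          have := betaW_nonneg (a := a / 2) (b := b) hs
          simp only [Pi.zero_apply]
          positivity
      _ = c * ε ^ (a / 2) * (t ^ (a / 2 + b - 1) * betaI (a / 2) b) := by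
          rw [integral_const_mul, integral_betaW ht'.1]
      _ ≤ c * ε ^ (a / 2) * (t₀ ^ (-1 : ℝ) * betaI (a / 2) b) := by
          have h5 : t ^ (a / 2 + b - 1) ≤ t₀ ^ (-1 : ℝ) := by
            refine (Real.rpow_le_rpow_of_exponent_ge ht'.1 ht.2 (z := -1) (by linarith)).trans ?_
            exact Real.rpow_le_rpow_of_nonpos ht₀ ht.1 (by norm_num)
          have := betaI_nonneg (a / 2) b
          gcongr
      _ = _ := by ring

end

/-! ### The Duhamel term -/

section

open Filter Topology

attribute [local irreducible] profile psi fullExp pk levyK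

/-- Families of Hölder functions whose Hölder norm has an integrable singularity at time zero. -/
structure HolFam (ω b B : ℝ) (Ψ : ℝ → Rn d → ℝ) : Prop where
  fam : Fam b B Ψ
  hol : ∀ t ∈ Ioc (0 : ℝ) 1, Hol ω (B * t ^ (b - 1)) (Ψ t)

/-- The time convolution of a kernel with a family of functions. -/
def duh (K : ℝ → Rn d → Rn d → ℝ) (Ψ : ℝ → Rn d → ℝ) (t : ℝ) (x : Rn d) : ℝ :=
  ∫ s in Ioo 0 t, act K (t - s) (Ψ s) x

lemma aestronglyMeasurable_Ioo {E : Type*} [TopologicalSpace E] [TopologicalSpace.PseudoMetrizableSpace E]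
    {t : ℝ} {f g : ℝ → E} (hg : AEStronglyMeasurable g (volume.restrict (Ioo 0 t)))
    (h : ∀ s ∈ Ioo 0 t, f s = g s) : AEStronglyMeasurable f (volume.restrict (Ioo 0 t)) :=
  hg.congr <| (ae_restrict_mem measurableSet_Ioo).mono fun s hs => (h s hs).symm

lemma continuousOn_duh {b B : ℝ} {Ψ : ℝ → Rn d → ℝ} {K : ℝ → Rn d → Rn d → ℝ} {a c : ℝ} (ha : 0 < a) (ha1 : a ≤ 1)
    (hb : 0 < b) (hc : 0 ≤ c) (hK : MeasKer K) (hΨ : Fam b B Ψ)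
    (hbd : ∀ t ∈ Ioc (0 : ℝ) 1, ∀ s ∈ Ioo 0 t, ∀ x, |act K (t - s) (Ψ s) x| ≤ c * betaW a b t s)
    (hcont : ∀ s ∈ Ioo (0 : ℝ) 1,
      ContinuousOn (fun w : ℝ × Rn d => act K w.1 (Ψ s) w.2) (Ioc 0 1 ×ˢ univ)) :
    ContinuousOn (fun w : ℝ × Rn d => duh K Ψ w.1 w.2) (Ioc 0 1 ×ˢ univ) := by
  refine continuousOn_integral_Ioo (G := fun t s x => act K (t - s) (Ψ s) x) ha ha1 hb hc
    (fun t ht x => hK.aestronglyMeasurable_act hΨ ht x) hbd fun s hs => ?_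
  refine (hcont s hs).comp (f := fun w : ℝ × Rn d => (w.1 - s, w.2)) (by fun_prop) fun w hw => ?_
  exact ⟨⟨by linarith [hw.1.1], by linarith [hw.1.2, hs.1]⟩, mem_univ _⟩

lemma Fam.integrableOn {b B : ℝ} {Ψ : ℝ → Rn d → ℝ} (hΨ : Fam b B Ψ) (hb : 0 < b) {t : ℝ}
    (ht : t ∈ Ioc (0 : ℝ) 1) (x : Rn d) : IntegrableOn (fun s => Ψ s x) (Ioo 0 t) := by
  refine Integrable.mono' ((integrableOn_rpow_Ioo hb ht.1.le).const_mul B) ?_ ?_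
  · obtain ⟨G, hG, e⟩ := hΨ.meas
    have m : Measurable fun s => G (s, x) := by fun_prop
    exact aestronglyMeasurable_Ioo m.aestronglyMeasurable fun s hs => e s (mem_Ioc_of_Ioo ht hs) x
  · filter_upwards [ae_restrict_mem measurableSet_Ioo] with s hs
    exact hΨ.bound s (mem_Ioc_of_Ioo ht hs) x

namespace Param

variable {α ω κ₀ κ₁ L C : ℝ} {n : Rn d → Rn d → ℝ} (P : Param d α ω κ₀ κ₁ L C n)

include P

variable {b B : ℝ} {Ψ : ℝ → Rn d → ℝ}

lemma continuousOn_duh_q (hb : 0 < b) (hΨ : Fam b B Ψ) :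
    ContinuousOn (fun w : ℝ × Rn d => duh (q α n) Ψ w.1 w.2) (Ioc 0 1 ×ˢ univ) := by
  have hC := P.hC
  have hm := mass_nonneg (d := d) (α - 4 * ω)
  have hB := hΨ.nonneg
  exact continuousOn_duh (c := C * mass d (α - 4 * ω) * B) one_pos le_rfl hb (by positivity)
    P.measKer_q hΨ (fun t ht s hs x => P.ker_q.abs_act_fam_le P.hγ hΨ ht hs x)
    fun s hs => P.continuousOn_act_q (hΨ.measurable ⟨hs.1, hs.2.le⟩) (hΨ.bound s ⟨hs.1, hs.2.le⟩)

lemma abs_duh_q_le (hb : 0 < b) (hΨ : Fam b B Ψ) {t : ℝ} (ht : t ∈ Ioc (0 : ℝ) 1) (x : Rn d) :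
    |duh (q α n) Ψ t x| ≤ C * mass d (α - 4 * ω) * B * betaI 1 b * t ^ b := by
  unfold duh
  rw [← Real.norm_eq_abs]
  refine (norm_integral_le_of_norm_le
    ((integrableOn_betaW one_pos hb ht.1).const_mul (C * mass d (α - 4 * ω) * B)) ?_).trans_eq ?_
  · filter_upwards [ae_restrict_mem measurableSet_Ioo] with s hs
    exact P.ker_q.abs_act_fam_le P.hγ hΨ ht hs x
  · rw [integral_const_mul, integral_betaW ht.1, show 1 + b - 1 = b by ring]
    ring

/-- The size constant of the generator acting on `act (q α n)`. -/
lemma exists_abs_act_bker_fam_le (hΨ : HolFam ω b B Ψ) : ∃ c ≥ 0, ∀ t ∈ Ioc (0 : ℝ) 1,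
    ∀ s ∈ Ioo 0 t, ∀ x, (∫ h, |dlt α (act (q α n) (t - s) (Ψ s)) x h * levyK α (n x) h|) ≤
        c * betaW (ω / α) b t s ∧
      |act (bker α n) (t - s) (Ψ s) x| ≤ c * betaW (ω / α) b t s := by
  have hC := P.hC
  have hκ := P.hκ₁
  have hJ := jumpMajC_nonneg d α ω
  have hm := mass_nonneg (d := d) (α - 2 * ω)
  have hB := hΨ.fam.nonneg
  refine ⟨3 * κ₁ * C * jumpMajC d α ω * mass d (α - 2 * ω) * B, by positivity,
    fun t ht s hs x => ⟨?_, ?_⟩⟩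
  · refine (P.integrable_dlt_act_q (hΨ.hol s (mem_Ioc_of_Ioo ht hs)) (sub_mem_Ioc ht hs)
      (P.measurable_n x) (P.abs_n_le x) x).2.trans_eq ?_
    unfold betaW; ring
  · refine (P.abs_act_bker_le (hΨ.hol s (mem_Ioc_of_Ioo ht hs)) (sub_mem_Ioc ht hs) x).trans_eq ?_
    unfold betaW; ring

lemma continuousOn_duh_bker (hb : 0 < b) (hΨ : HolFam ω b B Ψ) :
    ContinuousOn (fun w : ℝ × Rn d => duh (bker α n) Ψ w.1 w.2) (Ioc 0 1 ×ˢ univ) := by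
  obtain ⟨c, hc, h⟩ := P.exists_abs_act_bker_fam_le hΨ
  exact continuousOn_duh P.hβ P.hβ1 hb hc P.measKer_bker hΨ.fam
    (fun t ht s hs x => (h t ht s hs x).2)
    fun s hs => P.continuousOn_act_bker (hΨ.fam.measurable ⟨hs.1, hs.2.le⟩)
      (hΨ.fam.bound s ⟨hs.1, hs.2.le⟩)

lemma measKer_fderiv (h : Rn d) : MeasKer fun t x y => fderiv ℝ (pk α (n y) t) (x - y) h := by
  refine ⟨_, P.measurable_fderiv_pk (t := fun w : ℝ × Rn d × Rn d => w.1)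
    (z := fun w => w.2.1 - w.2.2) (y := fun w => w.2.2) (by fun_prop) (by fun_prop) (by fun_prop) h,
    fun t ht x y => P.fderiv_pk ht.1 y (x - y) h⟩

lemma measurable_fderiv_act_q (hΨ : Fam b B Ψ) {t : ℝ} (ht : t ∈ Ioc (0 : ℝ) 1) (x : Rn d) :
    Measurable ((Ioo 0 t).indicator fun s => fderiv ℝ (act (q α n) (t - s) (Ψ s)) x) := by
  refine measurable_clm fun v => ?_
  obtain ⟨G, hG, e⟩ := (P.measKer_fderiv v).measurable_act hΨ
  have m : Measurable fun s => G (t - s, s, x) := by fun_prop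
  convert m.indicator (measurableSet_Ioo (a := 0) (b := t)) using 1
  ext s
  by_cases hs : s ∈ Ioo 0 t
  · have hs' := mem_Ioc_of_Ioo ht hs
    rw [indicator_of_mem hs, indicator_of_mem hs, ← e _ (sub_mem_Ioc ht hs) s hs' x]
    exact (P.fderiv_act_q (hΨ.measurable hs') (hΨ.bound s hs') (sub_mem_Ioc ht hs) x v).2
  · rw [indicator_of_notMem hs, indicator_of_notMem hs]
    rfl

/-- The gradient of Q_{t-s}Ψ_s is of order (t−s)^{(-1+2ω)/α}, integrable because 1 − 2ω < α when α ≥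
1. For α < 1 differentiability is neither claimed nor needed. -/
lemma hasFDerivAt_duh_q (hα : 1 ≤ α) (hb : 0 < b) (hΨ : HolFam ω b B Ψ) {t : ℝ}
    (ht : t ∈ Ioc (0 : ℝ) 1) (x : Rn d) :
    IntegrableOn (fun s => fderiv ℝ (act (q α n) (t - s) (Ψ s)) x) (Ioo 0 t) ∧
    HasFDerivAt (duh (q α n) Ψ t) (∫ s in Ioo 0 t, fderiv ℝ (act (q α n) (t - s) (Ψ s)) x) x := by
  have h0 := P.h0
  have hω := P.hω0
  have ha : 0 < (-1 + 2 * ω) / α + 1 := by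
    rw [div_add_one h0.ne']
    exact div_pos (by linarith) h0
  have hmeas : AEStronglyMeasurable (fun s => fderiv ℝ (act (q α n) (t - s) (Ψ s)) x)
      (volume.restrict (Ioo 0 t)) :=
    aestronglyMeasurable_Ioo (P.measurable_fderiv_act_q hΨ.fam ht x).aestronglyMeasurable
      fun s hs => (indicator_of_mem hs
        (fun s => fderiv ℝ (act (q α n) (t - s) (Ψ s)) x)).symm
  have hbd : ∀ s ∈ Ioo 0 t, ∀ z, ‖fderiv ℝ (act (q α n) (t - s) (Ψ s)) z‖ ≤
      3 * C * mass d (α - 2 * ω) * B * betaW ((-1 + 2 * ω) / α + 1) b t s := by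
    intro s hs z
    refine (P.norm_fderiv_act_q_le (hΨ.hol s (mem_Ioc_of_Ioo ht hs)) (sub_mem_Ioc ht hs) z).trans_eq ?_
    rw [rt_rpow (sub_mem_Ioc ht hs)]
    unfold betaW
    rw [add_sub_cancel_right]; ring
  have hint : IntegrableOn (fun s => 3 * C * mass d (α - 2 * ω) * B *
      betaW ((-1 + 2 * ω) / α + 1) b t s) (Ioo 0 t) :=
    (integrableOn_betaW ha hb ht.1).const_mul _
  constructor
  · refine Integrable.mono' hint hmeas ?_
    filter_upwards [ae_restrict_mem measurableSet_Ioo] with s hs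
    exact hbd s hs x
  · refine hasFDerivAt_integral_of_dominated_of_fderiv_le (s := univ)
      (F := fun z s => act (q α n) (t - s) (Ψ s) z)
      (F' := fun z s => fderiv ℝ (act (q α n) (t - s) (Ψ s)) z) univ_mem
      (Eventually.of_forall fun z => P.measKer_q.aestronglyMeasurable_act hΨ.fam ht z)
      (P.ker_q.integrableOn_act_fam P.hγ one_pos hb hΨ.fam ht x) hmeas ?_ hint ?_
    · filter_upwards [ae_restrict_mem measurableSet_Ioo] with s hs z _
      exact hbd s hs z
    · filter_upwards [ae_restrict_mem measurableSet_Ioo] with s hs z _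
      have hs' := mem_Ioc_of_Ioo ht hs
      exact (P.differentiable_act_q (hΨ.fam.measurable hs') (hΨ.fam.bound s hs')
        (sub_mem_Ioc ht hs) z).hasFDerivAt

lemma dlt_duh_q (hb : 0 < b) (hΨ : HolFam ω b B Ψ) {t : ℝ} (ht : t ∈ Ioc (0 : ℝ) 1)
    (x h : Rn d) : dlt α (duh (q α n) Ψ t) x h =
      ∫ s in Ioo 0 t, dlt α (act (q α n) (t - s) (Ψ s)) x h := by
  have i1 := P.ker_q.integrableOn_act_fam P.hγ one_pos hb hΨ.fam ht (x + h)
  have i2 := P.ker_q.integrableOn_act_fam P.hγ one_pos hb hΨ.fam ht x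
  by_cases hα : 1 ≤ α
  · obtain ⟨i3, hd⟩ := P.hasFDerivAt_duh_q hα hb hΨ ht x
    have i4 : IntegrableOn (fun s => chi α h * fderiv ℝ (act (q α n) (t - s) (Ψ s)) x h) (Ioo 0 t) :=
      (i3.apply_continuousLinearMap h).const_mul _
    have i5 : IntegrableOn (fun s => act (q α n) (t - s) (Ψ s) (x + h) -
      act (q α n) (t - s) (Ψ s) x) (Ioo 0 t) := i1.sub i2
    unfold dlt
    rw [hd.fderiv, integral_sub i5 i4, integral_sub i1 i2, integral_const_mul,
      ContinuousLinearMap.integral_apply i3]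
    rfl
  -- For α < 1 the compensator vanishes, so the value of the derivative is irrelevant even if the
  -- function is not differentiable.
  · have hchi : chi α h = 0 := by
      unfold chi
      rw [if_neg]
      push Not at hα
      rintro (h | ⟨h, -⟩) <;> linarith
    unfold dlt
    simp only [hchi, zero_mul, sub_zero]
    rw [integral_sub i1 i2]
    rfl

lemma integrable_prod_dlt_act_q (hb : 0 < b) (hΨ : HolFam ω b B Ψ) {t : ℝ}
    (ht : t ∈ Ioc (0 : ℝ) 1) (x : Rn d) :
    Integrable (fun w : ℝ × Rn d => dlt α (act (q α n) (t - w.1) (Ψ w.1)) x w.2 *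
      levyK α (n x) w.2) ((volume.restrict (Ioo 0 t)).prod volume) := by
  obtain ⟨c, hc, hbd⟩ := P.exists_abs_act_bker_fam_le hΨ
  obtain ⟨G, hG, e⟩ := P.measKer_q.measurable_act hΨ.fam
  have hf := P.measurable_fderiv_act_q hΨ.fam ht x
  refine (integrable_prod_of_bound ?_ ((integrableOn_betaW P.hβ hb ht.1).const_mul c) ?_).1
  · have m1 : Measurable fun w : ℝ × Rn d => G (t - w.1, w.1, x + w.2) := by fun_prop
    have m2 : Measurable fun w : ℝ × Rn d => G (t - w.1, w.1, x) := by fun_prop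
    have m3 : Measurable fun w : ℝ × Rn d => (Ioo 0 t).indicator
        (fun s => fderiv ℝ (act (q α n) (t - s) (Ψ s)) x) w.1 w.2 :=
      (isBoundedBilinearMap_apply (𝕜 := ℝ) (E := Rn d) (F := ℝ)).continuous.measurable.fun_comp
        ((hf.fun_comp measurable_fst).prodMk measurable_snd)
    have m4 : Measurable fun w : ℝ × Rn d => chi α w.2 := (measurable_chi α).fun_comp measurable_snd
    have m5 : Measurable fun w : ℝ × Rn d => levyK α (n x) w.2 :=
      (measurable_levyK α (P.measurable_n x)).fun_comp measurable_snd
    refine (((m1.sub m2).sub (m4.mul m3)).mul m5).aestronglyMeasurable.congr ?_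
    have h1 : ∀ᵐ w : ℝ × Rn d ∂(volume.restrict (Ioo 0 t)).prod volume, w.1 ∈ Ioo 0 t := by
      rw [← restrict_prod_univ]
      exact (ae_restrict_mem (measurableSet_Ioo.prod MeasurableSet.univ)).mono fun w hw => hw.1
    filter_upwards [h1] with w hw
    have hw' := mem_Ioc_of_Ioo ht hw
    simp only [Pi.mul_apply, Pi.sub_apply, indicator_of_mem hw, dlt,
      e _ (sub_mem_Ioc ht hw) _ hw']
  · filter_upwards [ae_restrict_mem measurableSet_Ioo] with s hs
    exact ⟨(P.integrable_dlt_act_q (hΨ.hol s (mem_Ioc_of_Ioo ht hs)) (sub_mem_Ioc ht hs)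
      (P.measurable_n x) (P.abs_n_le x) x).1, (hbd t ht s hs x).1⟩

/-- The generator passes under the time integral by Fubini in (s, h). Absolute integrability comes
from the cancellation bound, hence the requirement that Ψ be a Hölder family. -/
lemma integral_dlt_duh_q (hb : 0 < b) (hΨ : HolFam ω b B Ψ) {t : ℝ} (ht : t ∈ Ioc (0 : ℝ) 1)
    (x : Rn d) : Integrable (fun h => dlt α (duh (q α n) Ψ t) x h * levyK α (n x) h) ∧
    ∫ h, dlt α (duh (q α n) Ψ t) x h * levyK α (n x) h = duh (bker α n) Ψ t x := by
  have hi := P.integrable_prod_dlt_act_q hb hΨ ht x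
  simp only [P.dlt_duh_q hb hΨ ht, ← integral_mul_const]
  refine ⟨hi.integral_prod_right, ?_⟩
  rw [← integral_integral_swap (f := fun s h => dlt α (act (q α n) (t - s) (Ψ s)) x h *
    levyK α (n x) h) hi]
  unfold duh
  refine setIntegral_congr_fun measurableSet_Ioo fun s hs => ?_
  have hs' := mem_Ioc_of_Ioo ht hs
  exact (P.act_bker_eq (hΨ.fam.measurable hs') (hΨ.fam.bound s hs') (sub_mem_Ioc ht hs) x).symm

/-- For each s the evolution of Q_{t-s}Ψ_s is integrated from its initial value Ψ_s; exchanging the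
integrals over the triangle s < r < t gives the Duhamel identity without differentiating under a
singular integral. -/
lemma duh_q_eq (hb : 0 < b) (hΨ : HolFam ω b B Ψ) {t : ℝ} (ht : t ∈ Ioc (0 : ℝ) 1) (x : Rn d) :
    IntegrableOn (fun r => duh (bfro α n) Ψ r x) (Ioo 0 t) ∧
    duh (q α n) Ψ t x = (∫ s in Ioo 0 t, Ψ s x) + ∫ r in Ioo 0 t, duh (bfro α n) Ψ r x := by
  obtain ⟨D, hD, hbd⟩ := P.exists_abs_act_bfro_le
  obtain ⟨G, hG, e⟩ := P.measKer_bfro.measurable_act hΨ.fam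
  have hB := hΨ.fam.nonneg
  set μ := volume.restrict (Ioo (0 : ℝ) t) with hμ
  -- The integrand restricted to the triangle s < r, so that Fubini can be used on the square
  -- (0,t)².
  set H : ℝ → ℝ → ℝ := fun r s => (Iio r).indicator (fun s => act (bfro α n) (r - s) (Ψ s) x) s with hH
  have hHeq : ∀ r ∈ Ioo 0 t, ∫ s, H r s ∂μ = duh (bfro α n) Ψ r x := by
    intro r hr
    rw [hH, hμ, setIntegral_indicator measurableSet_Iio]
    unfold duh
    rw [Ioo_inter_Iio, min_eq_right hr.2.le]
  have hb' : ∀ r ∈ Ioo 0 t, ∀ s ∈ Ioo 0 r, |act (bfro α n) (r - s) (Ψ s) x| ≤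
      D * B * betaW (ω / α) b r s := by
    intro r hr s hs
    have hr' := mem_Ioc_of_Ioo ht hr
    refine (hbd _ _ (hΨ.hol s (mem_Ioc_of_Ioo hr' hs)) _ (sub_mem_Ioc hr' hs) x).trans_eq ?_
    unfold betaW; ring
  have hint : Integrable (fun w : ℝ × ℝ => H w.1 w.2) (μ.prod μ) := by
    have hg : Integrable (fun r : ℝ => D * B * (r ^ (ω / α + b - 1) * betaI (ω / α) b)) μ :=
      ((integrableOn_rpow_Ioo (add_pos P.hβ hb) ht.1.le).mul_const _).const_mul _
    refine (integrable_prod_of_bound ?_ hg ?_).1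
    · have hs : MeasurableSet {w : ℝ × ℝ | w.2 < w.1} := measurableSet_lt measurable_snd measurable_fst
      have m1 : Measurable fun w : ℝ × ℝ => G (w.1 - w.2, w.2, x) := by fun_prop
      refine (m1.indicator hs).aestronglyMeasurable.congr ?_
      have h1 : ∀ᵐ w : ℝ × ℝ ∂μ.prod μ, w ∈ Ioo 0 t ×ˢ Ioo 0 t := by
        rw [hμ, Measure.prod_restrict]
        exact ae_restrict_mem (measurableSet_Ioo.prod measurableSet_Ioo)
      filter_upwards [h1] with w hw
      have hw1 := mem_Ioc_of_Ioo ht hw.1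
      by_cases h : w.2 < w.1
      · rw [indicator_of_mem (by exact h), hH]
        simp only
        rw [indicator_of_mem (by exact h)]
        exact (e _ (sub_mem_Ioc hw1 ⟨hw.2.1, h⟩) _ (mem_Ioc_of_Ioo ht hw.2) x).symm
      · rw [indicator_of_notMem (by exact h), hH]
        simp only
        rw [indicator_of_notMem (by exact h)]
    · filter_upwards [ae_restrict_mem measurableSet_Ioo] with r hr
      have hr' := mem_Ioc_of_Ioo ht hr
      have hab : (fun s => |H r s|) =
          (Iio r).indicator fun s => |act (bfro α n) (r - s) (Ψ s) x| := by
        funext s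
        by_cases h : s ∈ Iio r
        · simp only [hH, indicator_of_mem h]
        · simp only [hH, indicator_of_notMem h, abs_zero]
      have i0 : IntegrableOn (fun s => D * B * betaW (ω / α) b r s) (Ioo 0 r) :=
        (integrableOn_betaW P.hβ hb hr.1).const_mul _
      have i1 : IntegrableOn (fun s => act (bfro α n) (r - s) (Ψ s) x) (Ioo 0 r) := by
        refine Integrable.mono' i0 (P.measKer_bfro.aestronglyMeasurable_act hΨ.fam hr' x) ?_
        filter_upwards [ae_restrict_mem measurableSet_Ioo] with s hs
        exact hb' r hr s hs
      constructor
      · rw [hH]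
        simp only
        rw [integrable_indicator_iff measurableSet_Iio, hμ, IntegrableOn,
          Measure.restrict_restrict measurableSet_Iio, inter_comm, Ioo_inter_Iio, min_eq_right hr.2.le]
        exact i1
      · rw [hab, hμ, setIntegral_indicator measurableSet_Iio, Ioo_inter_Iio, min_eq_right hr.2.le]
        refine (integral_mono_ae i1.abs i0 ?_).trans_eq ?_
        · filter_upwards [ae_restrict_mem measurableSet_Ioo] with s hs
          exact hb' r hr s hs
        · rw [integral_const_mul, integral_betaW hr.1]
  have iΨ := hΨ.fam.integrableOn hb ht x
  have hcongr : ∀ f : ℝ → ℝ, (∀ r ∈ Ioo 0 t, f r = duh (bfro α n) Ψ r x) →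
      f =ᵐ[μ] fun r => duh (bfro α n) Ψ r x := fun f hf =>
    (ae_restrict_mem measurableSet_Ioo).mono fun r hr => hf r hr
  refine ⟨hint.integral_prod_left.congr (hcongr _ hHeq), ?_⟩
  rw [← integral_congr_ae (hcongr _ hHeq), integral_integral_swap hint,
    ← integral_add iΨ hint.integral_prod_right]
  unfold duh
  refine setIntegral_congr_fun measurableSet_Ioo fun s hs => ?_
  have hs' := mem_Ioc_of_Ioo ht hs
  simp only
  rw [(P.act_q_eq_add_integral (hΨ.hol s hs') (sub_mem_Ioc ht hs) x).2]
  congr 1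
  have e1 : ∀ r, H r s = (Ioi s).indicator (fun r => act (bfro α n) (r - s) (Ψ s) x) r := by
    intro r
    by_cases h : s < r
    · rw [hH]; simp only; rw [indicator_of_mem (by exact h), indicator_of_mem (by exact h)]
    · rw [hH]; simp only; rw [indicator_of_notMem (by exact h), indicator_of_notMem (by exact h)]
  simp only [e1]
  rw [hμ, setIntegral_indicator measurableSet_Ioi, Ioo_inter_Ioi, max_eq_right hs.1.le,
    ← integral_Ioc_eq_integral_Ioo, ← integral_Ioc_eq_integral_Ioo,
    ← intervalIntegral.integral_of_le hs.2.le, ← intervalIntegral.integral_of_le (sub_nonneg.2 hs.2.le),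
    intervalIntegral.integral_comp_sub_right (fun r => act (bfro α n) r (Ψ s) x) s, sub_self]

end Param

end

/-! ### The solution and its equation -/

section

open Filter Topology

attribute [local irreducible] profile psi fullExp pk levyK

lemma dlt_add {α : ℝ} {f g : Rn d → ℝ} {x : Rn d} (hf : 1 ≤ α → DifferentiableAt ℝ f x)
    (hg : 1 ≤ α → DifferentiableAt ℝ g x) (h : Rn d) :
    dlt α (fun z => f z + g z) x h = dlt α f x h + dlt α g x h := by
  unfold dlt
  by_cases hα : 1 ≤ α
  · rw [fderiv_fun_add (hf hα) (hg hα), add_apply]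
    ring
  · have hchi : chi α h = 0 := by
      unfold chi
      rw [if_neg]
      push Not at hα
      rintro (h | ⟨h, -⟩) <;> linarith
    rw [hchi]
    ring

lemma hol_of_contDiff {ω : ℝ} (hω0 : 0 < ω) (hω1 : 2 * ω ≤ 1) {φ : Rn d → ℝ}
    (hφ : ContDiff ℝ ((⊤ : ℕ∞) : WithTop ℕ∞) φ) (hs : HasCompactSupport φ) : ∃ M, Hol ω M φ := by
  obtain ⟨A, hA⟩ := hs.exists_bound_of_continuous hφ.continuous
  obtain ⟨K, hK⟩ := (hφ.of_le (m := 1) (by exact_mod_cast le_top)).lipschitzWith_of_hasCompactSupport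
    hs one_ne_zero
  have hA0 : 0 ≤ A := (norm_nonneg _).trans (hA 0)
  refine ⟨K + 2 * A, hφ.continuous.measurable, fun x => (hA x).trans ?_, fun x y => ?_⟩
  · linarith [NNReal.coe_nonneg K]
  · have h1 : |φ x - φ y| ≤ K * ‖x - y‖ := by
      have := hK.norm_sub_le x y
      simpa using this
    have h2 : |φ x - φ y| ≤ 2 * A := (abs_sub _ _).trans (by
      have := hA x; have := hA y; simp only [Real.norm_eq_abs] at *; linarith)
    have hK0 := NNReal.coe_nonneg K
    have hn := Real.rpow_nonneg (norm_nonneg (x - y)) (2 * ω)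
    rcases le_total ‖x - y‖ 1 with h | h
    · rcases (norm_nonneg (x - y)).eq_or_lt with h' | h'
      · rw [← h', mul_zero] at h1
        exact h1.trans (by positivity)
      · have h3 : ‖x - y‖ ≤ ‖x - y‖ ^ (2 * ω) := by
          conv_lhs => rw [← Real.rpow_one ‖x - y‖]
          exact Real.rpow_le_rpow_of_exponent_ge h' h hω1
        nlinarith
    · have h3 : 1 ≤ ‖x - y‖ ^ (2 * ω) := Real.one_le_rpow h (by positivity)
      nlinarith

namespace Param

variable {α ω κ₀ κ₁ L C : ℝ} {n : Rn d → Rn d → ℝ} (P : Param d α ω κ₀ κ₁ L C n)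

include P

lemma jumpOpDefinedAt_q {t : ℝ} (ht : t ∈ Ioc (0 : ℝ) 1) (x' x y : Rn d) :
    JumpOpDefinedAt α (n x') (fun z => q α n t z y) x := by
  have e : (fun z => q α n t z y) = fun z => pk α (n y) t (z - y) := funext fun z => q_eq α n t z y
  have hr := P.reg t ht y
  rw [e]
  refine ⟨fun _ => (hr.diff.comp (differentiable_id.sub_const y)).differentiableAt, ?_⟩
  rw [integrableOn_compl_zero P.hd]
  refine (hr.integrable_dlt P.hd P.h0 P.h2 (rt_pos α ht) (rt_le_one P.h0 ht) (P.measurable_n x')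
    (P.abs_n_le x') (x - y)).congr (Eventually.of_forall fun h => ?_)
  simp only [jumpIntegrand_eq, dlt_comp_sub]

lemma kernelDefinedAt {t : ℝ} (ht : t ∈ Ioc (0 : ℝ) 1) (x y : Rn d) : KernelDefinedAt α n t x y where
  exponent u := by
    rw [integrableOn_compl_zero P.hd]
    have := integrable_fullExp P.hd P.h0 P.h2 (P.measurable_n y) (P.abs_n_le y) u
    simpa only [fullExp, levyK_eq] using this
  density := by
    refine (integrable_exp_mul (integrable_exp_psi P.hd P.h0 P.h2 P.hκ₀ (P.coeff y) ht.1)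
      (x - y)).congr (Eventually.of_forall fun u => ?_)
    simp only
    rw [← neg_sub y x, inner_neg_right]
    push_cast
    rw [mul_neg]
  opA := P.jumpOpDefinedAt_q ht x x y
  opAFrozen := P.jumpOpDefinedAt_q ht y x y
  powers m := P.ker_F.tensorDefinedAt (ker_Fpow P.ker_F P.h0 P.hγ P.hβ m) P.h0 P.hγ P.hβ
    (mul_pos (by positivity) P.hβ) ht x y
  series := summable_Fpow P.ker_F P.h0 P.hγ P.hβ ht x y
  convolution := P.ker_q.tensorDefinedAt P.ker_Phi P.h0 P.hγ one_pos P.hβ ht x y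

variable {φ : Rn d → ℝ} {M : ℝ}

lemma exists_holFam_act_Phi (hφ : Hol ω M φ) :
    ∃ B, HolFam ω (ω / α) B fun s => act (Phi α n) s φ := by
  obtain ⟨A, hA, h⟩ := P.exists_act_Phi
  obtain ⟨h1, h2, -⟩ := h φ M hφ.meas hφ.bound
  refine ⟨A * M, h1, fun t ht => ⟨h1.measurable ht, h1.bound t ht, h2 t ht⟩⟩

lemma act_Phi_eq (hφ : Hol ω M φ) {t : ℝ} (ht : t ∈ Ioc (0 : ℝ) 1) (x : Rn d) :
    act (Phi α n) t φ x = act (F α n) t φ x + duh (F α n) (fun s => act (Phi α n) s φ) t x := by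
  obtain ⟨A, hA, h⟩ := P.exists_act_Phi
  exact (h φ M hφ.meas hφ.bound).2.2 t ht x

lemma integrable_p_mul (hφ : Hol ω M φ) {t : ℝ} (ht : t ∈ Ioc (0 : ℝ) 1) (x : Rn d) :
    Integrable (fun y => p α n t x y * φ y) ∧
    u α n φ t x = act (q α n) t φ x + duh (q α n) (fun s => act (Phi α n) s φ) t x := by
  have i1 := P.ker_q.integrable_act P.hγ hφ.meas hφ.bound ht x
  have i2 := (P.ker_q.tensor P.ker_Phi P.h0 P.hγ one_pos P.hβ).integrable_act P.hγ hφ.meas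
    hφ.bound ht x
  have e : (fun y => p α n t x y * φ y) = fun y => q α n t x y * φ y +
      tensor (q α n) (Phi α n) t x y * φ y := by
    funext y; rw [p, add_mul]
  refine ⟨e ▸ i1.add i2, ?_⟩
  rw [u, if_neg ht.1.ne', e, integral_add i1 i2]
  congr 1
  exact P.ker_q.act_tensor P.ker_Phi P.h0 P.hγ one_pos P.hβ hφ.meas hφ.bound ht x

/-- The time derivative of `u`. -/
def _root_.StableLike.du (α : ℝ) (n : Rn d → Rn d → ℝ) (φ : Rn d → ℝ) (t : ℝ) (x : Rn d) : ℝ :=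
  act (bker α n) t φ x + duh (bker α n) (fun s => act (Phi α n) s φ) t x

lemma continuousOn_du (hφ : Hol ω M φ) :
    ContinuousOn (fun w : ℝ × Rn d => du α n φ w.1 w.2) (Ioc 0 1 ×ˢ univ) := by
  obtain ⟨B, hB⟩ := P.exists_holFam_act_Phi hφ
  exact (P.continuousOn_act_bker hφ.meas hφ.bound).add (P.continuousOn_duh_bker P.hβ hB)

lemma continuousOn_u_Ioc (hφ : Hol ω M φ) :
    ContinuousOn (fun w : ℝ × Rn d => u α n φ w.1 w.2) (Ioc 0 1 ×ˢ univ) := by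
  obtain ⟨B, hB⟩ := P.exists_holFam_act_Phi hφ
  exact ((P.continuousOn_act_q hφ.meas hφ.bound).add (P.continuousOn_duh_q P.hβ hB.fam)).congr
    fun w hw => (P.integrable_p_mul hφ hw.1 w.2).2

/-- The parametrix term deviates from φ by O(t^{2ω/α}) and the Duhamel term is O(t^{ω/α}), both
uniformly in x. This gives boundedness of u and its joint continuity at time zero. -/
lemma exists_abs_u_sub_le (hφ : Hol ω M φ) : ∃ E ≥ 0, ∀ t ∈ Icc (0 : ℝ) 1, ∀ x,
    |u α n φ t x - φ x| ≤ E * t ^ (ω / α) := by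
  obtain ⟨B, hB⟩ := P.exists_holFam_act_Phi hφ
  have hC := P.hC
  have hm := mass_nonneg (d := d) (α - 2 * ω)
  have hm' := mass_nonneg (d := d) (α - 4 * ω)
  have hM := hφ.nonneg
  have hB0 := hB.fam.nonneg
  have hI := betaI_nonneg 1 (ω / α)
  refine ⟨3 * C * mass d (α - 2 * ω) * M + C * mass d (α - 4 * ω) * B * betaI 1 (ω / α),
    by positivity, fun t ht x => ?_⟩
  rcases ht.1.eq_or_lt with h | h
  · subst h
    simp only [u, if_true, sub_self, abs_zero]
    have := Real.rpow_nonneg (le_refl (0 : ℝ)) (ω / α)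
    positivity
  · have ht' : t ∈ Ioc (0 : ℝ) 1 := ⟨h, ht.2⟩
    rw [(P.integrable_p_mul hφ ht' x).2, add_sub_right_comm]
    have h1 := P.abs_act_q_sub_le hφ ht' x
    have h2 := P.abs_duh_q_le P.hβ hB.fam ht' x
    have h3 : rt α t ^ (2 * ω) ≤ t ^ (ω / α) := by
      rw [rt_rpow ht']
      refine Real.rpow_le_rpow_of_exponent_ge h ht.2 ?_
      have := P.hω0
      have := P.h0
      gcongr
      linarith
    refine (abs_add_le _ _).trans ((add_le_add h1 h2).trans ?_)
    rw [add_mul]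
    gcongr

lemma continuousOn_u (hφ : Hol ω M φ) (hc : Continuous φ) :
    ContinuousOn (fun w : ℝ × Rn d => u α n φ w.1 w.2) (Icc 0 1 ×ˢ univ) := by
  rintro ⟨t, x⟩ ⟨ht, -⟩
  rcases ht.1.eq_or_lt with h | h
  · simp only at h
    subst h
    obtain ⟨E, hE, hb⟩ := P.exists_abs_u_sub_le hφ
    have h1 : Tendsto (fun w : ℝ × Rn d => E * w.1 ^ (ω / α)) (𝓝[Icc 0 1 ×ˢ univ] (0, x)) (𝓝 0) := by
      have h2 : Continuous fun w : ℝ × Rn d => E * w.1 ^ (ω / α) :=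
        continuous_const.mul (continuous_fst.rpow_const fun _ => Or.inr P.hβ.le)
      have h3 := h2.tendsto (0, x)
      simp only [Real.zero_rpow P.hβ.ne', mul_zero] at h3
      exact h3.mono_left nhdsWithin_le_nhds
    have h2 : Tendsto (fun w : ℝ × Rn d => u α n φ w.1 w.2 - φ w.2) (𝓝[Icc 0 1 ×ˢ univ] (0, x))
        (𝓝 0) := by
      refine squeeze_zero_norm' ?_ h1
      filter_upwards [self_mem_nhdsWithin] with w hw
      exact hb w.1 hw.1 w.2
    have h3 : Tendsto (fun w : ℝ × Rn d => φ w.2) (𝓝[Icc 0 1 ×ˢ univ] (0, x)) (𝓝 (φ x)) :=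
      ((hc.comp continuous_snd).tendsto (0, x)).mono_left nhdsWithin_le_nhds
    have h4 := h2.add h3
    simp only [sub_add_cancel, zero_add] at h4
    rw [ContinuousWithinAt]
    simpa only [u, if_true] using h4
  · refine (P.continuousOn_u_Ioc hφ (t, x) ⟨⟨h, ht.2⟩, mem_univ _⟩).mono_of_mem_nhdsWithin ?_
    have h1 : Ioi (0 : ℝ) ×ˢ (univ : Set (Rn d)) ∈ 𝓝 (t, x) := prod_mem_nhds (Ioi_mem_nhds h) univ_mem
    refine mem_of_superset (inter_mem_nhdsWithin _ h1) ?_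
    rintro ⟨s, z⟩ ⟨⟨hs, -⟩, hs', -⟩
    exact ⟨⟨hs', hs.2⟩, mem_univ _⟩

/-- The integrated identities for Q_tφ and for the Duhamel term are added. Their integrand contains
the frozen kernel and the extra Φ_rφ created at s = r. -/
lemma u_eq_integral (hφ : Hol ω M φ) {t : ℝ} (ht : t ∈ Ioc (0 : ℝ) 1) (x : Rn d) :
    IntegrableOn (fun r => du α n φ r x) (Ioo 0 t) ∧
    u α n φ t x = φ x + ∫ r in Ioo 0 t, du α n φ r x := by
  obtain ⟨B, hB⟩ := P.exists_holFam_act_Phi hφ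
  obtain ⟨i1, e1⟩ := P.act_q_eq_add_integral hφ ht x
  obtain ⟨i2, e2⟩ := P.duh_q_eq P.hβ hB ht x
  have i3 := hB.fam.integrableOn P.hβ ht x
  obtain ⟨c, hc, hbd⟩ := P.exists_abs_act_bker_fam_le hB
  -- The heart of the parametrix: replacing the frozen kernel by 𝒜q − F produces −F_rφ − ∫ F_{r-s}
  -- Φ_s φ ds, which is exactly −Φ_rφ and cancels the extra term.
  have key : ∀ r ∈ Ioo 0 t, act (bfro α n) r φ x + (act (Phi α n) r φ x +
      duh (bfro α n) (fun s => act (Phi α n) s φ) r x) = du α n φ r x := by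
    intro r hr
    have hr' := mem_Ioc_of_Ioo ht hr
    have j1 : IntegrableOn (fun s => act (bker α n) (r - s) (act (Phi α n) s φ) x) (Ioo 0 r) := by
      refine Integrable.mono' ((integrableOn_betaW P.hβ P.hβ hr.1).const_mul c)
        (P.measKer_bker.aestronglyMeasurable_act hB.fam hr' x) ?_
      filter_upwards [ae_restrict_mem measurableSet_Ioo] with s hs
      exact (hbd r hr' s hs x).2
    have j2 := P.ker_F.integrableOn_act_fam P.hγ P.hβ P.hβ hB.fam hr' x
    have e3 : duh (bfro α n) (fun s => act (Phi α n) s φ) r x =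
        duh (bker α n) (fun s => act (Phi α n) s φ) r x -
          duh (F α n) (fun s => act (Phi α n) s φ) r x := by
      unfold duh
      rw [← integral_sub j1 j2]
      refine setIntegral_congr_fun measurableSet_Ioo fun s hs => ?_
      have hs' := mem_Ioc_of_Ioo hr' hs
      exact P.act_bfro_eq (hB.fam.measurable hs') (hB.fam.bound s hs') (sub_mem_Ioc hr' hs) x
    rw [e3, P.act_Phi_eq hφ hr' x, P.act_bfro_eq hφ.meas hφ.bound hr' x, du]
    ring
  have hae : (fun r => act (bfro α n) r φ x + (act (Phi α n) r φ x +
      duh (bfro α n) (fun s => act (Phi α n) s φ) r x)) =ᵐ[volume.restrict (Ioo 0 t)]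
      fun r => du α n φ r x := (ae_restrict_mem measurableSet_Ioo).mono key
  have i4 : IntegrableOn (fun r => act (Phi α n) r φ x +
      duh (bfro α n) (fun s => act (Phi α n) s φ) r x) (Ioo 0 t) := i3.add i2
  refine ⟨(i1.add i4).congr hae, ?_⟩
  rw [← integral_congr_ae hae, integral_add i1 i4, integral_add i3 i2,
    (P.integrable_p_mul hφ ht x).2, e1, e2]
  ring

/-- The operator is applied separately to Q_tφ and to the Duhamel term; additivity of the
compensated increment needs both gradients only when α ≥ 1. -/
lemma jumpOp_u (hφ : Hol ω M φ) {t : ℝ} (ht : t ∈ Ioc (0 : ℝ) 1) (x : Rn d) :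
    JumpOpDefinedAt α (n x) (u α n φ t) x ∧ opA α n (u α n φ t) x = du α n φ t x := by
  obtain ⟨B, hB⟩ := P.exists_holFam_act_Phi hφ
  have e : u α n φ t = fun z => act (q α n) t φ z + duh (q α n) (fun s => act (Phi α n) s φ) t z :=
    funext fun z => (P.integrable_p_mul hφ ht z).2
  have d1 := P.differentiable_act_q hφ.meas hφ.bound ht x
  have d2 : 1 ≤ α → DifferentiableAt ℝ (duh (q α n) (fun s => act (Phi α n) s φ) t) x := fun hα =>
    (P.hasFDerivAt_duh_q hα P.hβ hB ht x).2.differentiableAt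
  have i1 := (P.integrable_dlt_act_q hφ ht (P.measurable_n x) (P.abs_n_le x) x).1
  obtain ⟨i2, e2⟩ := P.integral_dlt_duh_q P.hβ hB ht x
  have e3 : ∀ h, dlt α (u α n φ t) x h * levyK α (n x) h =
      dlt α (act (q α n) t φ) x h * levyK α (n x) h +
        dlt α (duh (q α n) (fun s => act (Phi α n) s φ) t) x h * levyK α (n x) h := by
    intro h
    rw [e, dlt_add (fun _ => d1) d2, add_mul]
  refine ⟨⟨fun hα => e ▸ d1.add (d2 hα), ?_⟩, ?_⟩
  · rw [integrableOn_compl_zero P.hd]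
    refine (i1.add i2).congr (Eventually.of_forall fun h => ?_)
    simp only [jumpIntegrand_eq, e3, Pi.add_apply]
  · rw [opA, jumpOp_eq P.hd]
    simp only [e3]
    rw [integral_add i1 i2, e2, du, P.act_bker_eq hφ.meas hφ.bound ht x]

lemma hasDerivWithinAt_u (hφ : Hol ω M φ) {t : ℝ} (ht : t ∈ Ioc (0 : ℝ) 1) (x : Rn d) :
    HasDerivWithinAt (fun s => u α n φ s x) (du α n φ t x) (Icc 0 1) t := by
  have hc : ContinuousOn (fun r => du α n φ r x) (Ioc 0 1) :=
    (P.continuousOn_du hφ).comp (f := fun s : ℝ => (s, x)) (by fun_prop) fun s hs => ⟨hs, mem_univ _⟩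
  have hmem : Ioc (0 : ℝ) 1 ∈ 𝓝[Icc 0 1] t :=
    mem_of_superset (inter_mem_nhdsWithin _ (Ioi_mem_nhds ht.1)) fun s hs => ⟨hs.2, hs.1.2⟩
  -- Selects the version of the fundamental theorem of calculus relative to [0,1], which covers the
  -- one-sided derivative at t = 1 together with the interior points.
  have : Fact (t ∈ Icc (0 : ℝ) 1) := ⟨⟨ht.1.le, ht.2⟩⟩
  have h1 := intervalIntegral.integral_hasDerivWithinAt_right (s := Icc 0 1) (t := Icc 0 1)
    ((intervalIntegrable_iff_integrableOn_Ioo_of_le ht.1.le).2 (P.u_eq_integral hφ ht x).1)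
    ⟨Ioc 0 1, hmem, hc.aestronglyMeasurable measurableSet_Ioc⟩
    ((hc t ht).mono_of_mem_nhdsWithin hmem)
  refine (h1.const_add (φ x)).congr_of_mem (fun s hs => ?_) ⟨ht.1.le, ht.2⟩
  rcases hs.1.eq_or_lt with h | h
  · subst h
    simp [u]
  · rw [(P.u_eq_integral hφ ⟨h, hs.2⟩ x).2, intervalIntegral.integral_of_le h.le,
      integral_Ioc_eq_integral_Ioo]

end Param

end

end StableLike

end

theorem mainTheorem4 {d : ℕ} (hd : 1 ≤ d)
    {α : ℝ} (hα0 : 0 < α) (hα2 : α < 2)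
    {κ₀ κ₁ κ₂ θ : ℝ} (hκ₀ : 0 < κ₀) (hκ₂ : 0 < κ₂) (hθ0 : 0 < θ) (hθ1 : θ < 1)
    (n : StableLike.Rn d → StableLike.Rn d → ℝ)
    (hn_meas : Measurable (Function.uncurry n))
    (hn_lower : ∀ x h, κ₀ ≤ n x h) (hn_upper : ∀ x h, n x h ≤ κ₁)
    (hn_holder : ∀ x y h, |n x h - n y h| ≤ κ₂ * ‖x - y‖ ^ θ)
    (hn_one : α = 1 → ∀ (x : StableLike.Rn d) (r : ℝ), 0 < r →
      ∫ h, n x h • h ∂(StableLike.surfaceMeasure d r) = 0)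
    (φ : StableLike.Rn d → ℝ) (hφ : ContDiff ℝ ((⊤ : ℕ∞) : WithTop ℕ∞) φ)
    (hφ_supp : HasCompactSupport φ) :
    -- the kernel `p` and the function `u` are well-defined
    (∀ t ∈ Set.Ioc (0 : ℝ) 1, ∀ x y, StableLike.KernelDefinedAt α n t x y) ∧
    (∀ t ∈ Set.Ioc (0 : ℝ) 1, ∀ x,
      MeasureTheory.Integrable (fun y => StableLike.p α n t x y * φ y)) ∧
    -- `u` is bounded and continuous on `[0,1] × ℝ^d`, with initial value `φ`
    ContinuousOn (fun w : ℝ × StableLike.Rn d => StableLike.u α n φ w.1 w.2)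
      (Set.Icc (0 : ℝ) 1 ×ˢ (Set.univ : Set (StableLike.Rn d))) ∧
    (∃ M : ℝ, ∀ t ∈ Set.Icc (0 : ℝ) 1, ∀ x, |StableLike.u α n φ t x| ≤ M) ∧
    (∀ x, StableLike.u α n φ 0 x = φ x) ∧
    -- `𝒜 u(t,·)(x)` is well-defined, and `∂_t u = 𝒜 u` (one-sided derivative at `t = 1`)
    (∀ t ∈ Set.Ioc (0 : ℝ) 1, ∀ x,
      StableLike.JumpOpDefinedAt α (n x) (StableLike.u α n φ t) x ∧
      HasDerivWithinAt (fun s => StableLike.u α n φ s x)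
        (StableLike.opA α n (StableLike.u α n φ t) x) (Set.Icc 0 1) t) ∧
    -- `∂_t u` is continuous in each variable separately
    (∀ x, ContinuousOn (fun t => derivWithin (fun s => StableLike.u α n φ s x) (Set.Icc 0 1) t)
      (Set.Ioc 0 1)) ∧
    (∀ t ∈ Set.Ioc (0 : ℝ) 1,
      Continuous (fun x => derivWithin (fun s => StableLike.u α n φ s x) (Set.Icc 0 1) t)) := by
  obtain ⟨ω, L, C, P⟩ := StableLike.exists_param hd hα0 hα2 hκ₀ hκ₂ hθ0 n hn_meas hn_lower hn_upper
    hn_holder hn_one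
  obtain ⟨M, hM⟩ := StableLike.hol_of_contDiff P.hω0 (by linarith [P.hω0, P.hω1]) hφ hφ_supp
  have hderiv : ∀ t ∈ Set.Ioc (0 : ℝ) 1, ∀ x,
      derivWithin (fun s => StableLike.u α n φ s x) (Set.Icc 0 1) t = StableLike.du α n φ t x :=
    fun t ht x => (P.hasDerivWithinAt_u hM ht x).derivWithin
      (uniqueDiffOn_Icc zero_lt_one t ⟨ht.1.le, ht.2⟩)
  refine ⟨fun t ht x y => P.kernelDefinedAt ht x y, fun t ht x => (P.integrable_p_mul hM ht x).1,
    P.continuousOn_u hM hφ.continuous, ?_, fun x => by simp [StableLike.u],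
    fun t ht x => ⟨(P.jumpOp_u hM ht x).1, ?_⟩, fun x => ?_, fun t ht => ?_⟩
  · obtain ⟨E, hE, hb⟩ := P.exists_abs_u_sub_le hM
    refine ⟨E + M, fun t ht x => ?_⟩
    have h1 := hb t ht x
    have h2 : E * t ^ (ω / α) ≤ E := mul_le_of_le_one_right hE (Real.rpow_le_one ht.1 ht.2 P.hβ.le)
    have h3 := hM.bound x
    have h4 := abs_sub_abs_le_abs_sub (StableLike.u α n φ t x) (φ x)
    linarith
  · rw [(P.jumpOp_u hM ht x).2]
    exact P.hasDerivWithinAt_u hM ht x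
  · exact ((P.continuousOn_du hM).comp (f := fun s : ℝ => (s, x)) (by fun_prop)
      fun s hs => ⟨hs, Set.mem_univ _⟩).congr fun t ht => hderiv t ht x
  · simp only [hderiv t ht]
    exact (P.continuousOn_du hM).comp_continuous (f := fun x : StableLike.Rn d => (t, x))
      (by fun_prop) fun x => ⟨ht, Set.mem_univ _⟩
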